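/- \textbf{Setting.} Let $T,d\ge 1$, $0<\sigma<L$, $c_0\in(0,1)$, $B_X<\infty$. Let $\mathcal X\subseteq\mathbb R^d$ be compact and convex with Euclidean diameter at most $B_X$, and write $\mathcal X^o(c_0)=\{x:\ \mathbb B_2(x,c_0)\subseteq\mathcal X\}$, where $\mathbb B_2(x,r)$ is the closed Euclidean ball. Let $f_1,\dots,f_T:\mathcal X\to\mathbb R$ be twice continuously differentiable with, for all $t$ and all $x\in\mathcal X$, $|f_t(x)|\le 1$, $\|\nabla f_t(x)\|_2\le L$, $\|\nabla^2 f_t(x)\|_{\rm op}\le L$ and $-\nabla^2 f_t(x)\succeq\sigma I$, and such that the maximizer $x_t^*$ of $f_t$ over $\mathcal X$ satisfies $\|x_t^*-z\|_2\ge c_0$ for all $z\in\partial\mathcal X$. Let $\sum_{t=1}^{T-1}\sup_{x\in\mathcal X}|f_{t+1}(x)-f_t(x)|\le V_T$. In period $t$ the learner plays $x_t$ and receives a feedback $y_t$ with $|y_t|\le 1$ almost surely, whose conditional expectation given all earlier feedbacks and all random choices of the learner up to the choice of $x_t$ is $f_t(x_t)$. The random choices of the learner are independent of the past when they are made. \textbf{Algorithm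 $\mathcal A$ (batched gradient ascent).} Put $\gamma=\sigma/L$, $\eta_0=1/L$, $N_0=\lceil c_0^{-4}\rceil+1$ and $$\kappa_0=\sqrt{\ln(dT)}+L+\frac{2d\ln T}{1-\gamma}+\frac{16B_X^2d^{3/2}\ln^4(dT)}{c_0(1-\gamma)^3}+\frac{2L^2d^{3/2}\ln^4(dT)}{c_0(1-\gamma)^7}.$$ Start from an arbitrary $z_0\in\mathcal X^o(c_0)$. In epoch $s=0,1,2,\dots$ let $n_s=\lceil(1-\gamma)^{-4s}N_0\rceil$ and $\delta_s=n_s^{-1/4}$. For $j=1,\dots,d$ play $2n_s$ periods, alternating between $z_s+\delta_se_j$ and $z_s-\delta_se_j$ (starting with $+$), let $u_+,u_-$ be the sums of the feedbacks at the two points, and put $\hat g_s(j)=(u_+-u_-)/(2\delta_sn_s)$. Then $z_{s+1}$ is the Euclidean projection of $z_s+\eta_0\hat g_s$ onto $\mathcal X^o(c_0)$. After its $i$-th period, $\mathcal A$ outputs the estimate $\bar r=\frac1i(\text{sum of its first }i\text{ feedbacks})+2\kappa_0/\sqrt i$. \textbf{Multi-scale framework.} Let $\rho(k)=6\kappa_0/\sqrt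 k$ and $\hat\rho(k)=6(\log_2T+1)\rho(k)$. Time is divided into blocks; the first block starts at $t=1$ and has order $0$. In a block of order $n$ starting at $t_n$, for each $m=0,\dots,n$ and each $\tau=t_n+z2^m$, $z\in\{0,\dots,2^{n-m}-1\}$, a fresh copy of $\mathcal A$ (a thread of order $m$) is scheduled on $[\tau,\tau+2^m-1]$ with probability $\rho(2^n)/\rho(2^m)$, independently. In period $t$ the lowest-order scheduled thread covering $t$ is run (the others pause), which gives $x_t$, $y_t$, and the estimate $\bar r_t$. Let $U_t=\min_{t_n\le\tau\le t}\bar r_\tau$. Test 1 fails if for some scheduled thread, of some order $m$, with interval $[\tau_0,\tau_0+2^m-1]$, $\tau_0+2^m-1=t$, one has $2^{-m}\sum_{\tau=\tau_0}^{t}y_\tau\ge U_t+9\hat\rho(2^m)$. Test 2 fails if $\frac1{t-t_n+1}\sum_{\tau=t_n}^t(\bar r_\tau-y_\tau)\ge3\hat\rho(t-t_n+1)$. If a test fails in period $t$, a new block of order $0$ starts at $t+1$; otherwise, if $t=t_n+2^n-1$, a block of order $n+1$ starts at $t+1$. \textbf{Theorem.} There are absolute constants $C>0$ and $p,q\in\mathbb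 N$ such that for all $0<\sigma<L$, $c_0\in(0,1)$ and $B_X$ there is $T_0$, depending only on these four numbers, such that for all $T\ge T_0$, all $d\ge1$, and all $\mathcal X$, $f_1,\dots,f_T$, $V_T$, starting points and feedback distributions as above, the multi-scale framework run with $\mathcal A$ (neither of which is given $V_T$) only plays points $x_t\in\mathcal X$, and $$\mathbb E\Big[\sum_{t=1}^Tf_t(x_t^*)-f_t(x_t)\Big]\le C\Big(L+\frac1\sigma+B_X+\frac1{c_0}+\frac1{1-\sigma/L}\Big)^p\ln^q(dT)\,\Big(d^2V_T^{1/3}T^{2/3}+d^{3/2}\sqrt T\Big).$$ -/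

import Mathlib

open MeasureTheory ProbabilityTheory

noncomputable section

namespace NonstatBandit

/-- The space `ℝ^d` with the Euclidean norm. -/
abbrev Pt (d : ℕ) : Type := EuclideanSpace ℝ (Fin d)

/-- `Z^o(r)`: the points whose closed `r`-ball is contained in `Z`. -/
def innerSet {d : ℕ} (Z : Set (Pt d)) (r : ℝ) : Set (Pt d) :=
  {x | Metric.closedBall x r ⊆ Z}

/-- The Euclidean projection onto `Z` (a nearest point of `Z`; it is the unique one when `Z` is
nonempty, closed and convex). -/
def proj {d : ℕ} (Z : Set (Pt d)) (x : Pt d) : Pt d :=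
  Classical.epsilon fun z => z ∈ Z ∧ ∀ w ∈ Z, ‖z - x‖ ≤ ‖w - x‖

/-- The sup-norm on `X` of the difference of two functions. -/
def supDist {d : ℕ} (X : Set (Pt d)) (g h : Pt d → ℝ) : ℝ :=
  ⨆ x : X, |g x - h x|

/-! ### Bandit algorithms with an estimate, and the multi-scale framework -/

/-- A (deterministic) bandit optimization algorithm: from its internal state it chooses an action,
it updates the state with the observed feedback, and it then outputs the estimate `r̄`. -/
structure BanditAlg (d : ℕ) where
  State : Type
  action : State → Pt d
  update : State → ℝ → State
  estimate : State → ℝ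

/-- State of the multi-scale framework just before period `t`: the current block started at
`blockStart` and has order `order` (length `2^order`); `thread m` is the internal state of the most
recent order-`m` thread; `est τ` is the estimate `r̄_τ` of the past period `τ`. -/
structure MasterState {d : ℕ} (A : BanditAlg d) where
  t : ℕ
  blockStart : ℕ
  order : ℕ
  thread : ℕ → A.State
  est : ℕ → ℝ

namespace MasterState

variable {d : ℕ} {A : BanditAlg d}

/-- Start of the order-`m` window `[τ, τ + 2^m - 1]`, `τ = blockStart + z * 2^m`, containing the
current period. -/
def windowStart (S : MasterState A) (m : ℕ) : ℕ :=
  S.blockStart + (S.t - S.blockStart) / 2 ^ m * 2 ^ m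

/-- There is a scheduled order-`m` thread that covers the current period. The lottery of the
order-`m` window starting at `τ` is decided by the random number `u τ m`, uniform on `[0,1]`. -/
def Covers (ρ : ℕ → ℝ) (u : ℕ → ℕ → ℝ) (S : MasterState A) (m : ℕ) : Prop :=
  m ≤ S.order ∧ u (S.windowStart m) m ≤ ρ (2 ^ S.order) / ρ (2 ^ m)

/-- The order of the thread that is run in the current period: the lowest one covering it. -/
def active (ρ : ℕ → ℝ) (u : ℕ → ℕ → ℝ) (S : MasterState A) : ℕ :=
  sInf {m | S.Covers ρ u m}

/-- The internal state of the order-`m` thread at the beginning of the current period; a thread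
whose window starts now is a fresh copy. -/
def current (start : ℕ → ℕ → A.State) (S : MasterState A) (m : ℕ) : A.State :=
  if S.windowStart m = S.t then start S.t m else S.thread m

/-- The action taken in the current period. -/
def action (start : ℕ → ℕ → A.State) (ρ : ℕ → ℝ) (u : ℕ → ℕ → ℝ) (S : MasterState A) : Pt d :=
  A.action (S.current start (S.active ρ u))

/-- The state of the running thread after the current period with feedback `r`. -/
def played (start : ℕ → ℕ → A.State) (ρ : ℕ → ℝ) (u : ℕ → ℕ → ℝ) (S : MasterState A) (r : ℝ) :
    A.State :=
  A.update (S.current start (S.active ρ u)) r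

/-- The estimates, including the one output in the current period. -/
def newEst (start : ℕ → ℕ → A.State) (ρ : ℕ → ℝ) (u : ℕ → ℕ → ℝ) (S : MasterState A) (r : ℝ) :
    ℕ → ℝ :=
  Function.update S.est S.t (A.estimate (S.played start ρ u r))

end MasterState

/-- `ρ̂ = 6 (log₂ T + 1) ρ`. -/
def rhoHat (T : ℕ) (ρ : ℕ → ℝ) (k : ℕ) : ℝ := 6 * (Real.logb 2 T + 1) * ρ k

namespace MasterState

variable {d : ℕ} {A : BanditAlg d}

/-- `U_t`: the minimum of the estimates `e τ` over the current block up to now. -/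
def lowEst (S : MasterState A) (e : ℕ → ℝ) : ℝ :=
  sInf (e '' Set.Icc S.blockStart S.t)

/-- Test 1 reports a failure: for some scheduled order-`m` thread ending at the current period, the
average feedback over its window is at least `U_t + 9 ρ̂(2^m)`. Here `y` is the sequence of
feedbacks and `e` that of the estimates. -/
def Fail1 (T : ℕ) (ρ : ℕ → ℝ) (u : ℕ → ℕ → ℝ) (S : MasterState A) (y e : ℕ → ℝ) : Prop :=
  ∃ m, S.Covers ρ u m ∧ S.windowStart m + 2 ^ m = S.t + 1 ∧
    (∑ τ ∈ Finset.Icc (S.windowStart m) S.t, y τ) / (2 : ℝ) ^ m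
      ≥ S.lowEst e + 9 * rhoHat T ρ (2 ^ m)

/-- Test 2 reports a failure. -/
def Fail2 (T : ℕ) (ρ : ℕ → ℝ) (S : MasterState A) (y e : ℕ → ℝ) : Prop :=
  (∑ τ ∈ Finset.Icc S.blockStart S.t, (e τ - y τ)) / ((S.t - S.blockStart + 1 : ℕ) : ℝ)
    ≥ 3 * rhoHat T ρ (S.t - S.blockStart + 1)

open Classical in
/-- One period of the multi-scale framework. Of the feedback sequence `y` only the terms up to the
current period are used. After a failed test a block of order `0` is started; after the completion
of a block of order `n` a block of order `n + 1` is started. -/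
def next (start : ℕ → ℕ → A.State) (T : ℕ) (ρ : ℕ → ℝ) (u : ℕ → ℕ → ℝ) (y : ℕ → ℝ)
    (S : MasterState A) : MasterState A :=
  let e := S.newEst start ρ u (y S.t)
  let th := Function.update (S.current start) (S.active ρ u) (S.played start ρ u (y S.t))
  if S.Fail1 T ρ u y e ∨ S.Fail2 T ρ y e then
    { t := S.t + 1, blockStart := S.t + 1, order := 0, thread := th, est := e }
  else if S.t + 1 = S.blockStart + 2 ^ S.order then
    { t := S.t + 1, blockStart := S.t + 1, order := S.order + 1, thread := th, est := e }
  else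
    { t := S.t + 1, blockStart := S.blockStart, order := S.order, thread := th, est := e }

end MasterState

/-- The state of the multi-scale framework after `k` periods (that is, before period `k + 1`), for
the lottery numbers `u` and the feedback sequence `y`. `start τ m` is the starting state of the copy
of `A` that serves as order-`m` thread from period `τ` on. -/
def masterRun {d : ℕ} (A : BanditAlg d) (start : ℕ → ℕ → A.State) (T : ℕ) (ρ : ℕ → ℝ)
    (u : ℕ → ℕ → ℝ) (y : ℕ → ℝ) : ℕ → MasterState A
  | 0 => { t := 1, blockStart := 1, order := 0, thread := start 1, est := fun _ => 0 }
  | k + 1 => (masterRun A start T ρ u y k).next start T ρ u y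

/-- The action of the multi-scale framework in period `t ≥ 1`; it depends on the feedbacks before
period `t` and on the lottery numbers `u τ m` with `τ ≤ t` only. -/
def masterAction {d : ℕ} (A : BanditAlg d) (start : ℕ → ℕ → A.State) (T : ℕ) (ρ : ℕ → ℝ)
    (u : ℕ → ℕ → ℝ) (y : ℕ → ℝ) (t : ℕ) : Pt d :=
  (masterRun A start T ρ u y (t - 1)).action start ρ u

/-! ### Fixed-step batched gradient ascent -/

/-- `n_s = ⌈(1-γ)^{-4s} N₀⌉`. -/
def batchSize (γ : ℝ) (N₀ s : ℕ) : ℕ := ⌈(N₀ : ℝ) / (1 - γ) ^ (4 * s)⌉₊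

/-- `δ_s = n_s^{-1/4}`. -/
def radius (γ : ℝ) (N₀ s : ℕ) : ℝ := (batchSize γ N₀ s : ℝ) ^ (-(1 / 4) : ℝ)

/-- The `j`-th standard basis vector (`j < d`, counted from `0`). -/
def basisVec (d j : ℕ) : Pt d := WithLp.toLp 2 fun i : Fin d => if (i : ℕ) = j then (1 : ℝ) else 0

/-- State of the gradient ascent algorithm: epoch `s`, coordinate `j` (from `0`), number of steps
already made for this coordinate, `z_s`, `u₊`, `u₋`, the coordinates of `ĝ_s` found so far, the sum
of all feedbacks, and the number of all periods played by this copy. -/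
structure AscentState (d : ℕ) where
  epoch : ℕ
  coord : ℕ
  step : ℕ
  z : Pt d
  uPlus : ℝ
  uMinus : ℝ
  grad : Fin d → ℝ
  total : ℝ
  clock : ℕ

/-- The starting state with starting point `z₀`. -/
def AscentState.start {d : ℕ} (z₀ : Pt d) : AscentState d :=
  { epoch := 0, coord := 0, step := 0, z := z₀, uPlus := 0, uMinus := 0, grad := fun _ => 0,
    total := 0, clock := 0 }

/-- The action: `z_s + δ_s e_j` in even steps and `z_s - δ_s e_j` in odd ones. -/
def AscentState.action {d : ℕ} (γ : ℝ) (N₀ : ℕ) (S : AscentState d) : Pt d :=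
  if Even S.step then S.z + radius γ N₀ S.epoch • basisVec d S.coord
  else S.z - radius γ N₀ S.epoch • basisVec d S.coord

/-- The update with feedback `y`; `Z` is the set that iterates are projected to. -/
def AscentState.update {d : ℕ} (Z : Set (Pt d)) (η₀ γ : ℝ) (N₀ : ℕ) (S : AscentState d) (y : ℝ) :
    AscentState d :=
  let n := batchSize γ N₀ S.epoch
  let up := if Even S.step then S.uPlus + y else S.uPlus
  let um := if Even S.step then S.uMinus else S.uMinus + y
  if S.step + 1 < 2 * n then
    { S with step := S.step + 1, uPlus := up, uMinus := um, total := S.total + y,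
             clock := S.clock + 1 }
  else
    let g : Fin d → ℝ := fun i =>
      if (i : ℕ) = S.coord then (up - um) / (2 * radius γ N₀ S.epoch * n) else S.grad i
    if S.coord + 1 < d then
      { S with coord := S.coord + 1, step := 0, uPlus := 0, uMinus := 0, grad := g,
               total := S.total + y, clock := S.clock + 1 }
    else
      { epoch := S.epoch + 1, coord := 0, step := 0,
        z := proj Z (S.z + η₀ • (WithLp.toLp 2 g : Pt d)),
        uPlus := 0, uMinus := 0, grad := fun _ => 0, total := S.total + y, clock := S.clock + 1 }

/-- The batched gradient ascent algorithm with parameters `η₀, κ₀, γ, N₀`, projecting to `Z`; its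
estimate after `t` periods is the average of its feedbacks plus `2 κ₀ / √t`. -/
def ascentAlg {d : ℕ} (Z : Set (Pt d)) (η₀ κ₀ γ : ℝ) (N₀ : ℕ) : BanditAlg d where
  State := AscentState d
  action := AscentState.action γ N₀
  update := AscentState.update Z η₀ γ N₀
  estimate := fun S => S.total / S.clock + 2 * κ₀ / Real.sqrt S.clock

/-! ### The parameters and the combined algorithm -/

/-- `κ₀`, with `γ = σ / L`. -/
def kappa (d T : ℕ) (σ L B c₀ : ℝ) : ℝ :=
  Real.sqrt (Real.log (d * T)) + L + 2 * d * Real.log T / (1 - σ / L)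
    + 16 * B ^ 2 * (d : ℝ) ^ (3 / 2 : ℝ) * Real.log (d * T) ^ 4 / (c₀ * (1 - σ / L) ^ 3)
    + 2 * L ^ 2 * (d : ℝ) ^ (3 / 2 : ℝ) * Real.log (d * T) ^ 4 / (c₀ * (1 - σ / L) ^ 7)

/-- `N₀`. It makes `δ_s ≤ c₀`, so that all actions are feasible. -/
def batchBase (c₀ : ℝ) : ℕ := ⌈(c₀ ^ 4)⁻¹⌉₊ + 1

/-- `ρ(t) = 6 κ₀ / √t`. -/
def rate (κ₀ : ℝ) (t : ℕ) : ℝ := 6 * κ₀ / Real.sqrt t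

/-- The action in period `t` of the multi-scale framework run with the gradient ascent algorithm and
`ρ(t) = 6 κ₀ / √t`. The copy serving as order-`m` thread from period `τ` on starts at `z₀ τ m`. -/
def query {d : ℕ} (T : ℕ) (σ L B c₀ : ℝ) (X : Set (Pt d)) (z₀ : ℕ → ℕ → Pt d)
    (u : ℕ → ℕ → ℝ) (y : ℕ → ℝ) (t : ℕ) : Pt d :=
  masterAction
    (ascentAlg (innerSet X c₀) (1 / L) (kappa d T σ L B c₀) (σ / L) (batchBase c₀))
    (fun τ m => AscentState.start (z₀ τ m)) T (rate (kappa d T σ L B c₀)) u y t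

/-! ### The environment -/

/-- The assumptions on the domain `X`, the objectives `f_1, …, f_T` (only their values on `X`
matter) and their maximizers `xs_1, …, xs_T`. -/
structure Regular {d : ℕ} (T : ℕ) (σ L B c₀ : ℝ) (X : Set (Pt d)) (f : ℕ → Pt d → ℝ)
    (xs : ℕ → Pt d) : Prop where
  compact : IsCompact X
  convex : Convex ℝ X
  diam_le : Metric.diam X ≤ B
  bounded : ∀ t ∈ Finset.Icc 1 T, ∀ x ∈ X, |f t x| ≤ 1
  smooth : ∀ t ∈ Finset.Icc 1 T, ContDiffOn ℝ 2 (f t) X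
  grad_le : ∀ t ∈ Finset.Icc 1 T, ∀ x ∈ X, ‖fderivWithin ℝ (f t) X x‖ ≤ L
  hess_le : ∀ t ∈ Finset.Icc 1 T, ∀ x ∈ X,
    ‖fderivWithin ℝ (fderivWithin ℝ (f t) X) X x‖ ≤ L
  concave : ∀ t ∈ Finset.Icc 1 T, ∀ x ∈ X, ∀ v : Pt d,
    σ * ‖v‖ ^ 2 ≤ -(fderivWithin ℝ (fderivWithin ℝ (f t) X) X x v v)
  max_mem : ∀ t ∈ Finset.Icc 1 T, xs t ∈ X
  isMax : ∀ t ∈ Finset.Icc 1 T, IsMaxOn (f t) X (xs t)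
  interior : ∀ t ∈ Finset.Icc 1 T, ∀ z ∈ frontier X, c₀ ≤ dist (xs t) z

/-- The information before period `t`: all earlier feedbacks and lotteries. -/
abbrev past {Ω : Type*} (u : ℕ → ℕ → Ω → ℝ) (y : ℕ → Ω → ℝ) (t : ℕ) : MeasurableSpace Ω :=
  (⨆ s ∈ Set.Ico 1 t, MeasurableSpace.comap (y s) inferInstance) ⊔
    (⨆ s ∈ Set.Ico 1 t, ⨆ m : ℕ, MeasurableSpace.comap (u s m) inferInstance)

/-- The lotteries of the windows starting in period `t`. -/
abbrev fresh {Ω : Type*} (u : ℕ → ℕ → Ω → ℝ) (t : ℕ) : MeasurableSpace Ω :=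
  ⨆ m : ℕ, MeasurableSpace.comap (u t m) inferInstance

/-- The random interaction of a learner with the environment: `x t` is the action of the learner in
period `t`. The lotteries of the windows starting in period `t` are independent uniform random
numbers, drawn independently of the past (a lottery has no influence before its window starts, so it
is immaterial that it may be drawn at the beginning of the block already). The feedbacks are bounded
by `1` and have conditional mean `f_t(x_t)` given everything up to the choice of `x_t`. -/
structure Interaction {d : ℕ} {Ω : Type*} [MeasurableSpace Ω] (μ : Measure Ω) (T : ℕ)
    (f : ℕ → Pt d → ℝ) (u : ℕ → ℕ → Ω → ℝ) (y : ℕ → Ω → ℝ) (x : ℕ → Ω → Pt d) : Prop where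
  measurable_u : ∀ t m, Measurable (u t m)
  measurable_y : ∀ t, Measurable (y t)
  uniform : ∀ t m, Measure.map (u t m) μ = volume.restrict (Set.Icc (0 : ℝ) 1)
  indep : ∀ t, iIndepFun (fun m => u t m) μ
  indep_past : ∀ t ∈ Finset.Icc 1 T, Indep (fresh u t) (past u y t) μ
  bounded : ∀ t ∈ Finset.Icc 1 T, ∀ᵐ ω ∂μ, |y t ω| ≤ 1
  mean : ∀ t ∈ Finset.Icc 1 T,
    μ[y t | past u y t ⊔ fresh u t] =ᵐ[μ] fun ω => f t (x t ω)

end NonstatBandit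

end

noncomputable section

namespace NonstatBandit

/-! ### Euclidean geometry of the feasible set -/

/-! One copy of the ascent. Put q = 1 - σ/L. The map x ↦ x + ∇F(x)/L has derivative I + ∇²F/L,
symmetric with spectrum in [0, q], and it fixes the interior maximizer, so an exact step contracts
towards the maximizer by q (`SmoothObj.gradient_step_contraction`). Projecting onto the inner set,
which contains the maximizer, does no harm. In epoch s a two-point estimate of one partial
derivative errs by O(δ_s), for bias and noise alike, plus Δ/δ_s if the objectives have moved by Δ
(`two_point_error`). As δ_s decays like q^s, the distance of the iterate to the maximizer stays
below (s+1) √d A (q^s + Δ/q^s) (`iterate_error_step`, `ascentErr_ascentSeq`). The regret is at most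
L times the squared distance of the action, and after k plays q^(2s) is at most of order √(d/k). So
the k-th play has regret at most κ/(10√k) + MΔ as long as MΔ ≤ 6κ/√k (`ascentSeq_regret`).

The framework on a good realization (`GoodRun`). The estimate, a mean of feedbacks plus 2κ/√k, lies
above the current optimal value up to the drift. Inside a scheduled window of length N the inverse
square roots of the play counts sum to O(log T · √N), because threads of lower order are rare enough
(`Run.sum_inv_sqrt_window_le`). Two consequences follow: no test fails while the drift of the block
is small (`GoodRun.not_fail`), and a scheduled window of small drift that starts after a much too
low estimate makes Test 1 fail (`GoodRun.fail_of_bad_window`). The regret of a block splits into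
(optimum - estimate) + (estimate - feedback) + (feedback - value). Test 2 bounds the second part and
concentration the third. The first part is cut into dyadic levels: a large gap at scale 2^m makes
the next order-m window bad, unless a break point or the end of the block is near. At most one bad
window per block is scheduled, and each is scheduled with the same probability, independently of its
being bad, so there are few of them (`GoodRun.sum_excess_le`, `GoodRun.block_regret`).

Summation. For the analysis only, fix a length w and break points Q that cut the horizon into pieces
of length at most w and small drift (`exists_breaks`). Every failed test is charged to its own break
point, and without a failure the orders of successive blocks increase. Hence there are O(log
T)(|Q|+1) blocks, and the regret is at most of order κ log⁴T (T/√w + (|Q|+1)√w)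
(`GoodRun.total_regret`). With |Q| ≤ T/w + MV√w/(6κ), κ at most d^(3/2) up to logarithms and M = d³
up to logarithms, the choice w ≈ T^(2/3)/(d V^(2/3)) balances the terms (`exists_window`).

Probability. Concentration of the noise along intervals and along the plays of each thread, and of
the numbers of scheduled threads, comes from exponential supermartingales. This needs the control
flow to be predictable: it depends only on earlier feedbacks and lotteries. A union bound with ℓ = 6
ln T leaves an exceptional set on which the trivial regret 2T contributes a constant
(`exists_bad_set`, `integral_regret_le`). All dependence on σ, L, B, c₀ is absorbed into powers of
ln(dT) by taking T₀ large. -/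

lemma innerSet_subset {d : ℕ} {X : Set (Pt d)} {r : ℝ} (hr : 0 ≤ r) : innerSet X r ⊆ X :=
  fun _ hx => hx (Metric.mem_closedBall_self hr)

lemma innerSet_subset_interior {d : ℕ} {X : Set (Pt d)} {r : ℝ} (hr : 0 < r) :
    innerSet X r ⊆ interior X := fun x hx =>
  interior_mono (Metric.ball_subset_closedBall.trans hx)
    (by rw [Metric.isOpen_ball.interior_eq]; exact Metric.mem_ball_self hr)

lemma mem_innerSet_iff {d : ℕ} {X : Set (Pt d)} {r : ℝ} {x : Pt d} :
    x ∈ innerSet X r ↔ ∀ v : Pt d, ‖v‖ ≤ r → x + v ∈ X := by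
  constructor
  · intro h v hv
    exact h (by simpa [Metric.mem_closedBall, dist_eq_norm] using hv)
  · intro h w hw
    have := h (w - x) (by simpa [Metric.mem_closedBall, dist_eq_norm] using hw)
    simpa using this

lemma convex_innerSet {d : ℕ} {X : Set (Pt d)} {r : ℝ} (hX : Convex ℝ X) :
    Convex ℝ (innerSet X r) := by
  intro x hx y hy a b ha hb hab
  rw [mem_innerSet_iff] at *
  intro v hv
  have := hX (hx v hv) (hy v hv) ha hb hab
  have e : a • (x + v) + b • (y + v) = a • x + b • y + v := by
    rw [smul_add, smul_add]
    calc a • x + a • v + (b • y + b • v) = a • x + b • y + (a + b) • v := by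
          rw [add_smul]; abel
      _ = _ := by rw [hab, one_smul]
  rwa [e] at this

lemma isClosed_innerSet {d : ℕ} {X : Set (Pt d)} {r : ℝ} (hX : IsClosed X) :
    IsClosed (innerSet X r) := by
  have : innerSet X r = ⋂ (v : Pt d) (_ : ‖v‖ ≤ r), (fun x => x + v) ⁻¹' X := by
    ext x; simp [mem_innerSet_iff]
  rw [this]
  exact isClosed_iInter fun v => isClosed_iInter fun _ => hX.preimage (by fun_prop)

lemma proj_spec {d : ℕ} {Z : Set (Pt d)} (hne : Z.Nonempty) (hc : IsClosed Z)
    (x : Pt d) : proj Z x ∈ Z ∧ ∀ w ∈ Z, ‖proj Z x - x‖ ≤ ‖w - x‖ := by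
  apply Classical.epsilon_spec (p := fun z => z ∈ Z ∧ ∀ w ∈ Z, ‖z - x‖ ≤ ‖w - x‖)
  obtain ⟨z, hz, h⟩ := hc.exists_infDist_eq_dist hne x
  refine ⟨z, hz, fun w hw => ?_⟩
  have := Metric.infDist_le_dist_of_mem (x := x) hw
  rw [h, dist_comm, dist_comm x w, dist_eq_norm, dist_eq_norm] at this
  exact this

/-- By the variational inequality the angle at the projected point between x and w is obtuse, so
replacing x by its projection cannot increase the distance to w. Applied with w the maximizer, which
lies in the inner set. -/
lemma proj_dist_le {d : ℕ} {Z : Set (Pt d)} (hc : IsClosed Z) (hconv : Convex ℝ Z)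
    (x : Pt d) {w : Pt d} (hw : w ∈ Z) : ‖proj Z x - w‖ ≤ ‖x - w‖ := by
  obtain ⟨hm, hmin⟩ := proj_spec ⟨w, hw⟩ hc x
  set v := proj Z x with hv
  have hI : ‖x - v‖ = ⨅ w : Z, ‖x - (w : Pt d)‖ := by
    have : Nonempty Z := ⟨⟨w, hw⟩⟩
    apply le_antisymm
    · apply le_ciInf
      intro z
      rw [norm_sub_rev, norm_sub_rev x]
      exact hmin z z.2
    · exact ciInf_le ⟨0, by rintro _ ⟨z, rfl⟩; exact norm_nonneg _⟩ (⟨v, hm⟩ : Z)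
  have h := (norm_eq_iInf_iff_real_inner_le_zero hconv hm).1 hI w hw
  have e : ‖x - w‖ ^ 2 = ‖x - v‖ ^ 2 - 2 * inner ℝ (x - v) (w - v) + ‖v - w‖ ^ 2 := by
    have : x - w = (x - v) - (w - v) := by abel
    rw [this, norm_sub_sq_real, norm_sub_rev v w]
  nlinarith [norm_nonneg (x - w), norm_nonneg (v - w), sq_nonneg ‖x - v‖]

/-- A point of a closed set whose distance to the frontier is at least `r` has its closed
`r`-ball in the set. -/
lemma mem_innerSet_of_dist_frontier {d : ℕ} {X : Set (Pt d)} {r : ℝ} (hX : IsClosed X) {x : Pt d}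
    (hx : x ∈ X) (h : ∀ z ∈ frontier X, r ≤ dist x z) : x ∈ innerSet X r := by
  intro w hw
  by_contra hwX
  have hpc : IsPreconnected (segment ℝ x w) := (convex_segment x w).isPreconnected
  -- If the segment missed the frontier, the interior and the complement of the closed set would
  -- disconnect it.
  have : (segment ℝ x w ∩ frontier X).Nonempty := by
    by_contra hne
    rw [Set.not_nonempty_iff_eq_empty] at hne
    have hcov : segment ℝ x w ⊆ interior X ∪ Xᶜ := by
      intro z hz
      by_contra hz'
      simp only [Set.mem_union, not_or, Set.mem_compl_iff, not_not] at hz'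
      have : z ∈ segment ℝ x w ∩ frontier X :=
        ⟨hz, by rw [frontier, hX.closure_eq]; exact ⟨hz'.2, hz'.1⟩⟩
      rw [hne] at this; exact this
    have hxi : x ∈ interior X := by
      rcases hcov (left_mem_segment ℝ x w) with h1 | h1
      · exact h1
      · exact absurd hx h1
    obtain ⟨z, -, hz1, hz2⟩ := hpc (interior X) Xᶜ isOpen_interior hX.isOpen_compl hcov
      ⟨x, left_mem_segment ℝ x w, hxi⟩ ⟨w, right_mem_segment ℝ x w, hwX⟩
    exact hz2 (interior_subset hz1)
  obtain ⟨z, hz, hzf⟩ := this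
  have h1 := h z hzf
  have hd : dist x z + dist z w = dist x w := dist_add_dist_of_mem_segment hz
  have hw' : dist x w ≤ r := by rw [dist_comm]; exact hw
  -- A frontier point on the segment has distance at least r from x, while the segment has length at
  -- most r. It is therefore the far end w, which then lies in the closed set after all.
  have : dist z w = 0 := le_antisymm (by linarith) dist_nonneg
  have hzw : z = w := dist_eq_zero.1 this
  have hfX : frontier X ⊆ X := hX.frontier_subset
  exact hwX (hzw ▸ hfX hzf)

/-- `F` is twice continuously differentiable, `σ`-strongly concave and `L`-smooth on `X`, with an
interior maximizer `xs`. -/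
structure SmoothObj {d : ℕ} (σ L c₀ : ℝ) (X : Set (Pt d)) (F : Pt d → ℝ) (xs : Pt d) : Prop where
  closed : IsClosed X
  convex : Convex ℝ X
  smooth : ContDiffOn ℝ 2 F X
  hess_le : ∀ x ∈ X, ‖fderivWithin ℝ (fderivWithin ℝ F X) X x‖ ≤ L
  concave : ∀ x ∈ X, ∀ v : Pt d, σ * ‖v‖ ^ 2 ≤ -(fderivWithin ℝ (fderivWithin ℝ F X) X x v v)
  max_mem : xs ∈ innerSet X c₀
  isMax : IsMaxOn F X xs

lemma Regular.smoothObj {d T : ℕ} {σ L B c₀ : ℝ} {X : Set (Pt d)} {f : ℕ → Pt d → ℝ}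
    {xs : ℕ → Pt d} (h : Regular T σ L B c₀ X f xs) {t : ℕ} (ht : t ∈ Finset.Icc 1 T) :
    SmoothObj σ L c₀ X (f t) (xs t) where
  closed := h.compact.isClosed
  convex := h.convex
  smooth := h.smooth t ht
  hess_le := h.hess_le t ht
  concave := h.concave t ht
  max_mem := mem_innerSet_of_dist_frontier h.compact.isClosed (h.max_mem t ht) (h.interior t ht)
  isMax := h.isMax t ht

namespace SmoothObj

variable {d : ℕ} {σ L c₀ : ℝ} {X : Set (Pt d)} {F : Pt d → ℝ} {xs : Pt d}

lemma uniqueDiffOn (h : SmoothObj σ L c₀ X F xs) (hc : 0 < c₀) : UniqueDiffOn ℝ X :=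
  uniqueDiffOn_convex h.convex ⟨xs, innerSet_subset_interior hc h.max_mem⟩

lemma hasFDerivWithinAt (h : SmoothObj σ L c₀ X F xs) {x : Pt d} (hx : x ∈ X) :
    HasFDerivWithinAt F (fderivWithin ℝ F X x) X x :=
  ((h.smooth.differentiableOn (by norm_num)) x hx).hasFDerivWithinAt

lemma hasFDerivWithinAt_fderivWithin (h : SmoothObj σ L c₀ X F xs) (hc : 0 < c₀) {x : Pt d}
    (hx : x ∈ X) : HasFDerivWithinAt (fderivWithin ℝ F X)
      (fderivWithin ℝ (fderivWithin ℝ F X) X x) X x :=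
  (((h.smooth.fderivWithin (h.uniqueDiffOn hc) (m := 1) (by norm_num)).differentiableOn
    (by norm_num)) x hx).hasFDerivWithinAt

lemma fderivWithin_lipschitz (h : SmoothObj σ L c₀ X F xs) (hc : 0 < c₀) {x z : Pt d}
    (hx : x ∈ X) (hz : z ∈ X) : ‖fderivWithin ℝ F X z - fderivWithin ℝ F X x‖ ≤ L * ‖z - x‖ :=
  Convex.norm_image_sub_le_of_norm_hasFDerivWithin_le
    (fun _ hy => h.hasFDerivWithinAt_fderivWithin hc hy) h.hess_le h.convex hx hz

lemma fderivWithin_max (h : SmoothObj σ L c₀ X F xs) (hc : 0 < c₀) :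
    fderivWithin ℝ F X xs = 0 := by
  have hn : X ∈ nhds xs := mem_interior_iff_mem_nhds.1 (innerSet_subset_interior hc h.max_mem)
  rw [fderivWithin_of_mem_nhds hn]
  exact IsLocalMax.fderiv_eq_zero (h.isMax.isLocalMax hn)

/-- The derivative vanishes at the maximizer and is L-Lipschitz, hence bounded by L‖a - xs‖ on the
segment, and the mean value inequality gives the rest. The sharper constant L/2 is not needed; what
counts is that the loss is quadratic in the distance. -/
lemma max_sub_le (h : SmoothObj σ L c₀ X F xs) (hc : 0 < c₀) {a : Pt d}
    (ha : a ∈ X) : F xs - F a ≤ L * ‖a - xs‖ ^ 2 := by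
  have hxs := innerSet_subset hc.le h.max_mem
  have hL : 0 ≤ L := (h.hess_le xs hxs).trans' (ContinuousLinearMap.opNorm_nonneg _)
  have hseg : segment ℝ xs a ⊆ X := h.convex.segment_subset hxs ha
  have := Convex.norm_image_sub_le_of_norm_hasFDerivWithin_le (f := F) (C := L * ‖a - xs‖)
    (f' := fderivWithin ℝ F X) (s := segment ℝ xs a)
    (fun y hy => (h.hasFDerivWithinAt (hseg hy)).mono hseg) (fun y hy => by
      have h1 := h.fderivWithin_lipschitz hc hxs (hseg hy)
      rw [h.fderivWithin_max hc, sub_zero] at h1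
      refine h1.trans (mul_le_mul_of_nonneg_left ?_ hL)
      have := dist_add_dist_of_mem_segment hy
      rw [← dist_eq_norm, ← dist_eq_norm, dist_comm, dist_comm a]
      linarith [dist_nonneg (x := y) (y := a)]) (convex_segment xs a)
      (left_mem_segment ℝ xs a) (right_mem_segment ℝ xs a)
  rw [Real.norm_eq_abs] at this
  have := (abs_le.1 this).1
  nlinarith

/-- After subtracting the linear part at the centre, the derivative along the segment of length 2‖v‖
is at most L‖v‖. A Lipschitz gradient is enough for this second-order bound. -/
lemma central_difference (h : SmoothObj σ L c₀ X F xs) (hc : 0 < c₀) {z v : Pt d}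
    (h1 : z + v ∈ X) (h2 : z - v ∈ X) (hz : z ∈ X) :
    |F (z + v) - F (z - v) - 2 * fderivWithin ℝ F X z v| ≤ 2 * L * ‖v‖ ^ 2 := by
  have hL : 0 ≤ L := (h.hess_le z hz).trans' (ContinuousLinearMap.opNorm_nonneg _)
  have hseg : segment ℝ (z - v) (z + v) ⊆ X := h.convex.segment_subset h2 h1
  set D := fderivWithin ℝ F X z
  have := Convex.norm_image_sub_le_of_norm_hasFDerivWithin_le (f := fun x => F x - D x)
    (C := L * ‖v‖) (f' := fun x => fderivWithin ℝ F X x - D) (s := segment ℝ (z - v) (z + v))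
    (fun y hy => ((h.hasFDerivWithinAt (hseg hy)).mono hseg).sub D.hasFDerivWithinAt)
    (fun y hy => by
      refine (h.fderivWithin_lipschitz hc hz (hseg hy)).trans (mul_le_mul_of_nonneg_left ?_ hL)
      rw [segment_eq_image] at hy
      obtain ⟨s, ⟨hs0, hs1⟩, rfl⟩ := hy
      have : (1 - s) • (z - v) + s • (z + v) - z = (2 * s - 1) • v := by module
      rw [this, norm_smul, Real.norm_eq_abs]
      have : |2 * s - 1| ≤ 1 := abs_le.2 ⟨by linarith, by linarith⟩
      nlinarith [norm_nonneg v]) (convex_segment _ _)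
      (left_mem_segment ℝ _ _) (right_mem_segment ℝ _ _)
  have e1 : z + v - (z - v) = (2 : ℝ) • v := by module
  have e2 : F (z + v) - D (z + v) - (F (z - v) - D (z - v)) = F (z + v) - F (z - v) - 2 * D v := by
    simp only [map_add, map_sub]; ring
  rw [e1, e2, norm_smul, Real.norm_eq_abs, Real.norm_eq_abs, abs_two] at this
  linarith

/-- The gradient of `F`. -/
def grad (X : Set (Pt d)) (F : Pt d → ℝ) (x : Pt d) : Pt d :=
  (InnerProductSpace.toDual ℝ (Pt d)).symm (fderivWithin ℝ F X x)

lemma grad_max (h : SmoothObj σ L c₀ X F xs) (hc : 0 < c₀) : grad X F xs = 0 := by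
  rw [grad, h.fderivWithin_max hc, map_zero]

/-- A symmetric operator `A` with `0 ≤ A ≤ q` has norm at most `q`. -/
lemma norm_apply_le_of_symm {A : Pt d →L[ℝ] Pt d} {q : ℝ}
    (hs : ∀ v w, inner ℝ (A v) w = inner ℝ (A w) v) (h0 : ∀ v, 0 ≤ inner ℝ (A v) v)
    (h1 : ∀ v, inner ℝ (A v) v ≤ q * ‖v‖ ^ 2) (v : Pt d) : ‖A v‖ ≤ q * ‖v‖ := by
  -- Cauchy-Schwarz for the semidefinite form of A, read off the discriminant of the quadratic
  -- polynomial t ↦ ⟨A(v + tw), v + tw⟩. It is used with w = A v.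
  have key : ∀ w, (inner ℝ (A v) w) ^ 2 ≤ inner ℝ (A v) v * inner ℝ (A w) w := by
    intro w
    have := discrim_le_zero (a := inner ℝ (A w) w) (b := 2 * inner ℝ (A v) w)
      (c := inner ℝ (A v) v) (fun t => by
        have := h0 (v + t • w)
        rw [map_add, map_smul, inner_add_left, inner_add_right, inner_add_right, inner_smul_left,
          inner_smul_left, inner_smul_right, inner_smul_right, hs w v] at this
        simp only [conj_trivial] at this
        linarith)
    rw [discrim] at this
    linarith
  by_cases hA : A v = 0
  · rw [hA, norm_zero]
    by_cases hv : v = 0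
    · simp [hv]
    · have := (h0 v).trans (h1 v)
      have hv' : 0 < ‖v‖ := norm_pos_iff.2 hv
      have : 0 ≤ q := nonneg_of_mul_nonneg_left this (by positivity)
      positivity
  · have hp : 0 < ‖A v‖ := norm_pos_iff.2 hA
    have hk := key (A v)
    rw [real_inner_self_eq_norm_sq] at hk
    have a1 := h1 v
    have a2 := h1 (A v)
    have hq : 0 ≤ q := nonneg_of_mul_nonneg_left ((h0 _).trans a2) (by positivity)
    have : (‖A v‖ ^ 2) ^ 2 ≤ (q * ‖v‖ ^ 2) * (q * ‖A v‖ ^ 2) :=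
      hk.trans (mul_le_mul a1 a2 (h0 _) (by positivity))
    have h3 : ‖A v‖ ^ 2 ≤ (q * ‖v‖) ^ 2 := by
      have : ‖A v‖ ^ 2 * ‖A v‖ ^ 2 ≤ (q * ‖v‖) ^ 2 * ‖A v‖ ^ 2 := by nlinarith
      exact le_of_mul_le_mul_right this (by positivity)
    exact abs_le_of_sq_le_sq' h3 (by positivity) |>.2

/-- The derivative I + ∇²F/L of the step map is symmetric and lies between 0 (by smoothness) and 1 -
σ/L (by strong concavity), so its operator norm is at most 1 - σ/L on the convex set X. The
maximizer is a fixed point. -/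
lemma gradient_step_contraction (h : SmoothObj σ L c₀ X F xs) (hc : 0 < c₀) (hL : 0 < L)
    (hσ : σ ≤ L) {z : Pt d} (hz : z ∈ X) :
    ‖z + (1 / L) • grad X F z - xs‖ ≤ (1 - σ / L) * ‖z - xs‖ := by
  have hxs := innerSet_subset hc.le h.max_mem
  -- The inverse Riesz map, which turns derivatives into gradients and the second derivative into an
  -- operator on the space itself.
  let D : (Pt d →L[ℝ] ℝ) →L[ℝ] Pt d :=
    (InnerProductSpace.toDual ℝ (Pt d)).symm.toContinuousLinearEquiv.toContinuousLinearMap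
  have hD : ∀ (g : Pt d →L[ℝ] ℝ) (w : Pt d), inner ℝ (D g) w = g w := fun g w =>
    InnerProductSpace.toDual_symm_apply
  let H := fun x => fderivWithin ℝ (fderivWithin ℝ F X) X x
  let A : Pt d → (Pt d →L[ℝ] Pt d) := fun x =>
    ContinuousLinearMap.id ℝ (Pt d) + (1 / L) • D.comp (H x)
  have hA : ∀ x v w, inner ℝ (A x v) w = inner ℝ v w + (1 / L) * H x v w := by
    intro x v w
    change inner ℝ (v + (1 / L) • D (H x v)) w = _
    rw [inner_add_left, real_inner_smul_left, hD]
  have hb : ∀ x ∈ X, ‖A x‖ ≤ 1 - σ / L := by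
    intro x hx
    have hq : 0 ≤ 1 - σ / L := sub_nonneg.2 ((div_le_one hL).2 hσ)
    refine (A x).opNorm_le_bound hq (norm_apply_le_of_symm ?_ ?_ ?_)
    · intro v w
      -- Symmetry is also available at boundary points: a convex set with nonempty interior lies in
      -- the closure of that interior.
      have hsym : IsSymmSndFDerivWithinAt ℝ F X x :=
        (h.smooth x hx).isSymmSndFDerivWithinAt (by simp) (h.uniqueDiffOn hc)
          (by rw [(h.convex).closure_interior_eq_closure_of_nonempty_interior
                ⟨xs, innerSet_subset_interior hc h.max_mem⟩]; exact subset_closure hx) hx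
      rw [hA, hA, real_inner_comm, hsym v w]
    · intro v
      rw [hA, real_inner_self_eq_norm_sq]
      have h3 := (H x).le_opNorm₂ v v
      have h4 := h.hess_le x hx
      rw [Real.norm_eq_abs] at h3
      have h5 := (abs_le.1 h3).1
      have h6 : ‖H x‖ * ‖v‖ * ‖v‖ ≤ L * ‖v‖ * ‖v‖ := by gcongr
      have h7 : 0 ≤ L * ‖v‖ ^ 2 + H x v v := by nlinarith
      have : ‖v‖ ^ 2 + 1 / L * H x v v = (1 / L) * (L * ‖v‖ ^ 2 + H x v v) := by field_simp
      rw [this]; positivity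
    · intro v
      rw [hA, real_inner_self_eq_norm_sq]
      have h2 := h.concave x hx v
      change σ * ‖v‖ ^ 2 ≤ -(H x v v) at h2
      have : ‖v‖ ^ 2 + 1 / L * H x v v = (1 - σ / L) * ‖v‖ ^ 2
        + (1 / L) * (H x v v + σ * ‖v‖ ^ 2) := by field_simp; ring
      rw [this]
      have : (1 / L) * (H x v v + σ * ‖v‖ ^ 2) ≤ 0 :=
        mul_nonpos_of_nonneg_of_nonpos (by positivity) (by linarith)
      linarith
  have := Convex.norm_image_sub_le_of_norm_hasFDerivWithin_le
    (f := fun x => x + (1 / L) • grad X F x) (f' := A) (C := 1 - σ / L) (s := X)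
    (fun y hy => (hasFDerivWithinAt_id y X).add
      ((D.hasFDerivAt.comp_hasFDerivWithinAt y
        (h.hasFDerivWithinAt_fderivWithin hc hy)).const_smul (1 / L))) hb h.convex hxs hz
  simpa [h.grad_max hc] using this

end SmoothObj

/-! ### Coordinate vectors and one inexact projected gradient step. -/

lemma basisVec_eq_single {d j : ℕ} (hj : j < d) :
    basisVec d j = EuclideanSpace.single (⟨j, hj⟩ : Fin d) (1 : ℝ) := by
  ext i
  simp [basisVec, Fin.ext_iff]

lemma norm_basisVec {d j : ℕ} (hj : j < d) : ‖basisVec d j‖ = 1 := by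
  rw [basisVec_eq_single hj]; simp

lemma inner_basisVec {d j : ℕ} (hj : j < d) (x : Pt d) :
    inner ℝ x (basisVec d j) = x ⟨j, hj⟩ := by
  rw [basisVec_eq_single hj, EuclideanSpace.inner_single_right]; simp

lemma norm_le_sqrt_mul {d : ℕ} {x : Pt d} {ε : ℝ} (h : ∀ i, |x i| ≤ ε) (hε : 0 ≤ ε) :
    ‖x‖ ≤ Real.sqrt d * ε := by
  rw [EuclideanSpace.norm_eq]
  apply Real.sqrt_le_iff.2 ⟨by positivity, ?_⟩
  rw [mul_pow, Real.sq_sqrt (by positivity)]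
  calc ∑ i, ‖x i‖ ^ 2 ≤ ∑ _i : Fin d, ε ^ 2 := by
        apply Finset.sum_le_sum; intro i _
        rw [Real.norm_eq_abs]
        exact pow_le_pow_left₀ (abs_nonneg _) (h i) 2
    _ = d * ε ^ 2 := by simp

/-- One projected gradient step with an inexact gradient. -/
lemma SmoothObj.norm_proj_step_le {d : ℕ} {σ L c₀ : ℝ} {X : Set (Pt d)} {F : Pt d → ℝ} {xs : Pt d}
    (h : SmoothObj σ L c₀ X F xs) (hc : 0 < c₀) (hL : 0 < L) (hσ : σ ≤ L) {z : Pt d} (hz : z ∈ X)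
    {g : Fin d → ℝ} {ε : ℝ} (hε : 0 ≤ ε)
    (hg : ∀ i : Fin d, |g i - fderivWithin ℝ F X z (basisVec d i)| ≤ ε) :
    ‖proj (innerSet X c₀) (z + (1 / L) • (WithLp.toLp 2 g : Pt d)) - xs‖ ≤
      (1 - σ / L) * ‖z - xs‖ + (1 / L) * (Real.sqrt d * ε) := by
  refine (proj_dist_le (isClosed_innerSet h.closed) (convex_innerSet h.convex) _ h.max_mem).trans ?_
  have e : z + (1 / L) • (WithLp.toLp 2 g : Pt d) - xs = (z + (1 / L) • grad X F z - xs)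
      + (1 / L) • ((WithLp.toLp 2 g : Pt d) - grad X F z) := by module
  rw [e]
  refine (norm_add_le _ _).trans (add_le_add (h.gradient_step_contraction hc hL hσ hz) ?_)
  rw [norm_smul, Real.norm_eq_abs, abs_of_pos (by positivity)]
  refine mul_le_mul_of_nonneg_left (norm_le_sqrt_mul (fun i => ?_) hε) (by positivity)
  have h1 := hg i
  have h2 : fderivWithin ℝ F X z (basisVec d i) = grad X F z i := by
    rw [← inner_basisVec i.2, grad, InnerProductSpace.toDual_symm_apply]
  rw [h2] at h1
  exact h1


/-! ### Batch sizes and radii -/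

lemma batchBase_pos (c₀ : ℝ) : 1 ≤ batchBase c₀ := Nat.le_add_left 1 _

section Batch

variable {γ : ℝ} {N₀ : ℕ}

lemma le_batchSize (s : ℕ) : (N₀ : ℝ) / (1 - γ) ^ (4 * s) ≤ batchSize γ N₀ s := Nat.le_ceil _

lemma batchBase_le_batchSize (h0 : 0 < γ) (h1 : γ < 1) (s : ℕ) :
    (N₀ : ℝ) ≤ batchSize γ N₀ s := by
  refine le_trans ?_ (le_batchSize s)
  rw [le_div_iff₀ (pow_pos (by linarith) _)]
  exact mul_le_of_le_one_right (Nat.cast_nonneg _) (pow_le_one₀ (by linarith) (by linarith))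

lemma batchSize_pos (hN : 1 ≤ N₀) (h0 : 0 < γ) (h1 : γ < 1) (s : ℕ) : 0 < batchSize γ N₀ s := by
  have := batchBase_le_batchSize (N₀ := N₀) h0 h1 s
  have h : (1 : ℝ) ≤ N₀ := by exact_mod_cast hN
  exact_mod_cast (by linarith : (0 : ℝ) < batchSize γ N₀ s)

lemma batchSize_le (hN : 1 ≤ N₀) (h0 : 0 < γ) (h1 : γ < 1) (s : ℕ) :
    (batchSize γ N₀ s : ℝ) ≤ 2 * N₀ / (1 - γ) ^ (4 * s) := by
  have hp : 0 < (1 - γ) ^ (4 * s) := pow_pos (by linarith) _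
  have h : (1 : ℝ) ≤ N₀ := by exact_mod_cast hN
  have h2 : 1 ≤ (N₀ : ℝ) / (1 - γ) ^ (4 * s) := by
    rw [le_div_iff₀ hp, one_mul]
    exact (pow_le_one₀ (by linarith) (by linarith)).trans h
  have := Nat.ceil_lt_add_one (zero_le_one.trans h2)
  rw [mul_div_assoc, batchSize]
  linarith

lemma radius_pos (hN : 1 ≤ N₀) (h0 : 0 < γ) (h1 : γ < 1) (s : ℕ) : 0 < radius γ N₀ s :=
  Real.rpow_pos_of_pos (by exact_mod_cast batchSize_pos hN h0 h1 s) _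

/-- The balance that fixes the exponent -1/4: averaging n feedbacks leaves noise of order 1/√n,
hence 1/(δ√n) in the difference quotient. With δ⁴n = 1 this equals δ, the order of the bias. -/
lemma radius_pow_mul (hN : 1 ≤ N₀) (h0 : 0 < γ) (h1 : γ < 1) (s : ℕ) :
    radius γ N₀ s ^ 4 * batchSize γ N₀ s = 1 := by
  have hp : (0 : ℝ) < batchSize γ N₀ s := by exact_mod_cast batchSize_pos hN h0 h1 s
  rw [radius, ← Real.rpow_natCast, ← Real.rpow_mul hp.le]
  norm_num
  rw [Real.rpow_neg hp.le, Real.rpow_one, inv_mul_cancel₀ hp.ne']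

lemma radius_le_pow (hN : 1 ≤ N₀) (h0 : 0 < γ) (h1 : γ < 1) (s : ℕ) :
    radius γ N₀ s ≤ (1 - γ) ^ s := by
  have hq : 0 < 1 - γ := by linarith
  have hr := radius_pow_mul hN h0 h1 s
  have hb := le_batchSize (γ := γ) (N₀ := N₀) s
  have h : (1 : ℝ) ≤ N₀ := by exact_mod_cast hN
  have hpos := radius_pos hN h0 h1 s
  refine le_of_pow_le_pow_left₀ (n := 4) (by norm_num) (by positivity) ?_
  rw [← pow_mul, mul_comm s 4]
  rw [div_le_iff₀ (pow_pos hq _)] at hb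
  have h2 : 1 ≤ (batchSize γ N₀ s : ℝ) * (1 - γ) ^ (4 * s) := h.trans hb
  have hn : (0 : ℝ) < batchSize γ N₀ s := by exact_mod_cast batchSize_pos hN h0 h1 s
  nlinarith [pow_pos hpos 4]

lemma inv_radius_le (hN : 1 ≤ N₀) (h0 : 0 < γ) (h1 : γ < 1) (s : ℕ) :
    1 / radius γ N₀ s ≤ 2 * N₀ / (1 - γ) ^ s := by
  have hq : 0 < 1 - γ := by linarith
  have hr := radius_pow_mul hN h0 h1 s
  have hb := batchSize_le (γ := γ) hN h0 h1 s
  have h : (1 : ℝ) ≤ N₀ := by exact_mod_cast hN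
  have hpos := radius_pos hN h0 h1 s
  refine le_of_pow_le_pow_left₀ (n := 4) (by norm_num) (by positivity) ?_
  rw [div_pow, one_pow, div_pow, ← pow_mul, mul_comm s 4]
  have : 1 / radius γ N₀ s ^ 4 = batchSize γ N₀ s := by
    rw [div_eq_iff (by positivity)]; linarith
  rw [this]
  refine hb.trans (div_le_div_of_nonneg_right ?_ (by positivity))
  have h2 : (1 : ℝ) ≤ 2 * N₀ := by linarith
  exact le_self_pow₀ h2 (by norm_num)

lemma radius_le {c₀ : ℝ} (hc : 0 < c₀) (h0 : 0 < γ) (h1 : γ < 1) (s : ℕ) :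
    radius γ (batchBase c₀) s ≤ c₀ := by
  have hN := batchBase_pos c₀
  have hr := radius_pow_mul hN h0 h1 s
  have hb := batchBase_le_batchSize (N₀ := batchBase c₀) h0 h1 s
  have hpos := radius_pos hN h0 h1 s
  have h3 : (c₀ ^ 4)⁻¹ ≤ batchBase c₀ := by
    have := Nat.le_ceil ((c₀ ^ 4)⁻¹)
    rw [batchBase]; push_cast; linarith
  refine le_of_pow_le_pow_left₀ (n := 4) (by norm_num) hc.le ?_
  have h4 := h3.trans hb
  rw [inv_le_iff_one_le_mul₀ (by positivity)] at h4
  have hn : (0 : ℝ) < batchSize γ (batchBase c₀) s := by exact_mod_cast batchSize_pos hN h0 h1 s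
  nlinarith [pow_pos hpos 4]

end Batch

/-! ### A single copy of the ascent algorithm along its own plays -/

/-- The state of a copy of the ascent algorithm after `k` plays with feedbacks `Y 0, Y 1, …`. -/
def ascentSeq {d : ℕ} (Z : Set (Pt d)) (η γ : ℝ) (N₀ : ℕ) (z₀ : Pt d) (Y : ℕ → ℝ) :
    ℕ → AscentState d
  | 0 => AscentState.start z₀
  | k + 1 => (ascentSeq Z η γ N₀ z₀ Y k).update Z η γ N₀ (Y k)

/-- The bookkeeping of the ascent algorithm after `k` plays; `a` is the sequence of its actions. -/
structure AscentInv {d : ℕ} (Z : Set (Pt d)) (γ : ℝ) (N₀ : ℕ) (Y : ℕ → ℝ) (a : ℕ → Pt d)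
    (S : AscentState d) (k : ℕ) : Prop where
  clock : S.clock = k
  total : S.total = ∑ l ∈ Finset.range k, Y l
  coord_lt : S.coord < d
  step_lt : S.step < 2 * batchSize γ N₀ S.epoch
  index : k = d * ∑ r ∈ Finset.range S.epoch, 2 * batchSize γ N₀ r
    + 2 * batchSize γ N₀ S.epoch * S.coord + S.step
  mem : S.z ∈ Z
  uPlus : S.uPlus = ∑ l ∈ Finset.Ico (k - S.step) k with Even l, Y l
  uMinus : S.uMinus = ∑ l ∈ Finset.Ico (k - S.step) k with ¬ Even l, Y l
  acts : ∀ l ∈ Finset.Ico (k - S.step) k, a l =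
    if Even l then S.z + radius γ N₀ S.epoch • basisVec d S.coord
    else S.z - radius γ N₀ S.epoch • basisVec d S.coord

namespace AscentInv

variable {d : ℕ} {Z : Set (Pt d)} {η γ : ℝ} {N₀ : ℕ} {Y : ℕ → ℝ} {a : ℕ → Pt d}
  {S : AscentState d} {k : ℕ}

/-- All batches have even length, so the sign of a query depends only on the parity of the play
index within the thread. The plus and minus plays are thus described without reference to epochs,
which keeps the family of noise events small. -/
lemma even_step (h : AscentInv Z γ N₀ Y a S k) : Even S.step ↔ Even k := by
  have hi := h.index
  have : k = 2 * (d * ∑ r ∈ Finset.range S.epoch, batchSize γ N₀ r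
      + batchSize γ N₀ S.epoch * S.coord) + S.step := by
    rw [← Finset.mul_sum] at hi
    nlinarith
  rw [this]
  simp [Nat.even_add]

lemma step_le (h : AscentInv Z γ N₀ Y a S k) : S.step ≤ k := by
  have hi := h.index
  omega

lemma uPlus_next (h : AscentInv Z γ N₀ Y a S k) :
    (if Even S.step then S.uPlus + Y k else S.uPlus)
      = ∑ l ∈ Finset.Ico (k - S.step) (k + 1) with Even l, Y l := by
  have hle : k - S.step ≤ k := Nat.sub_le _ _
  rw [Finset.sum_filter, Finset.sum_Ico_succ_top hle, ← Finset.sum_filter, ← h.uPlus]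
  by_cases he : Even k
  · simp [he, h.even_step]
  · simp [he, h.even_step]

lemma uMinus_next (h : AscentInv Z γ N₀ Y a S k) :
    (if Even S.step then S.uMinus else S.uMinus + Y k)
      = ∑ l ∈ Finset.Ico (k - S.step) (k + 1) with ¬ Even l, Y l := by
  have hle : k - S.step ≤ k := Nat.sub_le _ _
  rw [Finset.sum_filter, Finset.sum_Ico_succ_top hle, ← Finset.sum_filter, ← h.uMinus]
  by_cases he : Even k
  · simp [he, h.even_step]
  · simp [he, h.even_step]

lemma acts_next (h : AscentInv Z γ N₀ Y a S k) (ha : a k = S.action γ N₀) :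
    ∀ l ∈ Finset.Ico (k - S.step) (k + 1), a l =
      if Even l then S.z + radius γ N₀ S.epoch • basisVec d S.coord
      else S.z - radius γ N₀ S.epoch • basisVec d S.coord := by
  intro l hl
  rw [Finset.mem_Ico] at hl
  rcases Nat.lt_succ_iff_lt_or_eq.1 hl.2 with h1 | h1
  · exact h.acts l (Finset.mem_Ico.2 ⟨hl.1, h1⟩)
  · rw [h1, ha, AscentState.action]
    simp only [h.even_step]

lemma update (h : AscentInv Z γ N₀ Y a S k) (hZc : IsClosed Z)
    (hn : ∀ s, 0 < batchSize γ N₀ s) (ha : a k = S.action γ N₀) :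
    AscentInv Z γ N₀ Y a (S.update Z η γ N₀ (Y k)) (k + 1) := by
  have hup := h.uPlus_next
  have hum := h.uMinus_next
  have hac := h.acts_next ha
  have hi := h.index
  have hst := h.step_lt
  have hco := h.coord_lt
  have hle := h.step_le
  unfold AscentState.update
  by_cases h1 : S.step + 1 < 2 * batchSize γ N₀ S.epoch
  · simp only [h1, if_true]
    have e : k + 1 - (S.step + 1) = k - S.step := by omega
    exact ⟨by simp [h.clock], by simp [h.total, Finset.sum_range_succ], hco, h1, by simp; omega,
      h.mem, by simpa [e] using hup, by simpa [e] using hum, by simpa [e] using hac⟩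
  · have h1' : S.step + 1 = 2 * batchSize γ N₀ S.epoch := by omega
    by_cases h2 : S.coord + 1 < d
    · simp only [h1, if_false, h2, if_true]
      refine ⟨by simp [h.clock], by simp [h.total, Finset.sum_range_succ], h2, ?_, ?_, h.mem,
        by simp, by simp, by simp⟩
      · simpa using hn _
      · simp only [mul_add, mul_one]; omega
    · have h2' : d = S.coord + 1 := by omega
      simp only [h1, if_false, h2]
      refine ⟨by simp [h.clock], by simp [h.total, Finset.sum_range_succ], by simp; omega, ?_, ?_,
        (proj_spec ⟨S.z, h.mem⟩ hZc _).1, by simp, by simp, by simp⟩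
      · simpa using hn _
      · simp only [Finset.sum_range_succ, mul_add, mul_zero, add_zero]
        have : d * (2 * batchSize γ N₀ S.epoch)
          = 2 * batchSize γ N₀ S.epoch * S.coord + 2 * batchSize γ N₀ S.epoch := by
          exact (congrArg (· * (2 * batchSize γ N₀ S.epoch)) h2').trans (by ring)
        omega

end AscentInv

lemma ascentInv_ascentSeq {d : ℕ} {Z : Set (Pt d)} {η γ : ℝ} {N₀ : ℕ} {z₀ : Pt d} {Y : ℕ → ℝ}
    (hd : 1 ≤ d) (hZc : IsClosed Z) (hz₀ : z₀ ∈ Z) (hn : ∀ s, 0 < batchSize γ N₀ s) (k : ℕ) :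
    AscentInv Z γ N₀ Y (fun l => (ascentSeq Z η γ N₀ z₀ Y l).action γ N₀)
      (ascentSeq Z η γ N₀ z₀ Y k) k := by
  induction k with
  | zero =>
    refine ⟨rfl, by simp [ascentSeq, AscentState.start], hd, ?_, ?_, hz₀, ?_, ?_, ?_⟩
    · simpa [ascentSeq, AscentState.start] using hn 0
    all_goals simp [ascentSeq, AscentState.start]
  | succ k ih => exact ih.update hZc hn rfl

lemma AscentState.action_mem {d : ℕ} {X : Set (Pt d)} {c₀ γ : ℝ} (hc : 0 < c₀) (h0 : 0 < γ)
    (h1 : γ < 1) {S : AscentState d} (hz : S.z ∈ innerSet X c₀) (hco : S.coord < d) :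
    S.action γ (batchBase c₀) ∈ X := by
  have hr := radius_le hc h0 h1 S.epoch
  have hp := radius_pos (batchBase_pos c₀) h0 h1 S.epoch
  have hv : ‖radius γ (batchBase c₀) S.epoch • basisVec d S.coord‖ ≤ c₀ := by
    rw [norm_smul, norm_basisVec hco, Real.norm_eq_abs, abs_of_pos hp, mul_one]; exact hr
  rw [mem_innerSet_iff] at hz
  unfold AscentState.action
  split_ifs
  · exact hz _ hv
  · rw [sub_eq_add_neg]; exact hz _ (by rwa [norm_neg])

lemma card_even_Ico {k : ℕ} (hk : Even k) (n : ℕ) :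
    ((Finset.Ico k (k + 2 * n)).filter Even).card = n ∧
      ((Finset.Ico k (k + 2 * n)).filter (fun l => ¬ Even l)).card = n := by
  induction n with
  | zero => simp
  | succ n ih =>
    have e : k + 2 * (n + 1) = k + 2 * n + 1 + 1 := by ring
    have ev : Even (k + 2 * n) := hk.add (by simp)
    rw [e, Finset.card_filter, Finset.card_filter, Finset.sum_Ico_succ_top (by omega),
      Finset.sum_Ico_succ_top (by omega), Finset.sum_Ico_succ_top (by omega),
      Finset.sum_Ico_succ_top (by omega), ← Finset.card_filter, ← Finset.card_filter, ih.1, ih.2]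
    simp [ev, Nat.even_add_one]

/-- The error of the two-point estimate of one partial derivative. -/
lemma two_point_error {d : ℕ} {σ L c₀ Δ ν δ : ℝ} {X : Set (Pt d)} {F : Pt d → ℝ} {xs z e : Pt d}
    (h : SmoothObj σ L c₀ X F xs) (hc : 0 < c₀) {n : ℕ} (hn : 0 < n) (hδ : 0 < δ)
    (hδn : δ ^ 4 * n = 1) (he : ‖e‖ = 1) (hz : z ∈ X) (hzp : z + δ • e ∈ X) (hzm : z - δ • e ∈ X)
    (hν : 0 ≤ ν) {up um : ℝ} (hup : |up - n * F (z + δ • e)| ≤ n * Δ + ν * Real.sqrt (2 * n))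
    (hum : |um - n * F (z - δ • e)| ≤ n * Δ + ν * Real.sqrt (2 * n)) :
    |(up - um) / (2 * δ * n) - fderivWithin ℝ F X z e| ≤ (L + 2 * ν) * δ + Δ * (1 / δ) := by
  have hn' : (0 : ℝ) < n := by exact_mod_cast hn
  -- Here δ⁴n = 1 enters: the square of the right side equals 4n. The noise √(2n) divided by δn is
  -- then of order δ.
  have hs : Real.sqrt (2 * n) ≤ 2 * δ ^ 2 * n := by
    apply Real.sqrt_le_iff.2 ⟨by positivity, ?_⟩
    have : (2 * δ ^ 2 * n) ^ 2 = 4 * (δ ^ 4 * n) * n := by ring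
    rw [this, hδn]; linarith
  have hcd := h.central_difference hc hzp hzm hz
  rw [norm_smul, he, Real.norm_eq_abs, abs_of_pos hδ, mul_one, map_smul, smul_eq_mul] at hcd
  set D := fderivWithin ℝ F X z e
  have hs' : ν * Real.sqrt (2 * n) ≤ ν * (2 * δ ^ 2 * n) := mul_le_mul_of_nonneg_left hs hν
  have hD : (up - um) / (2 * δ * n) - D = (up - um - 2 * δ * n * D) / (2 * δ * n) := by
    field_simp
  rw [hD, abs_div, abs_of_pos (by positivity : 0 < 2 * δ * n), div_le_iff₀ (by positivity)]
  have e1 : ((L + 2 * ν) * δ + Δ * (1 / δ)) * (2 * δ * n)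
    = 2 * (n * Δ) + 2 * (ν * (2 * δ ^ 2 * n)) + n * (2 * L * δ ^ 2) := by
    field_simp; ring
  rw [e1]
  have e2 : up - um - 2 * δ * n * D = (up - n * F (z + δ • e)) - (um - n * F (z - δ • e))
    + n * (F (z + δ • e) - F (z - δ • e) - 2 * (δ * D)) := by ring
  rw [e2]
  have h3 : |(n : ℝ) * (F (z + δ • e) - F (z - δ • e) - 2 * (δ * D))| ≤ n * (2 * L * δ ^ 2) := by
    rw [abs_mul, abs_of_pos hn']; exact mul_le_mul_of_nonneg_left hcd hn'.le
  have := abs_add_le (up - n * F (z + δ • e) - (um - n * F (z - δ • e)))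
    (n * (F (z + δ • e) - F (z - δ • e) - 2 * (δ * D)))
  have := abs_sub (up - n * F (z + δ • e)) (um - n * F (z - δ • e))
  linarith

/-- The sum of the feedbacks at one of the two points of a two-point estimate. -/
lemma abs_sum_feedback_sub_le {d : ℕ} {Δ b : ℝ} {F : Pt d → ℝ} {f : ℕ → Pt d → ℝ} {Y : ℕ → ℝ}
    {a : ℕ → Pt d} {w : Pt d} {s : Finset ℕ} (ha : ∀ l ∈ s, a l = w)
    (hΔ : ∀ l ∈ s, |f l w - F w| ≤ Δ) (hnoise : |∑ l ∈ s, (Y l - f l (a l))| ≤ b) :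
    |∑ l ∈ s, Y l - s.card * F w| ≤ s.card * Δ + b := by
  have e : ∑ l ∈ s, Y l - s.card * F w
      = ∑ l ∈ s, (f l w - F w) + ∑ l ∈ s, (Y l - f l (a l)) := by
    rw [← Finset.sum_add_distrib, ← nsmul_eq_mul, ← Finset.sum_const, ← Finset.sum_sub_distrib]
    refine Finset.sum_congr rfl fun l hl => ?_
    rw [ha l hl]; ring
  rw [e]
  refine (abs_add_le _ _).trans (add_le_add ?_ hnoise)
  refine (Finset.abs_sum_le_sum_abs _ _).trans ?_
  rw [← nsmul_eq_mul]
  exact Finset.sum_le_card_nsmul _ _ _ hΔ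


/-- Error bounds for the iterate and the partial derivatives found so far. -/
def AscentErr {d : ℕ} (X : Set (Pt d)) (F : Pt d → ℝ) (xs : Pt d) (E ε : ℕ → ℝ)
    (S : AscentState d) : Prop :=
  ‖S.z - xs‖ ≤ E S.epoch ∧ ∀ i : Fin d, (i : ℕ) < S.coord →
    |S.grad i - fderivWithin ℝ F X S.z (basisVec d i)| ≤ ε S.epoch

/-- Induction over single plays. The errors change only when a batch is complete: then a new partial
derivative becomes available, and after the last coordinate one inexact projected step is made. The
sequence `E` need only be a supersolution of the resulting recursion. -/
lemma ascentErr_ascentSeq {d : ℕ} {σ L c₀ Δ ν : ℝ} {X : Set (Pt d)} {F : Pt d → ℝ} {xs z₀ : Pt d}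
    {f : ℕ → Pt d → ℝ} {Y : ℕ → ℝ} {E : ℕ → ℝ} {K : ℕ}
    (hd : 1 ≤ d) (h : SmoothObj σ L c₀ X F xs) (hc : 0 < c₀) (hσ : 0 < σ) (hσL : σ < L)
    (hν : 0 ≤ ν) (hΔ : 0 ≤ Δ) (hz₀ : z₀ ∈ innerSet X c₀) (hE0 : ‖z₀ - xs‖ ≤ E 0)
    (hE : ∀ s, (1 - σ / L) * E s + (1 / L) * (Real.sqrt d *
      ((L + 2 * ν) * radius (σ / L) (batchBase c₀) s
        + Δ * (1 / radius (σ / L) (batchBase c₀) s))) ≤ E (s + 1))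
    (hdrift : ∀ l < K, ∀ x ∈ X, |f l x - F x| ≤ Δ)
    (hnoise : ∀ a b, a ≤ b → b ≤ K → ∀ p : ℕ → Prop, [DecidablePred p] →
      (p = Even ∨ p = fun l => ¬ Even l) →
      |∑ l ∈ Finset.Ico a b with p l, (Y l - f l ((ascentSeq (innerSet X c₀) (1 / L) (σ / L)
        (batchBase c₀) z₀ Y l).action (σ / L) (batchBase c₀)))| ≤ ν * Real.sqrt (b - a : ℕ))
    (k : ℕ) (hk : k ≤ K) :
    AscentErr X F xs E (fun s => (L + 2 * ν) * radius (σ / L) (batchBase c₀) s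
        + Δ * (1 / radius (σ / L) (batchBase c₀) s))
      (ascentSeq (innerSet X c₀) (1 / L) (σ / L) (batchBase c₀) z₀ Y k) := by
  have hL : 0 < L := hσ.trans hσL
  have h0 : 0 < σ / L := div_pos hσ hL
  have h1 : σ / L < 1 := (div_lt_one hL).2 hσL
  have hN := batchBase_pos c₀
  have hZc := isClosed_innerSet (r := c₀) h.closed
  induction k with
  | zero =>
    refine ⟨by simpa [ascentSeq, AscentState.start] using hE0, ?_⟩
    simp [ascentSeq, AscentState.start]
  | succ k ih =>
    have ih := ih (by omega)
    have hI := ascentInv_ascentSeq (η := 1 / L) (Y := Y) hd hZc hz₀ (batchSize_pos hN h0 h1) k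
    have hup := hI.uPlus_next
    have hum := hI.uMinus_next
    have hac := hI.acts_next rfl
    have hle := hI.step_le
    have hco := hI.coord_lt
    have hst := hI.step_lt
    have hmem := hI.mem
    have hact : ∀ l, (ascentSeq (innerSet X c₀) (1 / L) (σ / L) (batchBase c₀) z₀ Y l).action
        (σ / L) (batchBase c₀) ∈ X := fun l => by
      have := ascentInv_ascentSeq (η := 1 / L) (Y := Y) hd hZc hz₀ (batchSize_pos hN h0 h1) l
      exact AscentState.action_mem hc h0 h1 this.mem this.coord_lt
    rw [ascentSeq]
    set S := ascentSeq (innerSet X c₀) (1 / L) (σ / L) (batchBase c₀) z₀ Y k with hS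
    set δ := radius (σ / L) (batchBase c₀) S.epoch with hδdef
    have hδ : 0 < δ := radius_pos hN h0 h1 _
    unfold AscentState.update
    by_cases hc1 : S.step + 1 < 2 * batchSize (σ / L) (batchBase c₀) S.epoch
    · simp only [hc1, if_true]
      exact ih
    have hfull : S.step + 1 = 2 * batchSize (σ / L) (batchBase c₀) S.epoch := by omega
    have hnp := batchSize_pos hN h0 h1 S.epoch
    -- A batch starts at an even play index, so splitting its 2n plays by parity gives exactly n at
    -- each of the two points.
    have hk0 : Even (k - S.step) := by
      rw [Nat.even_sub hle, hI.even_step]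
    have hk1 : k + 1 = k - S.step + 2 * batchSize (σ / L) (batchBase c₀) S.epoch := by omega
    have hcard := card_even_Ico hk0 (batchSize (σ / L) (batchBase c₀) S.epoch)
    rw [← hk1] at hcard
    have hsub : ((k + 1 - (k - S.step) : ℕ) : ℝ)
        = 2 * batchSize (σ / L) (batchBase c₀) S.epoch := by
      have : k + 1 - (k - S.step) = 2 * batchSize (σ / L) (batchBase c₀) S.epoch := by omega
      rw [this]; push_cast; ring
    have hbp : ∀ w, (∀ l ∈ (Finset.Ico (k - S.step) (k + 1)).filter Even,
        (ascentSeq (innerSet X c₀) (1 / L) (σ / L) (batchBase c₀) z₀ Y l).action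
        (σ / L) (batchBase c₀) = w) → w ∈ X := by
      intro w hw
      have : ((Finset.Ico (k - S.step) (k + 1)).filter Even).Nonempty := by
        rw [← Finset.card_pos, hcard.1]; exact hnp
      obtain ⟨l, hl⟩ := this
      rw [← hw l hl]; exact hact l
    have hbm : ∀ w, (∀ l ∈ (Finset.Ico (k - S.step) (k + 1)).filter (fun l => ¬ Even l),
        (ascentSeq (innerSet X c₀) (1 / L) (σ / L) (batchBase c₀) z₀ Y l).action
        (σ / L) (batchBase c₀) = w) → w ∈ X := by
      intro w hw
      have : ((Finset.Ico (k - S.step) (k + 1)).filter (fun l => ¬ Even l)).Nonempty := by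
        rw [← Finset.card_pos, hcard.2]; exact hnp
      obtain ⟨l, hl⟩ := this
      rw [← hw l hl]; exact hact l
    have hap : ∀ l ∈ (Finset.Ico (k - S.step) (k + 1)).filter Even,
        (ascentSeq (innerSet X c₀) (1 / L) (σ / L) (batchBase c₀) z₀ Y l).action
        (σ / L) (batchBase c₀) = S.z + δ • basisVec d S.coord := by
      intro l hl
      rw [Finset.mem_filter] at hl
      have := hac l hl.1
      rwa [if_pos hl.2] at this
    have ham : ∀ l ∈ (Finset.Ico (k - S.step) (k + 1)).filter (fun l => ¬ Even l),
        (ascentSeq (innerSet X c₀) (1 / L) (σ / L) (batchBase c₀) z₀ Y l).action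
        (σ / L) (batchBase c₀) = S.z - δ • basisVec d S.coord := by
      intro l hl
      rw [Finset.mem_filter] at hl
      have := hac l hl.1
      rwa [if_neg hl.2] at this
    have hxp := hbp _ hap
    have hxm := hbm _ ham
    have e1 := abs_sum_feedback_sub_le (Y := Y) (f := f) (F := F) hap (fun l hl => by
      rw [Finset.mem_filter, Finset.mem_Ico] at hl
      exact hdrift l (by omega) _ hxp) (hnoise _ _ (by omega) hk Even (Or.inl rfl))
    have e2 := abs_sum_feedback_sub_le (Y := Y) (f := f) (F := F) ham (fun l hl => by
      rw [Finset.mem_filter, Finset.mem_Ico] at hl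
      exact hdrift l (by omega) _ hxm) (hnoise _ _ (by omega) hk (fun l => ¬ Even l) (Or.inr rfl))
    rw [hcard.1, ← hup, hsub] at e1
    rw [hcard.2, ← hum, hsub] at e2
    have hg := two_point_error h hc hnp hδ (radius_pow_mul hN h0 h1 _) (norm_basisVec hco)
      (innerSet_subset hc.le hmem) hxp hxm hν e1 e2
    have hgrad : ∀ i : Fin d, (i : ℕ) < S.coord + 1 →
        |(if (i : ℕ) = S.coord then
            ((if Even S.step then S.uPlus + Y k else S.uPlus)
              - (if Even S.step then S.uMinus else S.uMinus + Y k)) /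
              (2 * δ * batchSize (σ / L) (batchBase c₀) S.epoch) else S.grad i)
          - fderivWithin ℝ F X S.z (basisVec d i)| ≤ (L + 2 * ν) * δ + Δ * (1 / δ) := by
      intro i hi
      by_cases hi2 : (i : ℕ) = S.coord
      · rw [if_pos hi2, hi2]; exact hg
      · rw [if_neg hi2]; exact ih.2 i (by omega)
    by_cases hc2 : S.coord + 1 < d
    · simp only [hc1, if_false, hc2, if_true]
      exact ⟨ih.1, hgrad⟩
    · simp only [hc1, if_false, hc2]
      refine ⟨?_, by simp⟩
      have := h.norm_proj_step_le hc hL hσL.le (innerSet_subset hc.le hmem)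
        (by positivity) (fun i => hgrad i (by have := i.2; omega))
      refine this.trans (le_trans ?_ (hE S.epoch))
      have hq : 0 ≤ 1 - σ / L := by linarith
      have := mul_le_mul_of_nonneg_left ih.1 hq
      exact add_le_add_left this _


/-! ### Numerical form of the error recursion and the length of the epochs. -/

lemma mul_pow_add_div_le {q Δ : ℝ} {n : ℕ} (hq : 0 < q) (hq1 : q < 1) (hΔ : 0 ≤ Δ) :
    q * (q ^ n + Δ / q ^ n) ≤ q ^ (n + 1) + Δ / q ^ (n + 1) := by
  have e : q ^ (n + 1) = q * q ^ n := by ring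
  have : q * (Δ / q ^ n) ≤ Δ / q ^ (n + 1) := by
    rw [le_div_iff₀ (by positivity), pow_succ]
    have : q * (Δ / q ^ n) * (q ^ n * q) = Δ * (q * q) := by field_simp
    rw [this]
    have : q * q ≤ 1 := by nlinarith
    nlinarith
  rw [mul_add]
  linarith

/-- The new errors δ_s decay at the same rate q as the old ones are contracted, so they accumulate
linearly. This resonance is the origin of the factor s + 1. The constant A is chosen such that one
fresh error is at most D A (q^(n+1) + Δ/q^(n+1)). -/
lemma iterate_error_step {q L ν Δ D A N δ B s : ℝ} {n : ℕ} (hq : 0 < q) (hq1 : q < 1) (hL : 0 < L)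
    (hν : 0 ≤ ν) (hΔ : 0 ≤ Δ) (hD : 0 ≤ D) (hB : 0 ≤ B) (hN : 0 ≤ N)
    (hs : 0 ≤ s) (hA : A = B + (L + 2 * ν + 2 * N) / (L * q)) (hδ : δ ≤ q ^ n)
    (hδ' : 1 / δ ≤ 2 * N / q ^ n) :
    q * ((s + 1) * D * A * (q ^ n + Δ / q ^ n)) + (1 / L) * (D * ((L + 2 * ν) * δ + Δ * (1 / δ)))
      ≤ (s + 2) * D * A * (q ^ (n + 1) + Δ / q ^ (n + 1)) := by
  have hp : 0 < q ^ n := pow_pos hq n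
  have h1 : (L + 2 * ν) * δ + Δ * (1 / δ) ≤ (L + 2 * ν + 2 * N) * (q ^ n + Δ / q ^ n) := by
    have a1 : (L + 2 * ν) * δ ≤ (L + 2 * ν) * q ^ n := mul_le_mul_of_nonneg_left hδ (by positivity)
    have a2 : Δ * (1 / δ) ≤ Δ * (2 * N / q ^ n) := mul_le_mul_of_nonneg_left hδ' hΔ
    have a3 : Δ * (2 * N / q ^ n) = 2 * N * (Δ / q ^ n) := by ring
    have a4 : 0 ≤ (L + 2 * ν) * (Δ / q ^ n) := by positivity
    have a5 : 0 ≤ 2 * N * q ^ n := by positivity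
    nlinarith
  have h2 : (L + 2 * ν + 2 * N) / L ≤ A * q := by
    rw [hA, add_mul]
    have : (L + 2 * ν + 2 * N) / (L * q) * q = (L + 2 * ν + 2 * N) / L := by field_simp
    rw [this]; have := mul_nonneg hB hq.le; linarith
  have hA0 : 0 ≤ A := by rw [hA]; positivity
  have h3 := mul_pow_add_div_le (n := n) hq hq1 hΔ
  have h4 : (1 / L) * (D * ((L + 2 * ν) * δ + Δ * (1 / δ)))
      ≤ D * A * (q ^ (n + 1) + Δ / q ^ (n + 1)) := by
    calc (1 / L) * (D * ((L + 2 * ν) * δ + Δ * (1 / δ)))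
        ≤ (1 / L) * (D * ((L + 2 * ν + 2 * N) * (q ^ n + Δ / q ^ n))) := by gcongr
      _ = D * (((L + 2 * ν + 2 * N) / L) * (q ^ n + Δ / q ^ n)) := by ring
      _ ≤ D * ((A * q) * (q ^ n + Δ / q ^ n)) := by gcongr
      _ = D * A * (q * (q ^ n + Δ / q ^ n)) := by ring
      _ ≤ _ := by gcongr
  have h5 := mul_le_mul_of_nonneg_left h3 (by positivity : 0 ≤ (s + 1) * D * A)
  nlinarith

lemma sum_inv_pow_le {γ : ℝ} (h0 : 0 < γ) (h1 : γ < 1) (s : ℕ) :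
    ∑ r ∈ Finset.range (s + 1), 1 / (1 - γ) ^ (4 * r) ≤ 1 / (γ * (1 - γ) ^ (4 * s)) := by
  have hq : 0 < 1 - γ := by linarith
  induction s with
  | zero => simpa using (one_le_inv₀ h0).2 h1.le
  | succ s ih =>
    rw [Finset.sum_range_succ]
    refine (add_le_add_left ih _).trans ?_
    have hp : 0 < (1 - γ) ^ (4 * s) := pow_pos hq _
    have e : (1 - γ) ^ (4 * (s + 1)) = (1 - γ) ^ (4 * s) * (1 - γ) ^ 4 := by ring
    rw [e]
    have h4 : (1 - γ) ^ 4 ≤ 1 - γ := pow_le_of_le_one hq.le (by linarith) (by norm_num)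
    have hp4 : 0 < (1 - γ) ^ 4 := pow_pos hq _
    have : 1 / (γ * (1 - γ) ^ (4 * s)) + 1 / ((1 - γ) ^ (4 * s) * (1 - γ) ^ 4)
      = ((1 - γ) ^ 4 + γ) / (γ * ((1 - γ) ^ (4 * s) * (1 - γ) ^ 4)) := by
      field_simp
    rw [this]
    gcongr
    linarith

namespace AscentInv

variable {d : ℕ} {Z : Set (Pt d)} {γ : ℝ} {N₀ : ℕ} {Y : ℕ → ℝ} {a : ℕ → Pt d}
  {S : AscentState d} {k : ℕ}

/-- All plays so far lie in the epochs up to the current one, and the geometric sum of their lengths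
is dominated by its last term. This bounds q^(2s) by a multiple of √(d/k). -/
lemma index_le (h : AscentInv Z γ N₀ Y a S k) (hN : 1 ≤ N₀) (h0 : 0 < γ) (h1 : γ < 1) :
    (k : ℝ) + 1 ≤ 4 * d * N₀ / (γ * (1 - γ) ^ (4 * S.epoch)) := by
  have hq : 0 < 1 - γ := by linarith
  have hk : k + 1 ≤ d * ∑ r ∈ Finset.range (S.epoch + 1), 2 * batchSize γ N₀ r := by
    have hi := h.index
    have hs := h.step_lt
    have hc := h.coord_lt
    rw [Finset.sum_range_succ, mul_add]
    have : (S.coord + 1) * (2 * batchSize γ N₀ S.epoch) ≤ d * (2 * batchSize γ N₀ S.epoch) :=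
      Nat.mul_le_mul_right _ hc
    rw [add_mul, one_mul] at this
    have e : 2 * batchSize γ N₀ S.epoch * S.coord = S.coord * (2 * batchSize γ N₀ S.epoch) :=
      mul_comm _ _
    omega
  have hk' : (k : ℝ) + 1 ≤ d * ∑ r ∈ Finset.range (S.epoch + 1), 2 * (batchSize γ N₀ r : ℝ) := by
    exact_mod_cast hk
  refine hk'.trans ?_
  calc (d : ℝ) * ∑ r ∈ Finset.range (S.epoch + 1), 2 * (batchSize γ N₀ r : ℝ)
      ≤ d * ∑ r ∈ Finset.range (S.epoch + 1), 4 * N₀ * (1 / (1 - γ) ^ (4 * r)) := by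
        refine mul_le_mul_of_nonneg_left (Finset.sum_le_sum fun r _ => ?_) (Nat.cast_nonneg _)
        exact le_of_le_of_eq (mul_le_mul_of_nonneg_left (batchSize_le hN h0 h1 r) zero_le_two)
          (by ring)
    _ = 4 * d * N₀ * ∑ r ∈ Finset.range (S.epoch + 1), 1 / (1 - γ) ^ (4 * r) := by
        rw [← Finset.mul_sum]; ring
    _ ≤ 4 * d * N₀ * (1 / (γ * (1 - γ) ^ (4 * S.epoch))) := by
        gcongr; exact sum_inv_pow_le h0 h1 _
    _ = _ := by ring

/-- A positive epoch is entered only after the previous one has been finished. This bounds the drift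
amplification q^(-2s) by a multiple of √k, and it makes the number of epochs logarithmic. -/
lemma le_index (h : AscentInv Z γ N₀ Y a S k) (hN : 1 ≤ N₀) (h0 : 0 < γ) (h1 : γ < 1) :
    1 / (1 - γ) ^ (4 * S.epoch) ≤ ((k : ℝ) + 1) / (1 - γ) ^ 4 := by
  have hq : 0 < 1 - γ := by linarith
  have hp4 : 0 < (1 - γ) ^ 4 := pow_pos hq _
  have hp41 : (1 - γ) ^ 4 ≤ 1 := pow_le_one₀ hq.le (by linarith)
  rw [le_div_iff₀ hp4]
  rcases Nat.eq_zero_or_pos S.epoch with hs | hs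
  · rw [hs]; simp; have : (0 : ℝ) ≤ k := Nat.cast_nonneg _
    linarith
  · obtain ⟨s, hs'⟩ : ∃ s, S.epoch = s + 1 := ⟨S.epoch - 1, by omega⟩
    have hd : 1 ≤ d := by have := h.coord_lt; omega
    have hk : batchSize γ N₀ s ≤ k := by
      have hi := h.index
      rw [hs', Finset.sum_range_succ] at hi
      have : 1 * (2 * batchSize γ N₀ s) ≤ d * (2 * batchSize γ N₀ s) := Nat.mul_le_mul_right _ hd
      rw [mul_add] at hi
      omega
    have hk' : (batchSize γ N₀ s : ℝ) ≤ k := by exact_mod_cast hk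
    have hb := le_batchSize (γ := γ) (N₀ := N₀) s
    have hN' : (1 : ℝ) ≤ N₀ := by exact_mod_cast hN
    have hps : 0 < (1 - γ) ^ (4 * s) := pow_pos hq _
    have : 1 / (1 - γ) ^ (4 * s) ≤ (N₀ : ℝ) / (1 - γ) ^ (4 * s) := by gcongr
    have e : 1 / (1 - γ) ^ (4 * S.epoch) * (1 - γ) ^ 4 = 1 / (1 - γ) ^ (4 * s) := by
      rw [hs', show 4 * (s + 1) = 4 * s + 4 by ring, pow_add]
      field_simp
    rw [e]; linarith

end AscentInv

/-- The numerical part of `ascentSeq_regret`; `D` is the distance of the action to the maximizer. -/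
lemma sq_dist_bound {L N γ κ M W Δ A q D dd k : ℝ} {s : ℕ} (hL : 0 < L) (hγ : 0 < γ) (hγN : γ ≤ N)
    (hq : 0 < q) (hdd : 1 ≤ dd) (hΔ : 0 ≤ Δ) (hM : 0 < M) (hk : 0 < k) (hD0 : 0 ≤ D)
    (hD : D ≤ ((s : ℝ) + 2) * Real.sqrt dd * (A + 1) * (q ^ s + Δ / q ^ s))
    (hW : ((s : ℝ) + 2) ^ 2 * (A + 1) ^ 2 ≤ W)
    (hup : k ≤ 4 * dd * N / (γ * q ^ (4 * s))) (hlo : 1 / q ^ (4 * s) ≤ k / q ^ 4)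
    (h1 : 8 * L * (N / γ) * W * (dd * Real.sqrt dd) ≤ κ / 10)
    (h2 : 12 * κ * L * W * dd / q ^ 2 ≤ M ^ 2) (hMΔ : M * Δ ≤ 6 * κ / Real.sqrt k) :
    L * D ^ 2 ≤ (κ / 10) / Real.sqrt k + M * Δ := by
  have hqs : 0 < q ^ s := pow_pos hq s
  have hN : 0 < N := hγ.trans_le hγN
  have hW0 : 0 ≤ W := hW.trans' (by positivity)
  have hsq : D ^ 2 ≤ 2 * W * dd * ((q ^ s) ^ 2 + Δ ^ 2 * (1 / q ^ s) ^ 2) := by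
    calc D ^ 2 ≤ (((s : ℝ) + 2) * Real.sqrt dd * (A + 1) * (q ^ s + Δ / q ^ s)) ^ 2 :=
          pow_le_pow_left₀ hD0 hD 2
      _ = (((s : ℝ) + 2) ^ 2 * (A + 1) ^ 2) * (Real.sqrt dd) ^ 2 * (q ^ s + Δ / q ^ s) ^ 2 := by ring
      _ = (((s : ℝ) + 2) ^ 2 * (A + 1) ^ 2) * (dd * (q ^ s + Δ / q ^ s) ^ 2) := by
          rw [Real.sq_sqrt (by positivity)]; ring
      _ ≤ W * (dd * (2 * ((q ^ s) ^ 2 + (Δ / q ^ s) ^ 2))) := by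
          refine mul_le_mul hW ?_ (by positivity) hW0
          refine mul_le_mul_of_nonneg_left ?_ (by linarith)
          nlinarith [sq_nonneg (q ^ s - Δ / q ^ s)]
      _ = _ := by ring
  have hsK : 0 < Real.sqrt k := Real.sqrt_pos.2 hk
  have e4 : q ^ (4 * s) = ((q ^ s) ^ 2) ^ 2 := by ring
  have b1 : (q ^ s) ^ 2 ≤ 4 * (N / γ) * Real.sqrt dd / Real.sqrt k := by
    rw [le_div_iff₀ hsK]
    have hg : 1 ≤ N / γ := by rwa [le_div_iff₀ hγ, one_mul]
    refine le_of_pow_le_pow_left₀ (n := 2) (by norm_num) (by positivity) ?_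
    rw [mul_pow, mul_pow, Real.sq_sqrt hk.le, Real.sq_sqrt (by positivity), ← e4]
    rw [le_div_iff₀ (by positivity)] at hup
    have h3 : q ^ (4 * s) * k ≤ 4 * (N / γ) * dd := by
      have e : 4 * (N / γ) * dd = (4 * dd * N) / γ := by ring
      rw [e, le_div_iff₀ hγ]; linarith
    have : 4 * (N / γ) ≤ (4 * (N / γ)) ^ 2 := le_self_pow₀ (by linarith) (by norm_num)
    exact h3.trans (mul_le_mul_of_nonneg_right this (by linarith))
  have b2 : (1 / q ^ s) ^ 2 ≤ Real.sqrt k / q ^ 2 := by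
    rw [le_div_iff₀ (by positivity)]
    refine le_of_pow_le_pow_left₀ (n := 2) (by norm_num) (by positivity) ?_
    rw [Real.sq_sqrt hk.le]
    rw [le_div_iff₀ (by positivity)] at hlo
    calc ((1 / q ^ s) ^ 2 * q ^ 2) ^ 2 = 1 / q ^ (4 * s) * q ^ 4 := by rw [e4]; field_simp
      _ ≤ _ := hlo
  have c1 : L * (2 * W * dd * (q ^ s) ^ 2) ≤ (κ / 10) / Real.sqrt k := by
    calc L * (2 * W * dd * (q ^ s) ^ 2)
        ≤ L * (2 * W * dd * (4 * (N / γ) * Real.sqrt dd / Real.sqrt k)) := by gcongr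
      _ = (8 * L * (N / γ) * W * (dd * Real.sqrt dd)) / Real.sqrt k := by ring
      _ ≤ _ := by gcongr
  have c2 : L * (2 * W * dd * (Δ ^ 2 * (1 / q ^ s) ^ 2)) ≤ M * Δ := by
    -- One of the two factors Δ is traded for 6κ/(M√k). This cancels the √k from `b2`, and `h2`
    -- reduces the remaining coefficient of Δ to M.
    have hΔM : Δ ≤ 6 * κ / (M * Real.sqrt k) := by
      rw [le_div_iff₀ (by positivity)]
      rw [le_div_iff₀ hsK] at hMΔ
      linarith
    calc L * (2 * W * dd * (Δ ^ 2 * (1 / q ^ s) ^ 2))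
        ≤ L * (2 * W * dd * (Δ ^ 2 * (Real.sqrt k / q ^ 2))) := by gcongr
      _ = L * (2 * W * dd * (Real.sqrt k / q ^ 2)) * Δ * Δ := by ring
      _ ≤ L * (2 * W * dd * (Real.sqrt k / q ^ 2)) * Δ * (6 * κ / (M * Real.sqrt k)) := by gcongr
      _ = (12 * κ * L * W * dd / q ^ 2) / M * Δ := by field_simp; ring
      _ ≤ M ^ 2 / M * Δ := by gcongr
      _ = M * Δ := by field_simp
  calc L * D ^ 2 ≤ L * (2 * W * dd * ((q ^ s) ^ 2 + Δ ^ 2 * (1 / q ^ s) ^ 2)) := by gcongr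
    _ = L * (2 * W * dd * (q ^ s) ^ 2) + L * (2 * W * dd * (Δ ^ 2 * (1 / q ^ s) ^ 2)) := by ring
    _ ≤ _ := add_le_add c1 c2

/-- The regret of a single play of the ascent algorithm, when the noise has concentrated and the
objectives have moved by at most `Δ` so far. -/
lemma ascentSeq_regret {d : ℕ} {σ L B c₀ Δ ν κ M W : ℝ} {X : Set (Pt d)} {F : Pt d → ℝ}
    {xs z₀ : Pt d} {f : ℕ → Pt d → ℝ} {Y : ℕ → ℝ} {K : ℕ}
    (hd : 1 ≤ d) (h : SmoothObj σ L c₀ X F xs) (hc : 0 < c₀) (hσ : 0 < σ) (hσL : σ < L)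
    (hν : 0 ≤ ν) (hΔ : 0 ≤ Δ) (hz₀ : z₀ ∈ innerSet X c₀) (hB : ‖z₀ - xs‖ ≤ B)
    (hdrift : ∀ l < K, ∀ x ∈ X, |f l x - F x| ≤ Δ)
    (hnoise : ∀ a b, a ≤ b → b ≤ K → ∀ p : ℕ → Prop, [DecidablePred p] →
      (p = Even ∨ p = fun l => ¬ Even l) →
      |∑ l ∈ Finset.Ico a b with p l, (Y l - f l ((ascentSeq (innerSet X c₀) (1 / L) (σ / L)
        (batchBase c₀) z₀ Y l).action (σ / L) (batchBase c₀)))| ≤ ν * Real.sqrt (b - a : ℕ))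
    (hM : 0 < M)
    (hW : ∀ s : ℕ, 1 / (1 - σ / L) ^ (4 * s) ≤ ((K : ℝ) + 1) / (1 - σ / L) ^ 4 →
      ((s : ℝ) + 2) ^ 2 *
        (B + (L + 2 * ν + 2 * batchBase c₀) / (L * (1 - σ / L)) + 1) ^ 2 ≤ W)
    (h1 : 8 * L * (batchBase c₀ / (σ / L)) * W * (d * Real.sqrt d) ≤ κ / 10)
    (h2 : 12 * κ * L * W * d / (1 - σ / L) ^ 2 ≤ M ^ 2)
    (hMΔ : M * Δ ≤ 6 * κ / Real.sqrt (K + 1)) :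
    F xs - F ((ascentSeq (innerSet X c₀) (1 / L) (σ / L) (batchBase c₀) z₀ Y K).action (σ / L)
      (batchBase c₀)) ≤ (κ / 10) / Real.sqrt (K + 1) + M * Δ := by
  have hL : 0 < L := hσ.trans hσL
  have h0 : 0 < σ / L := div_pos hσ hL
  have h1' : σ / L < 1 := (div_lt_one hL).2 hσL
  have hN := batchBase_pos c₀
  have hNr : (1 : ℝ) ≤ batchBase c₀ := by exact_mod_cast hN
  have hZc := isClosed_innerSet (r := c₀) h.closed
  set q := 1 - σ / L with hqd
  have hq : 0 < q := by linarith
  have hq1 : q < 1 := by linarith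
  have hB0 : 0 ≤ B := (norm_nonneg _).trans hB
  set A := B + (L + 2 * ν + 2 * batchBase c₀) / (L * q) with hA
  have hA0 : 0 ≤ A := by positivity
  have hsd : 1 ≤ Real.sqrt d := Real.one_le_sqrt.2 (by exact_mod_cast hd)
  have hI := ascentInv_ascentSeq (η := 1 / L) (Y := Y) hd hZc hz₀ (batchSize_pos hN h0 h1') K
  have hE := ascentErr_ascentSeq (E := fun s => ((s : ℝ) + 1) * Real.sqrt d * A
      * (q ^ s + Δ / q ^ s)) hd h hc hσ hσL hν hΔ hz₀ (by
        simp only [Nat.cast_zero, pow_zero]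
        refine hB.trans ?_
        have : B ≤ A := by rw [hA]; have : 0 ≤ (L + 2 * ν + 2 * batchBase c₀) / (L * q) := by positivity
                           linarith
        calc B ≤ A := this
          _ = (0 + 1) * 1 * A * (1 + 0) := by ring
          _ ≤ (0 + 1) * Real.sqrt d * A * (1 + Δ / 1) := by gcongr; positivity)
      (fun s => by
        have := iterate_error_step (N := batchBase c₀) (n := s) (s := s) hq hq1 hL hν hΔ
          (Real.sqrt_nonneg d) hB0 (by positivity) (by positivity) hA
          (radius_le_pow hN h0 h1' s) (inv_radius_le hN h0 h1' s)
        refine this.trans (le_of_eq ?_)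
        push_cast
        ring) hdrift hnoise K le_rfl
  set S := ascentSeq (innerSet X c₀) (1 / L) (σ / L) (batchBase c₀) z₀ Y K with hS
  have hup := hI.index_le hN h0 h1'
  have hlo := hI.le_index hN h0 h1'
  set s := S.epoch with hs
  have hqs : 0 < q ^ s := pow_pos hq s
  have hWs := hW s hlo
  have hmem : S.action (σ / L) (batchBase c₀) ∈ X :=
    AscentState.action_mem hc h0 h1' hI.mem hI.coord_lt
  have hδ : 0 < radius (σ / L) (batchBase c₀) s := radius_pos hN h0 h1' s
  have hdist : ‖S.action (σ / L) (batchBase c₀) - xs‖ ≤ ‖S.z - xs‖ + q ^ s := by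
    have hv : ‖radius (σ / L) (batchBase c₀) s • basisVec d S.coord‖ ≤ q ^ s := by
      rw [norm_smul, norm_basisVec hI.coord_lt, Real.norm_eq_abs, abs_of_pos hδ, mul_one]
      exact radius_le_pow hN h0 h1' s
    unfold AscentState.action
    split_ifs
    · rw [add_sub_right_comm]; exact (norm_add_le _ _).trans (by gcongr)
    · rw [sub_right_comm]; exact (norm_sub_le _ _).trans (by gcongr)
  have hdist2 : ‖S.action (σ / L) (batchBase c₀) - xs‖
      ≤ ((s : ℝ) + 2) * Real.sqrt d * (A + 1) * (q ^ s + Δ / q ^ s) := by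
    have := hE.1
    have a1 : q ^ s ≤ 1 * 1 * (A + 1) * (q ^ s + Δ / q ^ s) := by
      have : 0 ≤ Δ / q ^ s := by positivity
      nlinarith
    have a2 : 1 * 1 * (A + 1) * (q ^ s + Δ / q ^ s)
      ≤ 1 * Real.sqrt d * (A + 1) * (q ^ s + Δ / q ^ s) := by gcongr
    have a3 : ((s : ℝ) + 1) * Real.sqrt d * A * (q ^ s + Δ / q ^ s)
      ≤ ((s : ℝ) + 1) * Real.sqrt d * (A + 1) * (q ^ s + Δ / q ^ s) := by gcongr; linarith
    have e : ((s : ℝ) + 2) * Real.sqrt d * (A + 1) * (q ^ s + Δ / q ^ s)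
      = ((s : ℝ) + 1) * Real.sqrt d * (A + 1) * (q ^ s + Δ / q ^ s)
        + 1 * Real.sqrt d * (A + 1) * (q ^ s + Δ / q ^ s) := by ring
    rw [e]; linarith
  have hreg := h.max_sub_le hc hmem
  refine hreg.trans ?_
  exact sq_dist_bound hL h0 (h1'.le.trans hNr) hq (by exact_mod_cast hd) hΔ hM (by positivity)
    (norm_nonneg _) hdist2 hWs hup hlo h1 h2 hMΔ


/-! ### The multi-scale framework along one realization -/

/-- The data of one run of the multi-scale framework. -/
structure Run (d : ℕ) where
  alg : BanditAlg d
  start : ℕ → ℕ → alg.State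
  T : ℕ
  ρ : ℕ → ℝ
  u : ℕ → ℕ → ℝ
  y : ℕ → ℝ

/-- The state of an algorithm after `k` steps from the state `s` with feedbacks `Y 0, Y 1, …`. -/
def BanditAlg.run {d : ℕ} (A : BanditAlg d) (s : A.State) (Y : ℕ → ℝ) : ℕ → A.State
  | 0 => s
  | k + 1 => A.update (A.run s Y k) (Y k)

namespace Run

variable {d : ℕ} (R : Run d)

/-- The state before period `t`. -/
def state (t : ℕ) : MasterState R.alg := masterRun R.alg R.start R.T R.ρ R.u R.y (t - 1)

/-- The start of the current block. -/
def bs (t : ℕ) : ℕ := (R.state t).blockStart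

/-- The order of the current block. -/
def ord (t : ℕ) : ℕ := (R.state t).order

/-- The order of the running thread. -/
def ac (t : ℕ) : ℕ := (R.state t).active R.ρ R.u

/-- The start of the current order-`m` window. -/
def ws (t m : ℕ) : ℕ := R.bs t + (t - R.bs t) / 2 ^ m * 2 ^ m

/-- The state of the order-`m` thread in period `t`. -/
def cur (t m : ℕ) : R.alg.State := (R.state t).current R.start m

/-- The estimate output in period `t`. -/
def est (t : ℕ) : ℝ := R.alg.estimate (R.alg.update (R.cur t (R.ac t)) (R.y t))

/-- The thread of order `m` is scheduled in period `t`. -/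
def Covers (t m : ℕ) : Prop := m ≤ R.ord t ∧ R.u (R.ws t m) m ≤ R.ρ (2 ^ R.ord t) / R.ρ (2 ^ m)

/-- Test 1 fails. -/
def FailOne (t : ℕ) : Prop :=
  ∃ m, R.Covers t m ∧ R.ws t m + 2 ^ m = t + 1 ∧ ∃ τ ∈ Finset.Icc (R.bs t) t,
    (∑ s ∈ Finset.Icc (R.ws t m) t, R.y s) / (2 : ℝ) ^ m ≥ R.est τ + 9 * rhoHat R.T R.ρ (2 ^ m)

/-- Test 2 fails. -/
def FailTwo (t : ℕ) : Prop :=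
  (∑ s ∈ Finset.Icc (R.bs t) t, (R.est s - R.y s)) / ((t - R.bs t + 1 : ℕ) : ℝ)
    ≥ 3 * rhoHat R.T R.ρ (t - R.bs t + 1)

/-- A test fails. -/
def Fail (t : ℕ) : Prop := R.FailOne t ∨ R.FailTwo t

lemma state_succ {t : ℕ} (ht : 1 ≤ t) :
    R.state (t + 1) = (R.state t).next R.start R.T R.ρ R.u R.y := by
  obtain ⟨k, rfl⟩ : ∃ k, t = k + 1 := ⟨t - 1, by omega⟩
  rfl

lemma state_one : R.state 1 = ⟨1, 1, 0, R.start 1, fun _ => 0⟩ := rfl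

lemma next_t (S : MasterState R.alg) : (S.next R.start R.T R.ρ R.u R.y).t = S.t + 1 := by
  unfold MasterState.next; simp only; split_ifs <;> rfl

lemma next_est (S : MasterState R.alg) :
    (S.next R.start R.T R.ρ R.u R.y).est = S.newEst R.start R.ρ R.u (R.y S.t) := by
  unfold MasterState.next; simp only; split_ifs <;> rfl

lemma next_thread (S : MasterState R.alg) :
    (S.next R.start R.T R.ρ R.u R.y).thread = Function.update (S.current R.start)
      (S.active R.ρ R.u) (S.played R.start R.ρ R.u (R.y S.t)) := by
  unfold MasterState.next; simp only; split_ifs <;> rfl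

lemma state_t {t : ℕ} (ht : 1 ≤ t) : (R.state t).t = t := by
  induction t, ht using Nat.le_induction with
  | base => rfl
  | succ t ht ih => rw [R.state_succ ht, next_t, ih]

lemma windowStart_eq {t : ℕ} (ht : 1 ≤ t) (m : ℕ) : (R.state t).windowStart m = R.ws t m := by
  unfold MasterState.windowStart ws bs
  rw [R.state_t ht]

lemma covers_iff {t : ℕ} (ht : 1 ≤ t) (m : ℕ) :
    (R.state t).Covers R.ρ R.u m ↔ R.Covers t m := by
  unfold MasterState.Covers Covers
  rw [R.windowStart_eq ht]; rfl

lemma ac_eq {t : ℕ} (ht : 1 ≤ t) : R.ac t = sInf {m | R.Covers t m} := by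
  unfold ac MasterState.active
  simp only [R.covers_iff ht]

lemma newEst_eq {t : ℕ} (ht : 1 ≤ t) {s : ℕ} (h1 : 1 ≤ s) (hs : s ≤ t) :
    (R.state t).newEst R.start R.ρ R.u (R.y t) s = R.est s := by
  have key : ∀ t, 1 ≤ t → (R.state t).newEst R.start R.ρ R.u (R.y t) t = R.est t := by
    intro t ht
    unfold MasterState.newEst
    rw [R.state_t ht, Function.update_self]
    rfl
  induction t, ht using Nat.le_induction with
  | base => rw [le_antisymm hs h1]; exact key 1 le_rfl
  | succ t ht ih =>
    rcases Nat.le_succ_iff.1 hs with h2 | h2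
    · unfold MasterState.newEst
      rw [R.state_t (by omega), Function.update_of_ne (by omega), R.state_succ ht, next_est,
        R.state_t ht]
      exact ih h2
    · rw [h2]; exact key _ (by omega)

lemma inv_aux {t : ℕ} (ht : 1 ≤ t) :
    1 ≤ R.bs t ∧ R.bs t ≤ t ∧ t < R.bs t + 2 ^ R.ord t := by
  induction t, ht using Nat.le_induction with
  | base => exact ⟨le_rfl, le_rfl, by simp [bs, state_one]⟩
  | succ t ht ih =>
    have hp : 0 < 2 ^ R.ord t := by positivity
    unfold bs ord at *
    rw [R.state_succ ht]
    unfold MasterState.next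
    simp only [R.state_t ht]
    split_ifs with h1 h2
    · simp
    · simp
    · simp only
      omega

lemma one_le_bs {t : ℕ} (ht : 1 ≤ t) : 1 ≤ R.bs t := (R.inv_aux ht).1
lemma bs_le {t : ℕ} (ht : 1 ≤ t) : R.bs t ≤ t := (R.inv_aux ht).2.1
lemma lt_bs_add {t : ℕ} (ht : 1 ≤ t) : t < R.bs t + 2 ^ R.ord t := (R.inv_aux ht).2.2

lemma finite_le_iff {s : Finset ℕ} (hs : s.Nonempty) (e : ℕ → ℝ) (a c : ℝ) :
    a ≥ sInf (e '' s) + c ↔ ∃ τ ∈ s, a ≥ e τ + c := by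
  have hf : (e '' s).Finite := s.finite_toSet.image e
  have hne : (e '' s).Nonempty := by simpa using hs
  constructor
  · intro h
    obtain ⟨τ, hτ, he⟩ := hne.csInf_mem hf
    exact ⟨τ, hτ, by rw [he]; exact h⟩
  · rintro ⟨τ, hτ, h⟩
    have := csInf_le hf.bddBelow (Set.mem_image_of_mem e hτ)
    linarith

lemma fail_iff {t : ℕ} (ht : 1 ≤ t) :
    ((R.state t).Fail1 R.T R.ρ R.u R.y ((R.state t).newEst R.start R.ρ R.u (R.y t)) ∨
      (R.state t).Fail2 R.T R.ρ R.y ((R.state t).newEst R.start R.ρ R.u (R.y t))) ↔ R.Fail t := by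
  have hb := R.bs_le ht
  have h1b := R.one_le_bs ht
  refine or_congr ?_ ?_
  · unfold MasterState.Fail1 FailOne
    refine exists_congr fun m => ?_
    rw [R.covers_iff ht, R.windowStart_eq ht, R.state_t ht]
    refine and_congr_right fun _ => and_congr_right fun _ => ?_
    unfold MasterState.lowEst
    rw [R.state_t ht, ← Finset.coe_Icc]
    rw [finite_le_iff (s := Finset.Icc (R.state t).blockStart t)
      ⟨R.bs t, Finset.mem_Icc.2 ⟨le_rfl, hb⟩⟩]
    refine exists_congr fun τ => and_congr_right fun hτ => ?_
    rw [Finset.mem_Icc] at hτ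
    change R.bs t ≤ τ ∧ τ ≤ t at hτ
    rw [R.newEst_eq ht (by omega) hτ.2]
  · unfold MasterState.Fail2 FailTwo
    rw [R.state_t ht]
    have : ∑ τ ∈ Finset.Icc (R.state t).blockStart t,
        ((R.state t).newEst R.start R.ρ R.u (R.y t) τ - R.y τ)
        = ∑ s ∈ Finset.Icc (R.bs t) t, (R.est s - R.y s) := by
      refine Finset.sum_congr rfl fun τ hτ => ?_
      rw [Finset.mem_Icc] at hτ
      change R.bs t ≤ τ ∧ τ ≤ t at hτ
      rw [R.newEst_eq ht (by omega) hτ.2]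
    rw [this]; rfl

open Classical in
lemma bs_succ {t : ℕ} (ht : 1 ≤ t) :
    R.bs (t + 1) = if R.Fail t ∨ t + 1 = R.bs t + 2 ^ R.ord t then t + 1 else R.bs t := by
  have hf := R.fail_iff ht
  unfold bs ord at *
  rw [R.state_succ ht]
  unfold MasterState.next
  simp only [R.state_t ht, hf]
  split_ifs <;> first | rfl | tauto

open Classical in
lemma ord_succ {t : ℕ} (ht : 1 ≤ t) :
    R.ord (t + 1) = if R.Fail t then 0
      else if t + 1 = R.bs t + 2 ^ R.ord t then R.ord t + 1 else R.ord t := by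
  have hf := R.fail_iff ht
  unfold bs ord at *
  rw [R.state_succ ht]
  unfold MasterState.next
  simp only [R.state_t ht, hf]
  split_ifs <;> rfl

lemma bs_succ_eq_or {t : ℕ} (ht : 1 ≤ t) :
    R.bs (t + 1) = t + 1 ∨ (R.bs (t + 1) = R.bs t ∧ R.ord (t + 1) = R.ord t ∧ ¬ R.Fail t) := by
  classical
  rw [R.bs_succ ht, R.ord_succ ht]
  split_ifs <;> tauto

lemma same_block {s t : ℕ} (ht : 1 ≤ t) (h1 : R.bs t ≤ s) (h2 : s ≤ t) :
    R.bs s = R.bs t ∧ R.ord s = R.ord t := by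
  induction t, ht using Nat.le_induction with
  | base => have := R.one_le_bs (le_refl 1); rw [show s = 1 by omega]; exact ⟨rfl, rfl⟩
  | succ t ht ih =>
    rcases Nat.le_succ_iff.1 h2 with h3 | h3
    · rcases R.bs_succ_eq_or ht with h4 | ⟨h4, h5, -⟩
      · omega
      · rw [h4] at h1 ⊢
        rw [h5]; exact ih h1 h3
    · rw [h3]; exact ⟨rfl, rfl⟩

lemma not_fail_of_bs_lt {s t : ℕ} (ht : 1 ≤ t) (h1 : R.bs t ≤ s) (h2 : s < t) : ¬ R.Fail s := by
  have hb := R.one_le_bs ht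
  rcases R.bs_succ_eq_or (t := s) (by omega) with h4 | ⟨-, -, h5⟩
  · have := (R.same_block ht (s := s + 1) (by omega) (by omega)).1
    omega
  · exact h5

lemma bs_mono {s t : ℕ} (hs : 1 ≤ s) (h : s ≤ t) : R.bs s ≤ R.bs t := by
  induction t, h using Nat.le_induction with
  | base => rfl
  | succ t ht ih =>
    rcases R.bs_succ_eq_or (t := t) (by omega) with h4 | ⟨h4, -, -⟩
    · have := R.bs_le (t := t) (by omega); omega
    · omega

lemma bs_le_ws (t m : ℕ) : R.bs t ≤ R.ws t m := Nat.le_add_right _ _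

lemma ws_le {t : ℕ} (ht : 1 ≤ t) (m : ℕ) : R.ws t m ≤ t := by
  have := R.bs_le ht
  have := Nat.div_mul_le_self (t - R.bs t) (2 ^ m)
  unfold ws; omega

lemma lt_ws_add (t m : ℕ) : t < R.ws t m + 2 ^ m := by
  have := Nat.lt_div_mul_add (a := t - R.bs t) (b := 2 ^ m) (by positivity)
  unfold ws; omega

lemma one_le_ws {t : ℕ} (ht : 1 ≤ t) (m : ℕ) : 1 ≤ R.ws t m :=
  (R.one_le_bs ht).trans (R.bs_le_ws t m)

/-- Within a window of order `m'`, the windows of lower order are nested. -/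
lemma ws_le_ws {s t m m' : ℕ} (ht : 1 ≤ t) (hm : m ≤ m') (h1 : R.ws t m' ≤ s) (h2 : s ≤ t) :
    R.ws t m' ≤ R.ws s m := by
  have hb := (R.same_block ht ((R.bs_le_ws t m').trans h1) h2).1
  unfold ws at *
  rw [hb]
  obtain ⟨c, hc⟩ := pow_dvd_pow 2 hm
  rw [hc] at h1 ⊢
  rw [← Nat.le_sub_iff_add_le' (by omega)] at h1
  have h3 : (t - R.bs t) / (2 ^ m * c) * (2 ^ m * c)
      = ((t - R.bs t) / (2 ^ m * c) * c) * 2 ^ m := by ring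
  rw [h3] at h1 ⊢
  have := (Nat.le_div_iff_mul_le (by positivity)).2 h1
  exact Nat.add_le_add_left (Nat.mul_le_mul_right _ this) _

lemma ws_eq {s t m : ℕ} (ht : 1 ≤ t) (h1 : R.ws t m ≤ s) (h2 : s ≤ t) : R.ws s m = R.ws t m := by
  have hb := (R.same_block ht ((R.bs_le_ws t m).trans h1) h2).1
  refine le_antisymm ?_ (R.ws_le_ws ht le_rfl h1 h2)
  unfold ws
  rw [hb]
  gcongr

lemma ws_ws {t : ℕ} (ht : 1 ≤ t) (m : ℕ) : R.ws (R.ws t m) m = R.ws t m :=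
  R.ws_eq ht le_rfl (R.ws_le ht m)

lemma covers_congr {s t m : ℕ} (ht : 1 ≤ t) (h1 : R.ws t m ≤ s) (h2 : s ≤ t) :
    R.Covers s m ↔ R.Covers t m := by
  unfold Covers
  rw [R.ws_eq ht h1 h2, (R.same_block ht ((R.bs_le_ws t m).trans h1) h2).2]

/-- Period `t` is played by the order-`m` thread that starts in period `τ`. -/
def Plays (τ m t : ℕ) : Prop := 1 ≤ t ∧ R.ws t m = τ ∧ R.ac t = m

lemma cur_of_ws_eq {t m : ℕ} (ht : 1 ≤ t) (h : R.ws t m = t) : R.cur t m = R.start t m := by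
  unfold cur MasterState.current
  rw [R.windowStart_eq ht, R.state_t ht, if_pos h]

open Classical in
lemma cur_succ {t m : ℕ} (ht : 1 ≤ t) (h : R.ws (t + 1) m ≠ t + 1) :
    R.cur (t + 1) m = if R.ac t = m then R.alg.update (R.cur t m) (R.y t) else R.cur t m := by
  have hw := R.windowStart_eq (t := t + 1) (by omega) m
  rw [cur, MasterState.current, hw, R.state_t (by omega), if_neg h, R.state_succ ht, next_thread]
  unfold MasterState.played
  rw [R.state_t ht]
  by_cases hm : R.ac t = m
  · rw [if_pos hm]; subst hm
    change Function.update _ (R.ac t) _ (R.ac t) = _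
    rw [Function.update_self]; rfl
  · rw [if_neg hm]
    change Function.update _ (R.ac t) _ m = _
    rw [Function.update_of_ne (Ne.symm hm)]; rfl

open Classical in
/-- The number of plays of the thread `(τ, m)` before period `t`. -/
def cnt (τ m t : ℕ) : ℕ := Nat.count (R.Plays τ m) t

/-- The period of the `k`-th play of the thread `(τ, m)`. -/
def playTime (τ m k : ℕ) : ℕ := Nat.nth (R.Plays τ m) k

lemma playTime_cnt {τ m t : ℕ} (h : R.Plays τ m t) : R.playTime τ m (R.cnt τ m t) = t := by
  classical
  exact Nat.nth_count h

lemma cnt_eq_zero (t m : ℕ) : R.cnt t m t = 0 := by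
  classical
  unfold cnt
  rw [Nat.count_iff_forall_not]
  intro s hs h
  have := R.ws_le h.1 m
  have := h.2.1
  omega

/-- The state of a thread is the state of the algorithm run on the feedbacks in its plays. -/
lemma cur_eq_run {t : ℕ} (ht : 1 ≤ t) (m : ℕ) :
    R.cur t m = R.alg.run (R.start (R.ws t m) m) (fun k => R.y (R.playTime (R.ws t m) m k))
      (R.cnt (R.ws t m) m t) := by
  classical
  have base : ∀ t, 1 ≤ t → R.ws t m = t →
      R.cur t m = R.alg.run (R.start (R.ws t m) m) (fun k => R.y (R.playTime (R.ws t m) m k))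
        (R.cnt (R.ws t m) m t) := by
    intro t ht h
    rw [h, R.cnt_eq_zero, R.cur_of_ws_eq ht h, BanditAlg.run]
  induction t, ht using Nat.le_induction with
  | base =>
    refine base 1 le_rfl ?_
    have h1 := R.ws_le (t := 1) le_rfl m
    have h2 := R.one_le_ws (t := 1) le_rfl m
    omega
  | succ t ht ih =>
    by_cases h : R.ws (t + 1) m = t + 1
    · exact base _ (by omega) h
    · have hw : R.ws t m = R.ws (t + 1) m := by
        have := R.ws_le (t := t + 1) (by omega) m
        exact R.ws_eq (by omega) (by omega) (by omega)
      rw [R.cur_succ ht h, ih, ← hw]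
      have hc : R.cnt (R.ws t m) m (t + 1)
          = R.cnt (R.ws t m) m t + if R.ac t = m then 1 else 0 := by
        unfold cnt
        rw [Nat.count_succ]
        congr 1
        have : R.Plays (R.ws t m) m t ↔ R.ac t = m := by simp [Plays, ht]
        simp [this]
      by_cases ha : R.ac t = m
      · rw [if_pos ha] at hc ⊢
        rw [hc, BanditAlg.run, R.playTime_cnt ⟨ht, rfl, ha⟩]
      · rw [if_neg ha] at hc ⊢
        rw [hc, add_zero]

end Run


/-! ### Sums of inverse square roots -/

lemma inv_sqrt_succ_le (n : ℕ) :
    1 / Real.sqrt ((n : ℝ) + 1) ≤ 2 * Real.sqrt ((n : ℝ) + 1) - 2 * Real.sqrt n := by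
  have h1 : 0 < Real.sqrt ((n : ℝ) + 1) := Real.sqrt_pos.2 (by positivity)
  rw [div_le_iff₀ h1]
  have e1 := Real.mul_self_sqrt (by positivity : (0 : ℝ) ≤ (n : ℝ) + 1)
  have e2 := Real.mul_self_sqrt (by positivity : (0 : ℝ) ≤ (n : ℝ))
  nlinarith [sq_nonneg (Real.sqrt ((n : ℝ) + 1) - Real.sqrt n)]

/-- `1/√1 + ⋯ + 1/√n ≤ 2 √n`, along the elements of a finite set of numbers. -/
lemma sum_inv_sqrt_card_le (A : Finset ℕ) :
    ∑ t ∈ A, 1 / Real.sqrt ((A.filter (· ≤ t)).card : ℝ) ≤ 2 * Real.sqrt A.card := by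
  induction A using Finset.induction_on_max with
  | empty => simp
  | insert t A hA ih =>
    have ht : t ∉ A := fun h => lt_irrefl _ (hA t h)
    rw [Finset.sum_insert ht, Finset.card_insert_of_notMem ht]
    have e1 : (insert t A).filter (· ≤ t) = insert t A := by
      apply Finset.filter_true_of_mem
      intro x hx
      rcases Finset.mem_insert.1 hx with rfl | hx
      · exact le_rfl
      · exact (hA x hx).le
    have e2 : ∀ s ∈ A, (insert t A).filter (· ≤ s) = A.filter (· ≤ s) := by
      intro s hs
      rw [Finset.filter_insert, if_neg (not_le.2 (hA s hs))]
    rw [e1, Finset.card_insert_of_notMem ht, Finset.sum_congr rfl fun s hs => by rw [e2 s hs]]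
    have := inv_sqrt_succ_le A.card
    push_cast
    linarith

lemma sum_inv_sqrt_range_le (n : ℕ) :
    ∑ l ∈ Finset.range n, 1 / Real.sqrt ((l : ℝ) + 1) ≤ 2 * Real.sqrt n := by
  induction n with
  | zero => simp
  | succ n ih =>
    rw [Finset.sum_range_succ]
    have := inv_sqrt_succ_le n
    push_cast
    linarith

lemma sum_sqrt_two_pow_le (k : ℕ) :
    ∑ m ∈ Finset.range k, Real.sqrt (2 ^ m) ≤ (1 + Real.sqrt 2) * Real.sqrt (2 ^ k) := by
  induction k with
  | zero => simp; positivity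
  | succ k ih =>
    rw [Finset.sum_range_succ, pow_succ, Real.sqrt_mul (by positivity)]
    have := Real.mul_self_sqrt (by norm_num : (0 : ℝ) ≤ 2)
    nlinarith [Real.sqrt_nonneg ((2 : ℝ) ^ k)]

lemma two_pow_clog_le {n : ℕ} (hn : 1 ≤ n) : 2 ^ Nat.clog 2 n ≤ 2 * n := by
  rcases Nat.eq_zero_or_pos (Nat.clog 2 n) with h | h
  · rw [h]; omega
  · obtain ⟨k, hk⟩ : ∃ k, Nat.clog 2 n = k + 1 := ⟨_, (Nat.succ_pred_eq_of_pos h).symm⟩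
    have : 2 ^ k < n := (Nat.lt_clog_iff_pow_lt (by norm_num)).1 (by omega)
    rw [hk, pow_succ]; omega

lemma sum_sqrt_two_pow_clog_le {n : ℕ} (hn : 1 ≤ n) :
    ∑ m ∈ Finset.range (Nat.clog 2 n), Real.sqrt (2 ^ m) ≤ 4 * Real.sqrt n := by
  refine (sum_sqrt_two_pow_le _).trans ?_
  have h1 : Real.sqrt ((2 : ℝ) ^ Nat.clog 2 n) ≤ Real.sqrt 2 * Real.sqrt n := by
    rw [← Real.sqrt_mul (by norm_num)]
    exact Real.sqrt_le_sqrt (by exact_mod_cast two_pow_clog_le hn)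
  have h2 := Real.mul_self_sqrt (by norm_num : (0 : ℝ) ≤ 2)
  have h3 : Real.sqrt 2 ≤ 2 := Real.sqrt_le_iff.2 (by norm_num)
  calc (1 + Real.sqrt 2) * Real.sqrt (2 ^ Nat.clog 2 n)
      ≤ (1 + Real.sqrt 2) * (Real.sqrt 2 * Real.sqrt n) := by gcongr
    _ = (Real.sqrt 2 + Real.sqrt 2 * Real.sqrt 2) * Real.sqrt n := by ring
    _ ≤ 4 * Real.sqrt n := by gcongr; linarith

lemma le_logb_of_two_pow_le {k : ℕ} {x : ℝ} (h : (2 : ℝ) ^ k ≤ x) : (k : ℝ) ≤ Real.logb 2 x := by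
  rw [Real.le_logb_iff_rpow_le (by norm_num) (lt_of_lt_of_le (by positivity) h), Real.rpow_natCast]
  exact h

lemma clog_le {n T : ℕ} (hn : 1 ≤ n) (hT : n ≤ T) : (Nat.clog 2 n : ℝ) ≤ Real.logb 2 T + 1 := by
  have hT1 : (1 : ℝ) ≤ T := by exact_mod_cast hn.trans hT
  rcases Nat.eq_zero_or_pos (Nat.clog 2 n) with h | h
  · rw [h]; have := Real.logb_nonneg (by norm_num : (1 : ℝ) < 2) hT1; simp; linarith
  · obtain ⟨k, hk⟩ : ∃ k, Nat.clog 2 n = k + 1 := ⟨_, (Nat.succ_pred_eq_of_pos h).symm⟩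
    have : 2 ^ k < n := (Nat.lt_clog_iff_pow_lt (by norm_num)).1 (by omega)
    have h2 : (2 : ℝ) ^ k ≤ T := by exact_mod_cast this.le.trans hT
    have := le_logb_of_two_pow_le h2
    rw [hk]; push_cast; linarith

/-! ### Play counts of the running thread and the grid of windows. -/

namespace Run

variable {d : ℕ} (R : Run d)

/-- The number of plays of the running thread, the current one included. -/
def plays (t : ℕ) : ℕ := R.cnt (R.ws t (R.ac t)) (R.ac t) t + 1

/-- The start of the running thread. -/
def ts (t : ℕ) : ℕ := R.ws t (R.ac t)

lemma ts_le {t : ℕ} (ht : 1 ≤ t) : R.ts t ≤ t := R.ws_le ht _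
lemma one_le_ts {t : ℕ} (ht : 1 ≤ t) : 1 ≤ R.ts t := R.one_le_ws ht _

lemma ac_le_of_covers {t m : ℕ} (ht : 1 ≤ t) (h : R.Covers t m) : R.ac t ≤ m := by
  rw [R.ac_eq ht]; exact Nat.sInf_le h

lemma covers_ac {t m : ℕ} (ht : 1 ≤ t) (h : R.Covers t m) : R.Covers t (R.ac t) := by
  rw [R.ac_eq ht]; exact Nat.sInf_mem (s := {m | R.Covers t m}) ⟨m, h⟩

lemma ac_le_ord {t : ℕ} (ht : 1 ≤ t) : R.ac t ≤ R.ord t := by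
  by_cases h : ∃ m, R.Covers t m
  · obtain ⟨m, hm⟩ := h
    exact (R.ac_le_of_covers ht hm).trans hm.1
  · have : {m | R.Covers t m} = ∅ := by
      ext m; simpa using fun hm => h ⟨m, hm⟩
    rw [R.ac_eq ht, this, Nat.sInf_empty]; exact Nat.zero_le _

open Classical in
lemma plays_eq_card {a t : ℕ} (ht : 1 ≤ t) (ha : a ≤ R.ts t) :
    R.plays t = ((Finset.Icc a t).filter (fun s => R.Plays (R.ts t) (R.ac t) s)).card := by
  have : R.plays t = Nat.count (R.Plays (R.ts t) (R.ac t)) (t + 1) := by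
    rw [Nat.count_succ, if_pos ⟨ht, rfl, rfl⟩]
    unfold plays cnt ts
    congr!
  rw [this, Nat.count_eq_card_filter_range]
  refine congrArg Finset.card (Finset.ext fun s => ?_)
  simp only [Finset.mem_filter, Finset.mem_range, Finset.mem_Icc]
  constructor
  · rintro ⟨h1, h2⟩
    have h3 := R.ws_le h2.1 (R.ac t)
    rw [h2.2.1] at h3
    exact ⟨⟨by omega, by omega⟩, h2⟩
  · rintro ⟨h1, h2⟩
    exact ⟨by omega, h2⟩

lemma plays_le {t : ℕ} (ht : 1 ≤ t) : R.plays t ≤ t - R.ts t + 1 := by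
  classical
  rw [R.plays_eq_card ht le_rfl]
  refine (Finset.card_filter_le _ _).trans ?_
  have := R.ts_le ht
  rw [Nat.card_Icc]; omega

lemma one_le_plays (t : ℕ) : 1 ≤ R.plays t := Nat.le_add_left 1 _

/-- The plays of one thread in an interval that does not start after the thread. -/
lemma sum_inv_sqrt_plays_le {a e τ m : ℕ} (hτ : a ≤ τ) (ha : 1 ≤ a) (A : Finset ℕ)
    (hA : ∀ t, t ∈ A ↔ t ∈ Finset.Icc a e ∧ R.ws t m = τ ∧ R.ac t = m) :
    ∑ t ∈ A, 1 / Real.sqrt (R.plays t) ≤ 2 * Real.sqrt A.card := by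
  classical
  refine le_trans (le_of_eq ?_) (sum_inv_sqrt_card_le A)
  refine Finset.sum_congr rfl fun t ht => ?_
  obtain ⟨h1, h2, h3⟩ := (hA t).1 ht
  rw [Finset.mem_Icc] at h1
  have hts : R.ts t = τ := by rw [ts, h3, h2]
  rw [R.plays_eq_card (a := a) (by omega) (by rw [hts]; exact hτ)]
  refine congrArg (fun n : ℕ => 1 / Real.sqrt (n : ℝ))
    (congrArg Finset.card (Finset.ext fun s => ?_))
  simp only [Finset.mem_filter, hA, Finset.mem_Icc, Plays, hts, h3]
  constructor
  · rintro ⟨h4, h5, h6, h7⟩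
    exact ⟨⟨⟨h4.1, by omega⟩, h6, h7⟩, h4.2⟩
  · rintro ⟨⟨h4, h6, h7⟩, h5⟩
    exact ⟨⟨h4.1, h5⟩, by omega, h6, h7⟩

/-- Grid points stay grid points for lower orders. -/
lemma ws_start_eq {e m m' : ℕ} (he : 1 ≤ e) (hm : m ≤ m') : R.ws (R.ws e m') m = R.ws e m' :=
  le_antisymm (R.ws_le (R.one_le_ws he _) _) (R.ws_le_ws he hm le_rfl (R.ws_le he _))

lemma ws_eq_of_lt {a t m : ℕ} (ht : 1 ≤ t) (ha : R.ws a m = a) (hb : R.bs t ≤ a) (hat : a ≤ t)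
    (hlt : t < a + 2 ^ m) : R.ws t m = a := by
  have h := (R.same_block ht hb hat).1
  have e : R.bs t + (a - R.bs t) / 2 ^ m * 2 ^ m = a := by
    conv_rhs => rw [← ha]
    unfold ws; rw [h]
  have : (t - R.bs t) / 2 ^ m = (a - R.bs t) / 2 ^ m :=
    Nat.div_eq_of_lt_le (by omega) (by rw [add_mul, one_mul]; omega)
  unfold ws
  rw [this, e]

lemma card_grid_le {a e m : ℕ} (ha : R.ws a m = a) (he : 1 ≤ e) (hb : R.bs e ≤ a)
    (hae : a ≤ e) (A : Finset ℕ) (hA : ∀ t ∈ A, t ∈ Finset.Icc a e ∧ R.ws t m = t) :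
    A.card ≤ (e - a) / 2 ^ m + 1 := by
  have hba := (R.same_block he hb hae).1
  have key : ∀ t ∈ A, t = a + (t - a) / 2 ^ m * 2 ^ m := by
    intro t ht
    obtain ⟨h1, h2⟩ := hA t ht
    rw [Finset.mem_Icc] at h1
    have hbt := (R.same_block he (hb.trans h1.1) h1.2).1
    unfold ws at ha h2
    rw [hba] at ha
    rw [hbt] at h2
    set c := (a - R.bs e) / 2 ^ m
    set c' := (t - R.bs e) / 2 ^ m
    have : t - a = (c' - c) * 2 ^ m := by rw [Nat.sub_mul]; omega
    rw [this, Nat.mul_div_cancel _ (by positivity), ← this]; omega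
  rw [← Finset.card_range ((e - a) / 2 ^ m + 1)]
  refine Finset.card_le_card_of_injOn (fun t => (t - a) / 2 ^ m) ?_ ?_
  · intro t ht
    have := hA t ht
    rw [Finset.mem_Icc] at this
    simp only [Finset.coe_range, Set.mem_Iio]
    exact Nat.lt_succ_of_le (Nat.div_le_div_right (by omega))
  · intro t ht s hs h
    simp only at h
    rw [key t ht, key s hs, h]

end Run


/-! ### Sums of inverse square roots of play counts over a scheduled window. -/

lemma rate_div_rate {κ : ℝ} (hκ : 0 < κ) (n m : ℕ) :
    rate κ (2 ^ n) / rate κ (2 ^ m) = Real.sqrt (2 ^ m) / Real.sqrt (2 ^ n) := by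
  unfold rate
  push_cast
  have h1 : 0 < Real.sqrt (2 ^ m) := by positivity
  have h2 : 0 < Real.sqrt (2 ^ n) := by positivity
  field_simp

namespace Run

variable {d : ℕ} (R : Run d)

/-- The starts in `[a, e]` of order-`m` windows in the block that starts in period `b`, provided
that this block has order `n`. -/
def starts (b n m a e : ℕ) : Finset ℕ :=
  (Finset.Icc a e).filter fun τ => R.bs τ = b ∧ R.ord τ = n ∧ R.ws τ m = τ

open Classical in
/-- The starts of the scheduled threads. -/
def wins (b n m a e : ℕ) : Finset ℕ :=
  (R.starts b n m a e).filter fun τ => R.u τ m ≤ R.ρ (2 ^ n) / R.ρ (2 ^ m)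

/-- The upper bound for the number of scheduled threads. -/
def FewWins (ℓ : ℝ) : Prop := ∀ b n m a e, b ≤ R.T → n ≤ R.T → m ≤ R.T → 1 ≤ a → a ≤ R.T → e ≤ R.T →
  ((R.wins b n m a e).card : ℝ) ≤
    16 / 5 * (R.ρ (2 ^ n) / R.ρ (2 ^ m)) * (R.starts b n m a e).card + ℓ / 2

variable {R}

lemma ord_le {t : ℕ} (ht : 1 ≤ t) : R.ord t ≤ t := by
  classical
  induction t, ht using Nat.le_induction with
  | base => simp [ord, state_one]
  | succ t ht ih =>
    rw [R.ord_succ ht]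
    split_ifs <;> omega

open Classical in
-- A window longer than e - a that meets [a, e] starts at a, because a is a grid point of every
-- lower order. So a thread of such an order covers either all of these periods or none, the lowest
-- one is the same throughout, and the sum runs over the plays of a single thread.
lemma sum_high_order_le {e m' : ℕ} (he : 1 ≤ e) (hcov : R.Covers e m') :
    ∑ t ∈ (Finset.Icc (R.ws e m') e).filter (fun t => e - R.ws e m' < 2 ^ R.ac t),
      1 / Real.sqrt (R.plays t) ≤ 2 * Real.sqrt ((e - R.ws e m' : ℕ) + 1 : ℝ) := by
  set a := R.ws e m' with ha
  have ha1 : 1 ≤ a := R.one_le_ws he m'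
  have hae : a ≤ e := R.ws_le he m'
  have hba : R.bs e ≤ a := R.bs_le_ws e m'
  set A := (Finset.Icc a e).filter (fun t => e - a < 2 ^ R.ac t) with hA
  rcases A.eq_empty_or_nonempty with h0 | ⟨t₁, ht₁⟩
  · rw [h0]; simp
  have hc : ∀ t ∈ Finset.Icc a e, R.Covers t m' := fun t ht => by
    rw [Finset.mem_Icc] at ht
    exact (R.covers_congr he ht.1 ht.2).2 hcov
  have hws : ∀ t ∈ A, ∀ s ∈ Finset.Icc a e, R.ws s (R.ac t) = a := by
    intro t ht s hs
    rw [hA, Finset.mem_filter] at ht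
    have h1 := R.ac_le_of_covers (by rw [Finset.mem_Icc] at ht; omega) (hc t ht.1)
    rw [Finset.mem_Icc] at hs
    refine R.ws_eq_of_lt (by omega) (R.ws_start_eq he h1) ?_ hs.1 (by omega)
    rw [(R.same_block he (hba.trans hs.1) hs.2).1]; exact hba
  have hle : ∀ t ∈ A, ∀ s ∈ A, R.ac s ≤ R.ac t := by
    intro t ht s hs
    have ht' := (Finset.mem_filter.1 ht).1
    have hs' := (Finset.mem_filter.1 hs).1
    have h1 := R.covers_ac (by rw [Finset.mem_Icc] at ht'; omega) (hc t ht')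
    refine R.ac_le_of_covers (by rw [Finset.mem_Icc] at hs'; omega) ?_
    unfold Covers at h1 ⊢
    rw [hws t ht s hs']
    rw [hws t ht t ht'] at h1
    rw [Finset.mem_Icc] at ht' hs'
    rw [(R.same_block he (hba.trans hs'.1) hs'.2).2, ← (R.same_block he (hba.trans ht'.1) ht'.2).2]
    exact h1
  have := R.sum_inv_sqrt_plays_le (a := a) (e := e) (τ := a) (m := R.ac t₁) le_rfl ha1 A (by
    intro t
    constructor
    · intro ht
      have ht' := (Finset.mem_filter.1 ht).1
      exact ⟨ht', hws _ ht₁ t ht', le_antisymm (hle _ ht₁ _ ht) (hle _ ht _ ht₁)⟩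
    · rintro ⟨h1, -, h3⟩
      rw [hA, Finset.mem_filter, h3]
      exact ⟨h1, (Finset.mem_filter.1 ht₁).2⟩)
  refine this.trans ?_
  have hcard : A.card ≤ e - a + 1 := by
    refine (Finset.card_filter_le _ _).trans ?_
    rw [Nat.card_Icc]; omega
  gcongr
  exact_mod_cast hcard

open Classical in
-- Each thread of order m has at most 2^m plays, so it contributes at most 2√(2^m). It remains to
-- count the scheduled threads that start inside the window.
lemma sum_order_le {e m m' : ℕ} (he : 1 ≤ e) (hm : m ≤ m')
    (hcov : R.Covers e m') :
    ∑ t ∈ (Finset.Icc (R.ws e m') e).filter (fun t => R.ac t = m),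
      1 / Real.sqrt (R.plays t) ≤
      (R.wins (R.bs e) (R.ord e) m (R.ws e m') e).card * (2 * Real.sqrt (2 ^ m)) := by
  set a := R.ws e m' with ha
  have ha1 : 1 ≤ a := R.one_le_ws he m'
  have hba : R.bs e ≤ a := R.bs_le_ws e m'
  set A := (Finset.Icc a e).filter (fun t => R.ac t = m) with hA
  have hmaps : ∀ t ∈ A, R.ws t m ∈ R.wins (R.bs e) (R.ord e) m a e := by
    intro t ht
    rw [hA, Finset.mem_filter, Finset.mem_Icc] at ht
    obtain ⟨⟨h1, h2⟩, h3⟩ := ht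
    have hc : R.Covers t m' := (R.covers_congr he h1 h2).2 hcov
    have hcm := R.covers_ac (by omega) hc
    rw [h3] at hcm
    have hge : a ≤ R.ws t m := by
      have hw : R.ws t m' = a := R.ws_eq he h1 h2
      rw [← hw]
      exact R.ws_le_ws (by omega) hm (by rw [hw]; exact h1) le_rfl
    have hle := R.ws_le (t := t) (by omega) m
    have hsb := R.same_block he (s := R.ws t m) (by omega) (by omega)
    have hsb' := R.same_block he (s := t) (by omega) (by omega)
    unfold wins starts
    rw [Finset.mem_filter, Finset.mem_filter, Finset.mem_Icc]
    refine ⟨⟨⟨hge, by omega⟩, hsb.1, hsb.2, R.ws_ws (by omega) m⟩, ?_⟩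
    rw [← hsb'.2]; exact hcm.2
  rw [← Finset.sum_fiberwise_of_maps_to hmaps, ← nsmul_eq_mul]
  refine Finset.sum_le_card_nsmul _ _ _ fun τ hτ => ?_
  have hτ' : a ≤ τ := by
    unfold wins starts at hτ
    rw [Finset.mem_filter, Finset.mem_filter, Finset.mem_Icc] at hτ
    exact hτ.1.1.1
  refine (R.sum_inv_sqrt_plays_le (a := a) (e := e) hτ' ha1 _ (by
    intro t
    rw [hA, Finset.mem_filter, Finset.mem_filter]
    tauto)).trans ?_
  have hcard : (A.filter (fun t => R.ws t m = τ)).card ≤ 2 ^ m := by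
    have : A.filter (fun t => R.ws t m = τ) ⊆ Finset.Ico τ (τ + 2 ^ m) := by
      intro t ht
      rw [Finset.mem_filter, hA, Finset.mem_filter, Finset.mem_Icc] at ht
      rw [Finset.mem_Ico, ← ht.2]
      exact ⟨R.ws_le (by omega) m, R.lt_ws_add t m⟩
    simpa using Finset.card_le_card this
  gcongr
  exact_mod_cast hcard

/-- The sum of the inverse square roots of the numbers of plays, over an initial part of the
window of a scheduled thread. -/
lemma sum_inv_sqrt_window_le {κ ℓ : ℝ} {e m' : ℕ} (hρ : R.ρ = rate κ) (hκ : 0 < κ)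
    (hℓ : ℓ ≤ 21 / 5 * (Real.logb 2 R.T + 1))
    (hfew : R.FewWins ℓ) (he : 1 ≤ e) (heT : e ≤ R.T) (hcov : R.Covers e m') :
    ∑ t ∈ Finset.Icc (R.ws e m') e, 1 / Real.sqrt (R.plays t) ≤
      32 * (Real.logb 2 R.T + 1) * Real.sqrt ((e - R.ws e m' : ℕ) + 1 : ℝ) := by
  classical
  set a := R.ws e m' with ha
  have ha1 : 1 ≤ a := R.one_le_ws he m'
  have hae : a ≤ e := R.ws_le he m'
  have hba : R.bs e ≤ a := R.bs_le_ws e m'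
  have hlt := R.lt_ws_add e m'
  rw [← ha] at hlt
  set N := e - a + 1 with hN
  have hNT : N ≤ R.T := by omega
  have hNc : (((e - a : ℕ) : ℝ) + 1) = (N : ℝ) := by rw [hN]; push_cast; ring
  rw [hNc]
  set lam := Real.logb 2 R.T + 1 with hlam
  have hclog := clog_le (n := N) (by omega) hNT
  rw [← hlam] at hclog
  have hlam1 : 1 ≤ lam := by
    have : (1 : ℝ) ≤ R.T := by exact_mod_cast (show 1 ≤ R.T by omega)
    have := Real.logb_nonneg (by norm_num : (1 : ℝ) < 2) this
    linarith
  have hNpos : (0 : ℝ) < N := by exact_mod_cast (show 0 < N by omega)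
  have hNn : (N : ℝ) ≤ 2 ^ R.ord e := by
    have h1 : N ≤ 2 ^ m' := by omega
    have h2 : 2 ^ m' ≤ 2 ^ R.ord e := Nat.pow_le_pow_right (by norm_num) hcov.1
    exact_mod_cast h1.trans h2
  -- The scheduling probability √(2^m)/√(2^n) is tailored to this step: about N/2^m windows, each
  -- contributing 2√(2^m) with that probability, give a multiple of N/√(2^n) ≤ √N at every order m.
  have hlow : ∀ m ∈ Finset.range (Nat.clog 2 N),
      ∑ t ∈ (Finset.Icc a e).filter (fun t => R.ac t = m), 1 / Real.sqrt (R.plays t)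
        ≤ 64 / 5 * Real.sqrt N + ℓ * Real.sqrt (2 ^ m) := by
    intro m hm
    rw [Finset.mem_range, Nat.lt_clog_iff_pow_lt (by norm_num)] at hm
    have hmm : m ≤ m' := by
      by_contra hcon
      have : 2 ^ m' ≤ 2 ^ m := Nat.pow_le_pow_right (by norm_num) (by omega)
      omega
    refine (sum_order_le he hmm hcov).trans ?_
    have hbs := R.bs_le he
    have hord := ord_le (R := R) he
    have hf := hfew (R.bs e) (R.ord e) m a e (by omega) (by omega)
      (by have := hcov.1; omega) ha1 (by omega) heT
    rw [hρ, rate_div_rate hκ] at hf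
    have hcard : (R.starts (R.bs e) (R.ord e) m a e).card ≤ (e - a) / 2 ^ m + 1 := by
      refine R.card_grid_le (R.ws_start_eq he hmm) he hba hae _ ?_
      intro t ht
      unfold starts at ht
      rw [Finset.mem_filter] at ht
      exact ⟨ht.1, ht.2.2.2⟩
    have hp : (0 : ℝ) < 2 ^ m := by positivity
    have hcard' : ((R.starts (R.bs e) (R.ord e) m a e).card : ℝ) ≤ 2 * N / 2 ^ m := by
      have h1 : (((e - a) / 2 ^ m : ℕ) : ℝ) ≤ ((e - a : ℕ) : ℝ) / 2 ^ m := by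
        have := Nat.cast_div_le (α := ℝ) (m := e - a) (n := 2 ^ m)
        simpa using this
      have h2 : (1 : ℝ) ≤ N / 2 ^ m := by
        rw [le_div_iff₀ hp, one_mul]; exact_mod_cast hm.le
      have h3 : ((e - a : ℕ) : ℝ) / 2 ^ m ≤ N / 2 ^ m := by
        gcongr; omega
      have h4 : ((R.starts (R.bs e) (R.ord e) m a e).card : ℝ) ≤ (((e - a) / 2 ^ m : ℕ) : ℝ) + 1 := by
        exact_mod_cast hcard
      have e5 : 2 * (N : ℝ) / 2 ^ m = N / 2 ^ m + N / 2 ^ m := by ring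
      rw [e5]; linarith
    have hs1 : 0 < Real.sqrt (2 ^ m) := Real.sqrt_pos.2 hp
    have hs2 : 0 < Real.sqrt (2 ^ R.ord e) := Real.sqrt_pos.2 (by positivity)
    have hsm : Real.sqrt (2 ^ m) * Real.sqrt (2 ^ m) = 2 ^ m := Real.mul_self_sqrt hp.le
    have hsN : Real.sqrt N * Real.sqrt N = N := Real.mul_self_sqrt hNpos.le
    have hNle : Real.sqrt N ≤ Real.sqrt (2 ^ R.ord e) := Real.sqrt_le_sqrt hNn
    calc ((R.wins (R.bs e) (R.ord e) m a e).card : ℝ) * (2 * Real.sqrt (2 ^ m))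
        ≤ (16 / 5 * (Real.sqrt (2 ^ m) / Real.sqrt (2 ^ R.ord e)) * (2 * N / 2 ^ m) + ℓ / 2)
          * (2 * Real.sqrt (2 ^ m)) := by
            refine mul_le_mul_of_nonneg_right (hf.trans ?_) (by positivity)
            gcongr
      _ = 64 / 5 * ((Real.sqrt (2 ^ m) * Real.sqrt (2 ^ m)) / 2 ^ m) * (N / Real.sqrt (2 ^ R.ord e))
          + ℓ * Real.sqrt (2 ^ m) := by ring
      _ ≤ 64 / 5 * 1 * Real.sqrt N + ℓ * Real.sqrt (2 ^ m) := by
          rw [hsm, div_self hp.ne']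
          have : (N : ℝ) / Real.sqrt (2 ^ R.ord e) ≤ Real.sqrt N := by
            have h5 := mul_le_mul_of_nonneg_left hNle (Real.sqrt_nonneg (N : ℝ))
            rwa [hsN, ← div_le_iff₀ hs2] at h5
          gcongr
      _ = _ := by ring
  have hhigh := sum_high_order_le he hcov
  rw [← ha, hNc] at hhigh
  have hsplit : ∑ t ∈ Finset.Icc a e, 1 / Real.sqrt (R.plays t)
      = ∑ t ∈ (Finset.Icc a e).filter (fun t => e - a < 2 ^ R.ac t), 1 / Real.sqrt (R.plays t)
        + ∑ m ∈ Finset.range (Nat.clog 2 N),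
          ∑ t ∈ (Finset.Icc a e).filter (fun t => R.ac t = m), 1 / Real.sqrt (R.plays t) := by
    rw [← Finset.sum_filter_add_sum_filter_not (Finset.Icc a e) (fun t => e - a < 2 ^ R.ac t)]
    congr 1
    have hmaps : ∀ t ∈ (Finset.Icc a e).filter (fun t => ¬ e - a < 2 ^ R.ac t),
        R.ac t ∈ Finset.range (Nat.clog 2 N) := by
      intro t ht
      rw [Finset.mem_filter] at ht
      rw [Finset.mem_range, Nat.lt_clog_iff_pow_lt (by norm_num)]
      omega
    rw [← Finset.sum_fiberwise_of_maps_to hmaps]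
    refine Finset.sum_congr rfl fun m hm => Finset.sum_congr ?_ fun _ _ => rfl
    rw [Finset.mem_range, Nat.lt_clog_iff_pow_lt (by norm_num)] at hm
    ext t
    simp only [Finset.mem_filter]
    constructor
    · rintro ⟨⟨h1, h2⟩, h3⟩; exact ⟨h1, h3⟩
    · rintro ⟨h1, h3⟩; exact ⟨⟨h1, by rw [h3]; omega⟩, h3⟩
  have hgeo := sum_sqrt_two_pow_clog_le (n := N) (by omega)
  have hlowsum := Finset.sum_le_sum hlow
  rw [Finset.sum_add_distrib, Finset.sum_const, Finset.card_range, nsmul_eq_mul,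
    ← Finset.mul_sum] at hlowsum
  have hsq : 0 ≤ Real.sqrt N := Real.sqrt_nonneg _
  have hsum0 : 0 ≤ ∑ m ∈ Finset.range (Nat.clog 2 N), Real.sqrt ((2 : ℝ) ^ m) :=
    Finset.sum_nonneg fun _ _ => Real.sqrt_nonneg _
  rw [hsplit]
  -- The coefficients are 2 + 64/5 + 4 · 21/5 ≤ 32. The number of orders is at most `lam`, while the
  -- terms with ℓ form a geometric sum over the orders.
  calc _ ≤ 2 * Real.sqrt N + (lam * (64 / 5 * Real.sqrt N) + 21 / 5 * lam * (4 * Real.sqrt N)) := by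
        refine add_le_add hhigh (hlowsum.trans (add_le_add ?_ ?_))
        · gcongr
        · calc ℓ * ∑ m ∈ Finset.range (Nat.clog 2 N), Real.sqrt (2 ^ m)
              ≤ (21 / 5 * lam) * ∑ m ∈ Finset.range (Nat.clog 2 N), Real.sqrt (2 ^ m) := by gcongr
            _ ≤ _ := by gcongr
    _ ≤ 2 * lam * Real.sqrt N + (lam * (64 / 5 * Real.sqrt N)
        + 21 / 5 * lam * (4 * Real.sqrt N)) := by
        gcongr; linarith
    _ ≤ 32 * lam * Real.sqrt N := by
        have : 0 ≤ lam * Real.sqrt N := by positivity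
        linarith

end Run


/-! ### Good runs and the behaviour of the two tests. -/

/-- The total drift between the periods `a` and `e`. -/
def drift (v : ℕ → ℝ) (a e : ℕ) : ℝ := ∑ s ∈ Finset.Ico a e, v s

lemma drift_nonneg {v : ℕ → ℝ} (hv : ∀ s, 0 ≤ v s) (a e : ℕ) : 0 ≤ drift v a e :=
  Finset.sum_nonneg fun s _ => hv s

lemma drift_mono {v : ℕ → ℝ} (hv : ∀ s, 0 ≤ v s) {a e a' e' : ℕ} (ha : a' ≤ a) (he : e ≤ e') :
    drift v a e ≤ drift v a' e' :=
  Finset.sum_le_sum_of_subset_of_nonneg (Finset.Ico_subset_Ico ha he) fun s _ _ => hv s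

/-- The deterministic properties of a run on which the analysis of the framework relies: `fs t` is
the optimal value in period `t`, `fx t` the value of the action, `v t` bounds the change of the
objective after period `t`. -/
structure GoodRun {d : ℕ} (R : Run d) (κ M ℓ : ℝ) (v fs fx : ℕ → ℝ) : Prop where
  rate_eq : R.ρ = rate κ
  one_le_kappa : 1 ≤ κ
  one_le_M : 1 ≤ M
  ell_le : ℓ ≤ 21 / 5 * (Real.logb 2 R.T + 1)
  v_nonneg : ∀ s, 0 ≤ v s
  fs_le : ∀ t, 1 ≤ t → t ≤ R.T → fs t ≤ 1
  fx_ge : ∀ t, 1 ≤ t → t ≤ R.T → -1 ≤ fx t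
  fx_le : ∀ t, 1 ≤ t → t ≤ R.T → fx t ≤ fs t
  est_ge : ∀ t, 1 ≤ t → t ≤ R.T → -1 ≤ R.est t
  fs_drift : ∀ s t, 1 ≤ s → s ≤ t → t ≤ R.T → |fs s - fs t| ≤ drift v s t
  regret : ∀ t, 1 ≤ t → t ≤ R.T → M * drift v (R.ts t) t ≤ 6 * κ / Real.sqrt (R.plays t) →
    fs t - fx t ≤ κ / 10 * (1 / Real.sqrt (R.plays t)) + M * drift v (R.ts t) t
  est_sub : ∀ t, 1 ≤ t → t ≤ R.T → M * drift v (R.ts t) t ≤ 6 * κ / Real.sqrt (R.plays t) →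
    R.est t - fx t ≤ 5 / 2 * κ * (1 / Real.sqrt (R.plays t)) + 2 * (M * drift v (R.ts t) t)
  le_est : ∀ t, 1 ≤ t → t ≤ R.T → M * drift v (R.ts t) t ≤ 6 * κ / Real.sqrt (R.plays t) →
    fs t - 2 * (M * drift v (R.ts t) t) ≤ R.est t
  noise : ∀ a e, 1 ≤ a → a ≤ e → e ≤ R.T →
    |∑ s ∈ Finset.Icc a e, (R.y s - fx s)| ≤ κ / 10 * Real.sqrt ((e - a : ℕ) + 1 : ℝ)
  few : R.FewWins ℓ
  covers_ord : ∀ t, 1 ≤ t → t ≤ R.T → R.Covers t (R.ord t)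

lemma Run.ws_ord {d : ℕ} (R : Run d) {t : ℕ} (ht : 1 ≤ t) : R.ws t (R.ord t) = R.bs t := by
  have h1 := R.lt_bs_add ht
  have h2 := R.bs_le ht
  unfold Run.ws
  rw [Nat.div_eq_of_lt (by omega), zero_mul, add_zero]

lemma rhoHat_rate (T : ℕ) (κ : ℝ) (k : ℕ) :
    rhoHat T (rate κ) k = 36 * (Real.logb 2 T + 1) * κ / Real.sqrt k := by
  unfold rhoHat rate; ring

lemma div_sqrt_mul_self (c x : ℝ) : c / Real.sqrt x * x = c * Real.sqrt x := by
  rw [div_mul_eq_mul_div, mul_div_assoc, Real.div_sqrt]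

namespace GoodRun

variable {d : ℕ} {R : Run d} {κ M ℓ : ℝ} {v fs fx : ℕ → ℝ}

lemma kappa_pos (h : GoodRun R κ M ℓ v fs fx) : 0 < κ := zero_lt_one.trans_le h.one_le_kappa

lemma M_drift_mono (h : GoodRun R κ M ℓ v fs fx) {a e a' e' : ℕ} (ha : a' ≤ a) (he : e ≤ e') :
    M * drift v a e ≤ M * drift v a' e' :=
  mul_le_mul_of_nonneg_left (drift_mono h.v_nonneg ha he) (zero_le_one.trans h.one_le_M)

lemma drift_le_M_drift (h : GoodRun R κ M ℓ v fs fx) (a e : ℕ) : drift v a e ≤ M * drift v a e :=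
  le_mul_of_one_le_left (drift_nonneg h.v_nonneg a e) h.one_le_M

/-- The drift condition for a thread that starts in an interval `[a, e]` with small drift. -/
lemma small_drift (h : GoodRun R κ M ℓ v fs fx) {a e t : ℕ} (ha : 1 ≤ a) (hat : a ≤ t) (hte : t ≤ e)
    (hts : a ≤ R.ts t) (hdr : M * drift v a e ≤ 6 * κ / Real.sqrt ((e - a : ℕ) + 1 : ℝ)) :
    M * drift v (R.ts t) t ≤ M * drift v a e ∧
      M * drift v (R.ts t) t ≤ 6 * κ / Real.sqrt (R.plays t) := by
  have h1 := h.M_drift_mono hts hte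
  refine ⟨h1, h1.trans (hdr.trans ?_)⟩
  have h2 := R.plays_le (t := t) (by omega)
  have h3 := R.one_le_plays t
  have h4 := h.kappa_pos
  have h5 : (0 : ℝ) < R.plays t := by exact_mod_cast h3
  have h6 : (R.plays t : ℝ) ≤ (e - a : ℕ) + 1 := by
    exact_mod_cast (show R.plays t ≤ e - a + 1 by omega)
  gcongr

lemma one_le_lam (hT : 1 ≤ R.T) : 1 ≤ Real.logb 2 R.T + 1 := by
  have : (1 : ℝ) ≤ R.T := by exact_mod_cast hT
  have := Real.logb_nonneg (by norm_num : (1 : ℝ) < 2) this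
  linarith

/-- The running thread has at most the order of any scheduled thread covering the period, and
windows of lower order are nested. So inside a scheduled window only threads started within it are
run, and only the drift of that window matters to them. -/
lemma ts_ge {e m' t : ℕ} (he : 1 ≤ e) (hcov : R.Covers e m') (h1 : R.ws e m' ≤ t) (h2 : t ≤ e) :
    R.ws e m' ≤ R.ts t := by
  have h0 := R.one_le_ws he m'
  have hc := (R.covers_congr he h1 h2).2 hcov
  have := R.ac_le_of_covers (by omega) hc
  have hw := R.ws_eq he h1 h2
  rw [← hw]
  exact R.ws_le_ws (by omega) this (by rw [hw]; exact h1) le_rfl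

/-- All threads run in the window start inside it, so the bounds for single plays hold with the
drift of the whole window. They are summed with `Run.sum_inv_sqrt_window_le`: the constants 16/5 and
80 are 32 times 1/10 and 5/2. -/
lemma window_bounds (h : GoodRun R κ M ℓ v fs fx) {e m' : ℕ} (he : 1 ≤ e) (heT : e ≤ R.T)
    (hcov : R.Covers e m') (hdr : M * drift v (R.ws e m') e ≤
      6 * κ / Real.sqrt ((e - R.ws e m' : ℕ) + 1 : ℝ)) :
    ∑ t ∈ Finset.Icc (R.ws e m') e, (fs t - fx t) ≤
        16 / 5 * κ * (Real.logb 2 R.T + 1) * Real.sqrt ((e - R.ws e m' : ℕ) + 1 : ℝ)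
          + ((e - R.ws e m' : ℕ) + 1) * (M * drift v (R.ws e m') e) ∧
      ∑ t ∈ Finset.Icc (R.ws e m') e, (R.est t - fx t) ≤
        80 * κ * (Real.logb 2 R.T + 1) * Real.sqrt ((e - R.ws e m' : ℕ) + 1 : ℝ)
          + 2 * (((e - R.ws e m' : ℕ) + 1) * (M * drift v (R.ws e m') e)) := by
  have hsum := Run.sum_inv_sqrt_window_le h.rate_eq h.kappa_pos h.ell_le h.few he heT hcov
  have hκ := h.kappa_pos
  have hge : ∀ t ∈ Finset.Icc (R.ws e m') e, R.ws e m' ≤ R.ts t := fun t ht => by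
    rw [Finset.mem_Icc] at ht
    exact ts_ge he hcov ht.1 ht.2
  have ha1 := R.one_le_ws he m'
  have hae := R.ws_le he m'
  generalize hD : M * drift v (R.ws e m') e = D at *
  generalize R.ws e m' = a at *
  have hcard : ((Finset.Icc a e).card : ℝ) = (e - a : ℕ) + 1 := by
    rw [Nat.card_Icc]
    exact_mod_cast (show e + 1 - a = e - a + 1 by omega)
  constructor
  · calc ∑ t ∈ Finset.Icc a e, (fs t - fx t)
        ≤ ∑ t ∈ Finset.Icc a e, (κ / 10 * (1 / Real.sqrt (R.plays t)) + D) := by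
          refine Finset.sum_le_sum fun t ht => ?_
          have ht' := Finset.mem_Icc.1 ht
          have hs := h.small_drift ha1 ht'.1 ht'.2 (hge t ht) (by rw [hD]; exact hdr)
          have := h.regret t (by omega) (by omega) hs.2
          rw [hD] at hs
          linarith [hs.1]
      _ = κ / 10 * ∑ t ∈ Finset.Icc a e, 1 / Real.sqrt (R.plays t) + ((e - a : ℕ) + 1) * D := by
          rw [Finset.sum_add_distrib, ← Finset.mul_sum, Finset.sum_const, nsmul_eq_mul, hcard]
      _ ≤ κ / 10 * (32 * (Real.logb 2 R.T + 1) * Real.sqrt ((e - a : ℕ) + 1 : ℝ))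
          + ((e - a : ℕ) + 1) * D := by gcongr
      _ = _ := by ring
  · calc ∑ t ∈ Finset.Icc a e, (R.est t - fx t)
        ≤ ∑ t ∈ Finset.Icc a e, (5 / 2 * κ * (1 / Real.sqrt (R.plays t)) + 2 * D) := by
          refine Finset.sum_le_sum fun t ht => ?_
          have ht' := Finset.mem_Icc.1 ht
          have hs := h.small_drift ha1 ht'.1 ht'.2 (hge t ht) (by rw [hD]; exact hdr)
          have := h.est_sub t (by omega) (by omega) hs.2
          rw [hD] at hs
          linarith [hs.1]
      _ = 5 / 2 * κ * ∑ t ∈ Finset.Icc a e, 1 / Real.sqrt (R.plays t)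
          + ((e - a : ℕ) + 1) * (2 * D) := by
          rw [Finset.sum_add_distrib, ← Finset.mul_sum, Finset.sum_const, nsmul_eq_mul, hcard]
      _ ≤ 5 / 2 * κ * (32 * (Real.logb 2 R.T + 1) * Real.sqrt ((e - a : ℕ) + 1 : ℝ))
          + ((e - a : ℕ) + 1) * (2 * D) := by gcongr
      _ = _ := by ring

/-- The tests do not fail as long as the drift of the block is small. -/
lemma not_fail (h : GoodRun R κ M ℓ v fs fx) {t : ℕ} (ht : 1 ≤ t) (htT : t ≤ R.T)
    (hdr : M * drift v (R.bs t) t ≤ 6 * κ / Real.sqrt ((t - R.bs t : ℕ) + 1 : ℝ)) :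
    ¬ R.Fail t := by
  have hκ := h.kappa_pos
  have hcov := h.covers_ord t ht htT
  have hws := R.ws_ord ht
  have hlam := one_le_lam (R := R) (by omega)
  have hb1 := R.one_le_bs ht
  have hbt := R.bs_le ht
  have hts : ∀ s ∈ Finset.Icc (R.bs t) t, R.bs t ≤ R.ts s := fun s hs => by
    rw [Finset.mem_Icc] at hs
    rw [← hws]; exact ts_ge ht hcov (by rw [hws]; exact hs.1) hs.2
  have hwb := (h.window_bounds ht htT hcov (by rw [hws]; exact hdr)).2
  rw [hws] at hwb
  set lam := Real.logb 2 R.T + 1 with hlamdef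
  set N : ℝ := (t - R.bs t : ℕ) + 1 with hN
  have hNpos : 0 < N := by positivity
  have hsN : 0 < Real.sqrt N := Real.sqrt_pos.2 hNpos
  have hNN : Real.sqrt N * Real.sqrt N = N := Real.mul_self_sqrt hNpos.le
  -- For Test 1, the average feedback and the estimate can deviate in the failing direction by four
  -- drift terms of size 6κ/S and a noise term κ/(10S). The threshold is 9 · 36 = 324 times `lam`
  -- κ/S.
  rintro (⟨m, hcm, hwm, τ, hτ, hge⟩ | h2)
  · rw [h.rate_eq, rhoHat_rate, ← hlamdef] at hge
    push_cast at hge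
    set S : ℝ := Real.sqrt (2 ^ m) with hS
    have hSpos : 0 < S := Real.sqrt_pos.2 (by positivity)
    have hSS : S * S = 2 ^ m := Real.mul_self_sqrt (by positivity)
    have hw1 := R.one_le_ws ht m
    have hwb' := R.bs_le_ws t m
    have hwt := R.ws_le ht m
    have hSN : S ≤ Real.sqrt N := by
      apply Real.sqrt_le_sqrt
      rw [hN]
      exact_mod_cast (show 2 ^ m ≤ t - R.bs t + 1 by omega)
    have hdS : M * drift v (R.bs t) t ≤ 6 * κ / S := hdr.trans (by gcongr)
    have hτ' := Finset.mem_Icc.1 hτ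
    have hsd := h.small_drift hb1 hτ'.1 hτ'.2 (hts τ hτ) hdr
    have hest := h.le_est τ (by omega) (by omega) hsd.2
    have hfs : ∀ s, R.bs t ≤ s → s ≤ t → |fs s - fs t| ≤ M * drift v (R.bs t) t := fun s h1 h2 =>
      (h.fs_drift s t (by omega) h2 htT).trans
        ((h.drift_le_M_drift _ _).trans (h.M_drift_mono h1 le_rfl))
    have h3 := (abs_le.1 (hfs τ hτ'.1 hτ'.2)).1
    have hy := (abs_le.1 (h.noise (R.ws t m) t hw1 hwt htT)).2
    have hcard : ((t - R.ws t m : ℕ) : ℝ) + 1 = 2 ^ m := by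
      exact_mod_cast (show t - R.ws t m + 1 = 2 ^ m by omega)
    rw [hcard, ← hS] at hy
    have hsum : ∑ s ∈ Finset.Icc (R.ws t m) t, fx s
        ≤ 2 ^ m * (fs t + M * drift v (R.bs t) t) := by
      have hc : ((Finset.Icc (R.ws t m) t).card : ℝ) = 2 ^ m := by
        rw [Nat.card_Icc]
        exact_mod_cast (show t + 1 - R.ws t m = 2 ^ m by omega)
      rw [← hc, ← nsmul_eq_mul]
      refine Finset.sum_le_card_nsmul _ _ _ fun s hs => ?_
      rw [Finset.mem_Icc] at hs
      have := (abs_le.1 (hfs s (by omega) hs.2)).2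
      have := h.fx_le s (by omega) (by omega)
      linarith
    rw [Finset.sum_sub_distrib] at hy
    have havg : (∑ s ∈ Finset.Icc (R.ws t m) t, R.y s) / (2 : ℝ) ^ m
        ≤ fs t + M * drift v (R.bs t) t + κ / 10 / S := by
      rw [div_le_iff₀ (by positivity)]
      have : κ / 10 / S * 2 ^ m = κ / 10 * S := by rw [← hSS]; field_simp
      rw [add_mul, this]
      linarith
    have e9 : 9 * (36 * lam * κ / S) = 324 * (lam * (κ / S)) := by ring
    have e6 : 6 * κ / S = 6 * (κ / S) := by ring
    have e10 : κ / 10 / S = (κ / S) / 10 := by ring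
    have hpos : 0 < κ / S := by positivity
    have : κ / S ≤ lam * (κ / S) := le_mul_of_one_le_left hpos.le hlam
    rw [e9] at hge
    rw [e6] at hdS
    rw [e10] at havg
    linarith [hsd.1]
  -- For Test 2, in units of κ√N, the estimates exceed the feedbacks by at most 80 `lam` + 2·6 +
  -- 1/10, below the threshold 3 · 36 = 108 times `lam`.
  · unfold Run.FailTwo at h2
    rw [h.rate_eq, rhoHat_rate, ← hlamdef] at h2
    push_cast at h2
    rw [← hN, ge_iff_le, le_div_iff₀ hNpos] at h2
    have hy := (abs_le.1 (h.noise (R.bs t) t hb1 hbt htT)).1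
    rw [← hN] at hy
    have hsplit : ∑ s ∈ Finset.Icc (R.bs t) t, (R.est s - R.y s)
        = ∑ s ∈ Finset.Icc (R.bs t) t, (R.est s - fx s)
          - ∑ s ∈ Finset.Icc (R.bs t) t, (R.y s - fx s) := by
      rw [← Finset.sum_sub_distrib]
      exact Finset.sum_congr rfl fun _ _ => by ring
    rw [hsplit] at h2
    have e1 : 3 * (36 * lam * κ / Real.sqrt N) * N = 108 * (lam * (κ * Real.sqrt N)) := by
      rw [mul_assoc, div_sqrt_mul_self]; ring
    have e2 : N * (M * drift v (R.bs t) t) ≤ 6 * (κ * Real.sqrt N) := by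
      have := mul_le_mul_of_nonneg_left hdr hNpos.le
      refine this.trans (le_of_eq ?_)
      rw [mul_comm, div_sqrt_mul_self]; ring
    rw [e1] at h2
    have hpos : 0 < κ * Real.sqrt N := by positivity
    have : κ * Real.sqrt N ≤ lam * (κ * Real.sqrt N) := le_mul_of_one_le_left hpos.le hlam
    have e3 : 80 * κ * lam * Real.sqrt N = 80 * (lam * (κ * Real.sqrt N)) := by ring
    rw [e3] at hwb
    linarith

/-- Test 1 fails at the end of a scheduled window when an earlier estimate of the block is far too
low. -/
lemma fail_of_bad_window (h : GoodRun R κ M ℓ v fs fx) {τ τ' m : ℕ} (hτ : 1 ≤ τ)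
    (hT : τ + 2 ^ m ≤ R.T + 1) (hbs : R.bs (τ + 2 ^ m - 1) = R.bs τ) (hws : R.ws τ m = τ)
    (hcov : R.Covers τ m) (hdr : M * drift v τ (τ + 2 ^ m - 1) ≤ 6 * κ / Real.sqrt (2 ^ m))
    (h1 : R.bs τ ≤ τ') (h2 : τ' < τ)
    (hest : R.est τ' ≤ fs τ - 12 * rhoHat R.T R.ρ (2 ^ m)) : R.Fail (τ + 2 ^ m - 1) := by
  have hκ := h.kappa_pos
  have h2m : 1 ≤ 2 ^ m := Nat.one_le_two_pow
  obtain ⟨t, ht⟩ : ∃ t, t = τ + 2 ^ m - 1 := ⟨_, rfl⟩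
  rw [← ht] at hbs hdr ⊢
  have hlam := one_le_lam (R := R) (by omega)
  have htT : t ≤ R.T := by omega
  have hbτ := R.bs_le hτ
  have hwt : R.ws t m = τ := R.ws_eq_of_lt (by omega) hws (by omega) (by omega) (by omega)
  have hcov' : R.Covers t m :=
    (R.covers_congr (by omega) (s := τ) (by omega) (by omega)).1 hcov
  have hcard : ((t - τ : ℕ) : ℝ) + 1 = 2 ^ m := by
    exact_mod_cast (show t - τ + 1 = 2 ^ m by omega)
  have hwb := (h.window_bounds (by omega) htT hcov' (by rw [hwt, hcard]; exact hdr)).1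
  rw [hwt, hcard] at hwb
  refine Or.inl ⟨m, hcov', by omega, τ', Finset.mem_Icc.2 ⟨by omega, by omega⟩, ?_⟩
  rw [h.rate_eq, rhoHat_rate] at hest ⊢
  push_cast at hest ⊢
  rw [hwt]
  set lam := Real.logb 2 R.T + 1
  set S : ℝ := Real.sqrt (2 ^ m) with hS
  have hSpos : 0 < S := Real.sqrt_pos.2 (by positivity)
  have hSS : S * S = 2 ^ m := Real.mul_self_sqrt (by positivity)
  have hy := (abs_le.1 (h.noise τ t hτ (by omega) htT)).1
  rw [hcard, ← hS, Finset.sum_sub_distrib] at hy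
  rw [Finset.sum_sub_distrib] at hwb
  have hsum : 2 ^ m * (fs τ - M * drift v τ t) ≤ ∑ s ∈ Finset.Icc τ t, fs s := by
    have hc : ((Finset.Icc τ t).card : ℝ) = 2 ^ m := by
      rw [Nat.card_Icc]
      exact_mod_cast (show t + 1 - τ = 2 ^ m by omega)
    rw [← hc, ← nsmul_eq_mul]
    refine Finset.card_nsmul_le_sum _ _ _ fun s hs => ?_
    rw [Finset.mem_Icc] at hs
    have h3 := (abs_le.1 (h.fs_drift τ s hτ hs.1 (by omega))).2
    have h4 := (h.drift_le_M_drift τ s).trans (h.M_drift_mono le_rfl hs.2)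
    linarith
  have hdr' : 2 ^ m * (M * drift v τ t) ≤ 6 * (κ * S) := by
    have := mul_le_mul_of_nonneg_left hdr (by positivity : (0 : ℝ) ≤ 2 ^ m)
    refine this.trans (le_of_eq ?_)
    conv_lhs => rw [← hSS]
    field_simp
  rw [ge_iff_le, le_div_iff₀ (by positivity)]
  have hest' := mul_le_mul_of_nonneg_right hest (by positivity : (0 : ℝ) ≤ 2 ^ m)
  -- The gap between the factors 12 and 9 leaves 108 `lam` κS. This pays for the regret 16/5 `lam`
  -- κS, the drift twice (6κS for the regret, 6κS for the optimal values) and the noise κS/10.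
  have e1 : (fs τ - 12 * (36 * lam * κ / S)) * 2 ^ m = 2 ^ m * fs τ - 432 * (lam * (κ * S)) := by
    rw [sub_mul]
    have : 12 * (36 * lam * κ / S) * 2 ^ m = 432 * (lam * (κ * S)) := by
      rw [← hSS]; field_simp; ring
    rw [this]; ring
  have e2 : (R.est τ' + 9 * (36 * lam * κ / S)) * 2 ^ m
      = R.est τ' * 2 ^ m + 324 * (lam * (κ * S)) := by
    rw [add_mul]
    have : 9 * (36 * lam * κ / S) * 2 ^ m = 324 * (lam * (κ * S)) := by
      rw [← hSS]; field_simp; ring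
    rw [this]
  rw [e1] at hest'
  rw [e2]
  have hpos : 0 < κ * S := by positivity
  have : κ * S ≤ lam * (κ * S) := le_mul_of_one_le_left hpos.le hlam
  have e3 : 16 / 5 * κ * lam * S = 16 / 5 * (lam * (κ * S)) := by ring
  rw [e3] at hwb
  linarith

end GoodRun


/-! ### Bad windows and the regret of one block. -/

namespace Run

variable {d : ℕ} (R : Run d)

open Classical in
/-- The starts of the order-`m` windows of the block `(b, n)` that contain no break point and before
which an estimate of the block was far too low. -/
def bad (fs : ℕ → ℝ) (Q : Finset ℕ) (b n m : ℕ) : Finset ℕ :=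
  (Finset.Icc 1 R.T).filter fun τ => (R.bs τ = b ∧ R.ord τ = n ∧ R.ws τ m = τ) ∧
    (∀ q ∈ Q, τ < q → τ + 2 ^ m ≤ q) ∧
    ∃ τ' ∈ Finset.Ico b τ, R.est τ' ≤ fs τ - 12 * rhoHat R.T R.ρ (2 ^ m)

open Classical in
/-- The lower bound for the number of scheduled threads in bad windows. -/
def ManyWins (fs : ℕ → ℝ) (Q : Finset ℕ) (ℓ : ℝ) : Prop := ∀ b n m, b ≤ R.T → n ≤ R.T → m ≤ R.T →
  (R.ρ (2 ^ n) / R.ρ (2 ^ m)) * ((R.bad fs Q b n m).card : ℝ) ≤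
    2 * ((((R.bad fs Q b n m).filter fun τ => R.u τ m ≤ R.ρ (2 ^ n) / R.ρ (2 ^ m)).card : ℝ) + ℓ)

end Run

/-- Break points that cut the time into intervals of length at most `w` with a small drift. -/
structure Breaks (T : ℕ) (κ M : ℝ) (v : ℕ → ℝ) (Q : Finset ℕ) (w : ℕ) : Prop where
  one_le : 1 ≤ w
  le_T : w ≤ T
  small : ∀ a e, 1 ≤ a → a ≤ e → e ≤ T → (∀ q ∈ Q, a < q → e < q) →
    e + 1 ≤ a + w ∧ M * drift v a e ≤ 6 * κ / Real.sqrt w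

namespace GoodRun

variable {d : ℕ} {R : Run d} {κ M ℓ : ℝ} {v fs fx : ℕ → ℝ} {Q : Finset ℕ} {w : ℕ}

/-- A block without a break point after its start has length at most w and so small a drift that its
tests cannot fail. Every failure can therefore be charged to a break point inside its block. -/
lemma break_of_fail (h : GoodRun R κ M ℓ v fs fx) (hQ : Breaks R.T κ M v Q w) {t : ℕ} (ht : 1 ≤ t)
    (htT : t ≤ R.T) (hf : R.Fail t) : ∃ q ∈ Q, R.bs t < q ∧ q ≤ t := by
  by_contra hcon
  push Not at hcon
  have hb := R.bs_le ht
  obtain ⟨h1, h2⟩ := hQ.small (R.bs t) t (R.one_le_bs ht) hb htT hcon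
  refine h.not_fail ht htT (h2.trans ?_) hf
  have := h.kappa_pos
  have h3 : ((t - R.bs t : ℕ) : ℝ) + 1 ≤ w := by
    exact_mod_cast (show t - R.bs t + 1 ≤ w by omega)
  gcongr

lemma sqrt_two_pow_le {m : ℕ} (hm : 2 ^ m ≤ w) :
    Real.sqrt (2 ^ m) ≤ Real.sqrt w := Real.sqrt_le_sqrt (by exact_mod_cast hm)

/-- In each block, at most one bad window is scheduled. -/
lemma card_bad_wins_le (h : GoodRun R κ M ℓ v fs fx) (hQ : Breaks R.T κ M v Q w) {b n m : ℕ}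
    (hm : 2 ^ m ≤ w) (hmn : m ≤ n) :
    (((R.bad fs Q b n m).filter fun τ => R.u τ m ≤ R.ρ (2 ^ n) / R.ρ (2 ^ m)).card) ≤ 1 := by
  classical
  -- The window of τ₁ ends before τ₂ and contains no break point after its start. Being scheduled
  -- and bad, it makes Test 1 fail at its end, so τ₂ could not belong to the same block.
  have key : ∀ τ₁ τ₂, τ₁ < τ₂ →
      τ₁ ∈ (R.bad fs Q b n m).filter (fun τ => R.u τ m ≤ R.ρ (2 ^ n) / R.ρ (2 ^ m)) →
      τ₂ ∈ (R.bad fs Q b n m).filter (fun τ => R.u τ m ≤ R.ρ (2 ^ n) / R.ρ (2 ^ m)) → False := by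
    intro τ₁ τ₂ hlt h1 h2
    unfold Run.bad at h1 h2
    rw [Finset.mem_filter, Finset.mem_filter, Finset.mem_Icc] at h1 h2
    obtain ⟨⟨⟨h11, h1T⟩, ⟨hb1, hn1, hw1⟩, hq1, τ', hτ', he1⟩, hu1⟩ := h1
    obtain ⟨⟨⟨h21, h2T⟩, ⟨hb2, hn2, hw2⟩, -⟩, -⟩ := h2
    rw [Finset.mem_Ico] at hτ'
    have hbτ := R.bs_le h11
    have hge : τ₁ + 2 ^ m ≤ τ₂ := by
      by_contra hcon
      have := R.ws_eq_of_lt h21 hw1 (by omega) hlt.le (by omega)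
      omega
    have h2m : 1 ≤ 2 ^ m := Nat.one_le_two_pow
    have hsb := R.same_block h21 (s := τ₁ + 2 ^ m - 1) (by omega) (by omega)
    have hdr := hQ.small τ₁ (τ₁ + 2 ^ m - 1) h11 (by omega) (by omega)
      (fun q hq hlt => by have := hq1 q hq hlt; omega)
    have hκ := h.kappa_pos
    refine R.not_fail_of_bs_lt h21 (s := τ₁ + 2 ^ m - 1) (by omega) (by omega) ?_
    refine h.fail_of_bad_window h11 (by omega) (by omega) hw1 ?_ (hdr.2.trans ?_) (τ' := τ')
      (by omega) hτ'.2 he1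
    · unfold Run.Covers
      rw [hn1, hw1]; exact ⟨hmn, hu1⟩
    · have := sqrt_two_pow_le hm
      gcongr
  rw [Finset.card_le_one]
  intro τ₁ h1 τ₂ h2
  rcases lt_trichotomy τ₁ τ₂ with hlt | heq | hlt
  · exact (key _ _ hlt h1 h2).elim
  · exact heq
  · exact (key _ _ hlt h2 h1).elim

/-- The periods of a block at which the estimate is far below the optimal value are few. -/
lemma card_excess_le (h : GoodRun R κ M ℓ v fs fx) (hQ : Breaks R.T κ M v Q w) {e m : ℕ}
    (he : 1 ≤ e) (heT : e ≤ R.T) (hm : 2 ^ m ≤ w) :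
    ((Finset.Ico (R.bs e) e).filter
      fun t => 13 * rhoHat R.T R.ρ (2 ^ m) < fs t - R.est t).card ≤
    2 ^ m * ((R.bad fs Q (R.bs e) (R.ord e) m).card
      + 2 * (Q.filter fun q => R.bs e < q ∧ q ≤ e).card + 2) := by
  classical
  have hκ := h.kappa_pos
  have hb1 := R.one_le_bs he
  have h2m : 1 ≤ 2 ^ m := Nat.one_le_two_pow
  have hlam := one_le_lam (R := R) (by omega)
  set B := R.bad fs Q (R.bs e) (R.ord e) m with hB
  set Q' := Q.filter fun q => R.bs e < q ∧ q ≤ e with hQ'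
  -- Look at the order-m window following the one that contains t. If it ends by e and no break
  -- point comes after t before its end, the optimal value changes by at most one unit `rhoHat` on
  -- the way. The gap 13 at t thus leaves 12 at the start of that window, which is bad. Otherwise t
  -- precedes a break point or e by at most 2 · 2^m.
  have hsub : (Finset.Ico (R.bs e) e).filter
      (fun t => 13 * rhoHat R.T R.ρ (2 ^ m) < fs t - R.est t) ⊆
      (B.biUnion fun τ => Finset.Ico (τ - 2 ^ m) τ) ∪
        ((Q'.biUnion fun q => Finset.Ico (q - 2 * 2 ^ m) q) ∪ Finset.Ico (e - 2 * 2 ^ m) e) := by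
    intro t ht
    rw [Finset.mem_filter, Finset.mem_Ico] at ht
    obtain ⟨⟨hbt, hte⟩, hex⟩ := ht
    have ht1 : 1 ≤ t := by omega
    have hwt := R.ws_le ht1 m
    have hlt := R.lt_ws_add t m
    simp only [Finset.mem_union, Finset.mem_biUnion, Finset.mem_Ico]
    by_cases hq : ∃ q ∈ Q, t < q ∧ q < R.ws t m + 2 ^ m + 2 ^ m ∧ q ≤ e
    · obtain ⟨q, hqQ, h1, h2, h3⟩ := hq
      exact Or.inr (Or.inl ⟨q, Finset.mem_filter.2 ⟨hqQ, by omega, h3⟩, by omega, h1⟩)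
    by_cases hend : R.ws t m + 2 ^ m + 2 ^ m ≤ e + 1
    swap
    · exact Or.inr (Or.inr ⟨by omega, hte⟩)
    push Not at hq
    refine Or.inl ⟨R.ws t m + 2 ^ m, ?_, by omega, hlt⟩
    set τ := R.ws t m + 2 ^ m with hτ
    have hbst := (R.same_block he hbt hte.le).1
    have hsb := R.same_block he (s := τ) (by omega) (by omega)
    have hwτ : R.ws τ m = τ := by
      have e1 : τ = R.bs e + ((t - R.bs e) / 2 ^ m + 1) * 2 ^ m := by
        rw [hτ, Run.ws, hbst]; ring
      rw [Run.ws, hsb.1]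
      have e2 : τ - R.bs e = ((t - R.bs e) / 2 ^ m + 1) * 2 ^ m := by omega
      rw [e2, Nat.mul_div_cancel _ (by positivity)]
      exact e1.symm
    have hdr := hQ.small t (τ + 2 ^ m - 1) ht1 (by omega) (by omega) (fun q hqQ h1 => by
      by_contra hcon
      have := hq q hqQ h1 (by omega)
      omega)
    have hsm := sqrt_two_pow_le hm
    have hsp : 0 < Real.sqrt (2 ^ m) := by positivity
    have hd : |fs t - fs τ| ≤ 6 * κ / Real.sqrt (2 ^ m) := by
      refine (h.fs_drift t τ ht1 (by omega) (by omega)).trans ((h.drift_le_M_drift _ _).trans ?_)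
      refine (h.M_drift_mono (le_refl t) (show τ ≤ τ + 2 ^ m - 1 by omega)).trans (hdr.2.trans ?_)
      gcongr
    rw [hB, Run.bad, Finset.mem_filter, Finset.mem_Icc]
    refine ⟨⟨by omega, by omega⟩, ⟨hsb.1, hsb.2, hwτ⟩, ?_, t, Finset.mem_Ico.2 ⟨hbt, hlt⟩, ?_⟩
    · intro q hqQ h1
      by_contra hcon
      have := hq q hqQ (by omega) (by omega)
      omega
    · rw [h.rate_eq, rhoHat_rate] at hex ⊢
      push_cast at hex ⊢
      have h1 := (abs_le.1 hd).2
      have e1 : 36 * (Real.logb 2 R.T + 1) * κ / Real.sqrt (2 ^ m)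
        = 36 * ((Real.logb 2 R.T + 1) * (κ / Real.sqrt (2 ^ m))) := by ring
      have e2 : 6 * κ / Real.sqrt (2 ^ m) = 6 * (κ / Real.sqrt (2 ^ m)) := by ring
      rw [e1] at hex ⊢
      rw [e2] at h1
      have hpos : 0 < κ / Real.sqrt (2 ^ m) := by positivity
      have := le_mul_of_one_le_left hpos.le hlam
      linarith
  refine (Finset.card_le_card hsub).trans ((Finset.card_union_le _ _).trans ?_)
  have c1 : (B.biUnion fun τ => Finset.Ico (τ - 2 ^ m) τ).card ≤ B.card * 2 ^ m :=
    Finset.card_biUnion_le_card_mul _ _ _ fun τ _ => by rw [Nat.card_Ico]; omega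
  have c2 : (Q'.biUnion fun q => Finset.Ico (q - 2 * 2 ^ m) q).card ≤ Q'.card * (2 * 2 ^ m) :=
    Finset.card_biUnion_le_card_mul _ _ _ fun q _ => by rw [Nat.card_Ico]; omega
  have c3 : (Finset.Ico (e - 2 * 2 ^ m) e).card ≤ 2 * 2 ^ m := by rw [Nat.card_Ico]; omega
  have c4 := (Finset.card_union_le (Q'.biUnion fun q => Finset.Ico (q - 2 * 2 ^ m) q)
    (Finset.Ico (e - 2 * 2 ^ m) e))
  calc _ ≤ B.card * 2 ^ m + (Q'.card * (2 * 2 ^ m) + 2 * 2 ^ m) := by omega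
    _ = _ := by ring

open Classical in
/-- Decomposition of the gap between the optimal value and the estimate into levels. -/
lemma excess_le_levels (h : GoodRun R κ M ℓ v fs fx) {t : ℕ} (ht : 1 ≤ t) (htT : t ≤ R.T) (k : ℕ) :
    fs t - R.est t ≤ 13 * rhoHat R.T R.ρ (2 ^ k) + ∑ m ∈ Finset.range (k + 1),
      26 * rhoHat R.T R.ρ (2 ^ m) *
        (if 13 * rhoHat R.T R.ρ (2 ^ m) < fs t - R.est t then 1 else 0) := by
  have hκ := h.one_le_kappa
  have hlam := one_le_lam (R := R) (by omega)
  have hρ : ∀ k, rhoHat R.T R.ρ (2 ^ k)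
      = 36 * (Real.logb 2 R.T + 1) * κ / Real.sqrt (2 ^ k) := fun k => by
    rw [h.rate_eq, rhoHat_rate]; push_cast; rfl
  have hpos : ∀ k, 0 ≤ rhoHat R.T R.ρ (2 ^ k) := fun k => by
    rw [hρ]; have := zero_le_one.trans hlam; have := zero_le_one.trans hκ; positivity
  have hterm : ∀ m, 0 ≤ 26 * rhoHat R.T R.ρ (2 ^ m) *
        (if 13 * rhoHat R.T R.ρ (2 ^ m) < fs t - R.est t then (1 : ℝ) else 0) := fun m => by
    have := hpos m
    split_ifs <;> positivity
  induction k with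
  | zero =>
    simp only [zero_add, Finset.range_one, Finset.sum_singleton]
    -- At the coarsest scale the indicator term suffices: optimum minus estimate is at most 2, while
    -- `rhoHat` at 1 is at least 36.
    split_ifs with hc
    · have h1 := h.fs_le t ht htT
      have h2 := h.est_ge t ht htT
      have h3 := hρ 0
      rw [pow_zero, pow_zero, Real.sqrt_one, div_one] at h3
      have : 1 ≤ (Real.logb 2 R.T + 1) * κ := one_le_mul_of_one_le_of_one_le hlam hκ
      rw [pow_zero, h3]
      linarith
    · push Not at hc; linarith
  | succ k ih =>
    rw [Finset.sum_range_succ]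
    by_cases hc : 13 * rhoHat R.T R.ρ (2 ^ (k + 1)) < fs t - R.est t
    · rw [if_pos hc]
      have h2 : rhoHat R.T R.ρ (2 ^ k) ≤ 2 * rhoHat R.T R.ρ (2 ^ (k + 1)) := by
        rw [hρ, hρ, ← mul_div_assoc]
        have hs : 0 < Real.sqrt (2 ^ k) := by positivity
        rw [div_le_div_iff₀ hs (by positivity), pow_succ, Real.sqrt_mul (by positivity)]
        have h3 : Real.sqrt 2 ≤ 2 := Real.sqrt_le_iff.2 (by norm_num)
        have h4 : 0 ≤ 36 * (Real.logb 2 R.T + 1) * κ := by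
          have := zero_le_one.trans hlam; have := zero_le_one.trans hκ; positivity
        calc 36 * (Real.logb 2 R.T + 1) * κ * (Real.sqrt (2 ^ k) * Real.sqrt 2)
            ≤ 36 * (Real.logb 2 R.T + 1) * κ * (Real.sqrt (2 ^ k) * 2) := by gcongr
          _ = _ := by ring
      have := hpos (k + 1)
      linarith
    · have h2 : 0 ≤ ∑ m ∈ Finset.range (k + 1), 26 * rhoHat R.T R.ρ (2 ^ m) *
        (if 13 * rhoHat R.T R.ρ (2 ^ m) < fs t - R.est t then (1 : ℝ) else 0) :=
        Finset.sum_nonneg fun m _ => hterm m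
      have h3 := hterm (k + 1)
      push Not at hc
      linarith

/-- The sum of the gaps between the optimal values and the estimates over a block. -/
lemma sum_excess_le (h : GoodRun R κ M ℓ v fs fx) (hQ : Breaks R.T κ M v Q w)
    (hmany : R.ManyWins fs Q ℓ) {e : ℕ} (he : 1 ≤ e) (heT : e ≤ R.T) :
    ∑ t ∈ Finset.Ico (R.bs e) e, (fs t - R.est t) ≤
      10203 * (Real.logb 2 R.T + 1) ^ 3 * κ * (Real.sqrt (2 ^ R.ord e)
        + ((e - R.bs e : ℕ) : ℝ) / Real.sqrt w
        + (((Q.filter fun q => R.bs e < q ∧ q ≤ e).card : ℝ) + 1) * Real.sqrt w) := by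
  classical
  have hκ := h.kappa_pos
  have hlam := one_le_lam (R := R) (by omega)
  set lam := Real.logb 2 R.T + 1 with hlamdef
  set n := R.ord e with hn
  set len : ℝ := ((e - R.bs e : ℕ) : ℝ) with hlen
  set q : ℝ := ((Q.filter fun q => R.bs e < q ∧ q ≤ e).card : ℝ) with hq
  have hq0 : 0 ≤ q := Nat.cast_nonneg _
  have hlen0 : 0 ≤ len := Nat.cast_nonneg _
  have hb1 := R.one_le_bs he
  have hw1 := hQ.one_le
  have hwT := hQ.le_T
  have hwpos : (0 : ℝ) < w := by exact_mod_cast hw1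
  have hsw : 0 < Real.sqrt w := Real.sqrt_pos.2 hwpos
  have hsn : 0 < Real.sqrt (2 ^ n) := by positivity
  -- The finest level used. Windows must not exceed w, for the break points to control their drift,
  -- nor the block.
  set k := min n (Nat.log 2 w) with hk
  have hkw : 2 ^ k ≤ w := (Nat.pow_le_pow_right (by norm_num) (min_le_right _ _)).trans
    (Nat.pow_log_le_self 2 (by omega))
  have hρ : ∀ k, rhoHat R.T R.ρ (2 ^ k) = 36 * lam * κ / Real.sqrt (2 ^ k) := fun k => by
    rw [h.rate_eq, rhoHat_rate]; push_cast; rfl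
  have hk1 : (k : ℝ) + 1 ≤ lam := by
    have := le_logb_of_two_pow_le (k := k) (x := R.T) (by exact_mod_cast hkw.trans hwT)
    linarith
  have hlevel : ∀ m ∈ Finset.range (k + 1), 26 * rhoHat R.T R.ρ (2 ^ m) *
      (((Finset.Ico (R.bs e) e).filter
        fun t => 13 * rhoHat R.T R.ρ (2 ^ m) < fs t - R.est t).card : ℝ)
      ≤ 936 * lam * κ * (52 / 5 * lam * Real.sqrt (2 ^ n) + (2 * q + 2) * Real.sqrt w) := by
    intro m hm
    rw [Finset.mem_range] at hm
    have hmn : m ≤ n := by have := min_le_left n (Nat.log 2 w); omega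
    have hmw : 2 ^ m ≤ w := (Nat.pow_le_pow_right (by norm_num) (by omega)).trans hkw
    have hc := h.card_excess_le hQ he heT hmw
    have hordT : n ≤ R.T := (Run.ord_le he).trans heT
    have hbT : R.bs e ≤ R.T := (R.bs_le he).trans heT
    have hmb := hmany (R.bs e) n m hbT hordT (by omega)
    have hw := h.card_bad_wins_le hQ (b := R.bs e) hmw hmn
    set B : ℝ := ((R.bad fs Q (R.bs e) n m).card : ℝ) with hB
    have hsm : 0 < Real.sqrt (2 ^ m) := by positivity
    have hsmm : Real.sqrt (2 ^ m) * Real.sqrt (2 ^ m) = 2 ^ m := Real.mul_self_sqrt (by positivity)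
    -- At most one bad window is scheduled, so probability times number of bad windows is at most
    -- 2(1 + ℓ) ≤ (2 + 42/5) `lam`.
    have hBle : Real.sqrt (2 ^ m) * B ≤ 52 / 5 * lam * Real.sqrt (2 ^ n) := by
      rw [h.rate_eq, rate_div_rate hκ] at hmb
      rw [h.rate_eq, rate_div_rate hκ] at hw
      have hw' : ((((R.bad fs Q (R.bs e) n m).filter fun τ =>
        R.u τ m ≤ Real.sqrt (2 ^ m) / Real.sqrt (2 ^ n)).card : ℕ) : ℝ) ≤ 1 := by exact_mod_cast hw
      have h1 : Real.sqrt (2 ^ m) / Real.sqrt (2 ^ n) * B ≤ 52 / 5 * lam := by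
        have := h.ell_le
        linarith
      rw [div_mul_eq_mul_div, div_le_iff₀ hsn] at h1
      exact h1
    have hc' : (((Finset.Ico (R.bs e) e).filter
        fun t => 13 * rhoHat R.T R.ρ (2 ^ m) < fs t - R.est t).card : ℝ) ≤
        2 ^ m * (B + 2 * q + 2) := by
      rw [hB, hq]; exact_mod_cast hc
    have hsmw := sqrt_two_pow_le hmw
    have hds : (2 : ℝ) ^ m / Real.sqrt (2 ^ m) = Real.sqrt (2 ^ m) := Real.div_sqrt
    calc _ ≤ 26 * rhoHat R.T R.ρ (2 ^ m) * (2 ^ m * (B + 2 * q + 2)) := by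
          refine mul_le_mul_of_nonneg_left hc' ?_
          rw [hρ]; positivity
      _ = 936 * lam * κ * (Real.sqrt (2 ^ m) * B + (2 * q + 2) * Real.sqrt (2 ^ m)) := by
          have e1 : 26 * rhoHat R.T R.ρ (2 ^ m) * (2 ^ m * (B + 2 * q + 2))
            = 936 * lam * κ * ((2 ^ m / Real.sqrt (2 ^ m)) * (B + 2 * q + 2)) := by
            rw [hρ]; ring
          rw [e1, hds]; ring
      _ ≤ _ := by gcongr
  have hbase : len * (13 * rhoHat R.T R.ρ (2 ^ k))
      ≤ 468 * lam * κ * (Real.sqrt (2 ^ n) + 2 * len / Real.sqrt w) := by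
    rw [hρ]
    have hkey : len / Real.sqrt (2 ^ k) ≤ Real.sqrt (2 ^ n) + 2 * len / Real.sqrt w := by
      rcases min_choice n (Nat.log 2 w) with hc | hc
      · have hkn : k = n := by rw [hk]; exact hc
        rw [hkn]
        have h1 : len ≤ 2 ^ n := by
          have := R.lt_bs_add he
          rw [← hn] at this
          have h2n := R.bs_le he
          rw [hlen]
          exact_mod_cast (show e - R.bs e ≤ 2 ^ n by omega)
        have h2 : len / Real.sqrt (2 ^ n) ≤ Real.sqrt (2 ^ n) := by
          rw [div_le_iff₀ hsn, Real.mul_self_sqrt (by positivity)]; exact h1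
        have : 0 ≤ 2 * len / Real.sqrt w := by positivity
        linarith
      · have hkn : k = Nat.log 2 w := by rw [hk]; exact hc
        have h1 : w < 2 * 2 ^ k := by
          have := Nat.lt_pow_succ_log_self (b := 2) (by norm_num) w
          rw [← hkn, pow_succ] at this; omega
        have h2 : Real.sqrt w ≤ 2 * Real.sqrt (2 ^ k) := by
          rw [Real.sqrt_le_iff]
          refine ⟨by positivity, ?_⟩
          rw [mul_pow, Real.sq_sqrt (by positivity)]
          have h3 : (w : ℝ) ≤ 2 * 2 ^ k := by exact_mod_cast h1.le
          have : (0 : ℝ) < 2 ^ k := by positivity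
          linarith
        have h3 : len / Real.sqrt (2 ^ k) ≤ 2 * len / Real.sqrt w := by
          have : 0 < Real.sqrt ((2 : ℝ) ^ k) := by positivity
          rw [div_le_div_iff₀ this hsw]
          nlinarith
        linarith
    calc len * (13 * (36 * lam * κ / Real.sqrt (2 ^ k)))
        = 468 * lam * κ * (len / Real.sqrt (2 ^ k)) := by ring
      _ ≤ _ := by gcongr
  have hsum : ∑ t ∈ Finset.Ico (R.bs e) e, (fs t - R.est t) ≤
      len * (13 * rhoHat R.T R.ρ (2 ^ k)) + ∑ m ∈ Finset.range (k + 1),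
        26 * rhoHat R.T R.ρ (2 ^ m) * (((Finset.Ico (R.bs e) e).filter
          fun t => 13 * rhoHat R.T R.ρ (2 ^ m) < fs t - R.est t).card : ℝ) := by
    refine (Finset.sum_le_sum fun t ht => h.excess_le_levels (t := t) ?_ ?_ k).trans (le_of_eq ?_)
    · rw [Finset.mem_Ico] at ht; omega
    · rw [Finset.mem_Ico] at ht; omega
    · rw [Finset.sum_add_distrib, Finset.sum_const, Nat.card_Ico, nsmul_eq_mul, Finset.sum_comm]
      congr 1
      refine Finset.sum_congr rfl fun m _ => ?_
      rw [← Finset.mul_sum, Finset.sum_boole]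
  have hlev := Finset.sum_le_card_nsmul _ _ _ hlevel
  rw [Finset.card_range, nsmul_eq_mul] at hlev
  push_cast at hlev
  have hlev2 : ((k : ℝ) + 1) * (936 * lam * κ * (52 / 5 * lam * Real.sqrt (2 ^ n)
      + (2 * q + 2) * Real.sqrt w))
      ≤ lam * (936 * lam * κ * (52 / 5 * lam * Real.sqrt (2 ^ n) + (2 * q + 2) * Real.sqrt w)) := by
    gcongr
  refine hsum.trans ((add_le_add hbase (hlev.trans hlev2)).trans ?_)
  have hl2 : lam ≤ lam ^ 3 := le_self_pow₀ hlam (by norm_num)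
  have hl3 : lam ^ 2 ≤ lam ^ 3 := pow_le_pow_right₀ hlam (by norm_num)
  have e1 : 468 * lam * κ * (Real.sqrt (2 ^ n) + 2 * len / Real.sqrt w)
      + lam * (936 * lam * κ * (52 / 5 * lam * Real.sqrt (2 ^ n) + (2 * q + 2) * Real.sqrt w))
      = lam * (468 * κ * Real.sqrt (2 ^ n) + 936 * κ * (len / Real.sqrt w))
        + lam ^ 3 * (936 * (52 / 5) * κ * Real.sqrt (2 ^ n))
        + lam ^ 2 * (1872 * κ * ((q + 1) * Real.sqrt w)) := by ring
  rw [e1]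
  calc _ ≤ lam ^ 3 * (468 * κ * Real.sqrt (2 ^ n) + 936 * κ * (len / Real.sqrt w))
        + lam ^ 3 * (936 * (52 / 5) * κ * Real.sqrt (2 ^ n))
        + lam ^ 3 * (1872 * κ * ((q + 1) * Real.sqrt w)) := by gcongr
    _ = lam ^ 3 * κ * ((468 + 936 * (52 / 5)) * Real.sqrt (2 ^ n) + 936 * (len / Real.sqrt w)
        + 1872 * ((q + 1) * Real.sqrt w)) := by ring
    _ ≤ lam ^ 3 * κ * (10203 * Real.sqrt (2 ^ n) + 10203 * (len / Real.sqrt w)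
        + 10203 * ((q + 1) * Real.sqrt w)) := by gcongr <;> norm_num
    _ = _ := by ring

/-- The regret of a block. -/
lemma block_regret (h : GoodRun R κ M ℓ v fs fx) (hQ : Breaks R.T κ M v Q w)
    (hmany : R.ManyWins fs Q ℓ) {e : ℕ} (he : 1 ≤ e) (heT : e ≤ R.T) :
    ∑ t ∈ Finset.Icc (R.bs e) e, (fs t - fx t) ≤
      11000 * (Real.logb 2 R.T + 1) ^ 3 * κ * (Real.sqrt (2 ^ R.ord e)
        + ((e - R.bs e : ℕ) : ℝ) / Real.sqrt w
        + (((Q.filter fun q => R.bs e < q ∧ q ≤ e).card : ℝ) + 1) * Real.sqrt w) := by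
  have hκ := h.kappa_pos
  have hlam := one_le_lam (R := R) (by omega)
  have hexc := h.sum_excess_le hQ hmany he heT
  have hbe := R.bs_le he
  have hb1 := R.one_le_bs he
  set lam := Real.logb 2 R.T + 1 with hlamdef
  set n := R.ord e with hn
  set Z : ℝ := ((e - R.bs e : ℕ) : ℝ) / Real.sqrt w
        + (((Q.filter fun q => R.bs e < q ∧ q ≤ e).card : ℝ) + 1) * Real.sqrt w with hZ
  have hZ0 : 0 ≤ Z := by positivity
  have hn1 : 1 ≤ Real.sqrt (2 ^ n) := Real.one_le_sqrt.2 (one_le_pow₀ (by norm_num))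
  -- A test may fail in the last period of the block. So Test 2 is used only up to the period
  -- before, and the last period is bounded trivially.
  have hlast : fs e - fx e ≤ 2 := by
    have := h.fs_le e he heT
    have := h.fx_ge e he heT
    linarith
  have hl1 : lam ≤ lam ^ 3 := le_self_pow₀ hlam (by norm_num)
  have htest : ∑ t ∈ Finset.Ico (R.bs e) e, (R.est t - R.y t) ≤
      108 * lam * κ * Real.sqrt (2 ^ n) ∧
      ∑ t ∈ Finset.Ico (R.bs e) e, (R.y t - fx t) ≤ κ / 10 * Real.sqrt (2 ^ n) := by
    rcases Nat.eq_or_lt_of_le hbe with heq | hlt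
    · rw [heq, Finset.Ico_self, Finset.sum_empty, Finset.sum_empty]
      constructor <;> positivity
    · obtain ⟨e', rfl⟩ : ∃ e', e = e' + 1 := ⟨e - 1, by omega⟩
      have hIco : Finset.Ico (R.bs (e' + 1)) (e' + 1) = Finset.Icc (R.bs (e' + 1)) e' := by
        ext x; simp only [Finset.mem_Ico, Finset.mem_Icc]; omega
      rw [hIco]
      have hsb := R.same_block he (s := e') (by omega) (by omega)
      have hnf := R.not_fail_of_bs_lt he (s := e') (by omega) (by omega)
      have hN : ((e' - R.bs (e' + 1) : ℕ) : ℝ) + 1 ≤ 2 ^ n := by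
        have := R.lt_bs_add he
        rw [← hn] at this
        exact_mod_cast (show e' - R.bs (e' + 1) + 1 ≤ 2 ^ n by omega)
      have hsN := Real.sqrt_le_sqrt hN
      constructor
      · have h2 : ¬ R.FailTwo e' := fun h2 => hnf (Or.inr h2)
        unfold Run.FailTwo at h2
        rw [hsb.1, h.rate_eq, rhoHat_rate, ← hlamdef, ge_iff_le, not_le] at h2
        push_cast at h2
        rw [div_lt_iff₀ (by positivity), mul_assoc, div_sqrt_mul_self] at h2
        refine h2.le.trans ?_
        calc 3 * (36 * lam * κ * Real.sqrt (((e' - R.bs (e' + 1) : ℕ) : ℝ) + 1))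
            ≤ 3 * (36 * lam * κ * Real.sqrt (2 ^ n)) := by gcongr
          _ = _ := by ring
      · refine ((abs_le.1 (h.noise (R.bs (e' + 1)) e' hb1 (by omega) (by omega))).2).trans ?_
        gcongr
  have hIcc : ∑ t ∈ Finset.Icc (R.bs e) e, (fs t - fx t)
      = ∑ t ∈ Finset.Ico (R.bs e) e, (fs t - R.est t)
        + ∑ t ∈ Finset.Ico (R.bs e) e, (R.est t - R.y t)
        + ∑ t ∈ Finset.Ico (R.bs e) e, (R.y t - fx t) + (fs e - fx e) := by
    rw [← Finset.sum_add_distrib, ← Finset.sum_add_distrib, ← Finset.Ico_succ_right_eq_Icc,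
      Order.succ_eq_add_one, Finset.sum_Ico_succ_top hbe]
    congr 1
    exact Finset.sum_congr rfl fun _ _ => by ring
  rw [hIcc, add_assoc (Real.sqrt (2 ^ n)), ← hZ]
  rw [add_assoc (Real.sqrt (2 ^ n)), ← hZ] at hexc
  have hKS : 1 ≤ κ * Real.sqrt (2 ^ n) := one_le_mul_of_one_le_of_one_le h.one_le_kappa hn1
  have h3 : lam * (κ * Real.sqrt (2 ^ n)) ≤ lam ^ 3 * (κ * Real.sqrt (2 ^ n)) := by gcongr
  have h4 : κ * Real.sqrt (2 ^ n) ≤ lam * (κ * Real.sqrt (2 ^ n)) :=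
    le_mul_of_one_le_left (by positivity) hlam
  have h5 : 0 ≤ lam ^ 3 * (κ * Z) := by positivity
  have e1 : 10203 * lam ^ 3 * κ * (Real.sqrt (2 ^ n) + Z)
    = 10203 * (lam ^ 3 * (κ * Real.sqrt (2 ^ n))) + 10203 * (lam ^ 3 * (κ * Z)) := by ring
  have e2 : 11000 * lam ^ 3 * κ * (Real.sqrt (2 ^ n) + Z)
    = 11000 * (lam ^ 3 * (κ * Real.sqrt (2 ^ n))) + 11000 * (lam ^ 3 * (κ * Z)) := by ring
  have e3 : 108 * lam * κ * Real.sqrt (2 ^ n) = 108 * (lam * (κ * Real.sqrt (2 ^ n))) := by ring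
  rw [e1] at hexc
  rw [e2]
  rw [e3] at htest
  linarith [htest.1, htest.2]

end GoodRun


/-! ### Break points -/

/-- The jumps of `⌊Φ / c⌋` up to time `T`. -/
def jumps (Φ : ℕ → ℝ) (c : ℝ) (T : ℕ) : Finset ℕ :=
  (Finset.Ioc 1 T).filter fun t => ⌊Φ (t - 1) / c⌋₊ < ⌊Φ t / c⌋₊

lemma card_jumps_le {Φ : ℕ → ℝ} {c : ℝ} (hc : 0 < c) (h0 : ∀ t, 0 ≤ Φ t) (hmono : Monotone Φ)
    (T : ℕ) : ((jumps Φ c T).card : ℝ) ≤ Φ T / c := by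
  have hg : Monotone fun t => ⌊Φ t / c⌋₊ := fun s t hst => Nat.floor_le_floor (by
    have := hmono hst; gcongr)
  have key : ∀ T, (jumps Φ c T).card ≤ ⌊Φ T / c⌋₊ := by
    intro T
    induction T with
    | zero => simp [jumps]
    | succ T ih =>
      by_cases hT : 1 < T + 1
      · have e : Finset.Ioc 1 (T + 1) = insert (T + 1) (Finset.Ioc 1 T) := by
          ext x; simp only [Finset.mem_Ioc, Finset.mem_insert]; omega
        unfold jumps at ih ⊢
        rw [e, Finset.filter_insert]
        have hm := hg (Nat.le_succ T)
        simp only [Nat.succ_eq_add_one] at hm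
        split_ifs with hj
        · refine (Finset.card_insert_le _ _).trans ?_
          simp only [Nat.add_sub_cancel] at hj
          omega
        · omega
      · have : Finset.Ioc 1 (T + 1) = ∅ := by
          rw [Finset.Ioc_eq_empty]; exact hT
        unfold jumps; rw [this]; simp
  exact (Nat.cast_le.2 (key T)).trans (Nat.floor_le (div_nonneg (h0 T) hc.le))

lemma sub_lt_of_no_jump {Φ : ℕ → ℝ} {c : ℝ} (hc : 0 < c) (h0 : ∀ t, 0 ≤ Φ t) (hmono : Monotone Φ)
    {a e T : ℕ} (ha : 1 ≤ a) (hae : a ≤ e) (heT : e ≤ T) (h : ∀ q ∈ jumps Φ c T, a < q → e < q) :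
    Φ e - Φ a < c := by
  have hg : Monotone fun t => ⌊Φ t / c⌋₊ := fun s t hst => Nat.floor_le_floor (by
    have := hmono hst; gcongr)
  have key : ∀ t, a ≤ t → t ≤ e → ⌊Φ t / c⌋₊ = ⌊Φ a / c⌋₊ := by
    intro t hat
    induction t, hat using Nat.le_induction with
    | base => intro _; rfl
    | succ t hat ih =>
      intro hte
      rw [← ih (by omega)]
      by_contra hne
      have hm := hg (Nat.le_succ t)
      simp only [Nat.succ_eq_add_one] at hm
      have : t + 1 ∈ jumps Φ c T := by
        unfold jumps
        rw [Finset.mem_filter, Finset.mem_Ioc]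
        refine ⟨⟨by omega, by omega⟩, ?_⟩
        simp only [Nat.add_sub_cancel]
        omega
      have := h _ this (by omega)
      omega
  have h1 := key e hae le_rfl
  have h2 := Nat.lt_floor_add_one (Φ e / c)
  have h3 := Nat.floor_le (div_nonneg (h0 a) hc.le)
  rw [h1] at h2
  have h4 : Φ e / c - Φ a / c < 1 := by linarith
  rw [← sub_div, div_lt_one hc] at h4
  exact h4

/-- The break points are the jumps of two monotone counters: elapsed time in units of w and
accumulated drift in units of 6κ/(M√w). Between jumps neither quantity can grow by a full unit, and
the number of jumps is at most the total divided by the unit. -/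
lemma exists_breaks {T w : ℕ} {κ M V : ℝ} {v : ℕ → ℝ} (hκ : 0 < κ) (hM : 0 < M)
    (hv : ∀ s, 0 ≤ v s) (hV : drift v 1 T ≤ V) (hw : 1 ≤ w) (hwT : w ≤ T) :
    ∃ Q : Finset ℕ, Breaks T κ M v Q w ∧
      (Q.card : ℝ) ≤ T / w + M * V * Real.sqrt w / (6 * κ) := by
  have hwpos : (0 : ℝ) < w := by exact_mod_cast hw
  have hsw : 0 < Real.sqrt w := Real.sqrt_pos.2 hwpos
  set c := 6 * κ / (M * Real.sqrt w) with hc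
  have hcpos : 0 < c := by positivity
  have hm1 : Monotone fun t : ℕ => (t : ℝ) := Nat.mono_cast
  have hm2 : Monotone fun t : ℕ => drift v 1 t := fun s t hst => drift_mono hv le_rfl hst
  have h01 : ∀ t : ℕ, (0 : ℝ) ≤ t := fun t => Nat.cast_nonneg t
  have h02 : ∀ t : ℕ, 0 ≤ drift v 1 t := fun t => drift_nonneg hv _ _
  refine ⟨jumps (fun t => (t : ℝ)) w T ∪ jumps (fun t => drift v 1 t) c T, ⟨hw, hwT, ?_⟩, ?_⟩
  · intro a e ha hae heT hq
    have h1 := sub_lt_of_no_jump hwpos h01 hm1 ha hae heT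
      (fun q hqm => hq q (Finset.mem_union_left _ hqm))
    have h2 := sub_lt_of_no_jump hcpos h02 hm2 ha hae heT
      (fun q hqm => hq q (Finset.mem_union_right _ hqm))
    constructor
    · have : (e : ℝ) < a + w := by linarith
      have : e < a + w := by exact_mod_cast this
      omega
    · have e1 : drift v 1 e = drift v 1 a + drift v a e :=
        (Finset.sum_Ico_consecutive _ ha hae).symm
      have h3 : drift v a e ≤ c := by linarith
      calc M * drift v a e ≤ M * c := by gcongr
        _ = _ := by rw [hc]; field_simp
  · have c1 := card_jumps_le hwpos h01 hm1 T
    have c2 := card_jumps_le hcpos h02 hm2 T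
    have c3 : ((jumps (fun t => (t : ℝ)) w T ∪ jumps (fun t => drift v 1 t) c T).card : ℝ)
        ≤ (jumps (fun t => (t : ℝ)) w T).card + (jumps (fun t => drift v 1 t) c T).card := by
      exact_mod_cast Finset.card_union_le _ _
    refine c3.trans (add_le_add c1 (c2.trans ?_))
    calc drift v 1 T / c ≤ V / c := by gcongr
      _ = _ := by rw [hc]; field_simp

/-! ### The sum over all blocks -/

namespace Run

variable {d : ℕ} (R : Run d)

/-- The block starts. -/
def blocks : Finset ℕ := (Finset.Icc 1 R.T).filter fun t => R.bs t = t

/-- The periods of the block that starts in period `b`. -/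
def block (b : ℕ) : Finset ℕ := (Finset.Icc 1 R.T).filter fun t => R.bs t = b

variable {R}

lemma bs_bs {t : ℕ} (ht : 1 ≤ t) : R.bs (R.bs t) = R.bs t := (R.same_block ht le_rfl (R.bs_le ht)).1

lemma bs_mem_blocks {t : ℕ} (ht : t ∈ Finset.Icc 1 R.T) : R.bs t ∈ R.blocks := by
  rw [Finset.mem_Icc] at ht
  have := R.bs_le ht.1
  exact Finset.mem_filter.2 ⟨Finset.mem_Icc.2 ⟨R.one_le_bs ht.1, by omega⟩, bs_bs ht.1⟩

lemma block_eq_Icc {b : ℕ} (hb : b ∈ R.blocks) :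
    ∃ e, 1 ≤ e ∧ e ≤ R.T ∧ R.bs e = b ∧ R.block b = Finset.Icc b e := by
  have hb' := Finset.mem_filter.1 hb
  have hne : (R.block b).Nonempty := ⟨b, Finset.mem_filter.2 ⟨hb'.1, hb'.2⟩⟩
  refine ⟨(R.block b).max' hne, ?_⟩
  have hm := (R.block b).max'_mem hne
  set e := (R.block b).max' hne with he
  have hm' := Finset.mem_filter.1 hm
  rw [Finset.mem_Icc] at hm'
  refine ⟨hm'.1.1, hm'.1.2, hm'.2, ?_⟩
  ext t
  constructor
  · intro ht
    have h1 := (R.block b).le_max' t ht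
    have ht' := Finset.mem_filter.1 ht
    rw [Finset.mem_Icc] at ht'
    rw [Finset.mem_Icc]
    have := R.bs_le ht'.1.1
    exact ⟨by omega, h1⟩
  · intro ht
    rw [Finset.mem_Icc] at ht hb'
    refine Finset.mem_filter.2 ⟨Finset.mem_Icc.2 ⟨by omega, by omega⟩, ?_⟩
    rw [(R.same_block hm'.1.1 (by omega) ht.2).1, hm'.2]

lemma block_start_cases {b : ℕ} (hb : R.bs b = b) (h2 : 2 ≤ b) :
    (R.Fail (b - 1) ∧ R.ord b = 0) ∨
      (b = R.bs (b - 1) + 2 ^ R.ord (b - 1) ∧ R.ord b = R.ord (b - 1) + 1) := by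
  classical
  obtain ⟨t, rfl⟩ : ∃ t, b = t + 1 := ⟨b - 1, by omega⟩
  have ht : 1 ≤ t := by omega
  rw [R.bs_succ ht] at hb
  rw [Nat.add_sub_cancel, R.ord_succ ht]
  have := R.bs_le ht
  by_cases hf : R.Fail t
  · left; simp [hf]
  · by_cases hc : t + 1 = R.bs t + 2 ^ R.ord t
    · right; simp only [hf, if_false, hc, if_true]; simp
    · simp only [hf, hc, or_self, if_false] at hb; omega

lemma prev_injOn : Set.InjOn (fun b => R.bs (b - 1)) {b | R.bs b = b ∧ 2 ≤ b} := by
  have key : ∀ b c, b < c → R.bs b = b → 2 ≤ b → R.bs (b - 1) < R.bs (c - 1) := by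
    intro b c hbc hb h2
    have h1 := R.bs_le (t := b - 1) (by omega)
    have h3 := R.bs_mono (s := b) (t := c - 1) (by omega) (by omega)
    omega
  intro b hb c hc h
  simp only at h
  rcases lt_trichotomy b c with hlt | heq | hlt
  · have := key b c hlt hb.1 hb.2; omega
  · exact heq
  · have := key c b hlt hc.1 hc.2; omega

lemma prev_mem_blocks {b : ℕ} (hb : b ∈ R.blocks) (h2 : 2 ≤ b) : R.bs (b - 1) ∈ R.blocks := by
  have := Finset.mem_filter.1 hb
  rw [Finset.mem_Icc] at this
  exact bs_mem_blocks (Finset.mem_Icc.2 ⟨by omega, by omega⟩)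

/-- A block may be cut short by a failure or by the horizon, so its nominal length 2^n is charged to
its predecessor. For positive order the predecessor was completed and has half that length. -/
lemma two_pow_ord_le {b : ℕ} (hb : b ∈ R.blocks) :
    R.ord b = 0 ∨ (2 ≤ b ∧ 2 ^ R.ord b = 2 * (R.block (R.bs (b - 1))).card) := by
  have hb' := Finset.mem_filter.1 hb
  rw [Finset.mem_Icc] at hb'
  by_cases h2 : 2 ≤ b
  · rcases block_start_cases hb'.2 h2 with ⟨-, h⟩ | ⟨h1, h3⟩
    · exact Or.inl h
    · refine Or.inr ⟨h2, ?_⟩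
      have : R.block (R.bs (b - 1)) = Finset.Icc (R.bs (b - 1)) (b - 1) := by
        ext t
        simp only [block, Finset.mem_filter, Finset.mem_Icc]
        constructor
        · rintro ⟨⟨h4, h5⟩, h6⟩
          have h7 := R.bs_le h4
          refine ⟨by omega, ?_⟩
          by_contra hcon
          have := R.bs_mono (s := b) (t := t) (by omega) (by omega)
          have := R.bs_le (t := b - 1) (by omega)
          omega
        · rintro ⟨h4, h5⟩
          have := R.one_le_bs (t := b - 1) (by omega)
          exact ⟨⟨by omega, by omega⟩, (R.same_block (by omega) h4 h5).1⟩
      rw [this, Nat.card_Icc, h3, pow_succ]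
      omega
  · have : b = 1 := by omega
    rw [this]; exact Or.inl rfl

lemma sum_blocks (g : ℕ → ℝ) :
    ∑ t ∈ Finset.Icc 1 R.T, g t = ∑ b ∈ R.blocks, ∑ t ∈ R.block b, g t :=
  (Finset.sum_fiberwise_of_maps_to (fun _ ht => bs_mem_blocks ht) _).symm

lemma sum_card_block : ∑ b ∈ R.blocks, (R.block b).card = R.T := by
  have := Finset.card_eq_sum_card_fiberwise (s := Finset.Icc 1 R.T) (t := R.blocks)
    (f := fun t => R.bs t) (fun _ ht => bs_mem_blocks ht)
  rw [Nat.card_Icc, Nat.add_sub_cancel] at this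
  exact this.symm

lemma sum_two_pow_ord_le :
    ∑ b ∈ R.blocks, 2 ^ R.ord b ≤ R.blocks.card + 2 * R.T := by
  classical
  have h1 : ∀ b ∈ R.blocks, 2 ^ R.ord b
      ≤ 1 + if ¬ R.ord b = 0 then 2 * (R.block (R.bs (b - 1))).card else 0 := by
    intro b hb
    rcases two_pow_ord_le hb with h | ⟨-, h⟩
    · simp [h]
    · rw [h]
      split_ifs with h0
      · rw [h0] at h; omega
      · omega
  refine (Finset.sum_le_sum h1).trans ?_
  rw [Finset.sum_add_distrib, Finset.sum_const, smul_eq_mul, mul_one]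
  refine Nat.add_le_add_left ?_ _
  rw [← Finset.sum_filter, ← Finset.mul_sum]
  refine Nat.mul_le_mul_left _ ?_
  conv_rhs => rw [← sum_card_block (R := R)]
  have hsub : ∀ b ∈ R.blocks.filter (fun b => ¬ R.ord b = 0), b ∈ R.blocks ∧ R.bs b = b ∧ 2 ≤ b := by
    intro b hb
    rw [Finset.mem_filter] at hb
    have h3 := (Finset.mem_filter.1 hb.1).2
    rcases two_pow_ord_le hb.1 with h | ⟨h, -⟩
    · exact absurd h hb.2
    · exact ⟨hb.1, h3, h⟩
  rw [← Finset.sum_image (f := fun c => (R.block c).card) (g := fun b => R.bs (b - 1))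
    (fun b hb c hc h => prev_injOn (hsub b hb).2 (hsub c hc).2 h)]
  refine Finset.sum_le_sum_of_subset fun c hc => ?_
  obtain ⟨b, hb, rfl⟩ := Finset.mem_image.1 hc
  exact prev_mem_blocks (hsub b hb).1 (hsub b hb).2.2

lemma ord_lt_log {b : ℕ} (hb : b ∈ R.blocks) : R.ord b < Nat.log 2 R.T + 2 := by
  rcases two_pow_ord_le hb with h | ⟨-, h⟩
  · omega
  · have h1 : (R.block (R.bs (b - 1))).card ≤ R.T := by
      refine (Finset.card_filter_le _ _).trans ?_
      rw [Nat.card_Icc]; omega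
    have hT : R.T ≠ 0 := by
      rintro h0
      have : 0 < 2 ^ R.ord b := by positivity
      omega
    by_contra hcon
    have h2 : 2 ^ (Nat.log 2 R.T + 2) ≤ 2 ^ R.ord b := Nat.pow_le_pow_right (by norm_num) (by omega)
    have h3 := Nat.lt_pow_succ_log_self (b := 2) (by norm_num) R.T
    rw [pow_succ] at h2
    omega

/-- A block of order k + 1 immediately follows a block of order k, and distinct blocks have distinct
predecessors. -/
lemma card_order_le (k : ℕ) : (R.blocks.filter fun b => R.ord b = k).card
    ≤ (R.blocks.filter fun b => R.ord b = 0).card := by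
  induction k with
  | zero => rfl
  | succ k ih =>
    refine le_trans ?_ ih
    have hsub : ∀ b ∈ R.blocks.filter (fun b => R.ord b = k + 1), R.bs b = b ∧ 2 ≤ b := by
      intro b hb
      rw [Finset.mem_filter] at hb
      have h3 := (Finset.mem_filter.1 hb.1).2
      rcases two_pow_ord_le hb.1 with h | ⟨h, -⟩
      · omega
      · exact ⟨h3, h⟩
    refine Finset.card_le_card_of_injOn (fun b => R.bs (b - 1)) ?_
      (fun b hb c hc h => prev_injOn (hsub b hb) (hsub c hc) h)
    intro b hb
    have h1 := hsub b hb
    have hb' := Finset.mem_filter.1 (Finset.mem_coe.1 hb)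
    refine Finset.mem_coe.2 (Finset.mem_filter.2 ⟨prev_mem_blocks hb'.1 h1.2, ?_⟩)
    have h4 := (R.same_block (t := b - 1) (by omega) le_rfl (R.bs_le (by omega))).2
    rcases block_start_cases h1.1 h1.2 with ⟨-, h⟩ | ⟨-, h⟩
    · omega
    · rw [h4]; omega

lemma card_blocks_le : R.blocks.card
    ≤ (Nat.log 2 R.T + 2) * (R.blocks.filter fun b => R.ord b = 0).card := by
  have := Finset.card_eq_sum_card_fiberwise (s := R.blocks) (t := Finset.range (Nat.log 2 R.T + 2))
    (f := fun b => R.ord b) (fun b hb => Finset.mem_coe.2 (Finset.mem_range.2 (ord_lt_log hb)))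
  rw [this]
  refine (Finset.sum_le_card_nsmul _ _ _ fun k _ => card_order_le k).trans ?_
  rw [Finset.card_range, smul_eq_mul]

end Run

namespace GoodRun

variable {d : ℕ} {R : Run d} {κ M ℓ : ℝ} {v fs fx : ℕ → ℝ} {Q : Finset ℕ} {w : ℕ}

/-- Apart from the first one, a block of order 0 starts right after a failed test. The failing block
contains a break point after its start, and these break points are distinct because the blocks are
disjoint. -/
lemma card_order_zero_le (h : GoodRun R κ M ℓ v fs fx) (hQ : Breaks R.T κ M v Q w) :
    (R.blocks.filter fun b => R.ord b = 0).card ≤ Q.card + 1 := by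
  classical
  set A := R.blocks.filter fun b => R.ord b = 0 with hA
  have hmem : ∀ b ∈ A.erase 1, R.bs b = b ∧ 2 ≤ b ∧ b ≤ R.T ∧ R.ord b = 0 := by
    intro b hb
    rw [Finset.mem_erase, hA, Finset.mem_filter] at hb
    have h3 := Finset.mem_filter.1 hb.2.1
    rw [Finset.mem_Icc] at h3
    exact ⟨h3.2, by omega, h3.1.2, hb.2.2⟩
  have hq : ∀ b ∈ A.erase 1, ∃ q ∈ Q, R.bs (b - 1) < q ∧ q ≤ b - 1 := by
    intro b hb
    obtain ⟨h1, h2, h3, h4⟩ := hmem b hb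
    rcases Run.block_start_cases h1 h2 with ⟨hf, -⟩ | ⟨-, h5⟩
    · exact h.break_of_fail hQ (by omega) (by omega) hf
    · omega
  choose! g hg using hq
  have hcard : (A.erase 1).card ≤ Q.card := by
    refine Finset.card_le_card_of_injOn g (fun b hb => (hg b hb).1) ?_
    have key : ∀ b ∈ A.erase 1, ∀ c ∈ A.erase 1, b < c → g b < g c := by
      intro b hb c hc hbc
      have h1 := (hg b hb).2.2
      have h2 := (hg c hc).2.1
      have h3 := R.bs_mono (s := b) (t := c - 1) (by have := hmem b hb; omega) (by omega)
      have h4 := (hmem b hb).1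
      omega
    intro b hb c hc heq
    rcases lt_trichotomy b c with hlt | he | hlt
    · have := key b hb c hc hlt; omega
    · exact he
    · have := key c hc b hb hlt; omega
  have := Finset.pred_card_le_card_erase (s := A) (a := 1)
  omega

/-- The regret of a good run. -/
lemma total_regret (h : GoodRun R κ M ℓ v fs fx) (hQ : Breaks R.T κ M v Q w)
    (hmany : R.ManyWins fs Q ℓ) :
    ∑ t ∈ Finset.Icc 1 R.T, (fs t - fx t) ≤
      77000 * (Real.logb 2 R.T + 1) ^ 4 * κ *
        (R.T / Real.sqrt w + ((Q.card : ℝ) + 1) * Real.sqrt w) := by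
  classical
  have hκ := h.kappa_pos
  have hw1 := hQ.one_le
  have hT1 : 1 ≤ R.T := hw1.trans hQ.le_T
  have hlam := one_le_lam (R := R) hT1
  have hwpos : (0 : ℝ) < w := by exact_mod_cast hw1
  set s := Real.sqrt w with hs
  have hs1 : 1 ≤ s := Real.one_le_sqrt.2 (by exact_mod_cast hw1)
  have hspos : 0 < s := by linarith
  have hss : s * s = w := Real.mul_self_sqrt hwpos.le
  set lam := Real.logb 2 R.T + 1 with hlamdef
  have hblock : ∀ b ∈ R.blocks, ∑ t ∈ R.block b, (fs t - fx t) ≤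
      11000 * lam ^ 3 * κ * ((2 ^ R.ord b : ℕ) / s + s + ((R.block b).card : ℝ) / s
        + (((Q.filter fun q => q ∈ R.block b).card : ℝ) + 1) * s) := by
    intro b hb
    obtain ⟨e, he1, heT, hbe, hblk⟩ := Run.block_eq_Icc hb
    have hbb := Finset.mem_filter.1 hb
    have hle := R.bs_le he1
    rw [hblk]
    have hr := h.block_regret hQ hmany he1 heT
    rw [hbe, ← hlamdef, ← hs] at hr
    refine hr.trans ?_
    have hord : R.ord e = R.ord b := (R.same_block he1 (by omega) (by omega)).2.symm
    rw [hord]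
    -- Inequality between arithmetic and geometric mean. It linearizes the square root, so that the
    -- nominal lengths can be summed over the blocks to O(T) plus the number of blocks.
    have hsq : Real.sqrt (2 ^ R.ord b) ≤ ((2 ^ R.ord b : ℕ) : ℝ) / s + s := by
      push_cast
      set x := Real.sqrt ((2 : ℝ) ^ R.ord b) with hx
      have hxx : x * x = 2 ^ R.ord b := Real.mul_self_sqrt (by positivity)
      have hx0 : 0 ≤ x := Real.sqrt_nonneg _
      rw [← hxx]
      have : x * x / s + s - x = ((x - s / 2) ^ 2 + 3 / 4 * s ^ 2) / s := by field_simp; ring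
      have h2 : 0 ≤ ((x - s / 2) ^ 2 + 3 / 4 * s ^ 2) / s := by positivity
      linarith
    have hlen : ((e - b : ℕ) : ℝ) ≤ ((Finset.Icc b e).card : ℝ) := by
      rw [Nat.card_Icc]; exact_mod_cast (by omega : e - b ≤ e + 1 - b)
    have hq : ((Q.filter fun q => b < q ∧ q ≤ e).card : ℝ)
        ≤ ((Q.filter fun q => q ∈ Finset.Icc b e).card : ℝ) := by
      refine Nat.cast_le.2 (Finset.card_le_card fun q hq => ?_)
      rw [Finset.mem_filter] at hq ⊢
      exact ⟨hq.1, Finset.mem_Icc.2 ⟨hq.2.1.le, hq.2.2⟩⟩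
    gcongr
  rw [Run.sum_blocks]
  refine (Finset.sum_le_sum hblock).trans ?_
  rw [← Finset.mul_sum]
  have hNB : (R.blocks.card : ℝ) ≤ 2 * lam * ((Q.card : ℝ) + 1) := by
    have h1 := Run.card_blocks_le (R := R)
    have h2 := h.card_order_zero_le hQ
    have h3 : R.blocks.card ≤ (Nat.log 2 R.T + 2) * (Q.card + 1) :=
      h1.trans (Nat.mul_le_mul_left _ h2)
    have h4 : (Nat.log 2 R.T : ℝ) ≤ lam - 1 := by
      have h5 := Nat.pow_log_le_self 2 (show R.T ≠ 0 by omega)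
      have := le_logb_of_two_pow_le (k := Nat.log 2 R.T) (x := R.T) (by exact_mod_cast h5)
      linarith
    have h6 : (R.blocks.card : ℝ) ≤ ((Nat.log 2 R.T : ℝ) + 2) * ((Q.card : ℝ) + 1) := by
      exact_mod_cast h3
    refine h6.trans ?_
    gcongr
    linarith
  have hq : ∑ b ∈ R.blocks, ((Q.filter fun q => q ∈ R.block b).card : ℝ) ≤ Q.card := by
    have hd : ∀ b ∈ R.blocks, ∀ c ∈ R.blocks, b ≠ c →
        Disjoint (Q.filter fun q => q ∈ R.block b) (Q.filter fun q => q ∈ R.block c) := by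
      intro b _ c _ hbc
      rw [Finset.disjoint_left]
      intro q hqb hqc
      have h1 := (Finset.mem_filter.1 (Finset.mem_filter.1 hqb).2).2
      have h2 := (Finset.mem_filter.1 (Finset.mem_filter.1 hqc).2).2
      exact hbc (h1.symm.trans h2)
    have h1 : ∑ b ∈ R.blocks, (Q.filter fun q => q ∈ R.block b).card ≤ Q.card := by
      rw [← Finset.card_biUnion hd]
      exact Finset.card_le_card fun q hq => by
        obtain ⟨b, -, hb⟩ := Finset.mem_biUnion.1 hq
        exact (Finset.mem_filter.1 hb).1
    exact_mod_cast h1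
  have hpow : ∑ b ∈ R.blocks, ((2 ^ R.ord b : ℕ) : ℝ) ≤ R.blocks.card + 2 * R.T := by
    exact_mod_cast Run.sum_two_pow_ord_le (R := R)
  have hlen : ∑ b ∈ R.blocks, ((R.block b).card : ℝ) = R.T := by
    exact_mod_cast Run.sum_card_block (R := R)
  have hsum : ∑ b ∈ R.blocks, (((2 ^ R.ord b : ℕ) : ℝ) / s + s + ((R.block b).card : ℝ) / s
        + (((Q.filter fun q => q ∈ R.block b).card : ℝ) + 1) * s)
      = (∑ b ∈ R.blocks, ((2 ^ R.ord b : ℕ) : ℝ)) / s + R.blocks.card * s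
        + (∑ b ∈ R.blocks, ((R.block b).card : ℝ)) / s
        + ((∑ b ∈ R.blocks, ((Q.filter fun q => q ∈ R.block b).card : ℝ)) + R.blocks.card) * s := by
    simp only [Finset.sum_add_distrib, ← Finset.sum_div, ← Finset.sum_mul, Finset.sum_const,
      nsmul_eq_mul, mul_one]
  rw [hsum, hlen]
  set NB : ℝ := (R.blocks.card : ℝ) with hNBdef
  set q1 : ℝ := (Q.card : ℝ) + 1 with hq1
  have hq1pos : 1 ≤ q1 := by rw [hq1]; have : (0 : ℝ) ≤ Q.card := Nat.cast_nonneg _; linarith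
  have hNB0 : 0 ≤ NB := Nat.cast_nonneg _
  have hT0 : (0 : ℝ) ≤ R.T := Nat.cast_nonneg _
  have hNBs : NB / s ≤ NB * s := by
    rw [div_le_iff₀ hspos]
    have : (1 : ℝ) ≤ s * s := by nlinarith
    calc NB = NB * 1 := (mul_one _).symm
      _ ≤ NB * (s * s) := mul_le_mul_of_nonneg_left this hNB0
      _ = NB * s * s := by ring
  have hbound : (∑ b ∈ R.blocks, ((2 ^ R.ord b : ℕ) : ℝ)) / s + NB * s + (R.T : ℝ) / s
        + ((∑ b ∈ R.blocks, ((Q.filter fun q => q ∈ R.block b).card : ℝ)) + NB) * s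
      ≤ 7 * lam * (R.T / s + q1 * s) := by
    calc _ ≤ (NB + 2 * R.T) / s + NB * s + (R.T : ℝ) / s + (q1 + NB) * s := by
          gcongr; linarith
      _ = NB / s + 3 * (R.T / s) + 2 * (NB * s) + q1 * s := by ring
      _ ≤ 3 * (R.T / s) + 3 * (NB * s) + q1 * s := by linarith
      _ ≤ 3 * (R.T / s) + 3 * ((2 * lam * q1) * s) + q1 * s := by gcongr
      _ = 3 * (R.T / s) + 6 * (lam * (q1 * s)) + q1 * s := by ring
      _ ≤ 7 * (lam * (R.T / s)) + 6 * (lam * (q1 * s)) + lam * (q1 * s) := by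
          have h1 : 0 ≤ R.T / s := by positivity
          have h2 := le_mul_of_one_le_left h1 hlam
          have h3 : 0 ≤ q1 * s := by positivity
          have h4 := le_mul_of_one_le_left h3 hlam
          linarith
      _ = _ := by ring
  calc _ ≤ 11000 * lam ^ 3 * κ * (7 * lam * (R.T / s + q1 * s)) := by gcongr
    _ = _ := by ring

end GoodRun


/-! ### The framework run with the ascent algorithm -/

namespace Run

variable {d : ℕ} {R : Run d}

lemma cnt_lt_playTime {τ m t l : ℕ} (ht : R.Plays τ m t) (hl : l < R.cnt τ m t) :
    R.Plays τ m (R.playTime τ m l) ∧ R.playTime τ m l < t ∧ R.cnt τ m (R.playTime τ m l) = l := by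
  classical
  have hc : ∀ hf : {s | R.Plays τ m s}.Finite, l < hf.toFinset.card := fun hf =>
    hl.trans (Nat.count_lt_card hf ht)
  exact ⟨Nat.nth_mem l hc, Nat.nth_lt_of_lt_count hl, Nat.count_nth hc⟩

open Classical in
/-- The periods in which the thread `(τ, m)` makes a play with index in `[a, b)` that satisfies `p`. -/
def playSet (R : Run d) (τ m a b : ℕ) (p : ℕ → Prop) : Finset ℕ :=
  (Finset.Icc 1 R.T).filter fun s =>
    R.Plays τ m s ∧ a ≤ R.cnt τ m s ∧ R.cnt τ m s < b ∧ p (R.cnt τ m s)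

lemma mem_playSet {τ m a b s : ℕ} {p : ℕ → Prop} : s ∈ R.playSet τ m a b p ↔
    s ∈ Finset.Icc 1 R.T ∧ R.Plays τ m s ∧ a ≤ R.cnt τ m s ∧ R.cnt τ m s < b ∧
      p (R.cnt τ m s) := by
  classical
  unfold playSet; rw [Finset.mem_filter]

/-- Translates between play indices, natural for the ascent, and periods, natural for the martingale
bounds: membership of a period in the play set is known when its action is chosen. -/
lemma sum_playSet {τ m t a b : ℕ} (ht : R.Plays τ m t) (htT : t ≤ R.T)
    (hb : b ≤ R.cnt τ m t + 1) (p : ℕ → Prop) [DecidablePred p] (g : ℕ → ℝ) :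
    ∑ s ∈ R.playSet τ m a b p, g s = ∑ l ∈ Finset.Ico a b with p l, g (R.playTime τ m l) := by
  have key : ∀ l < b, R.Plays τ m (R.playTime τ m l) ∧ R.playTime τ m l ≤ t ∧
      R.cnt τ m (R.playTime τ m l) = l := by
    intro l hl
    rcases Nat.lt_succ_iff_lt_or_eq.1 (hl.trans_le hb) with h | h
    · obtain ⟨h1, h2, h3⟩ := cnt_lt_playTime ht h
      exact ⟨h1, h2.le, h3⟩
    · rw [h, R.playTime_cnt ht]; exact ⟨ht, le_rfl, rfl⟩
  refine Finset.sum_nbij' (fun s => R.cnt τ m s) (fun l => R.playTime τ m l) ?_ ?_ ?_ ?_ ?_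
  · intro s hs
    obtain ⟨-, h1, h2, h3, h4⟩ := mem_playSet.1 hs
    exact Finset.mem_filter.2 ⟨Finset.mem_Ico.2 ⟨h2, h3⟩, h4⟩
  · intro l hl
    obtain ⟨h1, h2⟩ := Finset.mem_filter.1 hl
    rw [Finset.mem_Ico] at h1
    obtain ⟨k1, k2, k3⟩ := key l h1.2
    refine mem_playSet.2 ⟨Finset.mem_Icc.2 ⟨k1.1, k2.trans htT⟩, k1, ?_⟩
    rw [k3]; exact ⟨h1.1, h1.2, h2⟩
  · intro s hs
    exact R.playTime_cnt (mem_playSet.1 hs).2.1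
  · intro l hl
    have h1 := Finset.mem_Ico.1 (Finset.mem_filter.1 hl).1
    exact (key l h1.2).2.2
  · intro s hs
    rw [R.playTime_cnt (mem_playSet.1 hs).2.1]

/-- The feedbacks of the thread `(τ, m)`. -/
def feed (R : Run d) (τ m k : ℕ) : ℝ := R.y (R.playTime τ m k)

end Run

/-- One realization of the framework run with the ascent algorithm. -/
def ascentRun {d : ℕ} (T : ℕ) (σ L B c₀ : ℝ) (X : Set (Pt d)) (z₀ : ℕ → ℕ → Pt d)
    (u : ℕ → ℕ → ℝ) (y : ℕ → ℝ) : Run d where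
  alg := ascentAlg (innerSet X c₀) (1 / L) (kappa d T σ L B c₀) (σ / L) (batchBase c₀)
  start := fun τ m => AscentState.start (z₀ τ m)
  T := T
  ρ := rate (kappa d T σ L B c₀)
  u := u
  y := y

lemma ascentAlg_run {d : ℕ} (Z : Set (Pt d)) (η κ γ : ℝ) (N₀ : ℕ) (z₀ : Pt d) (Y : ℕ → ℝ) (k : ℕ) :
    (ascentAlg Z η κ γ N₀).run (AscentState.start z₀) Y k = ascentSeq Z η γ N₀ z₀ Y k := by
  induction k with
  | zero => rfl
  | succ k ih =>
    change AscentState.update Z η γ N₀ _ _ = _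
    rw [ascentSeq, ← ih]

section Ascent

variable {d T : ℕ} {σ L B c₀ : ℝ} {X : Set (Pt d)} {z₀ : ℕ → ℕ → Pt d} {u : ℕ → ℕ → ℝ} {y : ℕ → ℝ}

/-- The state of the `(τ, m)` thread after `k` plays. -/
def threadState (T : ℕ) (σ L B c₀ : ℝ) (X : Set (Pt d)) (z₀ : ℕ → ℕ → Pt d)
    (u : ℕ → ℕ → ℝ) (y : ℕ → ℝ) (τ m k : ℕ) : AscentState d :=
  ascentSeq (innerSet X c₀) (1 / L) (σ / L) (batchBase c₀) (z₀ τ m)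
    ((ascentRun T σ L B c₀ X z₀ u y).feed τ m) k

lemma ascentRun_cur {t : ℕ} (ht : 1 ≤ t) (m : ℕ) :
    (ascentRun T σ L B c₀ X z₀ u y).cur t m = threadState T σ L B c₀ X z₀ u y
      ((ascentRun T σ L B c₀ X z₀ u y).ws t m) m
      ((ascentRun T σ L B c₀ X z₀ u y).cnt ((ascentRun T σ L B c₀ X z₀ u y).ws t m) m t) := by
  rw [Run.cur_eq_run _ ht]
  exact ascentAlg_run _ _ _ _ _ _ _ _

lemma query_eq {t : ℕ} : query T σ L B c₀ X z₀ u y t =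
    AscentState.action (σ / L) (batchBase c₀) ((ascentRun T σ L B c₀ X z₀ u y).cur t
      ((ascentRun T σ L B c₀ X z₀ u y).ac t)) := rfl

lemma threadState_inv (hd : 1 ≤ d) (hX : IsClosed X) (hσ : 0 < σ) (hσL : σ < L)
    (hz₀ : ∀ τ m, z₀ τ m ∈ innerSet X c₀) (τ m k : ℕ) :
    AscentInv (innerSet X c₀) (σ / L) (batchBase c₀) ((ascentRun T σ L B c₀ X z₀ u y).feed τ m)
      (fun l => (threadState T σ L B c₀ X z₀ u y τ m l).action (σ / L) (batchBase c₀))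
      (threadState T σ L B c₀ X z₀ u y τ m k) k := by
  have hL : 0 < L := hσ.trans hσL
  exact ascentInv_ascentSeq hd (isClosed_innerSet hX) (hz₀ τ m) (fun s => batchSize_pos
    (batchBase_pos c₀) (div_pos hσ hL) ((div_lt_one hL).2 hσL) s) k

lemma query_mem (hd : 1 ≤ d) (hX : IsClosed X) (hσ : 0 < σ) (hσL : σ < L) (hc : 0 < c₀)
    (hz₀ : ∀ τ m, z₀ τ m ∈ innerSet X c₀) {t : ℕ} (ht : 1 ≤ t) :
    query T σ L B c₀ X z₀ u y t ∈ X := by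
  have hL : 0 < L := hσ.trans hσL
  rw [query_eq, ascentRun_cur ht]
  have h := threadState_inv (T := T) (B := B) (u := u) (y := y) hd hX hσ hσL hz₀
  exact AscentState.action_mem hc (div_pos hσ hL) ((div_lt_one hL).2 hσL) (h _ _ _).mem
    (h _ _ _).coord_lt

/-- The estimates: the mean of the feedbacks of the running thread plus a confidence term. -/
lemma ascentRun_est (hd : 1 ≤ d) (hX : IsClosed X) (hσ : 0 < σ) (hσL : σ < L)
    (hz₀ : ∀ τ m, z₀ τ m ∈ innerSet X c₀) {R : Run d} (hR : R = ascentRun T σ L B c₀ X z₀ u y)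
    {t : ℕ} (ht : 1 ≤ t) :
    R.est t = (∑ l ∈ Finset.range (R.plays t), R.feed (R.ts t) (R.ac t) l) / (R.plays t : ℝ)
      + 2 * kappa d T σ L B c₀ / Real.sqrt (R.plays t) := by
  have hy : R.y t = R.feed (R.ts t) (R.ac t) (R.cnt (R.ts t) (R.ac t) t) := by
    exact congrArg R.y (R.playTime_cnt (τ := R.ts t) (m := R.ac t) ⟨ht, rfl, rfl⟩).symm
  have h := threadState_inv (T := T) (B := B) (u := u) (y := y) hd hX hσ hσL hz₀ (R.ts t) (R.ac t)
    (R.plays t)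
  have he : R.est t = (threadState T σ L B c₀ X z₀ u y (R.ts t) (R.ac t) (R.plays t)).total
      / (threadState T σ L B c₀ X z₀ u y (R.ts t) (R.ac t) (R.plays t)).clock
      + 2 * kappa d T σ L B c₀ / Real.sqrt
        (threadState T σ L B c₀ X z₀ u y (R.ts t) (R.ac t) (R.plays t)).clock := by
    rw [Run.est, hy]
    subst hR
    rw [ascentRun_cur ht]
    rfl
  rw [he, h.clock, h.total, hR]

end Ascent


/-! ### From a good sample point to a good run. -/

/-- The variation of the objectives between periods `s` and `s + 1`. -/
def varStep {d : ℕ} (T : ℕ) (X : Set (Pt d)) (f : ℕ → Pt d → ℝ) (s : ℕ) : ℝ :=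
  if s ∈ Finset.Ico 1 T then supDist X (f (s + 1)) (f s) else 0

lemma supDist_nonneg {d : ℕ} (X : Set (Pt d)) (g h : Pt d → ℝ) : 0 ≤ supDist X g h :=
  Real.iSup_nonneg fun _ => abs_nonneg _

lemma varStep_nonneg {d : ℕ} (T : ℕ) (X : Set (Pt d)) (f : ℕ → Pt d → ℝ) (s : ℕ) :
    0 ≤ varStep T X f s := by
  unfold varStep; split_ifs
  · exact supDist_nonneg _ _ _
  · exact le_rfl

lemma drift_varStep {d : ℕ} (T : ℕ) (X : Set (Pt d)) (f : ℕ → Pt d → ℝ) :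
    drift (varStep T X f) 1 T = ∑ t ∈ Finset.Ico 1 T, supDist X (f (t + 1)) (f t) :=
  Finset.sum_congr rfl fun _ hs => if_pos hs

section

variable {d T : ℕ} {σ L B c₀ : ℝ} {X : Set (Pt d)} {f : ℕ → Pt d → ℝ} {xs : ℕ → Pt d}

lemma Regular.abs_sub_le_supDist (h : Regular T σ L B c₀ X f xs) {s : ℕ} (hs : s ∈ Finset.Ico 1 T)
    {x : Pt d} (hx : x ∈ X) : |f (s + 1) x - f s x| ≤ supDist X (f (s + 1)) (f s) := by
  rw [Finset.mem_Ico] at hs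
  refine le_ciSup (f := fun x : X => |f (s + 1) x - f s x|) ⟨2, ?_⟩ ⟨x, hx⟩
  rintro _ ⟨z, rfl⟩
  have h1 := h.bounded (s + 1) (Finset.mem_Icc.2 (by omega)) z z.2
  have h2 := h.bounded s (Finset.mem_Icc.2 (by omega)) z z.2
  have h3 := abs_sub (f (s + 1) z) (f s z)
  simp only
  linarith

lemma Regular.abs_sub_le_drift (h : Regular T σ L B c₀ X f xs) {s t : ℕ} (hs : 1 ≤ s) (hst : s ≤ t)
    (ht : t ≤ T) {x : Pt d} (hx : x ∈ X) : |f s x - f t x| ≤ drift (varStep T X f) s t := by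
  induction t, hst using Nat.le_induction with
  | base => simp [drift]
  | succ t hst ih =>
    have h1 := ih (by omega)
    have hm : t ∈ Finset.Ico 1 T := Finset.mem_Ico.2 ⟨by omega, by omega⟩
    have h2 := h.abs_sub_le_supDist hm hx
    rw [drift, Finset.sum_Ico_succ_top hst]
    rw [varStep, if_pos hm]
    rw [abs_sub_comm] at h2
    have h3 := abs_sub_le (f s x) (f t x) (f (t + 1) x)
    unfold drift at h1
    linarith

lemma Regular.abs_max_sub_le_drift (h : Regular T σ L B c₀ X f xs) {s t : ℕ} (hs : 1 ≤ s)
    (hst : s ≤ t) (ht : t ≤ T) :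
    |f s (xs s) - f t (xs t)| ≤ drift (varStep T X f) s t := by
  have ms : s ∈ Finset.Icc 1 T := Finset.mem_Icc.2 ⟨by omega, by omega⟩
  have mt : t ∈ Finset.Icc 1 T := Finset.mem_Icc.2 ⟨by omega, by omega⟩
  have h1 := abs_le.1 (h.abs_sub_le_drift hs hst ht (h.max_mem s ms))
  have h2 := abs_le.1 (h.abs_sub_le_drift hs hst ht (h.max_mem t mt))
  have h3 : f s (xs t) ≤ f s (xs s) := h.isMax s ms (h.max_mem t mt)
  have h4 : f t (xs s) ≤ f t (xs t) := h.isMax t mt (h.max_mem s ms)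
  rw [abs_le]
  constructor <;> linarith

end

lemma Run.playTime_facts {d : ℕ} (R : Run d) {t l : ℕ} (ht : 1 ≤ t) (hl : l < R.plays t) :
    1 ≤ R.playTime (R.ts t) (R.ac t) l ∧ R.playTime (R.ts t) (R.ac t) l ≤ t ∧
    R.ts (R.playTime (R.ts t) (R.ac t) l) = R.ts t ∧
    R.ac (R.playTime (R.ts t) (R.ac t) l) = R.ac t ∧
    R.plays (R.playTime (R.ts t) (R.ac t) l) = l + 1 ∧
    R.ts t ≤ R.playTime (R.ts t) (R.ac t) l := by
  have hplays : R.Plays (R.ts t) (R.ac t) t := ⟨ht, rfl, rfl⟩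
  obtain ⟨h1, h2, h3⟩ : R.Plays (R.ts t) (R.ac t) (R.playTime (R.ts t) (R.ac t) l) ∧
      R.playTime (R.ts t) (R.ac t) l ≤ t ∧
      R.cnt (R.ts t) (R.ac t) (R.playTime (R.ts t) (R.ac t) l) = l := by
    rcases (Nat.lt_succ_iff.1 hl).lt_or_eq with h | h
    · obtain ⟨h1, h2, h3⟩ := Run.cnt_lt_playTime hplays h
      exact ⟨h1, h2.le, h3⟩
    · rw [h]
      have e : R.playTime (R.ts t) (R.ac t) (R.cnt (R.ts t) (R.ac t) t) = t :=
        R.playTime_cnt hplays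
      rw [Run.ts] at e ⊢
      rw [e]; exact ⟨hplays, le_rfl, rfl⟩
  have h4 := R.ws_le h1.1 (R.ac t)
  rw [h1.2.1] at h4
  have h5 : R.ts (R.playTime (R.ts t) (R.ac t) l) = R.ts t := by
    rw [Run.ts, h1.2.2, h1.2.1]
  refine ⟨h1.1, h2, h5, h1.2.2, ?_, h4⟩
  have h6 := h1.2.1
  rw [Run.plays, h1.2.2, h1.2.1, h3]

/-- The numerical conditions on the constants in the analysis of a good run. -/
structure GoodParams (d T : ℕ) (σ L B c₀ κ M ℓ ν : ℝ) : Prop where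
  one_le_kappa : 1 ≤ κ
  one_le_M : 1 ≤ M
  ell_le : ℓ ≤ 21 / 5 * (Real.logb 2 T + 1)
  nu_nonneg : 0 ≤ ν
  nu_le : 2 * ν ≤ κ / 10
  exists_W : ∃ W : ℝ, (∀ s : ℕ, 1 / (1 - σ / L) ^ (4 * s) ≤ (T : ℝ) / (1 - σ / L) ^ 4 →
      ((s : ℝ) + 2) ^ 2 *
        (B + (L + 2 * ν + 2 * batchBase c₀) / (L * (1 - σ / L)) + 1) ^ 2 ≤ W) ∧
    8 * L * (batchBase c₀ / (σ / L)) * W * (d * Real.sqrt d) ≤ κ / 10 ∧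
    12 * κ * L * W * d / (1 - σ / L) ^ 2 ≤ M ^ 2

section Good

variable {d T : ℕ} {σ L B c₀ M ℓ ν : ℝ} {X : Set (Pt d)} {f : ℕ → Pt d → ℝ} {xs : ℕ → Pt d}
  {z₀ : ℕ → ℕ → Pt d} {u : ℕ → ℕ → ℝ} {y : ℕ → ℝ}

/-- The conditions on one realization that make it a good run. -/
structure GoodSample (T : ℕ) (σ L B c₀ ν ℓ : ℝ) (X : Set (Pt d)) (f : ℕ → Pt d → ℝ)
    (z₀ : ℕ → ℕ → Pt d) (u : ℕ → ℕ → ℝ) (y : ℕ → ℝ) : Prop where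
  abs_y_le : ∀ t ∈ Finset.Icc 1 T, |y t| ≤ 1
  u_le : ∀ t ∈ Finset.Icc 1 T, ∀ m, u t m ≤ 1
  noise : ∀ a e, 1 ≤ a → a ≤ e → e ≤ T →
    |∑ s ∈ Finset.Icc a e, (y s - f s (query T σ L B c₀ X z₀ u y s))|
      ≤ ν * Real.sqrt ((e - a : ℕ) + 1 : ℝ)
  noise_thread : ∀ τ m a b, τ ≤ T → m ≤ T → a ≤ b → b ≤ T → ∀ p : ℕ → Prop,
    (p = Even ∨ p = fun l => ¬ Even l) →
    |∑ s ∈ (ascentRun T σ L B c₀ X z₀ u y).playSet τ m a b p,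
      (y s - f s (query T σ L B c₀ X z₀ u y s))| ≤ ν * Real.sqrt (b - a : ℕ)
  few : (ascentRun T σ L B c₀ X z₀ u y).FewWins ℓ

/-- The bounds for one play of a thread. -/
lemma GoodSample.play (hg : GoodSample T σ L B c₀ ν ℓ X f z₀ u y)
    (hreg : Regular T σ L B c₀ X f xs) (hd : 1 ≤ d) (hσ : 0 < σ) (hσL : σ < L) (hc : 0 < c₀)
    (hz₀ : ∀ τ m, z₀ τ m ∈ innerSet X c₀)
    (hp : GoodParams d T σ L B c₀ (kappa d T σ L B c₀) M ℓ ν) {R : Run d}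
    (hR : R = ascentRun T σ L B c₀ X z₀ u y) {t : ℕ} (ht : 1 ≤ t) (htT : t ≤ T)
    (hMd : M * drift (varStep T X f) (R.ts t) t
      ≤ 6 * kappa d T σ L B c₀ / Real.sqrt (R.plays t)) :
    f t (xs t) - f t (query T σ L B c₀ X z₀ u y t) ≤
      kappa d T σ L B c₀ / 10 * (1 / Real.sqrt (R.plays t))
        + M * drift (varStep T X f) (R.ts t) t := by
  have hX := hreg.compact.isClosed
  have hv := varStep_nonneg T X f
  have hRT : R.T = T := by rw [hR]; rfl
  obtain ⟨W, hW, h1, h2⟩ := hp.exists_W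
  have hplays : R.Plays (R.ts t) (R.ac t) t := ⟨ht, rfl, rfl⟩
  have hK : R.plays t = R.cnt (R.ts t) (R.ac t) t + 1 := rfl
  set K := R.cnt (R.ts t) (R.ac t) t with hKdef
  have hKT : K + 1 ≤ T := by
    have h1 := R.plays_le ht
    have h2 := R.one_le_ts ht
    omega
  have hst : ∀ l ≤ K, query T σ L B c₀ X z₀ u y (R.playTime (R.ts t) (R.ac t) l) =
      (threadState T σ L B c₀ X z₀ u y (R.ts t) (R.ac t) l).action (σ / L) (batchBase c₀) ∧
      R.ts t ≤ R.playTime (R.ts t) (R.ac t) l ∧ R.playTime (R.ts t) (R.ac t) l ≤ t := by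
    intro l hl
    obtain ⟨h1, h2, h3, h4, h5, h6⟩ := R.playTime_facts ht (l := l) (by omega)
    refine ⟨?_, h6, h2⟩
    have h7 : R.plays (R.playTime (R.ts t) (R.ac t) l) = R.cnt (R.ts (R.playTime (R.ts t)
      (R.ac t) l)) (R.ac (R.playTime (R.ts t) (R.ac t) l)) (R.playTime (R.ts t) (R.ac t) l) + 1 := rfl
    rw [h5, h3, h4] at h7
    rw [query_eq, ascentRun_cur h1, ← hR, h4]
    rw [Run.ts, h4] at h3
    rw [h3]
    congr 2
    omega
  have hplay1 : R.playTime (R.ts t) (R.ac t) K = t := R.playTime_cnt hplays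
  -- The reference objective is the one of the present period t, so the maximizer aimed at is `xs t`
  -- and the drift is measured back from t to the start of the thread. This is done afresh for every
  -- play.
  have key := ascentSeq_regret (Δ := drift (varStep T X f) (R.ts t) t) (ν := ν) (B := B)
    (κ := kappa d T σ L B c₀) (M := M) (W := W) (z₀ := z₀ (R.ts t) (R.ac t))
    (f := fun l => f (R.playTime (R.ts t) (R.ac t) l)) (Y := R.feed (R.ts t) (R.ac t)) (K := K)
    hd (hreg.smoothObj (Finset.mem_Icc.2 ⟨ht, htT⟩)) hc hσ hσL hp.nu_nonneg (drift_nonneg hv _ _)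
    (hz₀ _ _) ?_ ?_ ?_ (by linarith [hp.one_le_M]) ?_ h1 h2 ?_
  · have h3 := (hst K le_rfl).1
    rw [hplay1] at h3
    rw [h3, hK]
    push_cast
    rw [mul_one_div]
    rw [hR] at key ⊢
    exact key
  · rw [← dist_eq_norm]
    exact (Metric.dist_le_diam_of_mem hreg.compact.isBounded
      (innerSet_subset hc.le (hz₀ _ _)) (hreg.max_mem t (Finset.mem_Icc.2 ⟨ht, htT⟩))).trans
      hreg.diam_le
  · intro l hl x hx
    obtain ⟨-, h4, h5⟩ := hst l hl.le
    exact (hreg.abs_sub_le_drift ((R.one_le_ts ht).trans h4) h5 htT hx).trans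
      (drift_mono hv h4 le_rfl)
  · intro a b hab hb p _ hpp
    have h6 := hg.noise_thread (R.ts t) (R.ac t) a b ((R.ts_le ht).trans htT)
      ((R.ac_le_ord ht).trans ((R.ord_le ht).trans htT)) hab (by omega) p hpp
    rw [← hR, Run.sum_playSet hplays (hRT ▸ htT) (by omega)] at h6
    refine le_trans (le_of_eq ?_) h6
    congr 1
    refine Finset.sum_congr rfl fun l hl => ?_
    have hl' := Finset.mem_Ico.1 (Finset.mem_filter.1 hl).1
    rw [(hst l (by omega)).1]
    have : R.y = y := by rw [hR]; rfl
    rw [Run.feed, this, hR]; rfl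
  · intro s hs
    refine hW s (hs.trans ?_)
    have hq : 0 < 1 - σ / L := by rw [sub_pos, div_lt_one (hσ.trans hσL)]; exact hσL
    gcongr
    exact_mod_cast hKT
  · rw [hK] at hMd; push_cast at hMd; exact hMd

lemma GoodSample.goodRun (hg : GoodSample T σ L B c₀ ν ℓ X f z₀ u y)
    (hreg : Regular T σ L B c₀ X f xs) (hd : 1 ≤ d) (hσ : 0 < σ) (hσL : σ < L) (hc : 0 < c₀)
    (hz₀ : ∀ τ m, z₀ τ m ∈ innerSet X c₀)
    (hp : GoodParams d T σ L B c₀ (kappa d T σ L B c₀) M ℓ ν) :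
    GoodRun (ascentRun T σ L B c₀ X z₀ u y) (kappa d T σ L B c₀) M ℓ (varStep T X f)
      (fun t => f t (xs t)) (fun t => f t (query T σ L B c₀ X z₀ u y t)) := by
  have hX := hreg.compact.isClosed
  have hv := varStep_nonneg T X f
  obtain ⟨R, hR⟩ : ∃ R, R = ascentRun T σ L B c₀ X z₀ u y := ⟨_, rfl⟩
  have hRT : R.T = T := by rw [hR]; rfl
  have hRy : R.y = y := by rw [hR]; rfl
  set κ := kappa d T σ L B c₀ with hκ
  have hκ1 := hp.one_le_kappa
  have hM1 := hp.one_le_M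
  have hmem : ∀ t, 1 ≤ t → query T σ L B c₀ X z₀ u y t ∈ X := fun t ht =>
    query_mem hd hX hσ hσL hc hz₀ ht
  have hfs : ∀ t, 1 ≤ t → t ≤ T → f t (query T σ L B c₀ X z₀ u y t) ≤ f t (xs t) :=
    fun t ht htT => hreg.isMax t (Finset.mem_Icc.2 ⟨ht, htT⟩) (hmem t ht)
  have hest : ∀ t, 1 ≤ t → R.est t =
      (∑ l ∈ Finset.range (R.plays t), R.feed (R.ts t) (R.ac t) l) / (R.plays t : ℝ)
      + 2 * κ / Real.sqrt (R.plays t) := fun t ht => ascentRun_est hd hX hσ hσL hz₀ hR ht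
  have hregret : ∀ t, 1 ≤ t → t ≤ T →
      M * drift (varStep T X f) (R.ts t) t ≤ 6 * κ / Real.sqrt (R.plays t) →
      f t (xs t) - f t (query T σ L B c₀ X z₀ u y t) ≤
      κ / 10 * (1 / Real.sqrt (R.plays t)) + M * drift (varStep T X f) (R.ts t) t :=
    fun t ht htT h => hg.play hreg hd hσ hσL hc hz₀ hp hR ht htT h
  -- The noise is controlled separately on even and odd plays, each within ν√k, and 2ν ≤ κ/10.
  have hnoise : ∀ t, 1 ≤ t → t ≤ T →
      |∑ l ∈ Finset.range (R.plays t), (R.feed (R.ts t) (R.ac t) l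
        - f (R.playTime (R.ts t) (R.ac t) l)
          (query T σ L B c₀ X z₀ u y (R.playTime (R.ts t) (R.ac t) l)))|
        ≤ κ / 10 * Real.sqrt (R.plays t) := by
    intro t ht htT
    have hplays : R.Plays (R.ts t) (R.ac t) t := ⟨ht, rfl, rfl⟩
    have hkT : R.plays t ≤ T := by
      have h1 := R.plays_le ht
      have h2 := R.one_le_ts ht
      omega
    have h1 : ∀ p : ℕ → Prop, [DecidablePred p] → (p = Even ∨ p = fun l => ¬ Even l) →
        |∑ l ∈ Finset.range (R.plays t) with p l, (R.feed (R.ts t) (R.ac t) l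
        - f (R.playTime (R.ts t) (R.ac t) l)
          (query T σ L B c₀ X z₀ u y (R.playTime (R.ts t) (R.ac t) l)))|
        ≤ ν * Real.sqrt (R.plays t) := by
      intro p _ hpp
      have h6 := hg.noise_thread (R.ts t) (R.ac t) 0 (R.plays t) ((R.ts_le ht).trans htT)
        ((R.ac_le_ord ht).trans ((R.ord_le ht).trans htT)) (Nat.zero_le _) hkT p hpp
      rw [← hR, Run.sum_playSet (b := R.plays t) hplays (hRT ▸ htT) le_rfl, ← Finset.range_eq_Ico]
        at h6
      simpa only [Run.feed, hRy, Nat.sub_zero] using h6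
    have h2 := h1 Even (Or.inl rfl)
    have h3 := h1 (fun l => ¬ Even l) (Or.inr rfl)
    rw [← Finset.sum_filter_add_sum_filter_not (Finset.range (R.plays t)) Even]
    refine (abs_add_le _ _).trans ?_
    have h4 := mul_le_mul_of_nonneg_right hp.nu_le (Real.sqrt_nonneg (R.plays t : ℝ))
    linarith
  have hsk : ∀ t, 0 < Real.sqrt (R.plays t : ℝ) ∧
      Real.sqrt (R.plays t) * Real.sqrt (R.plays t) = (R.plays t : ℝ) ∧ (0 : ℝ) < R.plays t := by
    intro t
    have : (0 : ℝ) < R.plays t := by exact_mod_cast R.one_le_plays t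
    exact ⟨Real.sqrt_pos.2 this, Real.mul_self_sqrt this.le, this⟩
  have hdiv : ∀ t, Real.sqrt (R.plays t) = (R.plays t : ℝ) / Real.sqrt (R.plays t) := fun t =>
    (Real.div_sqrt).symm
  have hDelta : ∀ t, drift (varStep T X f) (R.ts t) t ≤ M * drift (varStep T X f) (R.ts t) t :=
    fun t => le_mul_of_one_le_left (drift_nonneg hv _ _) hM1
  rw [← hR]
  refine
  { rate_eq := by rw [hR]; rfl
    one_le_kappa := hκ1
    one_le_M := hM1
    ell_le := by rw [hRT]; exact hp.ell_le
    v_nonneg := hv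
    fs_le := fun t ht htT => ?_
    fx_ge := fun t ht htT => ?_
    fx_le := fun t ht htT => hfs t ht (hRT ▸ htT)
    est_ge := fun t ht htT => ?_
    fs_drift := fun s t hs hst ht => hreg.abs_max_sub_le_drift hs hst (hRT ▸ ht)
    regret := fun t ht htT h => hregret t ht (hRT ▸ htT) h
    est_sub := fun t ht htT h => ?_
    le_est := fun t ht htT h => ?_
    noise := fun a e ha hae he => ?_
    few := by rw [hR]; exact hg.few
    covers_ord := fun t ht htT => ?_ }
  · rw [hRT] at htT
    have hm := Finset.mem_Icc.2 ⟨ht, htT⟩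
    exact (le_abs_self _).trans (hreg.bounded t hm _ (hreg.max_mem t hm))
  · rw [hRT] at htT
    exact (abs_le.1 (hreg.bounded t (Finset.mem_Icc.2 ⟨ht, htT⟩) _ (hmem t ht))).1
  · rw [hRT] at htT
    rw [hest t ht]
    obtain ⟨h1, h2, h3⟩ := hsk t
    have h4 : -1 ≤ (∑ l ∈ Finset.range (R.plays t), R.feed (R.ts t) (R.ac t) l) / (R.plays t : ℝ) := by
      rw [le_div_iff₀ h3]
      have : ∑ l ∈ Finset.range (R.plays t), (-1 : ℝ) ≤
          ∑ l ∈ Finset.range (R.plays t), R.feed (R.ts t) (R.ac t) l := by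
        refine Finset.sum_le_sum fun l hl => ?_
        obtain ⟨k1, k2, -⟩ := R.playTime_facts ht (Finset.mem_range.1 hl)
        rw [Run.feed, hRy]
        exact (abs_le.1 (hg.abs_y_le _ (Finset.mem_Icc.2 ⟨k1, k2.trans htT⟩))).1
      rw [Finset.sum_const, Finset.card_range, nsmul_eq_mul] at this
      linarith
    have h5 : 0 ≤ 2 * κ / Real.sqrt (R.plays t) := by positivity
    linarith
  -- In units of κ/√k the confidence term 2, the noise 1/10 and the regret 1/10 stay below 5/2. The
  -- drift enters once through the past optimal values and once through the regret.
  · rw [hRT] at htT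
    obtain ⟨h1, h2, h3⟩ := hsk t
    have hn := (abs_le.1 (hnoise t ht htT)).2
    rw [Finset.sum_sub_distrib] at hn
    have h4 : ∑ l ∈ Finset.range (R.plays t), f (R.playTime (R.ts t) (R.ac t) l)
          (query T σ L B c₀ X z₀ u y (R.playTime (R.ts t) (R.ac t) l)) ≤
        R.plays t * (f t (xs t) + drift (varStep T X f) (R.ts t) t) := by
      have : ∑ l ∈ Finset.range (R.plays t), f (R.playTime (R.ts t) (R.ac t) l)
          (query T σ L B c₀ X z₀ u y (R.playTime (R.ts t) (R.ac t) l)) ≤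
          ∑ l ∈ Finset.range (R.plays t), (f t (xs t) + drift (varStep T X f) (R.ts t) t) := by
        refine Finset.sum_le_sum fun l hl => ?_
        obtain ⟨k1, k2, -, -, -, k6⟩ := R.playTime_facts ht (Finset.mem_range.1 hl)
        have k7 := hfs _ k1 (k2.trans htT)
        have k8 := (abs_le.1 (hreg.abs_max_sub_le_drift k1 k2 htT)).2
        have k9 := drift_mono hv k6 (le_refl t)
        linarith
      rwa [Finset.sum_const, Finset.card_range, nsmul_eq_mul] at this
    have h5 : (∑ l ∈ Finset.range (R.plays t), R.feed (R.ts t) (R.ac t) l) / (R.plays t : ℝ) ≤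
        κ / 10 * (1 / Real.sqrt (R.plays t)) + (f t (xs t) + drift (varStep T X f) (R.ts t) t) := by
      rw [div_le_iff₀ h3]
      have e : κ / 10 * (1 / Real.sqrt (R.plays t)) * (R.plays t : ℝ)
          = κ / 10 * Real.sqrt (R.plays t) := by
        rw [mul_assoc, one_div, inv_mul_eq_div, ← hdiv t]
      rw [add_mul, e]; linarith
    have h6 := hregret t ht htT h
    have h7 := hDelta t
    rw [hest t ht]
    have e2 : 2 * κ / Real.sqrt (R.plays t) = 2 * κ * (1 / Real.sqrt (R.plays t)) := by ring
    have h8 : 0 ≤ κ * (1 / Real.sqrt (R.plays t)) := by positivity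
    rw [e2]
    linarith
  -- Earlier plays satisfy the drift condition as well, having smaller drift and fewer plays.
  -- Averaging their regrets costs (κ/5)/√k and the noise (κ/10)/√k, which the confidence term 2κ/√k
  -- outweighs.
  · rw [hRT] at htT
    obtain ⟨h1, h2, h3⟩ := hsk t
    have hn := (abs_le.1 (hnoise t ht htT)).1
    rw [Finset.sum_sub_distrib] at hn
    have h4 : R.plays t * (f t (xs t) - 2 * (M * drift (varStep T X f) (R.ts t) t))
          - κ / 10 * (2 * Real.sqrt (R.plays t)) ≤
        ∑ l ∈ Finset.range (R.plays t), f (R.playTime (R.ts t) (R.ac t) l)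
          (query T σ L B c₀ X z₀ u y (R.playTime (R.ts t) (R.ac t) l)) := by
      have : ∑ l ∈ Finset.range (R.plays t),
            ((f t (xs t) - 2 * (M * drift (varStep T X f) (R.ts t) t))
              - κ / 10 * (1 / Real.sqrt ((l : ℝ) + 1))) ≤
          ∑ l ∈ Finset.range (R.plays t), f (R.playTime (R.ts t) (R.ac t) l)
          (query T σ L B c₀ X z₀ u y (R.playTime (R.ts t) (R.ac t) l)) := by
        refine Finset.sum_le_sum fun l hl => ?_
        obtain ⟨k1, k2, k3, k4, k5, k6⟩ := R.playTime_facts ht (Finset.mem_range.1 hl)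
        have k8 := (abs_le.1 (hreg.abs_max_sub_le_drift k1 k2 htT)).1
        have k9 := drift_mono hv k6 (le_refl t)
        have k10 := drift_mono hv (le_refl (R.ts t)) k2
        have k11 := mul_le_mul_of_nonneg_left k10 (zero_le_one.trans hM1)
        have k12 := hregret _ k1 (k2.trans htT) (by
          rw [k3, k5]
          refine k11.trans (h.trans ?_)
          have hl' := Finset.mem_range.1 hl
          gcongr
          omega)
        rw [k3, k5] at k12
        push_cast at k12
        have k13 := hDelta t
        linarith
      rw [Finset.sum_sub_distrib, Finset.sum_const, Finset.card_range, nsmul_eq_mul,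
        ← Finset.mul_sum] at this
      have h9 := mul_le_mul_of_nonneg_left (sum_inv_sqrt_range_le (R.plays t))
        (by linarith : 0 ≤ κ / 10)
      linarith
    have h5 : (f t (xs t) - 2 * (M * drift (varStep T X f) (R.ts t) t))
        - 3 * κ / 10 * (1 / Real.sqrt (R.plays t)) ≤
        (∑ l ∈ Finset.range (R.plays t), R.feed (R.ts t) (R.ac t) l) / (R.plays t : ℝ) := by
      rw [le_div_iff₀ h3]
      have e : 3 * κ / 10 * (1 / Real.sqrt (R.plays t)) * (R.plays t : ℝ)
          = 3 * κ / 10 * Real.sqrt (R.plays t) := by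
        rw [mul_assoc, one_div, inv_mul_eq_div, ← hdiv t]
      rw [sub_mul, e]; linarith
    rw [hest t ht]
    have e2 : 2 * κ / Real.sqrt (R.plays t) = 2 * κ * (1 / Real.sqrt (R.plays t)) := by ring
    have h8 : 0 ≤ κ * (1 / Real.sqrt (R.plays t)) := by positivity
    rw [e2]
    linarith
  · rw [hRT] at he
    have h1 := hg.noise a e ha hae he
    rw [hRy]
    refine h1.trans ?_
    have := hp.nu_le
    have := hp.nu_nonneg
    gcongr
    linarith
  -- The thread whose order is that of the block has scheduling probability 1, so it is scheduled as
  -- soon as the lottery number is at most 1.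
  · rw [hRT] at htT
    refine ⟨le_rfl, ?_⟩
    have h1 : R.ρ = rate κ := by rw [hR]; rfl
    have h2 : 0 < rate κ (2 ^ R.ord t) := by
      unfold rate
      positivity
    rw [h1, div_self h2.ne']
    have h3 : R.u = u := by rw [hR]; rfl
    rw [h3]
    exact hg.u_le _ (Finset.mem_Icc.2 ⟨R.one_le_ws ht _, (R.ws_le ht _).trans htT⟩) _

end Good


/-! ### Measurability of the control flow -/

section Measurability

variable {d T : ℕ} {σ L B c₀ : ℝ} {X : Set (Pt d)} {z₀ : ℕ → ℕ → Pt d}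

/-- The realization of the framework at a sample point. -/
def sampleRun {Ω : Type*} (T : ℕ) (σ L B c₀ : ℝ) (X : Set (Pt d)) (z₀ : ℕ → ℕ → Pt d)
    (u : ℕ → ℕ → Ω → ℝ) (y : ℕ → Ω → ℝ) (ω : Ω) : Run d :=
  ascentRun T σ L B c₀ X z₀ (fun τ m => u τ m ω) (fun s => y s ω)

lemma measurable_comp_nat₂ {Ω : Type*} [MeasurableSpace Ω] {f g : Ω → ℕ} (hf : Measurable f)
    (hg : Measurable g) {β : Type*} [MeasurableSpace β] (F : ℕ → ℕ → β) :
    Measurable fun ω => F (f ω) (g ω) :=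
  (Measurable.of_discrete (f := fun p : ℕ × ℕ => F p.1 p.2)).comp (hf.prodMk hg)

lemma measurable_comp_nat {Ω : Type*} [MeasurableSpace Ω] {f : Ω → ℕ} (hf : Measurable f)
    {β : Type*} [MeasurableSpace β] (F : ℕ → β) : Measurable fun ω => F (f ω) :=
  (Measurable.of_discrete (f := F)).comp hf

variable {Ω : Type*} [MeasurableSpace Ω] {u : ℕ → ℕ → Ω → ℝ} {y : ℕ → Ω → ℝ} {R : Ω → Run d}

lemma measurable_ws {t : ℕ} (hb : Measurable fun ω => (R ω).bs t) {f : Ω → ℕ} (hf : Measurable f) :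
    Measurable fun ω => (R ω).ws t (f ω) :=
  measurable_comp_nat₂ hb hf fun b m => b + (t - b) / 2 ^ m * 2 ^ m

/-- The window start is random, so the lottery number is read at a random index. Splitting over its
possible values in [1, t] leaves lotteries at fixed indices. -/
lemma measurable_covers (hR : R = sampleRun T σ L B c₀ X z₀ u y) {t : ℕ} (ht : 1 ≤ t)
    (hu : ∀ s ∈ Set.Icc 1 t, ∀ m, Measurable (u s m)) (hb : Measurable fun ω => (R ω).bs t)
    (ho : Measurable fun ω => (R ω).ord t) (m : ℕ) : Measurable fun ω => (R ω).Covers t m := by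
  have h : (fun ω => (R ω).Covers t m) = fun ω => ∃ τ, τ ∈ Set.Icc 1 t ∧ ((R ω).ws t m = τ ∧
      m ≤ (R ω).ord t ∧ u τ m ω ≤ rate (kappa d T σ L B c₀) (2 ^ (R ω).ord t) /
        rate (kappa d T σ L B c₀) (2 ^ m)) := by
    funext ω
    have e1 : (R ω).ρ = rate (kappa d T σ L B c₀) := by rw [hR]; rfl
    have e2 : (R ω).u = fun τ m => u τ m ω := by rw [hR]; rfl
    rw [Run.Covers, e1, e2]
    refine propext ⟨fun h => ⟨(R ω).ws t m, ⟨(R ω).one_le_ws ht m, (R ω).ws_le ht m⟩, rfl, h⟩, ?_⟩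
    rintro ⟨τ, -, rfl, h⟩
    exact h
  rw [h]
  refine Measurable.exists fun τ => ?_
  by_cases hτ : τ ∈ Set.Icc 1 t
  · simp only [hτ, true_and]
    refine (measurable_comp_nat (measurable_ws hb measurable_const) fun k => k = τ).and
      ((measurable_comp_nat ho fun k => m ≤ k).and ?_)
    exact measurableSet_setOfPred.1 (measurableSet_le (hu τ hτ m) (measurable_comp_nat ho fun k =>
      rate (kappa d T σ L B c₀) (2 ^ k) / rate (kappa d T σ L B c₀) (2 ^ m)))
  · simp only [hτ, false_and]
    exact measurable_const

lemma measurable_ac {t : ℕ} (ht : 1 ≤ t) (hc : ∀ m, Measurable fun ω => (R ω).Covers t m) :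
    Measurable fun ω => (R ω).ac t := by
  refine measurable_to_countable' fun k => ?_
  have h : (fun ω => (R ω).ac t) ⁻¹' {k} = {ω | ((R ω).Covers t k ∧ ∀ j, j < k → ¬ (R ω).Covers t j) ∨
      (k = 0 ∧ ∀ j, ¬ (R ω).Covers t j)} := by
    ext ω
    simp only [Set.mem_preimage, Set.mem_singleton_iff, Set.mem_ofPred_eq]
    rw [(R ω).ac_eq ht]
    constructor
    · rintro rfl
      by_cases hne : ∃ j, (R ω).Covers t j
      · exact Or.inl ⟨Nat.sInf_mem (s := {m | (R ω).Covers t m}) hne,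
          fun j hj => Nat.notMem_of_lt_sInf hj⟩
      · push Not at hne
        have : {m | (R ω).Covers t m} = ∅ := by ext m; simpa using hne m
        exact Or.inr ⟨by rw [this, Nat.sInf_empty], hne⟩
    · rintro (⟨h1, h2⟩ | ⟨h1, h2⟩)
      · refine le_antisymm (Nat.sInf_le h1) ?_
        by_contra hlt
        exact h2 _ (not_le.1 hlt) (Nat.sInf_mem (s := {m | (R ω).Covers t m}) ⟨k, h1⟩)
      · have : {m | (R ω).Covers t m} = ∅ := by ext m; simpa using h2 m
        rw [this, Nat.sInf_empty, h1]
  rw [h]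
  refine measurableSet_setOfPred.2 (((hc k).and (Measurable.forall fun j => ?_)).or
    (measurable_const.and (Measurable.forall fun j => (hc j).not)))
  exact measurable_const.imp (hc j).not

open Classical in
/-- The estimate in terms of all feedbacks up to the current period. -/
lemma est_eq_sum (hd : 1 ≤ d) (hX : IsClosed X) (hσ : 0 < σ) (hσL : σ < L)
    (hz₀ : ∀ τ m, z₀ τ m ∈ innerSet X c₀) {u : ℕ → ℕ → ℝ} {y : ℕ → ℝ} {R : Run d}
    (hR : R = ascentRun T σ L B c₀ X z₀ u y) {t : ℕ} (ht : 1 ≤ t) :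
    R.est t = (∑ s ∈ Finset.Icc 1 t, if R.ws s (R.ac t) = R.ws t (R.ac t) ∧ R.ac s = R.ac t
        then y s else 0) /
      (∑ s ∈ Finset.Icc 1 t, if R.ws s (R.ac t) = R.ws t (R.ac t) ∧ R.ac s = R.ac t
        then (1 : ℝ) else 0)
      + 2 * kappa d T σ L B c₀ / Real.sqrt (∑ s ∈ Finset.Icc 1 t,
        if R.ws s (R.ac t) = R.ws t (R.ac t) ∧ R.ac s = R.ac t then (1 : ℝ) else 0) := by
  have key : ∀ g : ℕ → ℝ, ∑ l ∈ Finset.range (R.plays t), g (R.playTime (R.ts t) (R.ac t) l) =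
      ∑ s ∈ Finset.Icc 1 t, if R.ws s (R.ac t) = R.ws t (R.ac t) ∧ R.ac s = R.ac t
        then g s else 0 := by
    intro g
    rw [← Finset.sum_filter]
    refine Finset.sum_nbij' (fun l => R.playTime (R.ts t) (R.ac t) l)
      (fun s => R.cnt (R.ts t) (R.ac t) s) ?_ ?_ ?_ ?_ ?_
    · intro l hl
      obtain ⟨h1, h2, h3, h4, -⟩ := R.playTime_facts ht (Finset.mem_range.1 hl)
      refine Finset.mem_filter.2 ⟨Finset.mem_Icc.2 ⟨h1, h2⟩, ?_, h4⟩
      rw [Run.ts, h4] at h3; exact h3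
    · intro s hs
      obtain ⟨h1, h2, h3⟩ := Finset.mem_filter.1 hs
      rw [Finset.mem_Icc] at h1
      rw [Finset.mem_range, Run.plays, Nat.lt_succ_iff]
      exact Nat.count_monotone _ h1.2
    · intro l hl
      obtain ⟨h1, h2, h3, h4, h5, -⟩ := R.playTime_facts ht (Finset.mem_range.1 hl)
      have h7 : R.plays (R.playTime (R.ts t) (R.ac t) l) = R.cnt (R.ts (R.playTime (R.ts t)
        (R.ac t) l)) (R.ac (R.playTime (R.ts t) (R.ac t) l))
        (R.playTime (R.ts t) (R.ac t) l) + 1 := rfl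
      rw [h5, h3, h4] at h7
      exact (Nat.succ_injective h7).symm
    · intro s hs
      obtain ⟨h1, h2, h3⟩ := Finset.mem_filter.1 hs
      exact R.playTime_cnt ⟨(Finset.mem_Icc.1 h1).1, h2, h3⟩
    · intro l _; rfl
  have hy : R.y = y := by rw [hR]; rfl
  rw [ascentRun_est hd hX hσ hσL hz₀ hR ht, ← key, ← key, ← hy]
  simp only [Finset.sum_const, Finset.card_range, nsmul_eq_mul, mul_one]
  rfl

/-- The estimate depends on the feedbacks and on which thread was run in each period, but not on the
iterates. Hence no measurability of projections or objectives enters. -/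
lemma measurable_est (hd : 1 ≤ d) (hX : IsClosed X) (hσ : 0 < σ) (hσL : σ < L)
    (hz₀ : ∀ τ m, z₀ τ m ∈ innerSet X c₀) (hR : R = sampleRun T σ L B c₀ X z₀ u y) {t : ℕ}
    (ht : 1 ≤ t) (hy : ∀ s ∈ Set.Icc 1 t, Measurable (y s))
    (hb : ∀ s ∈ Set.Icc 1 t, Measurable fun ω => (R ω).bs s)
    (ha : ∀ s ∈ Set.Icc 1 t, Measurable fun ω => (R ω).ac s) :
    Measurable fun ω => (R ω).est t := by
  classical
  have h := funext fun ω => est_eq_sum (u := fun τ m => u τ m ω) (y := fun s => y s ω) (T := T)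
    (B := B) hd hX hσ hσL hz₀ (R := R ω) (by rw [hR]; rfl) ht
  rw [h]
  have ht' : t ∈ Set.Icc 1 t := ⟨ht, le_rfl⟩
  have key : ∀ g : ℕ → Ω → ℝ, (∀ s ∈ Set.Icc 1 t, Measurable (g s)) → Measurable fun ω =>
      ∑ s ∈ Finset.Icc 1 t, if (R ω).ws s ((R ω).ac t) = (R ω).ws t ((R ω).ac t) ∧
        (R ω).ac s = (R ω).ac t then g s ω else 0 := by
    intro g hg
    refine Finset.measurable_sum _ fun s hs => ?_
    have hs' : s ∈ Set.Icc 1 t := Finset.mem_Icc.1 hs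
    refine Measurable.ite (measurableSet_setOfPred.2 (Measurable.and ?_ ?_)) (hg s hs') measurable_const
    · exact measurable_comp_nat₂ (measurable_ws (hb s hs') (ha t ht'))
        (measurable_ws (hb t ht') (ha t ht')) fun i j => i = j
    · exact measurable_comp_nat₂ (ha s hs') (ha t ht') fun i j => i = j
  have h1 := key (fun s => y s) hy
  have h2 := key (fun _ _ => (1 : ℝ)) fun _ _ => measurable_const
  exact (h1.div h2).add (measurable_const.div h2.sqrt)

lemma measurable_fail (hR : R = sampleRun T σ L B c₀ X z₀ u y) {t : ℕ}
    (ht : 1 ≤ t) (hy : ∀ s ∈ Set.Icc 1 t, Measurable (y s))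
    (hb : Measurable fun ω => (R ω).bs t) (hc : ∀ m, Measurable fun ω => (R ω).Covers t m)
    (he : ∀ s ∈ Set.Icc 1 t, Measurable fun ω => (R ω).est s) :
    Measurable fun ω => (R ω).Fail t := by
  classical
  have e1 : ∀ ω, (R ω).ρ = rate (kappa d T σ L B c₀) := fun ω => by rw [hR]; rfl
  have e2 : ∀ ω, (R ω).y = fun s => y s ω := fun ω => by rw [hR]; rfl
  have e3 : ∀ ω, (R ω).T = T := fun ω => by rw [hR]; rfl
  have key : ∀ (f : Ω → ℕ), (∀ ω, 1 ≤ f ω) → Measurable f → ∀ g : ℕ → Ω → ℝ,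
      (∀ s ∈ Set.Icc 1 t, Measurable (g s)) →
      Measurable fun ω => ∑ s ∈ Finset.Icc (f ω) t, g s ω := by
    intro f hf1 hf g hg
    have : (fun ω => ∑ s ∈ Finset.Icc (f ω) t, g s ω) =
        fun ω => ∑ s ∈ Finset.Icc 1 t, if f ω ≤ s then g s ω else 0 := by
      funext ω
      rw [← Finset.sum_filter]
      refine Finset.sum_congr (Finset.ext fun s => ?_) fun _ _ => rfl
      have := hf1 ω
      simp only [Finset.mem_Icc, Finset.mem_filter]
      omega
    rw [this]
    refine Finset.measurable_sum _ fun s hs => Measurable.ite ?_ (hg s (Finset.mem_Icc.1 hs))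
      measurable_const
    exact measurableSet_setOfPred.2 (measurable_comp_nat hf fun k => k ≤ s)
  refine Measurable.or ?_ ?_
  · unfold Run.FailOne
    refine Measurable.exists fun m => (hc m).and (Measurable.and ?_ (Measurable.exists fun τ => ?_))
    · exact measurable_comp_nat (measurable_ws hb measurable_const) fun k => k + 2 ^ m = t + 1
    · by_cases hτ : τ ∈ Set.Icc 1 t
      · simp only [Finset.mem_Icc, e1, e2, e3]
        refine Measurable.and (measurable_comp_nat hb fun k => k ≤ τ ∧ τ ≤ t) ?_
        refine measurableSet_setOfPred.1 (measurableSet_le ((he τ hτ).add measurable_const) ?_)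
        exact (key _ (fun ω => (R ω).one_le_ws ht m) (measurable_ws hb measurable_const)
          (fun s => y s) hy).div_const _
      · have : ∀ ω, ¬ τ ∈ Finset.Icc ((R ω).bs t) t := by
          intro ω h
          rw [Finset.mem_Icc] at h
          exact hτ ⟨((R ω).one_le_bs ht).trans h.1, h.2⟩
        simp only [this, false_and]
        exact measurable_const
  · unfold Run.FailTwo
    simp only [e1, e2, e3]
    refine measurableSet_setOfPred.1 (measurableSet_le ?_ ?_)
    · exact measurable_comp_nat hb fun k =>
        3 * rhoHat T (rate (kappa d T σ L B c₀)) (t - k + 1)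
    · exact (key _ (fun ω => (R ω).one_le_bs ht) hb (fun s ω => (R ω).est s - y s ω)
        fun s hs => (he s hs).sub (hy s hs)).div
        (measurable_comp_nat hb fun k => ((t - k + 1 : ℕ) : ℝ))

/-- Strong induction on the period: earlier block data determine the running threads, these the
estimates, and these the tests. The σ-algebra is left free, so that the σ-algebra of the past can be
inserted later. -/
lemma measurable_bs_ord (hd : 1 ≤ d) (hX : IsClosed X) (hσ : 0 < σ) (hσL : σ < L)
    (hz₀ : ∀ τ m, z₀ τ m ∈ innerSet X c₀) (hR : R = sampleRun T σ L B c₀ X z₀ u y) {t : ℕ}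
    (ht : 1 ≤ t) (hu : ∀ s ∈ Set.Ico 1 t, ∀ m, Measurable (u s m))
    (hy : ∀ s ∈ Set.Ico 1 t, Measurable (y s)) :
    (Measurable fun ω => (R ω).bs t) ∧ Measurable fun ω => (R ω).ord t := by
  classical
  induction t using Nat.strong_induction_on with
  | _ t ih =>
    rcases ht.eq_or_lt with rfl | ht1
    · exact ⟨measurable_const (a := 1), measurable_const (a := 0)⟩
    obtain ⟨k, rfl⟩ : ∃ k, t = k + 1 := ⟨t - 1, by omega⟩
    have hk : 1 ≤ k := by omega
    have hbo : ∀ s ∈ Set.Icc 1 k, (Measurable fun ω => (R ω).bs s) ∧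
        Measurable fun ω => (R ω).ord s := fun s hs => ih s (Nat.lt_succ_of_le hs.2) hs.1
      (fun r hr => hu r ⟨hr.1, by have := hr.2; have := hs.2; omega⟩)
      (fun r hr => hy r ⟨hr.1, by have := hr.2; have := hs.2; omega⟩)
    have hc : ∀ s ∈ Set.Icc 1 k, ∀ m, Measurable fun ω => (R ω).Covers s m := fun s hs =>
      measurable_covers hR hs.1 (fun r hr => hu r ⟨hr.1, by have := hr.2; have := hs.2; omega⟩)
        (hbo s hs).1 (hbo s hs).2
    have ha : ∀ s ∈ Set.Icc 1 k, Measurable fun ω => (R ω).ac s := fun s hs =>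
      measurable_ac hs.1 (hc s hs)
    have hy' : ∀ s ∈ Set.Icc 1 k, Measurable (y s) := fun s hs => hy s ⟨hs.1, Nat.lt_succ_of_le hs.2⟩
    have he : ∀ s ∈ Set.Icc 1 k, Measurable fun ω => (R ω).est s := fun s hs =>
      measurable_est hd hX hσ hσL hz₀ hR hs.1 (fun r hr => hy' r ⟨hr.1, hr.2.trans hs.2⟩)
        (fun r hr => (hbo r ⟨hr.1, hr.2.trans hs.2⟩).1)
        (fun r hr => ha r ⟨hr.1, hr.2.trans hs.2⟩)
    have hkk : k ∈ Set.Icc 1 k := ⟨hk, le_rfl⟩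
    have hf := measurable_fail hR hk hy' (hbo k hkk).1 (hc k hkk) he
    have hend : Measurable fun ω => k + 1 = (R ω).bs k + 2 ^ (R ω).ord k :=
      measurable_comp_nat₂ (hbo k hkk).1 (hbo k hkk).2 fun i j => k + 1 = i + 2 ^ j
    have e1 := funext fun ω => (R ω).bs_succ hk
    have e2 := funext fun ω => (R ω).ord_succ hk
    rw [e1, e2]
    exact ⟨Measurable.ite (measurableSet_setOfPred.2 (hf.or hend)) measurable_const (hbo k hkk).1,
      Measurable.ite (measurableSet_setOfPred.2 hf) measurable_const
        (Measurable.ite (measurableSet_setOfPred.2 hend)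
          (measurable_comp_nat (hbo k hkk).2 fun i => i + 1) (hbo k hkk).2)⟩

end Measurability


/-! ### Exponential supermartingales -/

section Supermartingale

open scoped ENNReal

variable {Ω : Type*} {m0 : MeasurableSpace Ω} {μ : Measure Ω}

/-- The hypothesis says that the conditional expectation of W is at most 1, without conditional
expectations of extended nonnegative functions: on the smaller σ-algebra the measure with density W
is below μ, and P is integrated against both. -/
lemma lintegral_mul_le_of_setLIntegral_le {m : MeasurableSpace Ω} (hm : m ≤ m0) {W : Ω → ℝ≥0∞}
    (hW : Measurable[m0] W) (h : ∀ A, MeasurableSet[m] A → ∫⁻ ω in A, W ω ∂μ ≤ μ A)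
    {P : Ω → ℝ≥0∞} (hP : Measurable[m] P) : ∫⁻ ω, P ω * W ω ∂μ ≤ ∫⁻ ω, P ω ∂μ := by
  have h1 : ∫⁻ ω, P ω * W ω ∂μ = ∫⁻ ω, P ω ∂(μ.withDensity W) := by
    rw [lintegral_withDensity_eq_lintegral_mul _ hW (hP.mono hm le_rfl)]
    simp only [Pi.mul_apply, mul_comm]
  rw [h1, ← lintegral_trim hm hP, ← lintegral_trim hm hP]
  refine lintegral_mono' (Measure.le_iff.2 fun A hA => ?_) le_rfl
  rw [trim_measurableSet_eq hm hA, trim_measurableSet_eq hm hA, withDensity_apply _ (hm _ hA)]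
  exact h A hA

lemma lintegral_prod_le_one [IsProbabilityMeasure μ] {G : ℕ → MeasurableSpace Ω} (hG : ∀ t, G t ≤ m0)
    {T : ℕ} (hmono : ∀ t ∈ Finset.Icc 1 T, G t ≤ G (t + 1)) {W : ℕ → Ω → ℝ≥0∞}
    (hWm : ∀ t ∈ Finset.Icc 1 T, Measurable[G (t + 1)] (W t))
    (hW : ∀ t ∈ Finset.Icc 1 T, ∀ A, MeasurableSet[G t] A → ∫⁻ ω in A, W t ω ∂μ ≤ μ A) :
    ∫⁻ ω, ∏ t ∈ Finset.Icc 1 T, W t ω ∂μ ≤ 1 := by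
  have key : ∀ n ≤ T, (Measurable[G (n + 1)] fun ω => ∏ t ∈ Finset.Icc 1 n, W t ω) ∧
      ∫⁻ ω, ∏ t ∈ Finset.Icc 1 n, W t ω ∂μ ≤ 1 := by
    intro n hn
    induction n with
    | zero => simp
    | succ n ih =>
      obtain ⟨h1, h2⟩ := ih (by omega)
      have hmem : n + 1 ∈ Finset.Icc 1 T := Finset.mem_Icc.2 ⟨by omega, hn⟩
      have e : (fun ω => ∏ t ∈ Finset.Icc 1 (n + 1), W t ω) =
          fun ω => (∏ t ∈ Finset.Icc 1 n, W t ω) * W (n + 1) ω := by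
        funext ω
        rw [Finset.prod_Icc_succ_top (by omega)]
      rw [e]
      refine ⟨Measurable.mul (h1.mono (hmono _ hmem) le_rfl) (hWm _ hmem), ?_⟩
      exact (lintegral_mul_le_of_setLIntegral_le (hG _) ((hWm _ hmem).mono (hG _) le_rfl)
        (hW _ hmem) h1).trans h2
  exact (key T le_rfl).2

/-- Markov's inequality for an exponential supermartingale. -/
lemma measure_exp_sum_le [IsProbabilityMeasure μ] {G : ℕ → MeasurableSpace Ω} (hG : ∀ t, G t ≤ m0)
    {T : ℕ} (hmono : ∀ t ∈ Finset.Icc 1 T, G t ≤ G (t + 1)) {Z : ℕ → Ω → ℝ}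
    (hZm : ∀ t ∈ Finset.Icc 1 T, Measurable[G (t + 1)] (Z t))
    (hZ : ∀ t ∈ Finset.Icc 1 T, ∀ A, MeasurableSet[G t] A →
      ∫⁻ ω in A, ENNReal.ofReal (Real.exp (Z t ω)) ∂μ ≤ μ A) (ℓ : ℝ) :
    μ {ω | ℓ ≤ ∑ t ∈ Finset.Icc 1 T, Z t ω} ≤ ENNReal.ofReal (Real.exp (-ℓ)) := by
  have h1 := lintegral_prod_le_one (μ := μ) hG hmono
    (W := fun t ω => ENNReal.ofReal (Real.exp (Z t ω)))
    (fun t ht => ENNReal.measurable_ofReal.comp (Real.measurable_exp.comp (hZm t ht))) hZ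
  have e : ∀ ω, ∏ t ∈ Finset.Icc 1 T, ENNReal.ofReal (Real.exp (Z t ω)) =
      ENNReal.ofReal (Real.exp (∑ t ∈ Finset.Icc 1 T, Z t ω)) := by
    intro ω
    rw [Real.exp_sum, ENNReal.ofReal_prod_of_nonneg fun _ _ => (Real.exp_pos _).le]
  simp only [e] at h1
  have hZm0 : Measurable fun ω => ∑ t ∈ Finset.Icc 1 T, Z t ω :=
    Finset.measurable_sum _ fun t ht => (hZm t ht).mono (hG _) le_rfl
  have h2 := mul_meas_ge_le_lintegral₀ (μ := μ)
    (ENNReal.measurable_ofReal.comp (Real.measurable_exp.comp hZm0)).aemeasurable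
    (ENNReal.ofReal (Real.exp ℓ))
  have h3 : {ω | ℓ ≤ ∑ t ∈ Finset.Icc 1 T, Z t ω} ⊆ {ω | ENNReal.ofReal (Real.exp ℓ) ≤
      (ENNReal.ofReal ∘ (Real.exp ∘ fun ω => ∑ t ∈ Finset.Icc 1 T, Z t ω)) ω} := fun ω hω =>
    ENNReal.ofReal_le_ofReal (Real.exp_le_exp.2 hω)
  have h4 : ENNReal.ofReal (Real.exp ℓ) * μ {ω | ℓ ≤ ∑ t ∈ Finset.Icc 1 T, Z t ω} ≤ 1 :=
    (mul_le_mul_right (measure_mono h3) _).trans (h2.trans h1)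
  have h5 : ENNReal.ofReal (Real.exp (-ℓ)) * ENNReal.ofReal (Real.exp ℓ) = 1 := by
    rw [← ENNReal.ofReal_mul (Real.exp_pos _).le, ← Real.exp_add, neg_add_cancel, Real.exp_zero,
      ENNReal.ofReal_one]
  calc μ {ω | ℓ ≤ ∑ t ∈ Finset.Icc 1 T, Z t ω}
      = ENNReal.ofReal (Real.exp (-ℓ)) * (ENNReal.ofReal (Real.exp ℓ) *
        μ {ω | ℓ ≤ ∑ t ∈ Finset.Icc 1 T, Z t ω}) := by rw [← mul_assoc, h5, one_mul]
    _ ≤ ENNReal.ofReal (Real.exp (-ℓ)) * 1 := mul_le_mul_right h4 _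
    _ = _ := mul_one _

/-- Combines exp z ≤ 1 + z + z² for |z| ≤ 1 with (1 + 4l²) exp(-4l²) ≤ 1. The bound is affine in x,
so it integrates to at most the measure of any set on which x has integral zero. -/
lemma exp_le_one_add_mul {x l : ℝ} (hx : |x| ≤ 2) (hl : |l| ≤ 1 / 2) :
    Real.exp (l * x - 4 * l ^ 2) ≤ 1 + Real.exp (-(4 * l ^ 2)) * l * x := by
  have h1 : |l * x| ≤ 1 := by
    rw [abs_mul]
    calc |l| * |x| ≤ 1 / 2 * 2 := mul_le_mul hl hx (abs_nonneg _) (by norm_num)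
      _ = 1 := by norm_num
  have h2 := (abs_le.1 (Real.abs_exp_sub_one_sub_id_le h1)).2
  have h3 : (l * x) ^ 2 ≤ 4 * l ^ 2 := by
    have : x ^ 2 ≤ 4 := by nlinarith [abs_le.1 hx, sq_abs x, abs_nonneg x]
    rw [mul_pow]; nlinarith [sq_nonneg l]
  have h4 : (1 + 4 * l ^ 2) * Real.exp (-(4 * l ^ 2)) ≤ 1 := by
    have h5 := Real.add_one_le_exp (4 * l ^ 2)
    calc (1 + 4 * l ^ 2) * Real.exp (-(4 * l ^ 2)) ≤ Real.exp (4 * l ^ 2) * Real.exp (-(4 * l ^ 2)) := by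
          gcongr; linarith
      _ = 1 := by rw [← Real.exp_add, add_neg_cancel, Real.exp_zero]
  rw [sub_eq_add_neg, Real.exp_add]
  have h6 := Real.exp_pos (-(4 * l ^ 2))
  calc Real.exp (l * x) * Real.exp (-(4 * l ^ 2))
      ≤ (1 + l * x + 4 * l ^ 2) * Real.exp (-(4 * l ^ 2)) := by gcongr; linarith
    _ ≤ _ := by nlinarith

/-- One step of the noise supermartingale. -/
lemma setLIntegral_exp_noise_le [IsProbabilityMeasure μ] {m : MeasurableSpace Ω} (hm : m ≤ m0)
    {D : Ω → ℝ} (hD : Integrable D μ) (hD2 : ∀ᵐ ω ∂μ, |D ω| ≤ 2)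
    (hD0 : ∀ A, MeasurableSet[m] A → ∫ ω in A, D ω ∂μ = 0) {l : ℝ} (hl : |l| ≤ 1 / 2)
    {E : Set Ω} (hE : MeasurableSet[m] E) {A : Set Ω} (hA : MeasurableSet[m] A) :
    ∫⁻ ω in A, ENNReal.ofReal (Real.exp (E.indicator (fun ω => l * D ω - 4 * l ^ 2) ω)) ∂μ ≤ μ A := by
  have hAE := hm _ (hA.inter hE)
  rw [← lintegral_inter_add_sdiff _ A (hm _ hE), ← measure_inter_add_sdiff A (hm _ hE)]
  refine add_le_add ?_ ?_
  · have e : ∫⁻ ω in A ∩ E, ENNReal.ofReal (Real.exp (E.indicator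
        (fun ω => l * D ω - 4 * l ^ 2) ω)) ∂μ ≤ ∫⁻ ω in A ∩ E, ENNReal.ofReal
        (1 + Real.exp (-(4 * l ^ 2)) * l * D ω) ∂μ := by
      refine setLIntegral_mono_ae' hAE ?_
      filter_upwards [hD2] with ω h hω
      rw [Set.indicator_of_mem hω.2]
      exact ENNReal.ofReal_le_ofReal (exp_le_one_add_mul h hl)
    refine e.trans ?_
    have hint : Integrable (fun ω => 1 + Real.exp (-(4 * l ^ 2)) * l * D ω) (μ.restrict (A ∩ E)) :=
      (integrable_const _).add (hD.restrict.const_mul _)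
    rw [← ofReal_integral_eq_lintegral_ofReal hint]
    · rw [integral_add (integrable_const _) (hD.restrict.const_mul _), integral_const_mul,
        hD0 _ (hA.inter hE), mul_zero, add_zero, integral_const, smul_eq_mul, mul_one,
        measureReal_restrict_apply_univ, ofReal_measureReal]
    · refine ae_restrict_of_ae ?_
      filter_upwards [hD2] with ω h
      exact (Real.exp_pos _).le.trans (exp_le_one_add_mul h hl)
  · have : ∫⁻ ω in A \ E, ENNReal.ofReal (Real.exp (E.indicator
        (fun ω => l * D ω - 4 * l ^ 2) ω)) ∂μ = ∫⁻ _ in A \ E, 1 ∂μ := by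
      refine setLIntegral_congr_fun (hm _ (hA.diff hE)) fun ω hω => ?_
      rw [Set.indicator_of_notMem hω.2, Real.exp_zero, ENNReal.ofReal_one]
    rw [this, setLIntegral_one]

/-- One step of the lottery supermartingale. -/
lemma setLIntegral_exp_lottery_le [IsProbabilityMeasure μ] {m m' : MeasurableSpace Ω} (hm : m ≤ m0)
    (hm' : m' ≤ m0) (hind : Indep m' m μ) {S : Set Ω} (hS : MeasurableSet[m'] S) (θ : ℝ)
    {E : Set Ω} (hE : MeasurableSet[m] E) {A : Set Ω} (hA : MeasurableSet[m] A) :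
    ∫⁻ ω in A, ENNReal.ofReal (Real.exp (E.indicator
      (fun ω => S.indicator (fun _ => θ) ω - (Real.exp θ - 1) * μ.real S) ω)) ∂μ ≤ μ A := by
  have hAE := hm _ (hA.inter hE)
  rw [← lintegral_inter_add_sdiff _ A (hm _ hE), ← measure_inter_add_sdiff A (hm _ hE)]
  refine add_le_add ?_ ?_
  · set c := (Real.exp θ - 1) * μ.real S with hc
    have h1 : ∫⁻ ω in A ∩ E, ENNReal.ofReal (Real.exp (E.indicator
        (fun ω => S.indicator (fun _ => θ) ω - c) ω)) ∂μ =
        ∫⁻ ω in A ∩ E, ENNReal.ofReal (Real.exp (-c) * (1 + S.indicator (fun _ => Real.exp θ - 1) ω)) ∂μ := by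
      refine setLIntegral_congr_fun hAE fun ω hω => ?_
      rw [Set.indicator_of_mem hω.2]
      congr 1
      by_cases hs : ω ∈ S
      · rw [Set.indicator_of_mem hs, Set.indicator_of_mem hs, sub_eq_add_neg, Real.exp_add]; ring
      · rw [Set.indicator_of_notMem hs, Set.indicator_of_notMem hs, zero_sub, add_zero, mul_one]
    rw [h1]
    have hi : Integrable (S.indicator fun _ => Real.exp θ - 1) (μ.restrict (A ∩ E)) :=
      (integrable_const _).indicator (hm' _ hS)
    have hint : Integrable (fun ω => Real.exp (-c) * (1 + S.indicator (fun _ => Real.exp θ - 1) ω))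
        (μ.restrict (A ∩ E)) := ((integrable_const _).add hi).const_mul _
    rw [← ofReal_integral_eq_lintegral_ofReal hint]
    · have h2 : μ.real ((A ∩ E) ∩ S) = μ.real (A ∩ E) * μ.real S := by
        have := (Indep_iff _ _ _).1 hind S (A ∩ E) hS (hA.inter hE)
        rw [Set.inter_comm, measureReal_def, this, ENNReal.toReal_mul, mul_comm]; rfl
      rw [integral_const_mul, integral_add (integrable_const _) hi, integral_const,
        measureReal_restrict_apply_univ, integral_indicator (hm' _ hS),
        Measure.restrict_restrict (hm' _ hS), integral_const, measureReal_restrict_apply_univ,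
        Set.inter_comm S, h2, smul_eq_mul, smul_eq_mul, mul_one]
      have h3 : Real.exp (-c) * (μ.real (A ∩ E) + μ.real (A ∩ E) * μ.real S * (Real.exp θ - 1)) ≤
          μ.real (A ∩ E) := by
        have h4 : μ.real (A ∩ E) + μ.real (A ∩ E) * μ.real S * (Real.exp θ - 1) =
            μ.real (A ∩ E) * (1 + c) := by rw [hc]; ring
        have h5 : Real.exp (-c) * (1 + c) ≤ 1 := by
          have := Real.add_one_le_exp c
          calc Real.exp (-c) * (1 + c) ≤ Real.exp (-c) * Real.exp c := by gcongr; linarith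
            _ = 1 := by rw [← Real.exp_add, neg_add_cancel, Real.exp_zero]
        rw [h4]
        calc Real.exp (-c) * (μ.real (A ∩ E) * (1 + c)) = μ.real (A ∩ E) * (Real.exp (-c) * (1 + c)) := by
              ring
          _ ≤ μ.real (A ∩ E) * 1 := mul_le_mul_of_nonneg_left h5 measureReal_nonneg
          _ = _ := mul_one _
      exact (ENNReal.ofReal_le_ofReal h3).trans (ofReal_measureReal).le
    · refine Filter.Eventually.of_forall fun ω => mul_nonneg (Real.exp_pos _).le ?_
      by_cases hs : ω ∈ S
      · rw [Set.indicator_of_mem hs]; have := Real.exp_pos θ; linarith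
      · rw [Set.indicator_of_notMem hs, add_zero]; exact zero_le_one
  · have : ∫⁻ ω in A \ E, ENNReal.ofReal (Real.exp (E.indicator
        (fun ω => S.indicator (fun _ => θ) ω - (Real.exp θ - 1) * μ.real S) ω)) ∂μ
        = ∫⁻ _ in A \ E, 1 ∂μ := by
      refine setLIntegral_congr_fun (hm _ (hA.diff hE)) fun ω hω => ?_
      rw [Set.indicator_of_notMem hω.2, Real.exp_zero, ENNReal.ofReal_one]
    rw [this, setLIntegral_one]

end Supermartingale


/-! ### Tail bounds for the feedbacks and the lotteries -/

section Tail

open scoped ENNReal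

variable {Ω : Type*} {u : ℕ → ℕ → Ω → ℝ} {y : ℕ → Ω → ℝ}

lemma measurable_past_y {s t : ℕ} (hs : s ∈ Set.Ico 1 t) : Measurable[past u y t] (y s) :=
  (comap_measurable (y s)).mono (le_sup_of_le_left (le_iSup₂_of_le s hs le_rfl)) le_rfl

lemma measurable_past_u {s t : ℕ} (hs : s ∈ Set.Ico 1 t) (m : ℕ) :
    Measurable[past u y t] (u s m) :=
  (comap_measurable (u s m)).mono (le_sup_of_le_right (le_iSup₂_of_le s hs
    (le_iSup_of_le m le_rfl))) le_rfl

lemma measurable_fresh_u (t m : ℕ) : Measurable[fresh u t] (u t m) :=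
  (comap_measurable (u t m)).mono (le_iSup_of_le m le_rfl) le_rfl

lemma past_sup_fresh_le {t : ℕ} (ht : 1 ≤ t) : past u y t ⊔ fresh u t ≤ past u y (t + 1) := by
  refine sup_le (sup_le (iSup₂_le fun s hs => ?_) (iSup₂_le fun s hs => iSup_le fun m => ?_))
    (iSup_le fun m => ?_)
  · exact (measurable_past_y (u := u) (y := y) ⟨hs.1, by have := hs.2; omega⟩).comap_le
  · exact (measurable_past_u (u := u) (y := y) ⟨hs.1, by have := hs.2; omega⟩ m).comap_le
  · exact (measurable_past_u (u := u) (y := y) ⟨ht, by omega⟩ m).comap_le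

variable [m0 : MeasurableSpace Ω] {μ : Measure Ω} {d T : ℕ} {f : ℕ → Pt d → ℝ} {x : ℕ → Ω → Pt d}

lemma Interaction.fresh_le (hI : Interaction μ T f u y x) (t : ℕ) : fresh u t ≤ m0 :=
  iSup_le fun m => (hI.measurable_u t m).comap_le

lemma Interaction.past_le (hI : Interaction μ T f u y x) (t : ℕ) : past u y t ≤ m0 :=
  sup_le (iSup₂_le fun s _ => (hI.measurable_y s).comap_le)
    (iSup₂_le fun s _ => iSup_le fun m => (hI.measurable_u s m).comap_le)

lemma Interaction.measureReal_le (hI : Interaction μ T f u y x) 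
    {p : ℝ} (hp0 : 0 ≤ p) (hp1 : p ≤ 1) (t m : ℕ) :
    μ.real {ω | u t m ω ≤ p} = p := by
  have h : μ {ω | u t m ω ≤ p} = Measure.map (u t m) μ (Set.Iic p) :=
    (Measure.map_apply (hI.measurable_u t m) measurableSet_Iic).symm
  have e : Set.Iic p ∩ Set.Icc (0 : ℝ) 1 = Set.Icc 0 p := by
    ext z
    simp only [Set.mem_inter_iff, Set.mem_Iic, Set.mem_Icc]
    exact ⟨fun h => ⟨h.2.1, h.1⟩, fun h => ⟨h.2, h.1, h.2.trans hp1⟩⟩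
  rw [measureReal_def, h, hI.uniform, Measure.restrict_apply measurableSet_Iic, e, Real.volume_Icc,
    sub_zero, ENNReal.toReal_ofReal hp0]

lemma Interaction.ae_u_le (hI : Interaction μ T f u y x) : ∀ᵐ ω ∂μ, ∀ t m, u t m ω ≤ 1 := by
  rw [ae_all_iff]; intro t
  rw [ae_all_iff]; intro m
  have h : ∀ᵐ z ∂(Measure.map (u t m) μ), z ≤ 1 := by
    rw [hI.uniform]
    exact (ae_restrict_mem measurableSet_Icc).mono fun z hz => hz.2
  exact ae_of_ae_map (hI.measurable_u t m).aemeasurable h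

lemma Interaction.integrable_y [IsProbabilityMeasure μ] (hI : Interaction μ T f u y x) 
    {t : ℕ} (ht : t ∈ Finset.Icc 1 T) : Integrable (y t) μ :=
  Integrable.of_bound (hI.measurable_y t).aestronglyMeasurable 1 (hI.bounded t ht)

/-- The tail of the sum of the noise over a predictable set of periods. -/
lemma Interaction.noise_tail [IsProbabilityMeasure μ] (hI : Interaction μ T f u y x) 
    {k : ℕ} {ℓ : ℝ} (hℓ : 0 ≤ ℓ) {E : ℕ → Set Ω}
    (hE : ∀ t ∈ Finset.Icc 1 T, MeasurableSet[past u y t ⊔ fresh u t] (E t))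
    (hcard : ∀ ω, ∑ t ∈ Finset.Icc 1 T, (E t).indicator (fun _ => (1 : ℝ)) ω ≤ k) :
    μ {ω | 4 * Real.sqrt ℓ * Real.sqrt k <
      |∑ t ∈ Finset.Icc 1 T, (E t).indicator (fun ω => y t ω - f t (x t ω)) ω|} ≤
      2 * ENNReal.ofReal (Real.exp (-ℓ)) := by
  have hG : ∀ t, past u y t ⊔ fresh u t ≤ m0 := fun t => sup_le (hI.past_le t) (hI.fresh_le t)
  -- The conditional expectation replaces f_t(x_t), for which no measurability is assumed. The two
  -- agree almost everywhere.
  set D : ℕ → Ω → ℝ := fun t ω => y t ω - (μ[y t | past u y t ⊔ fresh u t]) ω with hDdef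
  have hDae : ∀ᵐ ω ∂μ, ∀ t ∈ Finset.Icc 1 T, y t ω - f t (x t ω) = D t ω := by
    rw [Finset.eventually_all]
    intro t ht
    filter_upwards [hI.mean t ht] with ω h
    rw [hDdef]; simp only; rw [h]
  have hD2 : ∀ t ∈ Finset.Icc 1 T, ∀ᵐ ω ∂μ, |D t ω| ≤ 2 := by
    intro t ht
    have h1 := ae_bdd_abs_condExp_of_ae_bdd_abs (m := past u y t ⊔ fresh u t) (hI.bounded t ht)
    filter_upwards [h1, hI.bounded t ht] with ω h1 h2
    exact (abs_sub _ _).trans (by linarith)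
  have hDi : ∀ t ∈ Finset.Icc 1 T, Integrable (D t) μ := fun t ht =>
    (hI.integrable_y ht).sub integrable_condExp
  have hD0 : ∀ t ∈ Finset.Icc 1 T, ∀ A, MeasurableSet[past u y t ⊔ fresh u t] A →
      ∫ ω in A, D t ω ∂μ = 0 := by
    intro t ht A hA
    rw [hDdef]
    simp only
    rw [integral_sub (hI.integrable_y ht).integrableOn integrable_condExp.integrableOn,
      setIntegral_condExp (hG t) (hI.integrable_y ht) hA, sub_self]
  have hDm : ∀ t ∈ Finset.Icc 1 T, Measurable[past u y (t + 1)] (D t) := by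
    intro t ht
    have h1 := (Finset.mem_Icc.1 ht).1
    refine Measurable.sub (measurable_past_y ⟨h1, by omega⟩) ?_
    exact (stronglyMeasurable_condExp.measurable).mono (past_sup_fresh_le h1) le_rfl
  -- If k ≤ ℓ the bound is deterministic: at most k terms of size 2 sum to at most 2k ≤ 4√ℓ√k.
  -- Otherwise the optimal exponent below is at most 1/2, as the supermartingale needs.
  rcases le_or_gt (k : ℝ) ℓ with hk | hk
  · have hnull : μ {ω | 4 * Real.sqrt ℓ * Real.sqrt k <
      |∑ t ∈ Finset.Icc 1 T, (E t).indicator (fun ω => y t ω - f t (x t ω)) ω|} = 0 := by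
      have hD2' : ∀ᵐ ω ∂μ, ∀ t ∈ Finset.Icc 1 T, |D t ω| ≤ 2 := by
        rw [Finset.eventually_all]; exact hD2
      rw [measure_eq_zero_iff_ae_notMem]
      filter_upwards [hDae, hD2'] with ω h1 h2
      rw [not_lt]
      have h3 : |∑ t ∈ Finset.Icc 1 T, (E t).indicator (fun ω => y t ω - f t (x t ω)) ω| ≤
          ∑ t ∈ Finset.Icc 1 T, 2 * (E t).indicator (fun _ => (1 : ℝ)) ω := by
        refine (Finset.abs_sum_le_sum_abs _ _).trans (Finset.sum_le_sum fun t ht => ?_)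
        by_cases he : ω ∈ E t
        · rw [Set.indicator_of_mem he, Set.indicator_of_mem he, h1 t ht, mul_one]; exact h2 t ht
        · rw [Set.indicator_of_notMem he, Set.indicator_of_notMem he, abs_zero, mul_zero]
      rw [← Finset.mul_sum] at h3
      have h4 := hcard ω
      have h5 : (k : ℝ) ≤ Real.sqrt ℓ * Real.sqrt k := by
        have := Real.sqrt_le_sqrt hk
        calc (k : ℝ) = Real.sqrt k * Real.sqrt k := (Real.mul_self_sqrt (Nat.cast_nonneg _)).symm
          _ ≤ _ := by gcongr
      have h6 : (0 : ℝ) ≤ k := Nat.cast_nonneg _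
      nlinarith
    rw [hnull]; exact bot_le
  · have hk0 : (0 : ℝ) < k := hℓ.trans_lt hk
    -- With this l the threshold 4√ℓ√k contributes 2ℓ to the exponent and the compensator 4l²k takes
    -- back ℓ.
    set l := 1 / 2 * Real.sqrt (ℓ / k) with hl
    have hl0 : 0 ≤ l := by positivity
    have hl1 : l ≤ 1 / 2 := by
      have : Real.sqrt (ℓ / k) ≤ 1 := by
        rw [Real.sqrt_le_one, div_le_one hk0]; exact hk.le
      linarith
    have hl2 : 4 * l ^ 2 * k = ℓ := by
      rw [hl, mul_pow, Real.sq_sqrt (by positivity)]; field_simp; norm_num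
    have hl3 : l * (4 * Real.sqrt ℓ * Real.sqrt k) = 2 * ℓ := by
      have hsk : 0 < Real.sqrt k := Real.sqrt_pos.2 hk0
      rw [hl, Real.sqrt_div hℓ]
      field_simp
      rw [Real.sq_sqrt hℓ]; ring
    have tail : ∀ c : ℝ, |c| ≤ 1 / 2 → μ {ω | ℓ ≤ ∑ t ∈ Finset.Icc 1 T,
        (E t).indicator (fun ω => c * D t ω - 4 * c ^ 2) ω} ≤ ENNReal.ofReal (Real.exp (-ℓ)) := by
      intro c hc
      refine measure_exp_sum_le hG (fun t ht => (past_sup_fresh_le (Finset.mem_Icc.1 ht).1).trans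
        le_sup_left) (fun t ht => ?_) (fun t ht A hA => setLIntegral_exp_noise_le (hG t) (hDi t ht)
          (hD2 t ht) (hD0 t ht) hc (hE t ht) hA) ℓ
      refine Measurable.mono (Measurable.indicator (((hDm t ht).const_mul c).sub_const _)
        (past_sup_fresh_le (Finset.mem_Icc.1 ht).1 _ (hE t ht))) le_sup_left le_rfl
    have hsum : ∀ c : ℝ, c ^ 2 = l ^ 2 → ∀ ω, c * ∑ t ∈ Finset.Icc 1 T, (E t).indicator (D t) ω - ℓ ≤
        ∑ t ∈ Finset.Icc 1 T, (E t).indicator (fun ω => c * D t ω - 4 * c ^ 2) ω := by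
      intro c hc ω
      have e : ∑ t ∈ Finset.Icc 1 T, (E t).indicator (fun ω => c * D t ω - 4 * c ^ 2) ω =
          c * ∑ t ∈ Finset.Icc 1 T, (E t).indicator (D t) ω -
          4 * c ^ 2 * ∑ t ∈ Finset.Icc 1 T, (E t).indicator (fun _ => (1 : ℝ)) ω := by
        rw [Finset.mul_sum, Finset.mul_sum, ← Finset.sum_sub_distrib]
        refine Finset.sum_congr rfl fun t _ => ?_
        by_cases he : ω ∈ E t
        · simp only [Set.indicator_of_mem he, mul_one]
        · simp only [Set.indicator_of_notMem he, mul_zero, sub_zero]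
      rw [e, hc]
      have := mul_le_mul_of_nonneg_left (hcard ω) (by positivity : 0 ≤ 4 * l ^ 2)
      linarith
    have hsub : {ω | 4 * Real.sqrt ℓ * Real.sqrt k <
        |∑ t ∈ Finset.Icc 1 T, (E t).indicator (fun ω => y t ω - f t (x t ω)) ω|} ≤ᵐ[μ]
        ({ω | ℓ ≤ ∑ t ∈ Finset.Icc 1 T, (E t).indicator (fun ω => l * D t ω - 4 * l ^ 2) ω} ∪
        {ω | ℓ ≤ ∑ t ∈ Finset.Icc 1 T, (E t).indicator (fun ω => (-l) * D t ω - 4 * (-l) ^ 2) ω} :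
          Set Ω) := by
      filter_upwards [hDae] with ω h1 h2
      have e : ∑ t ∈ Finset.Icc 1 T, (E t).indicator (fun ω => y t ω - f t (x t ω)) ω =
          ∑ t ∈ Finset.Icc 1 T, (E t).indicator (D t) ω := by
        refine Finset.sum_congr rfl fun t ht => ?_
        by_cases he : ω ∈ E t
        · rw [Set.indicator_of_mem he, Set.indicator_of_mem he, h1 t ht]
        · rw [Set.indicator_of_notMem he, Set.indicator_of_notMem he]
      change 4 * Real.sqrt ℓ * Real.sqrt k < |_| at h2
      rw [e] at h2
      rcases lt_abs.1 h2 with h3 | h3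
      · refine Or.inl ((?_ : ℓ ≤ _).trans (hsum l rfl ω))
        have := mul_le_mul_of_nonneg_left h3.le hl0
        linarith
      · refine Or.inr ((?_ : ℓ ≤ _).trans (hsum (-l) (by ring) ω))
        have := mul_le_mul_of_nonneg_left h3.le hl0
        linarith
    refine (measure_mono_ae hsub).trans ((measure_union_le _ _).trans ?_)
    rw [two_mul]
    exact add_le_add (tail l (by rwa [abs_of_nonneg hl0]))
      (tail (-l) (by rwa [abs_neg, abs_of_nonneg hl0]))

/-- The tail of the number of scheduled threads in a predictable set of periods. -/
lemma Interaction.lottery_tail [IsProbabilityMeasure μ] (hI : Interaction μ T f u y x) 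
    {p : ℝ} (hp0 : 0 ≤ p) (hp1 : p ≤ 1) (m : ℕ) (θ ℓ : ℝ) {E : ℕ → Set Ω}
    (hE : ∀ t ∈ Finset.Icc 1 T, MeasurableSet[past u y t] (E t)) :
    μ {ω | ℓ ≤ θ * ∑ t ∈ Finset.Icc 1 T, (E t ∩ {ω | u t m ω ≤ p}).indicator (fun _ => (1 : ℝ)) ω -
      (Real.exp θ - 1) * p * ∑ t ∈ Finset.Icc 1 T, (E t).indicator (fun _ => (1 : ℝ)) ω} ≤
      ENNReal.ofReal (Real.exp (-ℓ)) := by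
  have hS : ∀ t, MeasurableSet[fresh u t] {ω | u t m ω ≤ p} := fun t =>
    measurableSet_le (measurable_fresh_u t m) measurable_const
  have key := measure_exp_sum_le (μ := μ) (G := past u y) hI.past_le (T := T)
    (Z := fun t => (E t).indicator (fun ω => {ω | u t m ω ≤ p}.indicator (fun _ => θ) ω
      - (Real.exp θ - 1) * μ.real {ω | u t m ω ≤ p}))
    (fun t ht => le_sup_left.trans (past_sup_fresh_le (Finset.mem_Icc.1 ht).1)) (fun t ht => ?_)
    (fun t ht A hA => setLIntegral_exp_lottery_le (hI.past_le t) (hI.fresh_le t)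
      (hI.indep_past t ht) (hS t) θ (hE t ht) hA) ℓ
  · refine le_trans (measure_mono fun ω hω => ?_) key
    change ℓ ≤ _ at hω
    change ℓ ≤ _
    refine hω.trans (le_of_eq ?_)
    rw [Finset.mul_sum, Finset.mul_sum, ← Finset.sum_sub_distrib]
    refine Finset.sum_congr rfl fun t _ => ?_
    rw [hI.measureReal_le hp0 hp1]
    by_cases he : ω ∈ E t
    · by_cases hs : ω ∈ {ω | u t m ω ≤ p}
      · rw [Set.indicator_of_mem (s := E t ∩ {ω | u t m ω ≤ p}) ⟨he, hs⟩, Set.indicator_of_mem he, Set.indicator_of_mem he,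
          Set.indicator_of_mem hs, mul_one, mul_one]
      · rw [Set.indicator_of_notMem (s := E t ∩ {ω | u t m ω ≤ p}) (fun h => hs h.2), Set.indicator_of_mem he,
          Set.indicator_of_mem he, Set.indicator_of_notMem hs, mul_zero, mul_one]
    · rw [Set.indicator_of_notMem (s := E t ∩ {ω | u t m ω ≤ p}) (fun h => he h.1), Set.indicator_of_notMem he,
          Set.indicator_of_notMem he, mul_zero, mul_zero, sub_zero]
  · have h1 := (Finset.mem_Icc.1 ht).1
    have h2 := past_sup_fresh_le (u := u) (y := y) h1
    refine Measurable.indicator (Measurable.sub_const (Measurable.indicator measurable_const ?_) _)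
      (le_sup_left.trans h2 _ (hE t ht))
    exact le_sup_right.trans h2 _ (hS t)

end Tail


/-! ### Predictability of plays, window starts and bad windows. -/

section Flow

variable {d T : ℕ} {σ L B c₀ : ℝ} {X : Set (Pt d)} {z₀ : ℕ → ℕ → Pt d}
  {Ω : Type*} [mΩ : MeasurableSpace Ω] {u : ℕ → ℕ → Ω → ℝ} {y : ℕ → Ω → ℝ} {R : Ω → Run d}

lemma measurable_flow (hd : 1 ≤ d) (hX : IsClosed X) (hσ : 0 < σ) (hσL : σ < L)
    (hz₀ : ∀ τ m, z₀ τ m ∈ innerSet X c₀) (hR : R = sampleRun T σ L B c₀ X z₀ u y) {t : ℕ}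
    (hu : ∀ s ∈ Set.Icc 1 t, ∀ m, Measurable (u s m)) (hy : ∀ s ∈ Set.Ico 1 t, Measurable (y s))
    {s : ℕ} (hs : s ∈ Set.Icc 1 t) : (Measurable fun ω => (R ω).bs s) ∧
      (Measurable fun ω => (R ω).ord s) ∧ Measurable fun ω => (R ω).ac s := by
  obtain ⟨h1, h2⟩ := measurable_bs_ord hd hX hσ hσL hz₀ hR hs.1
    (fun r hr => hu r ⟨hr.1, hr.2.le.trans hs.2⟩) (fun r hr => hy r ⟨hr.1, hr.2.trans_le hs.2⟩)
  exact ⟨h1, h2, measurable_ac hs.1 (measurable_covers hR hs.1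
    (fun r hr => hu r ⟨hr.1, hr.2.trans hs.2⟩) h1 h2)⟩

lemma measurable_plays {s : ℕ} (hb : Measurable fun ω => (R ω).bs s)
    (ha : Measurable fun ω => (R ω).ac s) (τ m : ℕ) : Measurable fun ω => (R ω).Plays τ m s :=
  measurable_const.and ((measurable_comp_nat (measurable_ws hb measurable_const) fun k => k = τ).and
    (measurable_comp_nat ha fun k => k = m))

/-- Which thread plays in period t depends on the lotteries up to and including t, but only on the
feedbacks before t. This is what the noise of period t requires. -/
lemma measurable_mem_playSet (hd : 1 ≤ d) (hX : IsClosed X) (hσ : 0 < σ) (hσL : σ < L)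
    (hz₀ : ∀ τ m, z₀ τ m ∈ innerSet X c₀) (hR : R = sampleRun T σ L B c₀ X z₀ u y) {t : ℕ}
    (ht : 1 ≤ t) (hu : ∀ s ∈ Set.Icc 1 t, ∀ m, Measurable (u s m))
    (hy : ∀ s ∈ Set.Ico 1 t, Measurable (y s)) (τ m a b : ℕ) (p : ℕ → Prop) :
    Measurable fun ω => t ∈ (R ω).playSet τ m a b p := by
  classical
  have hp : ∀ s ∈ Set.Icc 1 t, Measurable fun ω => (R ω).Plays τ m s := fun s hs =>
    measurable_plays (measurable_flow hd hX hσ hσL hz₀ hR hu hy hs).1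
      (measurable_flow hd hX hσ hσL hz₀ hR hu hy hs).2.2 τ m
  have hcnt : ∀ s ≤ t, Measurable fun ω => (R ω).cnt τ m s := by
    intro s hs
    induction s with
    | zero => exact measurable_const (a := 0)
    | succ s ih =>
      have e : (fun ω => (R ω).cnt τ m (s + 1)) = fun ω => (R ω).cnt τ m s +
          if (R ω).Plays τ m s then 1 else 0 := by
        funext ω
        unfold Run.cnt
        rw [Nat.count_succ]
      rw [e]
      refine (ih (by omega)).add ?_
      rcases Nat.eq_zero_or_pos s with h | h
      · have : ∀ ω, ¬ (R ω).Plays τ m s := fun ω hω => by have := hω.1; omega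
        simp only [this, if_false]
        exact measurable_const
      · exact Measurable.ite (measurableSet_setOfPred.2 (hp s ⟨h, by omega⟩)) measurable_const
          measurable_const
  simp only [Run.mem_playSet]
  have e : ∀ ω, (R ω).T = T := fun ω => by rw [hR]; rfl
  simp only [e]
  exact measurable_const.and ((hp t ⟨ht, le_rfl⟩).and (measurable_comp_nat (hcnt t le_rfl)
    fun k => a ≤ k ∧ k < b ∧ p k))

/-- In contrast to the plays, only lotteries strictly before t are used, so the lottery of a window
starting at t is independent of this event. -/
lemma measurable_mem_starts (hd : 1 ≤ d) (hX : IsClosed X) (hσ : 0 < σ) (hσL : σ < L)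
    (hz₀ : ∀ τ m, z₀ τ m ∈ innerSet X c₀) (hR : R = sampleRun T σ L B c₀ X z₀ u y) {t : ℕ}
    (ht : 1 ≤ t) (hu : ∀ s ∈ Set.Ico 1 t, ∀ m, Measurable (u s m))
    (hy : ∀ s ∈ Set.Ico 1 t, Measurable (y s)) (b n m a e : ℕ) :
    Measurable fun ω => t ∈ (R ω).starts b n m a e := by
  obtain ⟨hb, ho⟩ := measurable_bs_ord hd hX hσ hσL hz₀ hR ht hu hy
  simp only [Run.starts, Finset.mem_filter]
  exact measurable_const.and ((measurable_comp_nat hb fun k => k = b).and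
    ((measurable_comp_nat ho fun k => k = n).and
      (measurable_comp_nat (measurable_ws hb measurable_const) fun k => k = t)))

/-- Badness is defined through estimates of earlier periods, fixed break points and fixed optimal
values, so it is decided before the lottery of the window is drawn. This is what makes the lower
bound on the number of scheduled bad windows possible. -/
lemma measurable_mem_bad (hd : 1 ≤ d) (hX : IsClosed X) (hσ : 0 < σ) (hσL : σ < L)
    (hz₀ : ∀ τ m, z₀ τ m ∈ innerSet X c₀) (hR : R = sampleRun T σ L B c₀ X z₀ u y) {t : ℕ}
    (ht : 1 ≤ t) (hu : ∀ s ∈ Set.Ico 1 t, ∀ m, Measurable (u s m))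
    (hy : ∀ s ∈ Set.Ico 1 t, Measurable (y s)) (fs : ℕ → ℝ) (Q : Finset ℕ) (b n m : ℕ) :
    Measurable fun ω => t ∈ (R ω).bad fs Q b n m := by
  obtain ⟨hb, ho⟩ := measurable_bs_ord hd hX hσ hσL hz₀ hR ht hu hy
  simp only [Run.bad, Finset.mem_filter]
  rcases Nat.eq_zero_or_pos b with hb0 | hb0
  · have : ∀ ω, ¬ (R ω).bs t = b := fun ω => by have := (R ω).one_le_bs ht; omega
    simp only [this, false_and, and_false]
    exact measurable_const
  have e1 : ∀ ω, (R ω).ρ = rate (kappa d T σ L B c₀) := fun ω => by rw [hR]; rfl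
  have e3 : ∀ ω, (R ω).T = T := fun ω => by rw [hR]; rfl
  simp only [e1, e3]
  refine measurable_const.and (Measurable.and ((measurable_comp_nat hb fun k => k = b).and
    ((measurable_comp_nat ho fun k => k = n).and
      (measurable_comp_nat (measurable_ws hb measurable_const) fun k => k = t)))
    (measurable_const.and (Measurable.exists fun τ => ?_)))
  by_cases hτ : τ ∈ Finset.Ico b t
  · simp only [hτ, true_and]
    rw [Finset.mem_Ico] at hτ
    have hlt : ∀ s ∈ Set.Icc 1 τ, s ∈ Set.Ico 1 t := fun s hs => ⟨hs.1, hs.2.trans_lt hτ.2⟩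
    have hf : ∀ s ∈ Set.Icc 1 τ, _ := fun s hs => measurable_flow (t := τ) hd hX hσ hσL hz₀ hR
      (fun r hr => hu r (hlt r hr)) (fun r hr => hy r (hlt r ⟨hr.1, hr.2.le⟩)) hs
    exact measurableSet_setOfPred.1 (measurableSet_le (measurable_est hd hX hσ hσL hz₀ hR
      (hb0.trans_le hτ.1) (fun r hr => hy r (hlt r hr)) (fun r hr => (hf r hr).1)
      (fun r hr => (hf r hr).2.2)) measurable_const)
  · simp only [hτ, false_and]
    exact measurable_const

end Flow

lemma sum_indicator_mem {Ω : Type*} {T : ℕ} {S : Ω → Finset ℕ} (hS : ∀ ω, S ω ⊆ Finset.Icc 1 T) (g : ℕ → Ω → ℝ)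
    (ω : Ω) : ∑ t ∈ Finset.Icc 1 T, {ω | t ∈ S ω}.indicator (g t) ω = ∑ t ∈ S ω, g t ω := by
  classical
  have : ∀ t, {ω | t ∈ S ω}.indicator (g t) ω = if t ∈ S ω then g t ω else 0 := fun t => by
    rw [Set.indicator_apply]; rfl
  simp only [this]
  rw [← Finset.sum_filter, Finset.filter_mem_eq_inter, Finset.inter_eq_right.2 (hS ω)]

section Union

open scoped ENNReal

variable {Ω : Type*} [m0 : MeasurableSpace Ω] {μ : Measure Ω} [IsProbabilityMeasure μ] {d T : ℕ}
  {f : ℕ → Pt d → ℝ} {u : ℕ → ℕ → Ω → ℝ} {y : ℕ → Ω → ℝ} {x : ℕ → Ω → Pt d}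

lemma Interaction.noise_tail_finset (hI : Interaction μ T f u y x) {k : ℕ} {ℓ : ℝ} (hℓ : 0 ≤ ℓ)
    {S : Ω → Finset ℕ} (hS : ∀ ω, S ω ⊆ Finset.Icc 1 T)
    (hm : ∀ t ∈ Finset.Icc 1 T, Measurable[past u y t ⊔ fresh u t] fun ω => t ∈ S ω)
    (hcard : ∀ ω, (S ω).card ≤ k) :
    μ {ω | 4 * Real.sqrt ℓ * Real.sqrt k < |∑ t ∈ S ω, (y t ω - f t (x t ω))|} ≤
      2 * ENNReal.ofReal (Real.exp (-ℓ)) := by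
  have h := hI.noise_tail (k := k) hℓ (E := fun t => {ω | t ∈ S ω})
    (fun t ht => (@measurableSet_setOfPred _ (past u y t ⊔ fresh u t) _).2 (hm t ht)) (fun ω => ?_)
  · simpa only [sum_indicator_mem hS (fun t ω => y t ω - f t (x t ω))] using h
  · rw [sum_indicator_mem hS (fun _ _ => (1 : ℝ)), Finset.sum_const, nsmul_eq_mul, mul_one]
    exact_mod_cast hcard ω

lemma Interaction.lottery_tail_finset (hI : Interaction μ T f u y x) {p : ℝ} (hp0 : 0 ≤ p)
    (hp1 : p ≤ 1) (m : ℕ) (θ ℓ : ℝ) {S : Ω → Finset ℕ} (hS : ∀ ω, S ω ⊆ Finset.Icc 1 T)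
    (hm : ∀ t ∈ Finset.Icc 1 T, Measurable[past u y t] fun ω => t ∈ S ω) :
    μ {ω | ℓ ≤ θ * (((S ω).filter fun t => u t m ω ≤ p).card : ℝ) -
      (Real.exp θ - 1) * p * ((S ω).card : ℝ)} ≤ ENNReal.ofReal (Real.exp (-ℓ)) := by
  have h := hI.lottery_tail hp0 hp1 m θ ℓ (E := fun t => {ω | t ∈ S ω})
    (fun t ht => (@measurableSet_setOfPred _ (past u y t) _).2 (hm t ht))
  have e1 : ∀ ω, ∑ t ∈ Finset.Icc 1 T, {ω | t ∈ S ω}.indicator (fun _ => (1 : ℝ)) ω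
      = ((S ω).card : ℝ) := fun ω => by
    rw [sum_indicator_mem hS (fun _ _ => (1 : ℝ)), Finset.sum_const, nsmul_eq_mul, mul_one]
  have e2 : ∀ ω, ∑ t ∈ Finset.Icc 1 T, ({ω | t ∈ S ω} ∩ {ω | u t m ω ≤ p}).indicator
      (fun _ => (1 : ℝ)) ω = (((S ω).filter fun t => u t m ω ≤ p).card : ℝ) := fun ω => by
    have := sum_indicator_mem (S := fun ω => (S ω).filter fun t => u t m ω ≤ p)
      (fun ω => (Finset.filter_subset _ _).trans (hS ω)) (fun _ _ => (1 : ℝ)) ω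
    rw [Finset.sum_const, nsmul_eq_mul, mul_one] at this
    rw [← this]
    refine Finset.sum_congr rfl fun t _ => ?_
    congr 1
    ext ω'
    simp only [Set.mem_inter_iff, Set.mem_ofPred_eq, Finset.mem_filter]
  simpa only [e1, e2] using h

end Union

lemma Run.card_playSet_le {d : ℕ} (R : Run d) (τ m a b : ℕ) (p : ℕ → Prop) :
    (R.playSet τ m a b p).card ≤ b - a := by
  rw [← Nat.card_Ico]
  refine Finset.card_le_card_of_injOn (fun s => R.cnt τ m s) (fun s hs => ?_) ?_
  · obtain ⟨-, -, h1, h2, -⟩ := Run.mem_playSet.1 hs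
    exact Finset.mem_coe.2 (Finset.mem_Ico.2 ⟨h1, h2⟩)
  · intro s hs t ht hst
    have h1 := R.playTime_cnt (Run.mem_playSet.1 hs).2.1
    have h2 := R.playTime_cnt (Run.mem_playSet.1 ht).2.1
    simp only at hst
    rw [← h1, ← h2, hst]

/-- The only order-m window start in such a block is the start of the block, before which the block
has no estimate. This disposes of the orders whose formal scheduling probability is 1 or more. -/
lemma Run.bad_eq_empty {d : ℕ} (R : Run d) (fs : ℕ → ℝ) (Q : Finset ℕ) (b : ℕ) {n m : ℕ}
    (h : n ≤ m) : R.bad fs Q b n m = ∅ := by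
  classical
  rw [Finset.eq_empty_iff_forall_notMem]
  intro t ht
  obtain ⟨h0, ⟨h1, h2, h3⟩, -, s, h4, -⟩ := Finset.mem_filter.1 ht
  have ht1 := (Finset.mem_Icc.1 h0).1
  have h5 := R.lt_bs_add ht1
  rw [h2] at h5
  have h6 : t - R.bs t < 2 ^ m := by
    have := Nat.pow_le_pow_right (show 0 < 2 by norm_num) h
    have := Nat.two_pow_pos m
    omega
  rw [Run.ws, Nat.div_eq_of_lt h6] at h3
  rw [Finset.mem_Ico] at h4
  omega

lemma rate_div_rate_le_one {κ : ℝ} (hκ : 0 < κ) {n m : ℕ} (h : m ≤ n) :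
    rate κ (2 ^ n) / rate κ (2 ^ m) ≤ 1 := by
  rw [rate_div_rate hκ, div_le_one (by positivity)]
  exact Real.sqrt_le_sqrt (pow_le_pow_right₀ (by norm_num) h)

lemma one_le_rate_div_rate {κ : ℝ} (hκ : 0 < κ) {n m : ℕ} (h : n ≤ m) :
    1 ≤ rate κ (2 ^ n) / rate κ (2 ^ m) := by
  rw [rate_div_rate hκ, one_le_div (by positivity)]
  exact Real.sqrt_le_sqrt (pow_le_pow_right₀ (by norm_num) h)

lemma rate_div_rate_nonneg {κ : ℝ} (hκ : 0 < κ) (n m : ℕ) :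
    0 ≤ rate κ (2 ^ n) / rate κ (2 ^ m) := by
  rw [rate_div_rate hκ]; positivity


/-! ### Exceptional events and the union bound. -/

section BadSet

open scoped ENNReal

variable {d T : ℕ} {σ L B c₀ : ℝ} {X : Set (Pt d)} {z₀ : ℕ → ℕ → Pt d}
  {Ω : Type*} [m0 : MeasurableSpace Ω] {μ : Measure Ω} [IsProbabilityMeasure μ]
  {f : ℕ → Pt d → ℝ} {u : ℕ → ℕ → Ω → ℝ} {y : ℕ → Ω → ℝ} {x : ℕ → Ω → Pt d}

/-- The noise over an interval is too large. -/
def noiseEvent (T : ℕ) (ℓ : ℝ) (f : ℕ → Pt d → ℝ) (y : ℕ → Ω → ℝ) (x : ℕ → Ω → Pt d) (a e : ℕ) :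
    Set Ω :=
  {ω | 4 * Real.sqrt ℓ * Real.sqrt (e + 1 - a : ℕ) <
    |∑ t ∈ (Finset.Icc 1 T).filter (fun t => t ∈ Finset.Icc a e), (y t ω - f t (x t ω))|}

/-- The noise over the plays of a thread is too large. -/
def threadNoiseEvent (R : Ω → Run d) (ℓ : ℝ) (f : ℕ → Pt d → ℝ) (y : ℕ → Ω → ℝ)
    (x : ℕ → Ω → Pt d) (τ m a b : ℕ) (p : ℕ → Prop) : Set Ω :=
  {ω | 4 * Real.sqrt ℓ * Real.sqrt (b - a : ℕ) <
    |∑ t ∈ (R ω).playSet τ m a b p, (y t ω - f t (x t ω))|}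

/-- Too many threads are scheduled. -/
def fewEvent (T : ℕ) (R : Ω → Run d) (κ ℓ : ℝ) (u : ℕ → ℕ → Ω → ℝ) (b n m a e : ℕ) : Set Ω :=
  {ω | (1 ≤ a ∧ e ≤ T) ∧ 16 / 5 * (rate κ (2 ^ n) / rate κ (2 ^ m)) * ((R ω).starts b n m a e).card
    + ℓ / 2 < (((R ω).starts b n m a e).filter
      fun t => u t m ω ≤ rate κ (2 ^ n) / rate κ (2 ^ m)).card}

/-- Too few threads are scheduled in bad windows. -/
def manyEvent (R : Ω → Run d) (κ ℓ : ℝ) (fs : ℕ → ℝ) (Q : Finset ℕ) (u : ℕ → ℕ → Ω → ℝ)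
    (b n m : ℕ) : Set Ω :=
  {ω | 2 * ((((R ω).bad fs Q b n m).filter
      fun t => u t m ω ≤ rate κ (2 ^ n) / rate κ (2 ^ m)).card + ℓ) <
    (rate κ (2 ^ n) / rate κ (2 ^ m)) * ((R ω).bad fs Q b n m).card}

lemma measure_noiseEvent_le (hI : Interaction μ T f u y x) {ℓ : ℝ} (hℓ : 0 ≤ ℓ) (a e : ℕ) :
    μ (noiseEvent T ℓ f y x a e) ≤ 2 * ENNReal.ofReal (Real.exp (-ℓ)) := by
  refine hI.noise_tail_finset hℓ (S := fun _ => (Finset.Icc 1 T).filter fun t => t ∈ Finset.Icc a e)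
    (fun _ => Finset.filter_subset _ _) (fun t _ => measurable_const) fun _ => ?_
  rw [← Nat.card_Icc]
  exact Finset.card_le_card fun t ht => (Finset.mem_filter.1 ht).2

lemma measure_threadNoiseEvent_le (hI : Interaction μ T f u y x) (hd : 1 ≤ d) (hX : IsClosed X)
    (hσ : 0 < σ) (hσL : σ < L) (hz₀ : ∀ τ m, z₀ τ m ∈ innerSet X c₀) {ℓ : ℝ} (hℓ : 0 ≤ ℓ)
    (τ m a b : ℕ) (p : ℕ → Prop) :
    μ (threadNoiseEvent (sampleRun T σ L B c₀ X z₀ u y) ℓ f y x τ m a b p) ≤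
      2 * ENNReal.ofReal (Real.exp (-ℓ)) := by
  refine hI.noise_tail_finset hℓ (S := fun ω => (sampleRun T σ L B c₀ X z₀ u y ω).playSet τ m a b p)
    (fun ω t h => (Run.mem_playSet.1 h).1) (fun t ht => ?_) fun ω => Run.card_playSet_le _ _ _ _ _ _
  have h1 := (Finset.mem_Icc.1 ht).1
  have hp : ∀ s ∈ Set.Ico 1 t, past u y t ≤ past u y t ⊔ fresh u t := fun _ _ => le_sup_left
  refine measurable_mem_playSet (mΩ := past u y t ⊔ fresh u t) hd hX hσ hσL hz₀ rfl h1
    (fun s hs m => ?_) (fun s hs => (measurable_past_y hs).mono le_sup_left le_rfl) τ m a b p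
  rcases hs.2.lt_or_eq with h | h
  · exact (measurable_past_u ⟨hs.1, h⟩ m).mono le_sup_left le_rfl
  · rw [h]; exact (measurable_fresh_u t m).mono le_sup_right le_rfl

lemma measure_fewEvent_le (hI : Interaction μ T f u y x) (hd : 1 ≤ d) (hX : IsClosed X)
    (hσ : 0 < σ) (hσL : σ < L) (hz₀ : ∀ τ m, z₀ τ m ∈ innerSet X c₀) {κ ℓ : ℝ} (hκ : 0 < κ)
    (hℓ : 0 ≤ ℓ) (b n m a e : ℕ) :
    μ (fewEvent T (sampleRun T σ L B c₀ X z₀ u y) κ ℓ u b n m a e) ≤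
      ENNReal.ofReal (Real.exp (-ℓ)) := by
  by_cases hae : 1 ≤ a ∧ e ≤ T
  swap
  · have : fewEvent T (sampleRun T σ L B c₀ X z₀ u y) κ ℓ u b n m a e = ∅ :=
      Set.eq_empty_iff_forall_notMem.2 fun ω hω => hae hω.1
    rw [this, measure_empty]; exact bot_le
  -- For n ≤ m the formal probability is at least 1 and the bound holds trivially, as scheduled
  -- threads are among the window starts.
  rcases le_total n m with h | h
  · have : fewEvent T (sampleRun T σ L B c₀ X z₀ u y) κ ℓ u b n m a e = ∅ := by
      refine Set.eq_empty_iff_forall_notMem.2 fun ω hω => ?_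
      have h1 := hω.2
      have h2 : (((((sampleRun T σ L B c₀ X z₀ u y ω).starts b n m a e).filter
        fun t => u t m ω ≤ rate κ (2 ^ n) / rate κ (2 ^ m)).card : ℕ) : ℝ) ≤
        ((sampleRun T σ L B c₀ X z₀ u y ω).starts b n m a e).card := by
        exact_mod_cast Finset.card_filter_le _ _
      have h3 := one_le_rate_div_rate hκ h
      have h4 : (0 : ℝ) ≤ ((sampleRun T σ L B c₀ X z₀ u y ω).starts b n m a e).card :=
        Nat.cast_nonneg _
      nlinarith
    rw [this, measure_empty]; exact bot_le
  · refine le_trans (measure_mono fun ω hω => ?_) (hI.lottery_tail_finset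
      (rate_div_rate_nonneg hκ n m) (rate_div_rate_le_one hκ h) m 2 ℓ
      (S := fun ω => (sampleRun T σ L B c₀ X z₀ u y ω).starts b n m a e)
      (fun ω => (Finset.filter_subset _ _).trans (Finset.Icc_subset_Icc hae.1 hae.2)) fun t ht => ?_)
    · have h1 := hω.2
      change ℓ ≤ _
      -- The lottery bound is used with θ = 2. Division by 2 gives the coefficients 16/5 and ℓ/2.
      have h2 : Real.exp 2 - 1 ≤ 32 / 5 := by
        have h3 := Real.exp_one_lt_d9
        have h4 : Real.exp 2 = Real.exp 1 * Real.exp 1 := by rw [← Real.exp_add]; norm_num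
        rw [h4]
        nlinarith [Real.exp_pos 1]
      have h5 : 0 ≤ (rate κ (2 ^ n) / rate κ (2 ^ m)) *
          (((sampleRun T σ L B c₀ X z₀ u y ω).starts b n m a e).card : ℝ) :=
        mul_nonneg (rate_div_rate_nonneg hκ n m) (Nat.cast_nonneg _)
      have h6 := mul_le_mul_of_nonneg_right h2 h5
      linarith
    · exact measurable_mem_starts (mΩ := past u y t) hd hX hσ hσL hz₀ rfl (Finset.mem_Icc.1 ht).1
        (fun s hs m => measurable_past_u hs m) (fun s hs => measurable_past_y hs) b n m a e

lemma measure_manyEvent_le (hI : Interaction μ T f u y x) (hd : 1 ≤ d) (hX : IsClosed X)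
    (hσ : 0 < σ) (hσL : σ < L) (hz₀ : ∀ τ m, z₀ τ m ∈ innerSet X c₀) {κ ℓ : ℝ} (hκ : 0 < κ)
    (hℓ : 0 ≤ ℓ) (fs : ℕ → ℝ) (Q : Finset ℕ) (b n m : ℕ) :
    μ (manyEvent (sampleRun T σ L B c₀ X z₀ u y) κ ℓ fs Q u b n m) ≤
      ENNReal.ofReal (Real.exp (-ℓ)) := by
  rcases le_total n m with h | h
  · have : manyEvent (sampleRun T σ L B c₀ X z₀ u y) κ ℓ fs Q u b n m = ∅ := by
      refine Set.eq_empty_iff_forall_notMem.2 fun ω hω => ?_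
      rw [manyEvent, Set.mem_ofPred_eq] at hω
      rw [Run.bad_eq_empty _ _ _ _ h, Finset.filter_empty, Finset.card_empty, Nat.cast_zero,
        mul_zero, zero_add] at hω
      linarith
    rw [this, measure_empty]; exact bot_le
  · refine le_trans (measure_mono fun ω hω => ?_) (hI.lottery_tail_finset
      (rate_div_rate_nonneg hκ n m) (rate_div_rate_le_one hκ h) m (-1) ℓ
      (S := fun ω => (sampleRun T σ L B c₀ X z₀ u y ω).bad fs Q b n m)
      (fun ω => Finset.filter_subset _ _) fun t ht => ?_)
    · rw [manyEvent, Set.mem_ofPred_eq] at hω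
      change ℓ ≤ _
      -- The lottery bound is used with θ = -1, which bounds the number of scheduled threads from
      -- below. The coefficient 1/2 becomes the factor 2 of the event.
      have h2 : Real.exp (-1) - 1 ≤ -(1 / 2) := by
        have h3 : (2 : ℝ) ≤ Real.exp 1 := by have := Real.add_one_le_exp 1; linarith
        have h4 : Real.exp (-1) * Real.exp 1 = 1 := by rw [← Real.exp_add]; norm_num
        nlinarith [Real.exp_pos (-1)]
      have h5 : 0 ≤ (rate κ (2 ^ n) / rate κ (2 ^ m)) *
          (((sampleRun T σ L B c₀ X z₀ u y ω).bad fs Q b n m).card : ℝ) :=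
        mul_nonneg (rate_div_rate_nonneg hκ n m) (Nat.cast_nonneg _)
      have h6 := mul_le_mul_of_nonneg_right h2 h5
      linarith
    · exact measurable_mem_bad (mΩ := past u y t) hd hX hσ hσL hz₀ rfl (Finset.mem_Icc.1 ht).1
        (fun s hs m => measurable_past_u hs m) (fun s hs => measurable_past_y hs) fs Q b n m

/-- Outside of a set of small probability, the realization is good. -/
lemma exists_bad_set (hI : Interaction μ T f u y x)
    (hx : ∀ t ω, x t ω = query T σ L B c₀ X z₀ (fun τ m => u τ m ω) (fun s => y s ω) t)
    (hd : 1 ≤ d) (hX : IsClosed X)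
    (hσ : 0 < σ) (hσL : σ < L) (hz₀ : ∀ τ m, z₀ τ m ∈ innerSet X c₀)
    (hκ : 0 < kappa d T σ L B c₀) {ℓ : ℝ} (hℓ : 0 ≤ ℓ) (fs : ℕ → ℝ) (Q : Finset ℕ) :
    ∃ N : Set Ω, μ N ≤ 8 * ((T : ℝ≥0∞) + 1) ^ 5 * ENNReal.ofReal (Real.exp (-ℓ)) ∧
      ∀ᵐ ω ∂μ, ω ∉ N → GoodSample T σ L B c₀ (4 * Real.sqrt ℓ) ℓ X f z₀ (fun τ m => u τ m ω)
        (fun s => y s ω) ∧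
        (ascentRun T σ L B c₀ X z₀ (fun τ m => u τ m ω) (fun s => y s ω)).ManyWins fs Q ℓ := by
  classical
  set κ := kappa d T σ L B c₀ with hκdef
  set R := sampleRun T σ L B c₀ X z₀ u y with hR
  set δ := ENNReal.ofReal (Real.exp (-ℓ)) with hδ
  set I : Finset (ℕ × ℕ × ℕ × ℕ × ℕ) := Finset.range (T + 1) ×ˢ Finset.range (T + 1) ×ˢ
    Finset.range (T + 1) ×ˢ Finset.range (T + 1) ×ˢ Finset.range (T + 1) with hIdef
  set A : ℕ × ℕ × ℕ × ℕ × ℕ → Set Ω := fun i =>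
    noiseEvent T ℓ f y x i.1 i.2.1 ∪ (threadNoiseEvent R ℓ f y x i.1 i.2.1 i.2.2.1 i.2.2.2.1 Even ∪
    (threadNoiseEvent R ℓ f y x i.1 i.2.1 i.2.2.1 i.2.2.2.1 (fun l => ¬ Even l) ∪
    (fewEvent T R κ ℓ u i.1 i.2.1 i.2.2.1 i.2.2.2.1 i.2.2.2.2 ∪
      manyEvent R κ ℓ fs Q u i.1 i.2.1 i.2.2.1))) with hA
  have hAle : ∀ i, μ (A i) ≤ 8 * δ := by
    intro i
    -- Three two-sided noise events and two one-sided lottery events per index tuple. Events with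
    -- fewer parameters ignore the superfluous ones.
    have e : (8 : ℝ≥0∞) * δ = 2 * δ + (2 * δ + (2 * δ + (δ + δ))) := by ring
    rw [e]
    refine (measure_union_le _ _).trans (add_le_add (measure_noiseEvent_le hI hℓ _ _) ?_)
    refine (measure_union_le _ _).trans (add_le_add
      (measure_threadNoiseEvent_le hI hd hX hσ hσL hz₀ hℓ _ _ _ _ _) ?_)
    refine (measure_union_le _ _).trans (add_le_add
      (measure_threadNoiseEvent_le hI hd hX hσ hσL hz₀ hℓ _ _ _ _ _) ?_)
    exact (measure_union_le _ _).trans (add_le_add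
      (measure_fewEvent_le hI hd hX hσ hσL hz₀ hκ hℓ _ _ _ _ _)
      (measure_manyEvent_le hI hd hX hσ hσL hz₀ hκ hℓ _ _ _ _ _))
  refine ⟨⋃ i ∈ I, A i, ?_, ?_⟩
  · refine (measure_biUnion_finset_le I A).trans ((Finset.sum_le_card_nsmul _ _ _ fun i _ =>
      hAle i).trans (le_of_eq ?_))
    have hc : I.card = (T + 1) ^ 5 := by
      simp only [hIdef, Finset.card_product, Finset.card_range]; ring
    rw [hc, nsmul_eq_mul]
    push_cast
    ring
  · have hy : ∀ᵐ ω ∂μ, ∀ t ∈ Finset.Icc 1 T, |y t ω| ≤ 1 := by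
      rw [Finset.eventually_all]; exact hI.bounded
    filter_upwards [hy, hI.ae_u_le] with ω h1 h2 hω
    simp only [Set.mem_iUnion, not_exists] at hω
    have hω' : ∀ i1 ≤ T, ∀ i2 ≤ T, ∀ i3 ≤ T, ∀ i4 ≤ T, ∀ i5 ≤ T, ω ∉ A (i1, i2, i3, i4, i5) := by
      intro i1 k1 i2 k2 i3 k3 i4 k4 i5 k5
      refine hω _ ?_
      simp only [hIdef, Finset.mem_product, Finset.mem_range]
      omega
    have hRω : ascentRun T σ L B c₀ X z₀ (fun τ m => u τ m ω) (fun s => y s ω) = R ω := rfl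
    have eρ : (R ω).ρ = rate κ := rfl
    have eT : (R ω).T = T := rfl
    have eu : (R ω).u = fun τ m => u τ m ω := rfl
    refine ⟨⟨h1, fun t _ m => h2 t m, ?_, ?_, ?_⟩, ?_⟩
    · intro a e ha hae he
      have h3 : ω ∉ noiseEvent T ℓ f y x a e := fun h =>
        hω' a (by omega) e he 0 (Nat.zero_le _) 0 (Nat.zero_le _) 0 (Nat.zero_le _) (Or.inl h)
      rw [noiseEvent, Set.mem_ofPred_eq, not_lt] at h3
      have h4 := h3
      have e1 : (Finset.Icc 1 T).filter (fun t => t ∈ Finset.Icc a e) = Finset.Icc a e := by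
        ext t; simp only [Finset.mem_filter, Finset.mem_Icc]; omega
      have e2 : ((e + 1 - a : ℕ) : ℝ) = ((e - a : ℕ) : ℝ) + 1 := by
        rw [← Nat.cast_succ]; congr 1; omega
      rw [e1, e2] at h4
      simpa only [hx] using h4
    · intro τ m a b hτ hm hab hb p hp
      rw [hRω]
      have h3 : ω ∉ threadNoiseEvent R ℓ f y x τ m a b p := by
        rcases hp with rfl | rfl
        · exact fun h => hω' τ hτ m hm a (hab.trans hb) b hb 0 (Nat.zero_le _) (Or.inr (Or.inl h))
        · exact fun h => hω' τ hτ m hm a (hab.trans hb) b hb 0 (Nat.zero_le _)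
            (Or.inr (Or.inr (Or.inl h)))
      rw [threadNoiseEvent, Set.mem_ofPred_eq, not_lt] at h3
      have h4 := h3
      simpa only [hx] using h4
    · rw [hRω]
      intro b n m a e hb hn hm ha haT he
      rw [eT] at hb hn hm haT he
      have h3 : ω ∉ fewEvent T R κ ℓ u b n m a e := fun h =>
        hω' b hb n hn m hm a haT e he (Or.inr (Or.inr (Or.inr (Or.inl h))))
      have h4 := not_lt.1 fun h => h3 ⟨⟨ha, he⟩, h⟩
      rw [Run.wins, eρ, eu]
      convert h4 using 4
    · rw [hRω]
      intro b n m hb hn hm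
      rw [eT] at hb hn hm
      have h3 : ω ∉ manyEvent R κ ℓ fs Q u b n m := fun h =>
        hω' b hb n hn m hm 0 (Nat.zero_le _) 0 (Nat.zero_le _)
          (Or.inr (Or.inr (Or.inr (Or.inr h))))
      rw [manyEvent, Set.mem_ofPred_eq, not_lt] at h3
      have h4 := h3
      rw [eρ, eu]
      convert h4 using 6

end BadSet


/-! ### The choice of the constants -/

lemma rpow_three_halves {x : ℝ} (hx : 0 < x) : x ^ (3 / 2 : ℝ) = x * Real.sqrt x := by
  rw [Real.sqrt_eq_rpow, ← Real.rpow_one_add' hx.le (by norm_num)]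
  norm_num

lemma log_mul_le_log {d T : ℕ} (hd : 1 ≤ d) (hT : 1 ≤ T) :
    Real.log T ≤ Real.log (d * T) := by
  have hd' : (1 : ℝ) ≤ d := by exact_mod_cast hd
  have hT' : (0 : ℝ) < T := by exact_mod_cast hT
  exact Real.log_le_log hT' (le_mul_of_one_le_left hT'.le hd')

/-- The number of epochs is logarithmic. -/
lemma epoch_le {q γ lam : ℝ} {T s : ℕ} (hT : 1 ≤ T) (hq : 0 < q) (hγ : 0 < γ) (hγq : γ = 1 - q)
    (hlam : lam = Real.log T) (h1 : 1 ≤ lam) (hs : 1 / q ^ (4 * s) ≤ (T : ℝ) / q ^ 4) :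
    (s : ℝ) + 2 ≤ (3 + 1 / γ) * lam := by
  have hT' : (0 : ℝ) < T := by exact_mod_cast hT
  have h2 := Real.log_le_log (by positivity) hs
  rw [Real.log_div one_ne_zero (by positivity), Real.log_one, Real.log_div hT'.ne' (by positivity),
    Real.log_pow, Real.log_pow] at h2
  have h3 := Real.log_le_sub_one_of_pos hq
  push_cast at h2
  have h4 : γ ≤ -Real.log q := by linarith
  have hg : 0 ≤ 1 / γ := by positivity
  rcases Nat.eq_zero_or_pos s with h | h
  · rw [h]; push_cast; nlinarith
  · have h5 : (1 : ℝ) ≤ s := by exact_mod_cast h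
    have h6 : ((s : ℝ) - 1) * γ ≤ lam := by
      have := mul_le_mul_of_nonneg_left h4 (by linarith : 0 ≤ (s : ℝ) - 1)
      nlinarith
    have h7 : (s : ℝ) - 1 ≤ 1 / γ * lam := by
      rw [one_div, ← div_eq_inv_mul, le_div_iff₀ hγ]; exact h6
    nlinarith

lemma sq_error_le {L N B q lam : ℝ} (hL : 0 < L) (hN : 0 ≤ N) (hB : 0 ≤ B) (hq : 0 < q)
    (h1 : 1 ≤ lam) :
    (B + (L + 2 * (4 * Real.sqrt (6 * lam)) + 2 * N) / (L * q) + 1) ^ 2 ≤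
      (B + 1 + (L + 20 + 2 * N) / (L * q)) ^ 2 * lam := by
  have hs1 : 1 ≤ Real.sqrt lam := Real.one_le_sqrt.2 h1
  have hs6 : Real.sqrt 6 ≤ 5 / 2 := by
    rw [Real.sqrt_le_left (by norm_num)]; norm_num
  have e : (B + 1 + (L + 20 + 2 * N) / (L * q)) ^ 2 * lam =
      ((B + 1 + (L + 20 + 2 * N) / (L * q)) * Real.sqrt lam) ^ 2 := by
    rw [mul_pow, Real.sq_sqrt (by linarith)]
  rw [e]
  refine pow_le_pow_left₀ (by positivity) ?_ 2
  have h2 : L + 2 * (4 * Real.sqrt (6 * lam)) + 2 * N ≤ (L + 20 + 2 * N) * Real.sqrt lam := by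
    rw [Real.sqrt_mul (by norm_num)]
    nlinarith
  have h3 : (L + 2 * (4 * Real.sqrt (6 * lam)) + 2 * N) / (L * q) ≤
      (L + 20 + 2 * N) / (L * q) * Real.sqrt lam := by
    rw [div_mul_eq_mul_div]
    gcongr
  nlinarith

/-- Every summand is a constant times x Lam⁴, and Lam exceeds the sum of these constants. This is
where the dependence on the problem parameters disappears from the final bound. -/
lemma sum_kappa_le {L q B c D x lam Lam : ℝ} (hL : 0 ≤ L) (hq : 0 < q) (hD : 1 ≤ D) (hDx : D ≤ x)
    (hlL : lam ≤ Lam) (hLam1 : 1 ≤ Lam)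
    (h : 1 + L + 2 / q + 16 * B ^ 2 / (c * q ^ 3) + 2 * L ^ 2 / (c * q ^ 7) ≤ Lam) :
    Real.sqrt Lam + L + 2 * D * lam / q + 16 * B ^ 2 * x * Lam ^ 4 / (c * q ^ 3)
      + 2 * L ^ 2 * x * Lam ^ 4 / (c * q ^ 7) ≤ Lam ^ 5 * x := by
  have hx1 : 1 ≤ x := hD.trans hDx
  have hL4 : 1 ≤ Lam ^ 4 := one_le_pow₀ hLam1
  have hLL4 : Lam ≤ Lam ^ 4 := le_self_pow₀ hLam1 (by norm_num)
  have hy : 1 ≤ x * Lam ^ 4 := one_le_mul_of_one_le_of_one_le hx1 hL4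
  have e1 : 16 * B ^ 2 * x * Lam ^ 4 / (c * q ^ 3) =
      16 * B ^ 2 / (c * q ^ 3) * (x * Lam ^ 4) := by
    rw [div_mul_eq_mul_div, mul_assoc (16 * B ^ 2)]
  have e2 : 2 * L ^ 2 * x * Lam ^ 4 / (c * q ^ 7) = 2 * L ^ 2 / (c * q ^ 7) * (x * Lam ^ 4) := by
    rw [div_mul_eq_mul_div, mul_assoc (2 * L ^ 2)]
  have e3 : Lam ^ 5 * x = Lam * (x * Lam ^ 4) := by ring
  have s1 : Real.sqrt Lam ≤ 1 * (x * Lam ^ 4) := by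
    have h1 : Real.sqrt Lam ≤ Lam := by
      rw [Real.sqrt_le_left (by linarith)]; nlinarith
    have h2 : Lam ^ 4 ≤ x * Lam ^ 4 := le_mul_of_one_le_left (by positivity) hx1
    linarith
  have s2 : L ≤ L * (x * Lam ^ 4) := le_mul_of_one_le_right hL hy
  have s3 : 2 * D * lam / q ≤ 2 / q * (x * Lam ^ 4) := by
    have h1 : D * lam ≤ x * Lam ^ 4 := by
      have h2 := hlL.trans hLL4
      calc D * lam ≤ D * Lam ^ 4 := mul_le_mul_of_nonneg_left h2 (by linarith)
        _ ≤ x * Lam ^ 4 := mul_le_mul_of_nonneg_right hDx (by positivity)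
    have h2 : 2 * D * lam / q = 2 / q * (D * lam) := by rw [div_mul_eq_mul_div, mul_assoc]
    rw [h2]
    exact mul_le_mul_of_nonneg_left h1 (by positivity)
  have s4 := mul_le_mul_of_nonneg_right h (by linarith : 0 ≤ x * Lam ^ 4)
  rw [add_mul, add_mul, add_mul, add_mul] at s4
  rw [e1, e2, e3]
  linarith

/-- The constant 21/5 is a rational upper bound for 6 ln 2. -/
lemma ell_le_logb {T : ℕ} (h : 0 ≤ Real.log T) :
    6 * Real.log T ≤ 21 / 5 * (Real.logb 2 T + 1) := by
  have h2 := Real.log_two_lt_d9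
  have h2' := Real.log_two_gt_d9
  have h3 : 10 / 7 * Real.log T ≤ Real.logb 2 T := by
    rw [Real.logb, le_div_iff₀ (by linarith)]
    nlinarith
  linarith

lemma eighty_sqrt_le {lam : ℝ} (h : 9600 ≤ lam) : 80 * Real.sqrt (6 * lam) ≤ 2 * lam := by
  have h2 : Real.sqrt (6 * lam) ≤ lam / 40 := by
    rw [Real.sqrt_le_left (by linarith)]; nlinarith
  linarith

lemma two_mul_le_div {lam D q : ℝ} (hlam : 0 ≤ lam) (hD : 1 ≤ D) (hq : 0 < q) (hq1 : q ≤ 1) :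
    2 * lam ≤ 2 * D * lam / q := by
  rw [le_div_iff₀ hq]
  have : lam ≤ D * lam := le_mul_of_one_le_left hlam hD
  nlinarith

/-- The last summand of κ carries Lam⁴, against lam³ on the left, and the spare logarithm absorbs
all constants. The factors c and q^7 in its denominator only help. -/
lemma eight_mul_le {L q c g A x lam Lam : ℝ} (hL : 0 < L) (hc : 0 < c) (hc1 : c < 1) (hq : 0 < q)
    (hq1 : q ≤ 1) (hx : 0 ≤ x) (hlam : 0 ≤ lam) (hlL : lam ≤ Lam) (h : 40 * g * A / L ≤ lam) :
    8 * L * g * (A * lam ^ 3) * x ≤ 2 * L ^ 2 * x * Lam ^ 4 / (c * q ^ 7) / 10 := by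
  rw [div_le_iff₀ hL] at h
  have h2 : 2 * L ^ 2 * x * Lam ^ 4 ≤ 2 * L ^ 2 * x * Lam ^ 4 / (c * q ^ 7) := by
    rw [le_div_iff₀ (by positivity)]
    refine mul_le_of_le_one_right (by positivity) ?_
    exact mul_le_one₀ hc1.le (by positivity) (pow_le_one₀ hq.le hq1)
  have h3 : 8 * L * g * (A * lam ^ 3) * x ≤ (2 * L ^ 2 * x * Lam ^ 4) / 10 := by
    calc 8 * L * g * (A * lam ^ 3) * x = (40 * g * A) * (L * lam ^ 3 * x / 5) := by ring
      _ ≤ (lam * L) * (L * lam ^ 3 * x / 5) := mul_le_mul_of_nonneg_right h (by positivity)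
      _ = L ^ 2 * x * lam ^ 4 / 5 := by ring
      _ ≤ L ^ 2 * x * Lam ^ 4 / 5 := by gcongr
      _ = _ := by ring
  linarith

/-- With κ at most Lam⁵ d^(3/2) the left side is at most Lam⁹ d^(5/2), so M = d³ Lam⁵ satisfies the
condition with room to spare. -/
lemma twelve_mul_le {L q A D κ lam Lam : ℝ} (hD : 1 ≤ D)
    (hκ : 0 ≤ κ) (hlam : 0 ≤ lam) (hlL : lam ≤ Lam) (hLam : 1 ≤ Lam)
    (h : 12 * L * A / q ^ 2 ≤ Lam) (hκ' : κ ≤ Lam ^ 5 * (D * Real.sqrt D)) :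
    12 * κ * L * (A * lam ^ 3) * D / q ^ 2 ≤ (D ^ 3 * Lam ^ 5) ^ 2 := by
  have hD0 : 0 ≤ D := by linarith
  have hxle : (D * Real.sqrt D) * D ≤ D ^ 6 := by
    have h2 : Real.sqrt D ≤ D := by rw [Real.sqrt_le_left hD0]; nlinarith
    calc (D * Real.sqrt D) * D ≤ (D * D) * D := by gcongr
      _ = D ^ 3 := by ring
      _ ≤ D ^ 6 := pow_le_pow_right₀ hD (by norm_num)
  have hl3 : lam ^ 3 ≤ Lam ^ 3 := pow_le_pow_left₀ hlam hlL 3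
  have e : 12 * κ * L * (A * lam ^ 3) * D / q ^ 2 = 12 * L * A / q ^ 2 * (κ * lam ^ 3 * D) := by ring
  rw [e]
  calc 12 * L * A / q ^ 2 * (κ * lam ^ 3 * D)
      ≤ Lam * ((Lam ^ 5 * (D * Real.sqrt D)) * Lam ^ 3 * D) := by gcongr
    _ = Lam ^ 9 * ((D * Real.sqrt D) * D) := by ring
    _ ≤ Lam ^ 10 * D ^ 6 := mul_le_mul (pow_le_pow_right₀ hLam (by norm_num)) hxle
        (by positivity) (by positivity)
    _ = (D ^ 3 * Lam ^ 5) ^ 2 := by ring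

/-- The constants of the analysis satisfy all conditions if `T` is large. -/
lemma exists_goodParams {σ L B c₀ : ℝ} (hσ : 0 < σ) (hσL : σ < L) (hc : 0 < c₀) (hc1 : c₀ < 1) :
    ∃ T₀ : ℕ, ∀ T : ℕ, T₀ ≤ T → ∀ d : ℕ, 1 ≤ d → 0 ≤ B →
      9600 ≤ Real.log T ∧
      kappa d T σ L B c₀ ≤ Real.log (d * T) ^ 5 * (d * Real.sqrt d) ∧
      GoodParams d T σ L B c₀ (kappa d T σ L B c₀) ((d : ℝ) ^ 3 * Real.log (d * T) ^ 5)
        (6 * Real.log T) (4 * Real.sqrt (6 * Real.log T)) := by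
  have hL : 0 < L := hσ.trans hσL
  set γ := σ / L with hγdef
  have hγ : 0 < γ := div_pos hσ hL
  have hγ1 : γ < 1 := (div_lt_one hL).2 hσL
  set q := 1 - γ with hqdef
  have hq : 0 < q := by linarith
  have hq1 : q ≤ 1 := by linarith
  set N : ℝ := (batchBase c₀ : ℝ) with hN
  have hN0 : 0 ≤ N := Nat.cast_nonneg _
  set A : ℝ := (3 + 1 / γ) ^ 2 * (B + 1 + (L + 20 + 2 * N) / (L * q)) ^ 2 with hA
  have hA0 : 0 ≤ A := by positivity
  set c1 : ℝ := 40 * (N / γ) * A / L with hc1def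
  set c2 : ℝ := 12 * L * A / q ^ 2 with hc2def
  set c3 : ℝ := 1 + L + 2 / q + 16 * B ^ 2 / (c₀ * q ^ 3) + 2 * L ^ 2 / (c₀ * q ^ 7) with hc3def
  have hc1' : 0 ≤ c1 := by positivity
  have hc2' : 0 ≤ c2 := by positivity
  have hc3' : 0 ≤ c3 := by positivity
  -- T₀ makes ln T exceed every constant depending on the parameters. The number 9600 serves the
  -- noise: 80√(6 ln T) ≤ 2 ln T, and 2 ln T is below the third summand of κ.
  refine ⟨⌈Real.exp (9600 + c1 + c2 + c3)⌉₊, fun T hT d hd hB => ?_⟩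
  have hTexp : Real.exp (9600 + c1 + c2 + c3) ≤ T := Nat.ceil_le.1 hT
  have hTpos : (0 : ℝ) < T := (Real.exp_pos _).trans_le hTexp
  have hT1 : 1 ≤ T := by exact_mod_cast hTpos
  set lam := Real.log T with hlam
  have hbig : 9600 + c1 + c2 + c3 ≤ lam := by
    rw [hlam, Real.le_log_iff_exp_le hTpos]; exact hTexp
  set Lam := Real.log (d * T) with hLam
  have hlL : lam ≤ Lam := log_mul_le_log hd hT1
  have hlam1 : 1 ≤ lam := by linarith
  have hLam1 : 1 ≤ Lam := by linarith
  have hd1 : (1 : ℝ) ≤ d := by exact_mod_cast hd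
  have hd0 : (0 : ℝ) < d := by linarith
  have hsd : 1 ≤ Real.sqrt d := Real.one_le_sqrt.2 hd1
  set x : ℝ := d * Real.sqrt d with hx
  have hxd : (d : ℝ) ≤ x := le_mul_of_one_le_right hd0.le hsd
  have hx1 : 1 ≤ x := hd1.trans hxd
  have hκeq : kappa d T σ L B c₀ = Real.sqrt Lam + L + 2 * d * lam / q
      + 16 * B ^ 2 * x * Lam ^ 4 / (c₀ * q ^ 3) + 2 * L ^ 2 * x * Lam ^ 4 / (c₀ * q ^ 7) := by
    rw [kappa, rpow_three_halves hd0]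
  have hL4 : 1 ≤ Lam ^ 4 := one_le_pow₀ hLam1
  have hLL4 : Lam ≤ Lam ^ 4 := le_self_pow₀ hLam1 (by norm_num)
  have t1 : 1 ≤ Real.sqrt Lam := Real.one_le_sqrt.2 hLam1
  have t3 : 0 ≤ 2 * d * lam / q := by positivity
  have t4 : 0 ≤ 16 * B ^ 2 * x * Lam ^ 4 / (c₀ * q ^ 3) := by positivity
  have t5 : 0 ≤ 2 * L ^ 2 * x * Lam ^ 4 / (c₀ * q ^ 7) := by positivity
  have hκ1 : 1 ≤ kappa d T σ L B c₀ := by rw [hκeq]; linarith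
  have hκup : kappa d T σ L B c₀ ≤ Lam ^ 5 * x := by
    rw [hκeq]
    exact sum_kappa_le hL.le hq hd1 hxd hlL hLam1 (by linarith)
  refine ⟨by linarith, hκup, ⟨hκ1, ?_, ?_, by positivity, ?_, A * lam ^ 3, ?_, ?_, ?_⟩⟩
  · exact one_le_mul_of_one_le_of_one_le (one_le_pow₀ hd1) (one_le_pow₀ hLam1)
  · exact ell_le_logb (by linarith)
  · have h1 := eighty_sqrt_le (by linarith : 9600 ≤ lam)
    have h3 : 2 * lam ≤ 2 * d * lam / q := two_mul_le_div (by linarith) hd1 hq hq1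
    rw [hκeq]
    linarith
  · intro s hs
    have h1 := epoch_le hT1 hq hγ (by rw [hqdef]; ring) hlam hlam1 hs
    have h2 := sq_error_le hL hN0 hB hq hlam1
    have h3 : ((s : ℝ) + 2) ^ 2 ≤ ((3 + 1 / γ) * lam) ^ 2 := pow_le_pow_left₀ (by positivity) h1 2
    refine (mul_le_mul h3 h2 (sq_nonneg _) (sq_nonneg _)).trans (le_of_eq ?_)
    rw [hA]; ring
  · rw [hκeq]
    have h3 := eight_mul_le (x := x) hL hc hc1 hq hq1 (by linarith) (by linarith) hlL
      (by linarith : c1 ≤ lam)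
    exact h3.trans (div_le_div_of_nonneg_right (by linarith) (by norm_num))
  · exact twelve_mul_le hd1 (by linarith) (by linarith) hlL hLam1
      (by linarith : c2 ≤ Lam) hκup

/-- The choice of the window length. -/
lemma exists_window {T : ℕ} {D V κ H : ℝ} (hT : 1 ≤ T) (hD : 1 ≤ D) (hV : 0 ≤ V)
    (hH : 0 ≤ H) (hκH : κ ≤ H * (D * Real.sqrt D)) :
    (T : ℝ) ≤ D ^ 2 * V ^ (1 / 3 : ℝ) * (T : ℝ) ^ (2 / 3 : ℝ) ∨
    ∃ w : ℕ, 1 ≤ w ∧ w ≤ T ∧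
      2 * κ * (T / Real.sqrt w) + κ * Real.sqrt w + D ^ 3 * H * V * w / 6 ≤
        3 * H * (D ^ 2 * V ^ (1 / 3 : ℝ) * (T : ℝ) ^ (2 / 3 : ℝ) + D * Real.sqrt D * Real.sqrt T) := by
  have hT' : (1 : ℝ) ≤ T := by exact_mod_cast hT
  set r := V ^ (1 / 3 : ℝ) with hr
  set s := (T : ℝ) ^ (1 / 3 : ℝ) with hs
  have hr0 : 0 ≤ r := Real.rpow_nonneg hV _
  have hs1 : 1 ≤ s := Real.one_le_rpow hT' (by norm_num)
  have hr3 : r ^ 3 = V := by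
    rw [hr, ← Real.rpow_natCast, ← Real.rpow_mul hV]; norm_num
  have hs3 : s ^ 3 = T := by
    rw [hs, ← Real.rpow_natCast, ← Real.rpow_mul (by linarith)]; norm_num
  have hs2 : (T : ℝ) ^ (2 / 3 : ℝ) = s ^ 2 := by
    rw [hs, ← Real.rpow_natCast, ← Real.rpow_mul (by linarith)]; norm_num
  rw [hs2]
  have hsT : 0 < Real.sqrt T := Real.sqrt_pos.2 (by linarith)
  have hsD : 1 ≤ Real.sqrt D := Real.one_le_sqrt.2 hD
  have hx : 0 ≤ D * Real.sqrt D * Real.sqrt T := by positivity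
  -- With r = V^(1/3) and s = T^(1/3) the balancing length is s²/(D r²). In this case it would be at
  -- least s³ = T (r may even vanish), so w = T is taken and the √T term of the bound covers the
  -- cost of κ√T.
  by_cases h1 : D * r ^ 2 * s ≤ 1
  · refine Or.inr ⟨T, hT, le_rfl, ?_⟩
    rw [Real.div_sqrt]
    have h2 : κ * Real.sqrt T ≤ H * (D * Real.sqrt D * Real.sqrt T) := by
      rw [← mul_assoc]; gcongr
    have h3 : D ^ 3 * H * V * T ≤ H * (D ^ 2 * r * s ^ 2) := by
      rw [← hr3, ← hs3]
      calc D ^ 3 * H * r ^ 3 * s ^ 3 = H * (D ^ 2 * r * s ^ 2) * (D * r ^ 2 * s) := by ring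
        _ ≤ H * (D ^ 2 * r * s ^ 2) * 1 := by gcongr
        _ = _ := mul_one _
    have h4 : 0 ≤ H * (D ^ 2 * r * s ^ 2) := by positivity
    nlinarith
  push Not at h1
  have hrpos : 0 < r := by
    rcases hr0.eq_or_lt with h | h
    · rw [← h] at h1; norm_num at h1
    · exact h
  -- Now the balancing length would be below 1. The variation is then so large that the claimed
  -- bound exceeds T.
  by_cases h2 : s ^ 2 < D * r ^ 2
  · left
    have h3 : s ≤ D ^ 2 * r := by
      refine le_of_pow_le_pow_left₀ (n := 2) (by norm_num) (by positivity) ?_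
      have h4 : D ≤ D ^ 4 := le_self_pow₀ hD (by norm_num)
      calc s ^ 2 ≤ D * r ^ 2 := h2.le
        _ ≤ D ^ 4 * r ^ 2 := by gcongr
        _ = (D ^ 2 * r) ^ 2 := by ring
    rw [← hs3]
    calc s ^ 3 = s * s ^ 2 := by ring
      _ ≤ D ^ 2 * r * s ^ 2 := by gcongr
  · push Not at h2
    right
    set w0 := s ^ 2 / (D * r ^ 2) with hw0
    have hDr : 0 < D * r ^ 2 := by positivity
    have hw1 : 1 ≤ w0 := by rw [hw0, one_le_div hDr]; exact h2
    have hwT : w0 ≤ T := by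
      rw [hw0, div_le_iff₀ hDr, ← hs3]
      calc s ^ 2 = s ^ 2 * 1 := (mul_one _).symm
        _ ≤ s ^ 2 * (D * r ^ 2 * s) := by gcongr
        _ = s ^ 3 * (D * r ^ 2) := by ring
    have hle : (⌈w0⌉₊ : ℝ) ≤ T := by exact_mod_cast Nat.ceil_le.2 hwT
    have hge : w0 ≤ (⌈w0⌉₊ : ℝ) := Nat.le_ceil _
    have hlt : (⌈w0⌉₊ : ℝ) ≤ 2 * w0 := by
      have := Nat.ceil_lt_add_one (zero_le_one.trans hw1); linarith
    refine ⟨⌈w0⌉₊, Nat.one_le_ceil_iff.2 (by linarith), Nat.ceil_le.2 hwT, ?_⟩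
    have hsw : Real.sqrt w0 = s / (Real.sqrt D * r) := by
      rw [hw0, Real.sqrt_div (by positivity), Real.sqrt_sq (by linarith), Real.sqrt_mul (by linarith),
        Real.sqrt_sq hr0]
    have b1 : κ * (T / Real.sqrt ⌈w0⌉₊) ≤ H * (D ^ 2 * r * s ^ 2) := by
      calc κ * (T / Real.sqrt ⌈w0⌉₊) ≤ (H * (D * Real.sqrt D)) * (T / Real.sqrt w0) := by
            gcongr
        _ = H * (D * Real.sqrt D) * (s ^ 3 / (s / (Real.sqrt D * r))) := by rw [hsw, hs3]
        _ = H * (D * (Real.sqrt D * Real.sqrt D) * r * s ^ 2) := by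
            have : s ≠ 0 := by linarith
            field_simp
        _ = _ := by rw [Real.mul_self_sqrt (by linarith)]; ring
    have b2 : κ * Real.sqrt ⌈w0⌉₊ ≤ H * (D * Real.sqrt D * Real.sqrt T) := by
      calc κ * Real.sqrt ⌈w0⌉₊ ≤ (H * (D * Real.sqrt D)) * Real.sqrt T := by gcongr
        _ = _ := by ring
    have b3 : D ^ 3 * H * V * ⌈w0⌉₊ ≤ 2 * (H * (D ^ 2 * r * s ^ 2)) := by
      calc D ^ 3 * H * V * ⌈w0⌉₊ ≤ D ^ 3 * H * V * (2 * w0) := by gcongr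
        _ = 2 * (H * (D ^ 2 * r * s ^ 2)) := by
            rw [← hr3, hw0]
            have : r ≠ 0 := hrpos.ne'
            field_simp
    have b4 : 0 ≤ H * (D ^ 2 * r * s ^ 2) := by positivity
    have b5 : 0 ≤ H * (D * Real.sqrt D * Real.sqrt T) := by positivity
    nlinarith


/-- The actions are not assumed measurable. Integrability comes from the almost sure equality with a
conditional expectation. -/
lemma Interaction.integrable_value {Ω : Type*} [MeasurableSpace Ω] {μ : Measure Ω} {d T : ℕ}
    {f : ℕ → Pt d → ℝ} {u : ℕ → ℕ → Ω → ℝ} {y : ℕ → Ω → ℝ} {x : ℕ → Ω → Pt d}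
    (hI : Interaction μ T f u y x) {t : ℕ} (ht : t ∈ Finset.Icc 1 T) :
    Integrable (fun ω => f t (x t ω)) μ :=
  integrable_condExp.congr (hI.mean t ht)

/-! ### From good realizations to the expected regret. -/

section Final

open scoped ENNReal

variable {Ω : Type*} [m0 : MeasurableSpace Ω] {μ : Measure Ω} [IsProbabilityMeasure μ]

/-- The expectation of a bounded quantity that is small outside of a set of small probability. -/
lemma integral_le_of_small_off {g : Ω → ℝ} (hg : Integrable g μ) {b C δ : ℝ} (hb : 0 ≤ b)
    (hC : 0 ≤ C) (hδ : 0 ≤ δ) (hgC : ∀ ω, g ω ≤ C) {N : Set Ω} (hN : μ N ≤ ENNReal.ofReal δ)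
    (hgb : ∀ᵐ ω ∂μ, ω ∉ N → g ω ≤ b) : ∫ ω, g ω ∂μ ≤ b + C * δ := by
  -- The exceptional set carries no measurability assumption, so it is replaced by its measurable
  -- hull of equal measure.
  have hm := measurableSet_toMeasurable μ N
  have hi : Integrable ((toMeasurable μ N).indicator fun _ => C) μ :=
    (integrable_const C).indicator hm
  have h1 : ∫ ω, g ω ∂μ ≤ ∫ ω, (b + (toMeasurable μ N).indicator (fun _ => C) ω) ∂μ := by
    refine integral_mono_ae hg ((integrable_const b).add hi) ?_
    filter_upwards [hgb] with ω h
    by_cases hω : ω ∈ toMeasurable μ N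
    · simp only [Set.indicator_of_mem hω]; linarith [hgC ω]
    · simp only [Set.indicator_of_notMem hω, add_zero]
      exact h fun h' => hω (subset_toMeasurable μ N h')
  refine h1.trans ?_
  rw [integral_add (integrable_const b) hi, integral_const, integral_indicator hm, integral_const,
    probReal_univ, one_smul, measureReal_restrict_apply_univ, smul_eq_mul, mul_comm]
  have h2 : μ.real (toMeasurable μ N) ≤ δ := by
    rw [measureReal_def, measure_toMeasurable]
    exact ENNReal.toReal_le_of_le_ofReal hδ hN
  gcongr

/-- The exponent 6 pays for the (T+1)^5 index tuples and for the trivial regret 2T on the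
exceptional set. -/
lemma failure_prob_le {T : ℕ} (hT : 1 ≤ T) :
    2 * (T : ℝ) * (8 * ((T : ℝ) + 1) ^ 5 * Real.exp (-(6 * Real.log T))) ≤ 512 := by
  have hT' : (1 : ℝ) ≤ T := by exact_mod_cast hT
  have e : Real.exp (-(6 * Real.log T)) = ((T : ℝ) ^ 6)⁻¹ := by
    rw [Real.exp_neg, mul_comm, Real.exp_mul, Real.exp_log (by linarith)]
    norm_cast
  rw [e, ← mul_assoc, ← div_eq_mul_inv, div_le_iff₀ (by positivity)]
  have h : ((T : ℝ) + 1) ^ 5 ≤ (2 * T) ^ 5 := pow_le_pow_left₀ (by linarith) (by linarith) 5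
  calc 2 * (T : ℝ) * (8 * ((T : ℝ) + 1) ^ 5) ≤ 2 * (T : ℝ) * (8 * (2 * T) ^ 5) := by gcongr
    _ = 512 * (T : ℝ) ^ 6 := by ring

variable {d T : ℕ} {σ L B c₀ : ℝ} {X : Set (Pt d)} {z₀ : ℕ → ℕ → Pt d}
  {f : ℕ → Pt d → ℝ} {xs : ℕ → Pt d} {u : ℕ → ℕ → Ω → ℝ} {y : ℕ → Ω → ℝ} {x : ℕ → Ω → Pt d}

lemma regret_le_two_mul (hreg : Regular T σ L B c₀ X f xs) {a : ℕ → Pt d}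
    (ha : ∀ t ∈ Finset.Icc 1 T, a t ∈ X) :
    ∑ t ∈ Finset.Icc 1 T, (f t (xs t) - f t (a t)) ≤ 2 * T := by
  have : ∑ t ∈ Finset.Icc 1 T, (f t (xs t) - f t (a t)) ≤ ∑ t ∈ Finset.Icc 1 T, (2 : ℝ) := by
    refine Finset.sum_le_sum fun t ht => ?_
    have h1 := (abs_le.1 (hreg.bounded t ht _ (hreg.max_mem t ht))).2
    have h2 := (abs_le.1 (hreg.bounded t ht _ (ha t ht))).1
    linarith
  rw [Finset.sum_const, Nat.card_Icc, nsmul_eq_mul, Nat.add_sub_cancel] at this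
  linarith

/-- The expected regret for one window length. -/
lemma integral_regret_le (hreg : Regular T σ L B c₀ X f xs) (hI : Interaction μ T f u y x)
    (hx : ∀ t ω, x t ω = query T σ L B c₀ X z₀ (fun τ m => u τ m ω) (fun s => y s ω) t)
    (hd : 1 ≤ d) (hT : 1 ≤ T) (hσ : 0 < σ) (hσL : σ < L) (hc : 0 < c₀)
    (hz₀ : ∀ τ m, z₀ τ m ∈ innerSet X c₀) {M V κ : ℝ} (hκ : κ = kappa d T σ L B c₀)
    (hp : GoodParams d T σ L B c₀ (kappa d T σ L B c₀) M (6 * Real.log T)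
      (4 * Real.sqrt (6 * Real.log T)))
    (hV : ∑ t ∈ Finset.Ico 1 T, supDist X (f (t + 1)) (f t) ≤ V) {w : ℕ} (hw : 1 ≤ w)
    (hwT : w ≤ T) :
    ∫ ω, ∑ t ∈ Finset.Icc 1 T, (f t (xs t) - f t (x t ω)) ∂μ ≤
      77000 * (Real.logb 2 T + 1) ^ 4 * (2 * κ * (T / Real.sqrt w) + κ * Real.sqrt w + M * V * w / 6)
        + 512 := by
  have hX := hreg.compact.isClosed
  have hκ1 : 1 ≤ κ := hκ ▸ hp.one_le_kappa
  have hM1 := hp.one_le_M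
  have hV0 : 0 ≤ V := (Finset.sum_nonneg fun t _ => supDist_nonneg _ _ _).trans hV
  have hT' : (1 : ℝ) ≤ T := by exact_mod_cast hT
  have hlog : 0 ≤ Real.logb 2 T := Real.logb_nonneg (by norm_num) hT'
  have hw' : (1 : ℝ) ≤ w := by exact_mod_cast hw
  have hsw : 0 < Real.sqrt w := Real.sqrt_pos.2 (by linarith)
  obtain ⟨Q, hQ, hQcard⟩ := exists_breaks (T := T) (w := w) (κ := κ) (M := M) (V := V)
    (v := varStep T X f) (by linarith) (by linarith) (varStep_nonneg T X f)
    (by rw [drift_varStep]; exact hV) hw hwT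
  obtain ⟨N, hN, hgood⟩ := exists_bad_set hI hx hd hX hσ hσL hz₀ (by rw [← hκ]; linarith)
    (ℓ := 6 * Real.log T) (by have := Real.log_nonneg hT'; positivity) (fun t => f t (xs t)) Q
  have hint : Integrable (fun ω => ∑ t ∈ Finset.Icc 1 T, (f t (xs t) - f t (x t ω))) μ :=
    integrable_finsetSum _ fun t ht => (integrable_const _).sub (hI.integrable_value ht)
  refine (integral_le_of_small_off hint (C := 2 * T)
    (δ := 8 * ((T : ℝ) + 1) ^ 5 * Real.exp (-(6 * Real.log T))) (by positivity) (by positivity)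
    (by positivity) (fun ω => ?_) (N := N) ?_ ?_).trans
    (add_le_add (le_refl (77000 * (Real.logb 2 T + 1) ^ 4 *
      (2 * κ * (T / Real.sqrt w) + κ * Real.sqrt w + M * V * w / 6))) (failure_prob_le hT))
  · refine regret_le_two_mul hreg fun t ht => ?_
    rw [hx]; exact query_mem hd hX hσ hσL hc hz₀ (Finset.mem_Icc.1 ht).1
  · refine hN.trans (le_of_eq ?_)
    rw [ENNReal.ofReal_mul (by positivity), ENNReal.ofReal_mul (by norm_num),
      ENNReal.ofReal_pow (by positivity), ENNReal.ofReal_add (by positivity) (by norm_num),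
      ENNReal.ofReal_natCast, ENNReal.ofReal_one]
    norm_num
  · filter_upwards [hgood] with ω h hω
    obtain ⟨h1, h2⟩ := h hω
    have h3 := h1.goodRun hreg hd hσ hσL hc hz₀ hp
    rw [← hκ] at h3
    have h4 := h3.total_regret hQ h2
    simp only [hx]
    refine h4.trans ?_
    rw [mul_assoc (77000 * _)]
    refine mul_le_mul_of_nonneg_left ?_ (by positivity)
    change κ * (T / Real.sqrt w + ((Q.card : ℝ) + 1) * Real.sqrt w) ≤ _
    have h5 : ((Q.card : ℝ) + 1) * Real.sqrt w ≤
        (T / w + M * V * Real.sqrt w / (6 * κ) + 1) * Real.sqrt w := by gcongr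
    have hss : Real.sqrt w * Real.sqrt w = w := Real.mul_self_sqrt (by linarith)
    have h6 : (T / w + M * V * Real.sqrt w / (6 * κ) + 1) * Real.sqrt w =
        T / Real.sqrt w + M * V * w / (6 * κ) + Real.sqrt w := by
      have e1 : (T : ℝ) / w * Real.sqrt w = T / Real.sqrt w := by
        rw [div_mul_eq_mul_div, div_eq_div_iff (by positivity) hsw.ne', mul_assoc, hss]
      have e2 : M * V * Real.sqrt w / (6 * κ) * Real.sqrt w = M * V * w / (6 * κ) := by
        rw [div_mul_eq_mul_div, mul_assoc (M * V), hss]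
      rw [add_mul, add_mul, e1, e2, one_mul]
    have h7 : κ * (M * V * w / (6 * κ)) = M * V * w / 6 := by field_simp
    calc κ * (T / Real.sqrt w + ((Q.card : ℝ) + 1) * Real.sqrt w)
        ≤ κ * (T / Real.sqrt w + (T / Real.sqrt w + M * V * w / (6 * κ) + Real.sqrt w)) := by
          rw [← h6]; gcongr
      _ = 2 * κ * (T / Real.sqrt w) + κ * Real.sqrt w + κ * (M * V * w / (6 * κ)) := by ring
      _ = _ := by rw [h7]

end Final

end NonstatBandit

end

theorem theorem1 :
    ∃ (C : ℝ) (p q : ℕ), 0 < C ∧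
      ∀ (σ L B c₀ : ℝ), 0 < σ → σ < L → 0 < c₀ → c₀ < 1 →
      ∃ T₀ : ℕ, ∀ T : ℕ, T₀ ≤ T → ∀ d : ℕ, 1 ≤ d →
      ∀ (X : Set (NonstatBandit.Pt d)) (f : ℕ → NonstatBandit.Pt d → ℝ)
        (xs : ℕ → NonstatBandit.Pt d) (V : ℝ),
        NonstatBandit.Regular T σ L B c₀ X f xs →
        ∑ t ∈ Finset.Ico 1 T, NonstatBandit.supDist X (f (t + 1)) (f t) ≤ V →
      ∀ (z₀ : ℕ → ℕ → NonstatBandit.Pt d),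
        (∀ τ m, z₀ τ m ∈ NonstatBandit.innerSet X c₀) →
      ∀ (Ω : Type*) [MeasurableSpace Ω] (μ : MeasureTheory.Measure Ω)
        [MeasureTheory.IsProbabilityMeasure μ]
        (u : ℕ → ℕ → Ω → ℝ) (y : ℕ → Ω → ℝ) (x : ℕ → Ω → NonstatBandit.Pt d),
        (∀ t ω, x t ω = NonstatBandit.query T σ L B c₀ X z₀
          (fun τ m => u τ m ω) (fun s => y s ω) t) →
        NonstatBandit.Interaction μ T f u y x →
        (∀ t ∈ Finset.Icc 1 T, ∀ ω, x t ω ∈ X) ∧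
        MeasureTheory.Integrable
          (fun ω => ∑ t ∈ Finset.Icc 1 T, (f t (xs t) - f t (x t ω))) μ ∧
        ∫ ω, ∑ t ∈ Finset.Icc 1 T, (f t (xs t) - f t (x t ω)) ∂μ ≤
          C * (L + σ⁻¹ + B + c₀⁻¹ + (1 - σ / L)⁻¹) ^ p * Real.log (d * T) ^ q *
            ((d : ℝ) ^ 2 * V ^ (1 / 3 : ℝ) * (T : ℝ) ^ (2 / 3 : ℝ)
              + (d : ℝ) ^ (3 / 2 : ℝ) * Real.sqrt T) := by
  -- The exponent p is 0 because the parameters only influence T₀. The exponent 9 is 4 from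
  -- `integral_regret_le` plus 5 from κ and M, and the constant covers 77000 · 2⁴ · 3 + 512.
  refine ⟨4000000, 0, 9, by norm_num, fun σ L B c₀ hσ hσL hc hc1 => ?_⟩
  obtain ⟨T₀, hT₀⟩ := NonstatBandit.exists_goodParams (B := B) hσ hσL hc hc1
  refine ⟨max T₀ 1, fun T hT d hd X f xs V hreg hV z₀ hz₀ Ω _ μ _ u y x hx hI => ?_⟩
  have hT1 : 1 ≤ T := (le_max_right _ _).trans hT
  have hX := hreg.compact.isClosed
  have hB : 0 ≤ B := Metric.diam_nonneg.trans hreg.diam_le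
  have hmem : ∀ t ∈ Finset.Icc 1 T, ∀ ω, x t ω ∈ X := fun t ht ω => by
    rw [hx]; exact NonstatBandit.query_mem hd hX hσ hσL hc hz₀ (Finset.mem_Icc.1 ht).1
  have hint : Integrable (fun ω => ∑ t ∈ Finset.Icc 1 T, (f t (xs t) - f t (x t ω))) μ :=
    integrable_finsetSum _ fun t ht => (integrable_const _).sub (hI.integrable_value ht)
  refine ⟨hmem, hint, ?_⟩
  obtain ⟨hlam, hκ, hp⟩ := hT₀ T ((le_max_left _ _).trans hT) d hd hB
  have hd1 : (1 : ℝ) ≤ d := by exact_mod_cast hd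
  have hT' : (1 : ℝ) ≤ T := by exact_mod_cast hT1
  have hV0 : 0 ≤ V := (Finset.sum_nonneg fun t _ => NonstatBandit.supDist_nonneg _ _ _).trans hV
  set Lam := Real.log (d * T) with hLam
  have hlL : Real.log T ≤ Lam := NonstatBandit.log_mul_le_log hd hT1
  have hLam1 : 1 ≤ Lam := by linarith
  rw [pow_zero, mul_one, NonstatBandit.rpow_three_halves (by linarith)]
  set P := (d : ℝ) ^ 2 * V ^ (1 / 3 : ℝ) * (T : ℝ) ^ (2 / 3 : ℝ) with hP
  set S := (d : ℝ) * Real.sqrt d * Real.sqrt T with hS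
  have hP0 : 0 ≤ P := by positivity
  have hS1 : 1 ≤ S := one_le_mul_of_one_le_of_one_le
    (one_le_mul_of_one_le_of_one_le hd1 (Real.one_le_sqrt.2 hd1)) (Real.one_le_sqrt.2 hT')
  have hL9 : 1 ≤ Lam ^ 9 := one_le_pow₀ hLam1
  -- Either the trivial bound 2T is already good enough, or a suitable window length exists.
  rcases NonstatBandit.exists_window hT1 hd1 hV0 (by positivity : 0 ≤ Lam ^ 5) hκ with
    h | ⟨w, hw, hwT, h⟩
  · have h1 : ∫ ω, ∑ t ∈ Finset.Icc 1 T, (f t (xs t) - f t (x t ω)) ∂μ ≤ ∫ _, 2 * (T : ℝ) ∂μ :=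
      integral_mono hint (integrable_const _) fun ω =>
        NonstatBandit.regret_le_two_mul hreg fun t ht => hmem t ht ω
    rw [integral_const, probReal_univ, one_smul] at h1
    have h2 : P ≤ Lam ^ 9 * (P + S) := by nlinarith
    nlinarith
  · have h1 := NonstatBandit.integral_regret_le hreg hI hx hd hT1 hσ hσL hc hz₀ rfl hp hV hw hwT
    have hlg : Real.logb 2 T + 1 ≤ 2 * Lam := by
      have h2 := Real.log_two_gt_d9
      have h3 : Real.logb 2 T ≤ 3 / 2 * Real.log T := by
        rw [Real.logb, div_le_iff₀ (by linarith)]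
        nlinarith
      linarith
    have hlg0 : 0 ≤ Real.logb 2 T := Real.logb_nonneg (by norm_num) hT'
    have hlg4 : (Real.logb 2 T + 1) ^ 4 ≤ (2 * Lam) ^ 4 := pow_le_pow_left₀ (by linarith) hlg 4
    have h4 : 77000 * (Real.logb 2 T + 1) ^ 4 *
        (2 * NonstatBandit.kappa d T σ L B c₀ * (T / Real.sqrt w) +
          NonstatBandit.kappa d T σ L B c₀ * Real.sqrt w + (d : ℝ) ^ 3 * Lam ^ 5 * V * w / 6) ≤
        77000 * (2 * Lam) ^ 4 * (3 * Lam ^ 5 * (P + S)) := by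
      refine mul_le_mul (by linarith) h ?_ (by positivity)
      have := hp.one_le_kappa
      positivity
    have h5 : 77000 * (2 * Lam) ^ 4 * (3 * Lam ^ 5 * (P + S)) = 3696000 * (Lam ^ 9 * (P + S)) := by
      ring
    have h6 : 1 ≤ Lam ^ 9 * (P + S) := one_le_mul_of_one_le_of_one_le hL9 (by linarith)
    rw [mul_assoc]
    linarith
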